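/- Let $M$ be a smooth $n$-dimensional manifold with a smooth Riemannian metric $g$ and Levi-Civita connection $\nabla$ (Christoffel symbols $\Gamma$). Write the components of an endomorphism field $I$ as $I_\mu{}^\nu$, and $I_{\mu\nu}=I_\mu{}^\lambda g_{\lambda\nu}$. Let $K=3$ (or $K=7$), and let $I^1,\dots,I^K$ be smooth endomorphism fields on $M$ which are antisymmetric ($I^a_{\mu\nu}=-I^a_{\nu\mu}$), satisfy the Clifford algebra $I^aI^b+I^bI^a=-2\delta^{ab}$, are integrable (vanishing Nijenhuis tensor, $\partial_{[\mu}I_{\nu]}{}^{\lambda}=I_\mu{}^\sigma I_\nu{}^\rho\,\partial_{[\sigma}I_{\rho]}{}^\lambda$ for each $I=I^a$), and have vanishing Nijenhuis concomitants $$\tfrac12 N(a,b)_{\mu\nu}{}^\lambda=\big\{(I^a)_{[\mu}{}^{\sigma}\partial_\sigma (I^b)_{\nu]}{}^{\lambda}-\partial_{[\mu}(I^b)_{\nu]}{}^{\sigma}(I^a)_\sigma{}^\lambda\big\}+(a\leftrightarrow b)=0 .$$ For a complex structure $I$ of this kind and a smooth 3-form $C$ put $$B_{\mu\nu\lambda}(I)=I_\mu{}^\alpha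 I_\nu{}^\beta I_\lambda{}^\gamma\,(\nabla_\alpha I_{\beta\gamma}+\nabla_\beta I_{\gamma\alpha}+\nabla_\gamma I_{\alpha\beta})$$ (the Bismut torsion of $I$) and $$H_{\mu\nu\lambda}(C,I)=\tfrac14\big(C_{\mu\nu\lambda}-I_\mu{}^\rho I_\nu{}^\sigma C_{\rho\sigma\lambda}-I_\lambda{}^\rho I_\mu{}^\sigma C_{\rho\sigma\nu}-I_\nu{}^\rho I_\lambda{}^\sigma C_{\rho\sigma\mu}\big)$$ (the sum of the holomorphic and antiholomorphic parts of $C$). Let $C$ be a smooth 3-form (a totally antisymmetric torsion) such that, for every $a$, $C=B^a+H^a$, where $B^a=B(I^a)$ and $H^a=H(C,I^a)$. Supercharges. In each chart of the given atlas of $M$, with coordinates $x^\mu$, fix a smooth vielbein $e_{a}{}^{\mu}$ (an orthonormal frame; $a$ is here a flat index). Let $\psi^{a}$ be operators on a nonzero finite-dimensional complex vector space $S$ (the same for all charts) with $\{\psi^{a},\psi^{b}\}=\delta^{ab}$, put $\psi^\mu=e_{a}{}^\mu\psi^{a}$ and $p_\mu=-i\partial_\mu$ (acting at fixed $\psi^{a}$),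 and let $\Omega_{\mu,\nu\lambda}=e_\nu{}^{a}e_\lambda{}^{b}\,e_{a\rho}(\partial_\mu e_{b}{}^\rho+\Gamma^\rho_{\mu\sigma}e_{b}{}^\sigma)$ be the spin connection. The quantum supercharges $Q$ and $Q^a$ $(a=1,\dots,K)$ are the operators on smooth $S$-valued functions on the chart which are obtained from the classical functions $$Q=\psi^\mu\Big(p_\mu-\tfrac i2\Omega_{\mu,\nu\lambda}\psi^\nu\psi^\lambda+\tfrac i{12}C_{\mu\nu\lambda}\psi^\nu\psi^\lambda\Big),$$ $$Q^a=\psi^\sigma (I^a)_\sigma{}^\mu\Big(p_\mu-\tfrac i2\Omega_{\mu,\nu\lambda}\psi^\nu\psi^\lambda-\tfrac i4B^a_{\mu\nu\lambda}\psi^\nu\psi^\lambda+\tfrac i{12}H^a_{\mu\nu\lambda}\psi^\nu\psi^\lambda\Big)$$ by Weyl ordering (in terms of $x^\mu$, $p_\mu$ and the $\psi^{a}$ with flat indices: symmetrized in $x$ and $p$, antisymmetrized in the $\psi$'s) followed by the similarity transformation $\mathcal O\mapsto (\det g)^{-1/4}\,\mathcal O\,(\det g)^{1/4}$. We say that real supercharges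 $q_1,\dots,q_N$ satisfy the $\mathcal N=N$ supersymmetry algebra if there is an operator $\mathsf H$ (the Hamiltonian) with $\{q_A,q_B\}=2\delta_{AB}\mathsf H$ for all $A,B$. Theorem. Suppose that, in every chart of the atlas and for every $a$, the pair $(Q,Q^a)$ satisfies the $\mathcal N=2$ algebra: $Q^2=(Q^a)^2$ and $\{Q,Q^a\}=0$. Then: 1. in every chart of the atlas, $Q,Q^1,\dots,Q^K$ together satisfy the $\mathcal N=K+1$ algebra, i.e. the $\mathcal N=4$ algebra for $K=3$ (the $\mathcal N=8$ algebra for $K=7$); 2. $(M,g,I^a,C)$ is a CKT geometry for $K=3$ (an OKT geometry for $K=7$): the $I^a$ are antisymmetric integrable complex structures that satisfy the Clifford algebra and have vanishing concomitants, and for every $a$ one has $\tilde\nabla_{(\lambda}I^a_{\mu)}{}^{\nu}=0$, where $\tilde\nabla$ is the connection with coefficients $\Gamma^\rho_{\mu\nu}+\tfrac12 g^{\rho\sigma}C_{\sigma\mu\nu}$, and $\iota_a\,dC=\tfrac23\,d(\iota_aC)$, where $(\iota_a\omega)_{\mu_1\dots\mu_p}=\sum_{k}(I^a)_{\mu_k}{}^{\nu}\,\omega_{\mu_1\dots\nu\dots\mu_p}$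 (with $\nu$ in the $k$-th place) for a $p$-form $\omega$. -/

import Mathlib

open scoped Manifold ContDiff

noncomputable section

namespace CliffordKT

/-- Coordinate space: charts of the `n`-dimensional manifold take values here. -/
abbrev Coord (n : ℕ) : Type := EuclideanSpace ℝ (Fin n)

/-! ## Tensor calculus in one coordinate chart

Tensors are given by their components, which are functions of the coordinates.
`g y μ ν` is `g_{μν}(y)`, and for an endomorphism field `J y μ ν` is `I_μ{}^ν(y)`, so that the matrix
product `J * J'` is `I_μ{}^λ I'_λ{}^ν`. -/

section Local

variable {n : ℕ}

/-- The partial derivative `∂_μ f` of a scalar function. -/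
def pd (μ : Fin n) (f : Coord n → ℝ) (y : Coord n) : ℝ :=
  fderiv ℝ f y (EuclideanSpace.single μ 1)

/-- Christoffel symbols of the Levi-Civita connection: `christoffel g y ρ μ ν` is `Γ^ρ_{μν}`. -/
def christoffel (g : Coord n → Matrix (Fin n) (Fin n) ℝ) (y : Coord n) (ρ μ ν : Fin n) : ℝ :=
  ∑ σ, (g y)⁻¹ ρ σ * ((1 / 2) *
    (pd μ (fun z => g z σ ν) y + pd ν (fun z => g z μ σ) y - pd σ (fun z => g z μ ν) y))

/-- The endomorphism field with its upper index lowered: `I_{μν} = I_μ{}^λ g_{λν}`. -/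
def lower (g J : Coord n → Matrix (Fin n) (Fin n) ℝ) (y : Coord n) : Matrix (Fin n) (Fin n) ℝ :=
  J y * g y

/-- The Levi-Civita derivative `∇_α I_{βγ}`. -/
def nablaLower (g J : Coord n → Matrix (Fin n) (Fin n) ℝ) (y : Coord n) (α β γ : Fin n) : ℝ :=
  pd α (fun z => lower g J z β γ) y
    - ∑ σ, christoffel g y σ α β * lower g J y σ γ
    - ∑ σ, christoffel g y σ α γ * lower g J y β σ

/-- The Bismut torsion of `I`:
`B_{μνλ} = I_μ{}^α I_ν{}^β I_λ{}^γ (∇_α I_{βγ} + ∇_β I_{γα} + ∇_γ I_{αβ})`. -/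
def bismut (g J : Coord n → Matrix (Fin n) (Fin n) ℝ) (y : Coord n) (μ ν l : Fin n) : ℝ :=
  ∑ α, ∑ β, ∑ γ, J y μ α * J y ν β * J y l γ *
    (nablaLower g J y α β γ + nablaLower g J y β γ α + nablaLower g J y γ α β)

/-- The sum of the holomorphic and antiholomorphic projections of a 3-form with respect to `I`:
`H_{μνλ} = ¼ (C_{μνλ} - I_μ{}^ρ I_ν{}^σ C_{ρσλ} - I_λ{}^ρ I_μ{}^σ C_{ρσν}
- I_ν{}^ρ I_λ{}^σ C_{ρσμ})`. -/
def holPart (J : Coord n → Matrix (Fin n) (Fin n) ℝ)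
    (C : Coord n → (Fin 3 → Fin n) → ℝ) (y : Coord n) (μ ν l : Fin n) : ℝ :=
  (1 / 4) * (C y ![μ, ν, l]
    - ∑ ρ, ∑ σ, J y μ ρ * J y ν σ * C y ![ρ, σ, l]
    - ∑ ρ, ∑ σ, J y l ρ * J y μ σ * C y ![ρ, σ, ν]
    - ∑ ρ, ∑ σ, J y ν ρ * J y l σ * C y ![ρ, σ, μ])

/-- The metric connection with torsion `C`: `torsionConn g C y ρ μ ν` is
`Γ^ρ_{μν} + ½ g^{ρσ} C_{σμν}`. -/
def torsionConn (g : Coord n → Matrix (Fin n) (Fin n) ℝ) (C : Coord n → (Fin 3 → Fin n) → ℝ)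
    (y : Coord n) (ρ μ ν : Fin n) : ℝ :=
  christoffel g y ρ μ ν + (1 / 2) * ∑ σ, (g y)⁻¹ ρ σ * C y ![σ, μ, ν]

/-- The derivative `∇̃_λ I_μ{}^ν` with respect to the metric connection with torsion `C`. -/
def nablaTorsion (g : Coord n → Matrix (Fin n) (Fin n) ℝ) (C : Coord n → (Fin 3 → Fin n) → ℝ)
    (J : Coord n → Matrix (Fin n) (Fin n) ℝ) (y : Coord n) (l μ ν : Fin n) : ℝ :=
  pd l (fun z => J z μ ν) y
    - ∑ σ, torsionConn g C y σ l μ * J y σ ν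
    + ∑ σ, torsionConn g C y ν l σ * J y μ σ

/-- Vanishing of the Nijenhuis tensor:
`∂_{[μ} I_{ν]}{}^λ = I_μ{}^σ I_ν{}^ρ ∂_{[σ} I_{ρ]}{}^λ` (twice this identity). -/
def NijenhuisVanishes (J : Coord n → Matrix (Fin n) (Fin n) ℝ) (y : Coord n) : Prop :=
  ∀ μ ν l : Fin n,
    pd μ (fun z => J z ν l) y - pd ν (fun z => J z μ l) y =
      ∑ σ, ∑ ρ, J y μ σ * J y ν ρ *
        (pd σ (fun z => J z ρ l) y - pd ρ (fun z => J z σ l) y)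

/-- The half `½ (I_μ{}^σ ∂_σ J_ν{}^λ - ∂_μ J_ν{}^σ I_σ{}^λ - (μ ↔ ν))` of the concomitant that is
to be symmetrized in `I ↔ J`. -/
def concomitantHalf (I J : Coord n → Matrix (Fin n) (Fin n) ℝ) (y : Coord n)
    (μ ν l : Fin n) : ℝ :=
  (1 / 2) * ((∑ σ, I y μ σ * pd σ (fun z => J z ν l) y)
      - (∑ σ, I y ν σ * pd σ (fun z => J z μ l) y))
    - (1 / 2) * ((∑ σ, pd μ (fun z => J z ν σ) y * I y σ l)
      - (∑ σ, pd ν (fun z => J z μ σ) y * I y σ l))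

/-- The Nijenhuis concomitant `N(I, J)_{μν}{}^λ` of two endomorphism fields. -/
def concomitant (I J : Coord n → Matrix (Fin n) (Fin n) ℝ) (y : Coord n)
    (μ ν l : Fin n) : ℝ :=
  2 * (concomitantHalf I J y μ ν l + concomitantHalf J I y μ ν l)

/-- The exterior derivative on components of a `p`-form:
`(dη)_{μ_0 … μ_p} = ∑_k (-1)^k ∂_{μ_k} η_{μ_0 … (omit μ_k) … μ_p}`. -/
def extD {p : ℕ} (η : Coord n → (Fin p → Fin n) → ℝ) (y : Coord n)
    (m : Fin (p + 1) → Fin n) : ℝ :=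
  ∑ k : Fin (p + 1), (-1) ^ (k : ℕ) * pd (m k) (fun z => η z (fun i => m (k.succAbove i))) y

/-- The operation `ι_I` on components of a `p`-form, the sum over the slots of the insertions of
`I` into the slot: `(ι_I η)_{μ_1 … μ_p} = ∑_k I_{μ_k}{}^ν η_{μ_1 … ν … μ_p}`. On a form of type
`(p, q)` it is multiplication by `i (p - q)`, up to an overall sign that depends on which eigenvectors
are called holomorphic and that cancels in the identity where `ι_I` is used. -/
def iota {p : ℕ} (J : Coord n → Matrix (Fin n) (Fin n) ℝ)
    (η : Coord n → (Fin p → Fin n) → ℝ) (y : Coord n) (m : Fin p → Fin n) : ℝ :=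
  ∑ k : Fin p, ∑ ν, J y (m k) ν * η y (Function.update m k ν)

/-! ### Vielbeins and the spin connection

A vielbein is given by the orthonormal frame `e y a μ = e_a{}^μ(y)`, where `a` is a flat index. -/

/-- The spin connection with flat indices,
`Ω_{μ,ab} = e_{aρ} (∂_μ e_b{}^ρ + Γ^ρ_{μσ} e_b{}^σ)`. -/
def spinConnFlat (g e : Coord n → Matrix (Fin n) (Fin n) ℝ) (y : Coord n) (μ a b : Fin n) : ℝ :=
  ∑ ρ, (∑ τ, g y ρ τ * e y a τ) *
    (pd μ (fun z => e z b ρ) y + ∑ σ, christoffel g y ρ μ σ * e y b σ)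

/-- The spin connection with world indices, `Ω_{μ,νλ} = e_ν{}^a e_λ{}^b Ω_{μ,ab}`, where
`e_ν{}^a = g_{νσ} e_a{}^σ`. -/
def spinConn (g e : Coord n → Matrix (Fin n) (Fin n) ℝ) (y : Coord n) (μ ν l : Fin n) : ℝ :=
  ∑ a, ∑ b, (∑ σ, g y ν σ * e y a σ) * (∑ σ, g y l σ * e y b σ) * spinConnFlat g e y μ a b

/-! ### Quantization of supercharges

A quantum supercharge is obtained from the classical one by Weyl ordering, followed by the similarity
transformation with `(det g)^{1/4}` to covariant wave functions. The momenta `p_μ` are conjugate to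
the coordinates at fixed fermions with flat indices. -/

/-- A representation on the complex vector space `S` of the canonical anticommutation relations
`{ψ^a, ψ^b} = δ^{ab}` of the real fermions with flat indices. (The Fock space of wave functions that
depend on half of the Grassmann variables, for any splitting of the `ψ^a` into coordinates and momenta,
is such a representation when `n` is even.) -/
structure FermionRep (n : ℕ) (S : Type*) [AddCommGroup S] [Module ℂ S] where
  /-- the fermion operators -/
  ψ : Fin n → Module.End ℂ S
  anticomm : ∀ a b, ψ a * ψ b + ψ b * ψ a = if a = b then 1 else 0

/-- The classical function `ψ^a v_a{}^μ p_μ + i T_{abc} ψ^a ψ^b ψ^c` on phase space, with real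
coefficients that depend on the coordinates; the `ψ^a` have flat indices. -/
structure ClassicalCharge (n : ℕ) where
  v : Coord n → Fin n → Fin n → ℝ
  T : Coord n → Fin n → Fin n → Fin n → ℝ

/-- The classical singlet supercharge
`Q = ψ^μ (p_μ - (i/2) Ω_{μ,νλ} ψ^ν ψ^λ + (i/12) C_{μνλ} ψ^ν ψ^λ)`, with `ψ^μ = e_a{}^μ ψ^a`. -/
def singletCharge (g e : Coord n → Matrix (Fin n) (Fin n) ℝ)
    (C : Coord n → (Fin 3 → Fin n) → ℝ) : ClassicalCharge n where
  v y a μ := e y a μ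
  T y a b c := ∑ μ, ∑ ν, ∑ l, e y a μ * e y b ν * e y c l *
    (-(1 / 2) * spinConn g e y μ ν l + (1 / 12) * C y ![μ, ν, l])

/-- The classical supercharge of the complex structure `I`,
`Q^I = ψ^σ I_σ{}^μ (p_μ - (i/2) Ω_{μ,νλ} ψ^ν ψ^λ - (i/4) B_{μνλ} ψ^ν ψ^λ + (i/12) H_{μνλ} ψ^ν ψ^λ)`,
with `B` the Bismut torsion of `I` and `H = H(C, I)`. -/
def structureCharge (g e : Coord n → Matrix (Fin n) (Fin n) ℝ)
    (C : Coord n → (Fin 3 → Fin n) → ℝ) (J : Coord n → Matrix (Fin n) (Fin n) ℝ) :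
    ClassicalCharge n where
  v y a μ := ∑ σ, e y a σ * J y σ μ
  T y a b c := ∑ μ, ∑ ν, ∑ l, (∑ σ, e y a σ * J y σ μ) * e y b ν * e y c l *
    (-(1 / 2) * spinConn g e y μ ν l - (1 / 4) * bismut g J y μ ν l
      + (1 / 12) * holPart J C y μ ν l)

variable {S : Type*} [NormedAddCommGroup S] [NormedSpace ℂ S]

/-- The momentum operator `p_μ = -i ∂_μ` on wave functions with values in `S`. -/
def momentum (μ : Fin n) (Ψ : Coord n → S) (y : Coord n) : S :=
  (-Complex.I) • fderiv ℝ Ψ y (EuclideanSpace.single μ 1)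

/-- The Weyl-ordered product of `ψ^a ψ^b ψ^c`. -/
def weylCubic (F : FermionRep n S) (a b c : Fin n) : Module.End ℂ S :=
  (1 / 6 : ℂ) •
    (F.ψ a * F.ψ b * F.ψ c + F.ψ b * F.ψ c * F.ψ a + F.ψ c * F.ψ a * F.ψ b
      - F.ψ b * F.ψ a * F.ψ c - F.ψ a * F.ψ c * F.ψ b - F.ψ c * F.ψ b * F.ψ a)

/-- Weyl ordering of a classical function; `v p` becomes `½ (v p + p v)`. -/
def weylOrder (F : FermionRep n S) (q : ClassicalCharge n) (Ψ : Coord n → S) (y : Coord n) : S :=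
  (∑ a, ∑ μ, (1 / 2 : ℂ) • F.ψ a
      (((q.v y a μ : ℝ) : ℂ) • momentum μ Ψ y
        + momentum μ (fun z => ((q.v z a μ : ℝ) : ℂ) • Ψ z) y))
    + ∑ a, ∑ b, ∑ c, (Complex.I * ((q.T y a b c : ℝ) : ℂ)) • weylCubic F a b c (Ψ y)

/-- The quantum operator of a classical function, acting on covariant wave functions (those
normalized with the Riemannian measure `√(det g)`): the similarity transform
`(det g)^{-1/4} O (det g)^{1/4}` of the Weyl-ordered operator `O`. -/
def quantize (F : FermionRep n S) (g : Coord n → Matrix (Fin n) (Fin n) ℝ)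
    (q : ClassicalCharge n) (Ψ : Coord n → S) (y : Coord n) : S :=
  ((((g y).det ^ (-(1 / 4) : ℝ) : ℝ) : ℂ)) •
    weylOrder F q (fun z => ((((g z).det ^ ((1 / 4) : ℝ) : ℝ) : ℂ)) • Ψ z) y

/-- The `N` real supercharges `q A` form, as operators on smooth wave functions on the open set `U`,
the `N`-extended supersymmetry algebra `{q_A, q_B} = 2 δ_{AB} H` with some Hamiltonian `H`; in
other words, all squares `(q_A)²` coincide with `H`, and the charges anticommute pairwise. -/
def FormsSusyAlgebra (U : Set (Coord n)) {N : ℕ}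
    (q : Fin N → (Coord n → S) → (Coord n → S)) : Prop :=
  ∃ H : (Coord n → S) → (Coord n → S), ∀ A B : Fin N, ∀ Ψ : Coord n → S,
    ContDiffOn ℝ ∞ Ψ U → ∀ y ∈ U,
      q A (q B Ψ) y + q B (q A Ψ) y = if A = B then (2 : ℂ) • H Ψ y else 0

end Local

/-! ## Tensor fields on a manifold and their components in charts -/

section Global

variable {n : ℕ} {M : Type*} [TopologicalSpace M] [ChartedSpace (Coord n) M]

/-- The coordinate vector `∂_μ` of the chart `c` at the point with coordinates `y`. -/
def coordVec (c : OpenPartialHomeomorph M (Coord n)) (y : Coord n) (μ : Fin n) :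
    TangentSpace (𝓡 n) (c.symm y) :=
  mfderiv (𝓡 n) (𝓡 n) c.symm y (EuclideanSpace.single μ (1 : ℝ) : Coord n)

/-- The coordinate differential `dx^ν` of the chart `c` at the point `x`. -/
def coordDiff (c : OpenPartialHomeomorph M (Coord n)) (x : M) (ν : Fin n)
    (w : TangentSpace (𝓡 n) x) : ℝ :=
  (EuclideanSpace.proj ν : Coord n →L[ℝ] ℝ) (mfderiv (𝓡 n) (𝓡 n) c x w)

variable (n M) in
/-- Smooth Riemannian metrics on `M`. -/
abbrev Metric [IsManifold (𝓡 n) ∞ M] : Type _ :=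
  Bundle.ContMDiffRiemannianMetric (𝓡 n) ∞ (Coord n) (fun x : M => TangentSpace (𝓡 n) x)

variable (n M) in
/-- Fields of endomorphisms of the tangent spaces. -/
abbrev EndField : Type _ :=
  (x : M) → TangentSpace (𝓡 n) x →L[ℝ] TangentSpace (𝓡 n) x

variable (n M) in
/-- Fields of alternating trilinear forms on the tangent spaces. -/
abbrev ThreeForm : Type _ :=
  (x : M) → (TangentSpace (𝓡 n) x) [⋀^Fin 3]→ₗ[ℝ] ℝ

/-- The components `g_{μν}` in the chart `c`. -/
def metricComp [IsManifold (𝓡 n) ∞ M] (g : Metric n M)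
    (c : OpenPartialHomeomorph M (Coord n)) (y : Coord n) : Matrix (Fin n) (Fin n) ℝ :=
  Matrix.of fun μ ν => g.inner (c.symm y) (coordVec c y μ) (coordVec c y ν)

/-- The components `I_μ{}^ν` in the chart `c`, defined by `I ∂_μ = I_μ{}^ν ∂_ν`. -/
def endComp (J : EndField n M) (c : OpenPartialHomeomorph M (Coord n)) (y : Coord n) :
    Matrix (Fin n) (Fin n) ℝ :=
  Matrix.of fun μ ν => coordDiff c (c.symm y) ν (J (c.symm y) (coordVec c y μ))

/-- The components `C_{μνλ}` in the chart `c`. -/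
def formComp (C : ThreeForm n M) (c : OpenPartialHomeomorph M (Coord n)) (y : Coord n)
    (m : Fin 3 → Fin n) : ℝ :=
  C (c.symm y) fun k => coordVec c y (m k)

/-- Smoothness of an endomorphism field: its components in each chart of the atlas are smooth. -/
def SmoothEnd (J : EndField n M) : Prop :=
  ∀ c ∈ atlas (Coord n) M, ∀ μ ν, ContDiffOn ℝ ∞ (fun y => endComp J c y μ ν) c.target

/-- Smoothness of a 3-form: its components in each chart of the atlas are smooth. -/
def SmoothForm (C : ThreeForm n M) : Prop :=
  ∀ c ∈ atlas (Coord n) M, ∀ m, ContDiffOn ℝ ∞ (fun y => formComp C c y m) c.target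

variable [IsManifold (𝓡 n) ∞ M]

/-- `e` is a smooth vielbein over the chart `c`: a smooth frame `e_a = e_a{}^μ ∂_μ` with
`g_{μν} e_a{}^μ e_b{}^ν = δ_{ab}`. -/
def IsVielbein (g : Metric n M) (c : OpenPartialHomeomorph M (Coord n))
    (e : Coord n → Matrix (Fin n) (Fin n) ℝ) : Prop :=
  (∀ a μ, ContDiffOn ℝ ∞ (fun y => e y a μ) c.target) ∧
  ∀ y ∈ c.target, ∀ a b,
    ∑ μ, ∑ ν, metricComp g c y μ ν * e y a μ * e y b ν = if a = b then 1 else 0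

/-- The complex structures `I^a` are antisymmetric (`I_{μν} = -I_{νμ}`), integrable, satisfy the
Clifford algebra `I^a I^b + I^b I^a = -2 δ^{ab}`, and their Nijenhuis concomitants vanish. -/
structure IsCliffordFamily (g : Metric n M) {K : ℕ} (J : Fin K → EndField n M) : Prop where
  smooth : ∀ a, SmoothEnd (J a)
  clifford : ∀ a b x, J a x ∘L J b x + J b x ∘L J a x =
    if a = b then (-2 : ℝ) • ContinuousLinearMap.id ℝ (TangentSpace (𝓡 n) x) else 0
  antisymm : ∀ a x (w w' : TangentSpace (𝓡 n) x),
    g.inner x (J a x w) w' = -g.inner x w (J a x w')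
  integrable : ∀ a, ∀ c ∈ atlas (Coord n) M, ∀ y ∈ c.target,
    NijenhuisVanishes (endComp (J a) c) y
  concomitant_eq_zero : ∀ a b, ∀ c ∈ atlas (Coord n) M, ∀ y ∈ c.target, ∀ μ ν l,
    concomitant (endComp (J a) c) (endComp (J b) c) y μ ν l = 0

/-- The torsion `C` is, for each `I^a`, the Bismut torsion of `I^a` completed by the holomorphic
and antiholomorphic parts of `C`: `C = B^a + H(C, I^a)`. -/
def IsCompletedBismut (g : Metric n M) {K : ℕ} (J : Fin K → EndField n M)
    (C : ThreeForm n M) : Prop :=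
  ∀ a, ∀ c ∈ atlas (Coord n) M, ∀ y ∈ c.target, ∀ μ ν l,
    formComp C c y ![μ, ν, l] =
      bismut (metricComp g c) (endComp (J a) c) y μ ν l
        + holPart (endComp (J a) c) (formComp C c) y μ ν l

/-- Clifford Kähler geometry with torsion: `K` integrable antisymmetric complex structures that
satisfy the Clifford algebra and have vanishing concomitants, together with a totally
antisymmetric torsion `C` such that `∇̃_{(λ} I^a_{μ)}{}^ν = 0` and `ι_a dC = (2/3) d(ι_a C)`.
This is CKT geometry for `K = 3` and OKT geometry for `K = 7`. -/
structure IsCliffordKahlerTorsion (g : Metric n M) {K : ℕ} (J : Fin K → EndField n M)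
    (C : ThreeForm n M) : Prop where
  family : IsCliffordFamily g J
  smooth : SmoothForm C
  weaklyCovariant : ∀ a, ∀ c ∈ atlas (Coord n) M, ∀ y ∈ c.target, ∀ l μ ν,
    nablaTorsion (metricComp g c) (formComp C c) (endComp (J a) c) y l μ ν
      + nablaTorsion (metricComp g c) (formComp C c) (endComp (J a) c) y μ l ν = 0
  torsion_eq : ∀ a, ∀ c ∈ atlas (Coord n) M, ∀ y ∈ c.target, ∀ m : Fin 4 → Fin n,
    iota (endComp (J a) c) (extD (formComp C c)) y m =
      (2 / 3) * extD (iota (endComp (J a) c) (formComp C c)) y m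

variable {S : Type*} [NormedAddCommGroup S] [NormedSpace ℂ S]

/-- The quantum supercharge `Q` in the chart `c` with the vielbein `e`. -/
def Q (F : FermionRep n S) (g : Metric n M) (C : ThreeForm n M)
    (c : OpenPartialHomeomorph M (Coord n)) (e : Coord n → Matrix (Fin n) (Fin n) ℝ) :
    (Coord n → S) → (Coord n → S) :=
  quantize F (metricComp g c) (singletCharge (metricComp g c) e (formComp C c))

/-- The quantum supercharge `Q^I` of the complex structure `I` in the chart `c` with the
vielbein `e`. -/
def QI (F : FermionRep n S) (g : Metric n M) (C : ThreeForm n M) (I : EndField n M)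
    (c : OpenPartialHomeomorph M (Coord n)) (e : Coord n → Matrix (Fin n) (Fin n) ℝ) :
    (Coord n → S) → (Coord n → S) :=
  quantize F (metricComp g c) (structureCharge (metricComp g c) e (formComp C c) (endComp I c))

end Global

end CliffordKT

end

noncomputable section

namespace CliffordKT

/-! ## An algebra of differential operators with Clifford coefficients -/

/-! Weak covariance needs no supersymmetry. For an antisymmetric integrable `I` the array `∇_α
I_{βγ}` has enough linear symmetries to be recovered from its cyclic sum, so `C = B + H` becomes the
explicit formula `∇I = ¼ (I₀ - I₁ - I₂ - I₀I₁I₂) C`, where `I_k` is `I` acting on slot `k`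
(`eq_of_bismut`, `nablaArr_eq`). Adding the torsion terms, with the upper index lowered, leaves a
totally antisymmetric array (`nablaTorsion_symm`).

For the torsion equation let `D = Q + i Q^a`, after removal of the density factors. The `𝒩 = 2`
relations say exactly that `D² = 0`. Let `G = (i/2) I_{bc} ψ^b ψ^c` in flat indices. The formula for
`∇I` yields `[G, D] = D + W`, where `W` is `(1/24) C_{μνλ} Θ^μ Θ^ν Θ^λ` plus an element linear in
the fermions, and `Θ^μ = [D, x^μ]` are the fermions projected to one eigenspace of `I`. Nilpotency
forces `{D, W} = 0`. Since the `Θ^μ` anticommute with `D` and with each other, the quartic part of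
this relation is `∂_σ C_{μνλ} Θ^σ Θ^μ Θ^ν Θ^λ = 0` up to lower degree: the projection of `dC` to one
extreme type vanishes (`alt4_eq_zero_of_mul_self_eq_zero`, `act4_holMat_extD`). Reality of `dC`
disposes of the conjugate type.

The rest is calculus with `ι`. Integrability gives `[ι, [ι, d]] = -d` (`extD_iota_iota`), and the
Bismut formula says that `ι³C + 9ιC` is `-8` times the differential of the fundamental form
(`iota_cubed_add`). Together with the type of `dC` these give `(3ι² + 8)(dιC - (3/2) ι dC) = 0`; on
4-index arrays `ι` has eigenvalues `0, ±2i, ±4i`, so `3ι² + 8` is invertible (`torsion_eq_of_type`).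

For the extended algebra let `X = {Q^a, Q^b}` with `a ≠ b`. The Clifford relation removes its
second-order part. As `Q`, `Q^a`, `Q^b` have the same square and `Q` anticommutes with the other
two, `X` commutes with all three. Commuting these relations twice with coordinates constrains the
bivector that multiplies `∂_μ`: its antisymmetric part becomes a 3-form on which `I^a`, and likewise
`I^b`, acts equally on all slots, and two anticommuting structures allow only the zero form
(`eq_zero_of_slot_eq`, `eq_of_bracket_eq`). Hence `X` has order zero, commutes with every fermion,
and is a function (`exists_anticomm_eq_m`). That function equals its normalized trace, a quadratic
expression in the spin connection and the torsion, which vanishes by the Clifford relation and the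
vanishing concomitant (`pairing_charges`, `structureOp_anticomm`). This is the only place where the
concomitants are used. -/

/-- The relations between multiplication operators `m f`, fermions `ψ a` and partial derivatives
`d μ` in a ring of operators. -/
structure DiffOpAlg (n : ℕ) (R A : Type*) [CommRing R] [Algebra ℂ R] [Ring A]
    [Algebra ℂ A] where
  /-- multiplication by a function -/
  m : R →ₐ[ℂ] A
  /-- the partial derivative of a function -/
  δ : Fin n → Derivation ℂ R R
  /-- the coordinate functions -/
  x : Fin n → R
  /-- the fermions -/
  ψ : Fin n → A
  /-- the partial derivatives as operators -/
  d : Fin n → A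
  ψ_anticomm : ∀ a b, ψ a * ψ b + ψ b * ψ a = if a = b then 1 else 0
  ψ_m : ∀ a f, ψ a * m f = m f * ψ a
  d_ψ : ∀ μ a, d μ * ψ a = ψ a * d μ
  d_m : ∀ μ f, d μ * m f = m f * d μ + m (δ μ f)
  d_comm : ∀ μ ν, d μ * d ν = d ν * d μ
  δ_x : ∀ μ ν, δ μ (x ν) = if μ = ν then 1 else 0

namespace DiffOpAlg

variable {n : ℕ} {R A : Type*} [CommRing R] [Algebra ℂ R] [Ring A] [Algebra ℂ A]
  (O : DiffOpAlg n R A)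

/-- The Clifford element `u_a ψ^a`. -/
def lin (u : Fin n → R) : A := ∑ a, O.m (u a) * O.ψ a

/-- The Clifford element `u_{ab} ψ^a ψ^b`. -/
def quad (u : Fin n → Fin n → R) : A := ∑ a, ∑ b, O.m (u a b) * (O.ψ a * O.ψ b)

/-- The Clifford element `u_{abc} ψ^a ψ^b ψ^c`. -/
def cub (u : Fin n → Fin n → Fin n → R) : A :=
  ∑ a, ∑ b, ∑ c, O.m (u a b c) * (O.ψ a * O.ψ b * O.ψ c)

/-- The Clifford element `u_{abcd} ψ^a ψ^b ψ^c ψ^d`. -/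
def quart (u : Fin n → Fin n → Fin n → Fin n → R) : A :=
  ∑ a, ∑ b, ∑ c, ∑ e, O.m (u a b c e) * (O.ψ a * O.ψ b * O.ψ c * O.ψ e)

lemma ψ_swap (a b : Fin n) : O.ψ a * O.ψ b = (if a = b then 1 else 0) - O.ψ b * O.ψ a :=
  eq_sub_of_add_eq (O.ψ_anticomm a b)

/-- The supercommutator with `ψ^e` is contraction with a basis covector and lowers the degree by
one. This lemma and its analogues in degrees two to four read off antisymmetrized coefficients
without a basis theorem for the Clifford algebra. -/
lemma lin_anticomm_ψ (u : Fin n → R) (e : Fin n) :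
    O.lin u * O.ψ e + O.ψ e * O.lin u = O.m (u e) := by
  have h : ∀ a, O.m (u a) * O.ψ a * O.ψ e + O.ψ e * (O.m (u a) * O.ψ a)
      = if a = e then O.m (u a) else 0 := by
    intro a
    have h1 := O.ψ_anticomm a e
    rw [← mul_assoc, O.ψ_m, mul_assoc, mul_assoc, ← mul_add, h1]
    split_ifs <;> simp
  simp only [lin, Finset.sum_mul, Finset.mul_sum, ← Finset.sum_add_distrib, h]
  simp

lemma quad_comm_ψ (u : Fin n → Fin n → R) (e : Fin n) :
    O.quad u * O.ψ e - O.ψ e * O.quad u = O.lin (fun a => u a e - u e a) := by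
  have h : ∀ a b, O.m (u a b) * (O.ψ a * O.ψ b) * O.ψ e - O.ψ e * (O.m (u a b) * (O.ψ a * O.ψ b))
      = (if b = e then O.m (u a b) * O.ψ a else 0) - if a = e then O.m (u a b) * O.ψ b else 0 := by
    intro a b
    have h1 : O.ψ a * O.ψ b * O.ψ e - O.ψ e * (O.ψ a * O.ψ b)
        = O.ψ a * (O.ψ b * O.ψ e + O.ψ e * O.ψ b) - (O.ψ a * O.ψ e + O.ψ e * O.ψ a) * O.ψ b := by
      noncomm_ring
    rw [← mul_assoc (O.ψ e), O.ψ_m, mul_assoc, mul_assoc (O.m _), ← mul_sub, h1,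
      O.ψ_anticomm, O.ψ_anticomm, mul_sub]
    split_ifs <;> simp
  simp only [quad, lin, Finset.sum_mul, Finset.mul_sum, ← Finset.sum_sub_distrib, h]
  simp only [Finset.sum_sub_distrib, map_sub, sub_mul]
  simp [Finset.sum_ite_irrel]

lemma cub_anticomm_ψ (u : Fin n → Fin n → Fin n → R) (e : Fin n) :
    O.cub u * O.ψ e + O.ψ e * O.cub u
      = O.quad (fun a b => u a b e - u a e b + u e a b) := by
  have h : ∀ a b c, O.m (u a b c) * (O.ψ a * O.ψ b * O.ψ c) * O.ψ e
      + O.ψ e * (O.m (u a b c) * (O.ψ a * O.ψ b * O.ψ c))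
      = (if c = e then O.m (u a b c) * (O.ψ a * O.ψ b) else 0)
        - (if b = e then O.m (u a b c) * (O.ψ a * O.ψ c) else 0)
        + if a = e then O.m (u a b c) * (O.ψ b * O.ψ c) else 0 := by
    intro a b c
    have h1 : O.ψ a * O.ψ b * O.ψ c * O.ψ e + O.ψ e * (O.ψ a * O.ψ b * O.ψ c)
        = O.ψ a * O.ψ b * (O.ψ c * O.ψ e + O.ψ e * O.ψ c)
          - O.ψ a * (O.ψ b * O.ψ e + O.ψ e * O.ψ b) * O.ψ c
          + (O.ψ a * O.ψ e + O.ψ e * O.ψ a) * O.ψ b * O.ψ c := by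
      noncomm_ring
    rw [← mul_assoc (O.ψ e), O.ψ_m, mul_assoc, mul_assoc (O.m _), ← mul_add, h1,
      O.ψ_anticomm, O.ψ_anticomm, O.ψ_anticomm, mul_add, mul_sub]
    split_ifs <;> simp
  simp only [cub, quad, Finset.sum_mul, Finset.mul_sum, ← Finset.sum_add_distrib, h]
  simp only [Finset.sum_sub_distrib, Finset.sum_add_distrib, map_sub, map_add, sub_mul, add_mul]
  simp [Finset.sum_ite_irrel]

lemma quart_comm_ψ (u : Fin n → Fin n → Fin n → Fin n → R) (e : Fin n) :
    O.quart u * O.ψ e - O.ψ e * O.quart u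
      = O.cub (fun a b c => u a b c e - u a b e c + u a e b c - u e a b c) := by
  have h : ∀ a b c f, O.m (u a b c f) * (O.ψ a * O.ψ b * O.ψ c * O.ψ f) * O.ψ e
      - O.ψ e * (O.m (u a b c f) * (O.ψ a * O.ψ b * O.ψ c * O.ψ f))
      = (if f = e then O.m (u a b c f) * (O.ψ a * O.ψ b * O.ψ c) else 0)
        - (if c = e then O.m (u a b c f) * (O.ψ a * O.ψ b * O.ψ f) else 0)
        + (if b = e then O.m (u a b c f) * (O.ψ a * O.ψ c * O.ψ f) else 0)
        - if a = e then O.m (u a b c f) * (O.ψ b * O.ψ c * O.ψ f) else 0 := by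
    intro a b c f
    have h1 : O.ψ a * O.ψ b * O.ψ c * O.ψ f * O.ψ e - O.ψ e * (O.ψ a * O.ψ b * O.ψ c * O.ψ f)
        = O.ψ a * O.ψ b * O.ψ c * (O.ψ f * O.ψ e + O.ψ e * O.ψ f)
          - O.ψ a * O.ψ b * (O.ψ c * O.ψ e + O.ψ e * O.ψ c) * O.ψ f
          + O.ψ a * (O.ψ b * O.ψ e + O.ψ e * O.ψ b) * O.ψ c * O.ψ f
          - (O.ψ a * O.ψ e + O.ψ e * O.ψ a) * O.ψ b * O.ψ c * O.ψ f := by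
      noncomm_ring
    rw [← mul_assoc (O.ψ e), O.ψ_m, mul_assoc, mul_assoc (O.m _), ← mul_sub, h1,
      O.ψ_anticomm, O.ψ_anticomm, O.ψ_anticomm, O.ψ_anticomm, mul_sub, mul_add, mul_sub]
    split_ifs <;> simp
  simp only [cub, quart, Finset.sum_mul, Finset.mul_sum, ← Finset.sum_sub_distrib, h]
  simp only [Finset.sum_sub_distrib, Finset.sum_add_distrib, map_sub, map_add, sub_mul, add_mul]
  simp [Finset.sum_ite_irrel]

/-- The antisymmetrized coefficient of a quartic Clifford element vanishes if the element is of
lower degree. -/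
lemma alternation_eq_zero_of_quart_eq (hm : Function.Injective O.m)
    {z : Fin n → Fin n → Fin n → Fin n → R} {y : Fin n → Fin n → R} {s : R}
    (h : O.quart z + O.quad y + O.m s = 0) (a b c e : Fin n) :
    (z a b c e - z a b e c + z a e b c - z e a b c)
      - (z a c b e - z a c e b + z a e c b - z e a c b)
      + (z c a b e - z c a e b + z c e a b - z e c a b)
      - ((z b a c e - z b a e c + z b e a c - z e b a c)
      - (z b c a e - z b c e a + z b e c a - z e b c a)
      + (z c b a e - z c b e a + z c e b a - z e c b a)) = 0 := by
  -- Four successive supercommutators, with the fermions `e`, `c`, `b`, `a`. The scalar disappears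
  -- at the first and the quadratic term at the third; what is left of the quartic term is `m` of
  -- its alternated coefficient.
  have h1 : O.cub (fun a b c => z a b c e - z a b e c + z a e b c - z e a b c)
      + O.lin (fun a => y a e - y e a) = 0 := by
    rw [← quart_comm_ψ, ← quad_comm_ψ]
    have h0 := congrArg (fun w => w * O.ψ e - O.ψ e * w) h
    simp only [add_mul, mul_add, zero_mul, mul_zero, sub_zero, O.ψ_m] at h0
    rw [← h0]; abel
  have h2 := congrArg (fun w => w * O.ψ c + O.ψ c * w) h1
  simp only [add_mul, mul_add, zero_mul, mul_zero, add_zero] at h2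
  rw [add_add_add_comm, cub_anticomm_ψ, lin_anticomm_ψ] at h2
  have h3 := congrArg (fun w => w * O.ψ b - O.ψ b * w) h2
  simp only [add_mul, mul_add, zero_mul, mul_zero, sub_zero, O.ψ_m, add_sub_add_right_eq_sub,
    quad_comm_ψ] at h3
  have h4 := congrArg (fun w => w * O.ψ a + O.ψ a * w) h3
  simp only [zero_mul, mul_zero, add_zero, lin_anticomm_ψ] at h4
  have h5 := hm (h4.trans O.m.map_zero.symm)
  linear_combination h5

end DiffOpAlg

end CliffordKT

/-! ### Weyl-ordered charges and their symbols -/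

namespace CliffordKT
namespace DiffOpAlg

variable {n : ℕ} {R A : Type*} [CommRing R] [Algebra ℂ R] [Ring A] [Algebra ℂ A]
  (O : DiffOpAlg n R A)

lemma m_comm (f g : R) : O.m f * O.m g = O.m g * O.m f := by
  rw [← map_mul, mul_comm, map_mul]

lemma ψψ_m (a b : Fin n) (f : R) : O.ψ a * O.ψ b * O.m f = O.m f * (O.ψ a * O.ψ b) := by
  rw [mul_assoc, O.ψ_m, ← mul_assoc, O.ψ_m, mul_assoc]

lemma ψψψ_m (a b c : Fin n) (f : R) :
    O.ψ a * O.ψ b * O.ψ c * O.m f = O.m f * (O.ψ a * O.ψ b * O.ψ c) := by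
  rw [mul_assoc, O.ψ_m, ← mul_assoc, ψψ_m, mul_assoc]

lemma lin_m (u : Fin n → R) (f : R) : O.lin u * O.m f = O.m f * O.lin u := by
  simp only [lin, Finset.sum_mul, Finset.mul_sum]
  refine Finset.sum_congr rfl fun a _ => ?_
  rw [mul_assoc, O.ψ_m, ← mul_assoc, O.m_comm, mul_assoc]

lemma quad_m (u : Fin n → Fin n → R) (f : R) : O.quad u * O.m f = O.m f * O.quad u := by
  simp only [quad, Finset.sum_mul, Finset.mul_sum]
  refine Finset.sum_congr rfl fun a _ => Finset.sum_congr rfl fun b _ => ?_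
  rw [mul_assoc, ψψ_m, ← mul_assoc, O.m_comm, mul_assoc]

lemma cub_m (u : Fin n → Fin n → Fin n → R) (f : R) : O.cub u * O.m f = O.m f * O.cub u := by
  simp only [cub, Finset.sum_mul, Finset.mul_sum]
  refine Finset.sum_congr rfl fun a _ => Finset.sum_congr rfl fun b _ =>
    Finset.sum_congr rfl fun c _ => ?_
  rw [mul_assoc, ψψψ_m, ← mul_assoc, O.m_comm, mul_assoc]

lemma d_lin (μ : Fin n) (u : Fin n → R) :
    O.d μ * O.lin u = O.lin u * O.d μ + O.lin (fun a => O.δ μ (u a)) := by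
  simp only [lin, Finset.sum_mul, Finset.mul_sum, ← Finset.sum_add_distrib]
  refine Finset.sum_congr rfl fun a _ => ?_
  rw [← mul_assoc, O.d_m, add_mul, mul_assoc, O.d_ψ, mul_assoc]

lemma d_quad (μ : Fin n) (u : Fin n → Fin n → R) :
    O.d μ * O.quad u = O.quad u * O.d μ + O.quad (fun a b => O.δ μ (u a b)) := by
  simp only [quad, Finset.sum_mul, Finset.mul_sum, ← Finset.sum_add_distrib]
  refine Finset.sum_congr rfl fun a _ => Finset.sum_congr rfl fun b _ => ?_
  rw [← mul_assoc, O.d_m, add_mul, mul_assoc, ← mul_assoc (O.d μ), O.d_ψ, mul_assoc (O.ψ a),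
    O.d_ψ, mul_assoc, mul_assoc]

lemma d_cub (μ : Fin n) (u : Fin n → Fin n → Fin n → R) :
    O.d μ * O.cub u = O.cub u * O.d μ + O.cub (fun a b c => O.δ μ (u a b c)) := by
  simp only [cub, Finset.sum_mul, Finset.mul_sum, ← Finset.sum_add_distrib]
  refine Finset.sum_congr rfl fun a _ => Finset.sum_congr rfl fun b _ =>
    Finset.sum_congr rfl fun c _ => ?_
  rw [← mul_assoc, O.d_m, add_mul]
  have : O.d μ * (O.ψ a * O.ψ b * O.ψ c) = O.ψ a * O.ψ b * O.ψ c * O.d μ := by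
    rw [← mul_assoc, ← mul_assoc, O.d_ψ, mul_assoc (O.ψ a), O.d_ψ, ← mul_assoc, mul_assoc, O.d_ψ,
      ← mul_assoc]
  rw [mul_assoc (O.m _), this, ← mul_assoc (O.m _)]

/-- The symbol `v_a{}^μ ψ^a`. -/
def symb (v : Fin n → Fin n → R) (μ : Fin n) : A := O.lin fun a => v a μ

/-- The part of order zero of the Weyl-ordered charge with coefficients `v`, `t`. -/
def order0 (v : Fin n → Fin n → R) (t : Fin n → Fin n → Fin n → R) : A :=
  O.lin (fun a => (1 / 2 : ℂ) • ∑ μ, O.δ μ (v a μ)) + O.cub t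

/-- The Weyl-ordered operator `½ ψ^a (v_a{}^μ ∂_μ + ∂_μ v_a{}^μ) + t_{abc} ψ^a ψ^b ψ^c`. -/
def charge (v : Fin n → Fin n → R) (t : Fin n → Fin n → Fin n → R) : A :=
  ∑ μ, O.symb v μ * O.d μ + O.order0 v t

lemma order0_m (v : Fin n → Fin n → R) (t : Fin n → Fin n → Fin n → R) (f : R) :
    O.order0 v t * O.m f = O.m f * O.order0 v t := by
  rw [order0, add_mul, lin_m, cub_m, mul_add]

lemma symb_m (v : Fin n → Fin n → R) (μ : Fin n) (f : R) :
    O.symb v μ * O.m f = O.m f * O.symb v μ := O.lin_m _ _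

lemma charge_m (v : Fin n → Fin n → R) (t : Fin n → Fin n → Fin n → R) (f : R) :
    O.charge v t * O.m f = O.m f * O.charge v t + ∑ μ, O.m (O.δ μ f) * O.symb v μ := by
  rw [charge, add_mul, order0_m, mul_add, Finset.sum_mul, Finset.mul_sum, add_right_comm,
    ← Finset.sum_add_distrib]
  congr 1
  refine Finset.sum_congr rfl fun μ _ => ?_
  rw [mul_assoc, O.d_m, mul_add, ← mul_assoc, symb_m, symb_m, mul_assoc]

/-- Coordinates detect the symbol: this is how operator identities are converted into identities
between their leading coefficients. -/
lemma charge_x (v : Fin n → Fin n → R) (t : Fin n → Fin n → Fin n → R) (μ : Fin n) :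
    O.charge v t * O.m (O.x μ) - O.m (O.x μ) * O.charge v t = O.symb v μ := by
  rw [charge_m, add_sub_cancel_left, Finset.sum_eq_single μ]
  · simp [O.δ_x]
  · intro ν _ h; simp [O.δ_x, h]
  · simp

lemma symb_anticomm (v w : Fin n → Fin n → R) (μ ν : Fin n) :
    O.symb v μ * O.symb w ν + O.symb w ν * O.symb v μ = O.m (∑ a, v a μ * w a ν) := by
  rw [symb, symb]
  conv_lhs => rw [lin.eq_def O (fun a => w a ν)]
  rw [Finset.mul_sum, Finset.sum_mul, ← Finset.sum_add_distrib, map_sum]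
  refine Finset.sum_congr rfl fun a _ => ?_
  rw [← mul_assoc, lin_m, mul_assoc, mul_assoc, ← mul_add, lin_anticomm_ψ, ← map_mul, mul_comm]

/-- A transposition of neighbouring fermions costs a sign and the contraction of the two indices,
which is linear in the fermions. -/
lemma cub_swap_left (r : Fin n → Fin n → Fin n → R) :
    ∃ ε, O.cub (fun a b c => r b a c) = O.lin ε - O.cub r := by
  refine ⟨fun c => ∑ a, r a a c, ?_⟩
  have h : ∀ a b c, O.m (r b a c) * (O.ψ a * O.ψ b * O.ψ c)
      = (if a = b then O.m (r b a c) * O.ψ c else 0)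
        - O.m (r b a c) * (O.ψ b * O.ψ a * O.ψ c) := by
    intro a b c
    rw [O.ψ_swap a b, sub_mul, mul_sub]
    split_ifs <;> simp
  simp only [cub, h, Finset.sum_sub_distrib]
  congr 1
  · simp only [lin, Finset.sum_ite_irrel, map_sum, Finset.sum_mul]
    rw [Finset.sum_comm]
    simp
    rw [Finset.sum_comm]
  · rw [Finset.sum_comm]

lemma cub_swap_right (r : Fin n → Fin n → Fin n → R) :
    ∃ ε, O.cub (fun a b c => r a c b) = O.lin ε - O.cub r := by
  refine ⟨fun c => ∑ a, r c a a, ?_⟩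
  have h : ∀ a b c, O.m (r a c b) * (O.ψ a * O.ψ b * O.ψ c)
      = (if b = c then O.m (r a c b) * O.ψ a else 0)
        - O.m (r a c b) * (O.ψ a * O.ψ c * O.ψ b) := by
    intro a b c
    rw [mul_assoc (O.ψ a), O.ψ_swap b c, mul_sub, mul_sub, mul_assoc (O.ψ a)]
    split_ifs <;> simp
  simp only [cub, h, Finset.sum_sub_distrib]
  congr 1
  · simp [lin, Finset.sum_mul]
  · exact Finset.sum_congr rfl fun a _ => Finset.sum_comm

lemma lin_add (u v : Fin n → R) : O.lin u + O.lin v = O.lin (fun a => u a + v a) := by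
  simp [lin, add_mul, Finset.sum_add_distrib]

lemma lin_sub (u v : Fin n → R) : O.lin u - O.lin v = O.lin (fun a => u a - v a) := by
  simp [lin, sub_mul, Finset.sum_sub_distrib]

lemma lin_smul (k : ℂ) (u : Fin n → R) : k • O.lin u = O.lin (fun a => k • u a) := by
  simp [lin, Finset.smul_sum]

lemma quad_add (u v : Fin n → Fin n → R) :
    O.quad u + O.quad v = O.quad (fun a b => u a b + v a b) := by
  simp [quad, add_mul, Finset.sum_add_distrib]

lemma cub_add (u v : Fin n → Fin n → Fin n → R) :
    O.cub u + O.cub v = O.cub (fun a b c => u a b c + v a b c) := by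
  simp [cub, add_mul, Finset.sum_add_distrib]

lemma cub_sub (u v : Fin n → Fin n → Fin n → R) :
    O.cub u - O.cub v = O.cub (fun a b c => u a b c - v a b c) := by
  simp [cub, sub_mul, Finset.sum_sub_distrib]

/-- A cubic Clifford element whose antisymmetrized coefficient vanishes is linear. -/
lemma cub_eq_lin (r : Fin n → Fin n → Fin n → R)
    (h : ∀ a b c, r a b c + r b c a + r c a b - r b a c - r a c b - r c b a = 0) :
    ∃ ε, O.cub r = O.lin ε := by
  obtain ⟨e1, h1⟩ := O.cub_swap_left r
  obtain ⟨e2, h2⟩ := O.cub_swap_right r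
  obtain ⟨e3, h3⟩ := O.cub_swap_left fun a b c => r a c b
  obtain ⟨e4, h4⟩ := O.cub_swap_right fun a b c => r b a c
  obtain ⟨e5, h5⟩ := O.cub_swap_left fun a b c => r c a b
  have h0 : O.cub r + O.cub (fun a b c => r b c a) + O.cub (fun a b c => r c a b)
      - O.cub (fun a b c => r b a c) - O.cub (fun a b c => r a c b)
      - O.cub (fun a b c => r c b a) = 0 := by
    simp only [cub_add, cub_sub, h]
    simp [cub]
  rw [h5, h4, h3, h2, h1] at h0
  -- Modulo linear elements each of the six permuted cubics is `± O.cub r`. Their signed sum is zero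
  -- by `h0`, so six times `O.cub r` is the collected linear corrections.
  refine ⟨fun a => (1 / 6 : ℂ) • (e1 a + e2 a - (e3 a - e2 a) - (e4 a - e1 a)
    + (e5 a - (e4 a - e1 a))), ?_⟩
  rw [← lin_smul, ← lin_add, ← lin_sub, ← lin_sub, ← lin_sub, ← lin_sub, ← lin_sub, ← lin_sub,
    ← lin_add]
  have : (6 : ℂ) • O.cub r = O.lin e1 + O.lin e2 - (O.lin e3 - O.lin e2) - (O.lin e4 - O.lin e1)
      + (O.lin e5 - (O.lin e4 - O.lin e1)) := by
    rw [← sub_eq_zero, ← h0]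
    module
  rw [← this, smul_smul]
  norm_num

end DiffOpAlg
end CliffordKT

/-! ### Products of Clifford elements, and rotations generated by bivectors -/

namespace CliffordKT
namespace DiffOpAlg

variable {n : ℕ} {R A : Type*} [CommRing R] [Algebra ℂ R] [Ring A] [Algebra ℂ A]
  (O : DiffOpAlg n R A)

lemma lin_mul_quad (u : Fin n → R) (v : Fin n → Fin n → R) :
    O.lin u * O.quad v = O.cub fun a b c => u a * v b c := by
  rw [lin, quad, cub, Finset.sum_mul]
  refine Finset.sum_congr rfl fun a _ => ?_
  simp only [Finset.mul_sum]
  refine Finset.sum_congr rfl fun b _ => Finset.sum_congr rfl fun c _ => ?_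
  rw [mul_assoc, ← mul_assoc (O.ψ a), O.ψ_m, map_mul]
  simp only [mul_assoc]

lemma lin_mul_lin (u v : Fin n → R) : O.lin u * O.lin v = O.quad fun a b => u a * v b := by
  simp only [lin, quad, Finset.sum_mul_sum]
  refine Finset.sum_congr rfl fun a _ => Finset.sum_congr rfl fun b _ => ?_
  rw [mul_assoc, ← mul_assoc (O.ψ a), O.ψ_m, map_mul]
  simp only [mul_assoc]

lemma lin_mul_cub (u : Fin n → R) (v : Fin n → Fin n → Fin n → R) :
    O.lin u * O.cub v = O.quart fun a b c e => u a * v b c e := by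
  rw [lin, quart, cub, Finset.sum_mul]
  refine Finset.sum_congr rfl fun a _ => ?_
  simp only [Finset.mul_sum]
  refine Finset.sum_congr rfl fun b _ => Finset.sum_congr rfl fun c _ =>
    Finset.sum_congr rfl fun e _ => ?_
  rw [mul_assoc, ← mul_assoc (O.ψ a), O.ψ_m, map_mul]
  simp only [mul_assoc]

lemma cub_anticomm_lin (t : Fin n → Fin n → Fin n → R) (u : Fin n → R) :
    O.cub t * O.lin u + O.lin u * O.cub t
      = O.quad fun a b => ∑ e, u e * (t a b e - t a e b + t e a b) := by
  have h : ∀ e, O.m (u e) * (O.cub t * O.ψ e + O.ψ e * O.cub t)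
      = O.quad fun a b => u e * (t a b e - t a e b + t e a b) := by
    intro e
    rw [cub_anticomm_ψ, quad, quad]
    simp only [Finset.mul_sum, ← mul_assoc, map_mul]
  have h2 : O.cub t * O.lin u + O.lin u * O.cub t
      = ∑ e, O.m (u e) * (O.cub t * O.ψ e + O.ψ e * O.cub t) := by
    rw [lin, Finset.mul_sum, Finset.sum_mul, ← Finset.sum_add_distrib]
    refine Finset.sum_congr rfl fun e _ => ?_
    rw [← mul_assoc, cub_m]; noncomm_ring
  rw [h2]
  simp only [h, quad, map_sum, Finset.sum_mul]
  rw [Finset.sum_comm]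
  exact Finset.sum_congr rfl fun a _ => Finset.sum_comm

lemma lin_anticomm_lin (v u : Fin n → R) :
    O.lin v * O.lin u + O.lin u * O.lin v = O.m (∑ e, v e * u e) := by
  conv_lhs => rw [lin.eq_def O u]
  rw [Finset.mul_sum, Finset.sum_mul, ← Finset.sum_add_distrib, map_sum]
  refine Finset.sum_congr rfl fun a _ => ?_
  rw [← mul_assoc, lin_m, mul_assoc, mul_assoc, ← mul_add, lin_anticomm_ψ, ← map_mul, mul_comm]

lemma cub_eq_sum_ψ_mul (t : Fin n → Fin n → Fin n → R) :
    O.cub t = ∑ a, O.ψ a * O.quad (t a) := by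
  simp only [cub, quad, Finset.mul_sum]
  refine Finset.sum_congr rfl fun a _ => Finset.sum_congr rfl fun b _ =>
    Finset.sum_congr rfl fun c _ => ?_
  rw [← mul_assoc (O.ψ a), O.ψ_m]; simp only [mul_assoc]

lemma quad_eq_sum_ψ_mul (t : Fin n → Fin n → R) : O.quad t = ∑ a, O.ψ a * O.lin (t a) := by
  simp only [lin, quad, Finset.mul_sum]
  refine Finset.sum_congr rfl fun a _ => Finset.sum_congr rfl fun b _ => ?_
  rw [← mul_assoc (O.ψ a), O.ψ_m]; simp only [mul_assoc]

lemma sum_lin {ι : Type*} (s : Finset ι) (u : ι → Fin n → R) :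
    ∑ i ∈ s, O.lin (u i) = O.lin fun a => ∑ i ∈ s, u i a := by
  simp only [lin, map_sum, Finset.sum_mul]
  exact Finset.sum_comm

lemma sum_quad {ι : Type*} (s : Finset ι) (u : ι → Fin n → Fin n → R) :
    ∑ i ∈ s, O.quad (u i) = O.quad fun a b => ∑ i ∈ s, u i a b := by
  simp only [quad_eq_sum_ψ_mul, ← sum_lin, Finset.mul_sum]
  exact Finset.sum_comm

lemma sum_cub {ι : Type*} (s : Finset ι) (u : ι → Fin n → Fin n → Fin n → R) :
    ∑ i ∈ s, O.cub (u i) = O.cub fun a b c => ∑ i ∈ s, u i a b c := by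
  simp only [cub_eq_sum_ψ_mul, ← sum_quad, Finset.mul_sum]
  exact Finset.sum_comm

/-- The contraction of the three slots of `t` with `j`. -/
def insert3 (j : Fin n → Fin n → R) (t : Fin n → Fin n → Fin n → R) (a b c : Fin n) : R :=
  ∑ e, j a e * t e b c + ∑ e, j b e * t a e c + ∑ e, j c e * t a b e

section Rotation

variable {j : Fin n → Fin n → R} (hj : ∀ a b, j a b = -j b a)

include hj

/-- An antisymmetric bivector generates a rotation of the fermions; the factor 2 comes from its two
equal slots. The next three lemmas extend this by the Leibniz rule. -/
lemma quad_comm_ψ_of_antisymm (k : ℂ) (e : Fin n) :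
    O.quad (fun a b => k • j a b) * O.ψ e
      = O.ψ e * O.quad (fun a b => k • j a b) + O.lin fun a => (2 * k) • j a e := by
  rw [← sub_eq_iff_eq_add', quad_comm_ψ]
  congr 1; ext a
  rw [hj e a]; module

lemma quad_comm_lin_of_antisymm (k : ℂ) (u : Fin n → R) :
    O.quad (fun a b => k • j a b) * O.lin u
      = O.lin u * O.quad (fun a b => k • j a b)
        + O.lin fun a => (2 * k) • ∑ e, j a e * u e := by
  have h : ∀ e, O.quad (fun a b => k • j a b) * (O.m (u e) * O.ψ e)
      = O.m (u e) * O.ψ e * O.quad (fun a b => k • j a b)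
        + O.lin fun a => (2 * k) • (j a e * u e) := by
    intro e
    rw [← mul_assoc, quad_m, mul_assoc, O.quad_comm_ψ_of_antisymm hj, mul_add, mul_assoc]
    congr 1
    simp only [lin, Finset.mul_sum, ← mul_assoc, ← map_mul, mul_comm (u e), smul_mul_assoc]
  conv_lhs => rw [lin, Finset.mul_sum]
  simp only [h]
  rw [Finset.sum_add_distrib, ← Finset.sum_mul, ← lin, sum_lin]
  simp only [Finset.smul_sum]

lemma quad_comm_quad_of_antisymm (k : ℂ) (u : Fin n → Fin n → R) :
    O.quad (fun a b => k • j a b) * O.quad u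
      = O.quad u * O.quad (fun a b => k • j a b)
        + O.quad fun a b => (2 * k) • (∑ e, j a e * u e b + ∑ e, j b e * u a e) := by
  have h : ∀ e, O.quad (fun a b => k • j a b) * (O.ψ e * O.lin (u e))
      = O.ψ e * O.lin (u e) * O.quad (fun a b => k • j a b)
        + ((O.quad fun a b => (2 * k) • (j a e * u e b))
        + O.ψ e * O.lin fun b => (2 * k) • ∑ f, j b f * u e f) := by
    intro e
    rw [← mul_assoc, O.quad_comm_ψ_of_antisymm hj, add_mul, mul_assoc,
      O.quad_comm_lin_of_antisymm hj, mul_add, ← mul_assoc, lin_mul_lin]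
    simp only [smul_mul_assoc]
    abel
  conv_lhs => rw [quad_eq_sum_ψ_mul O u, Finset.mul_sum]
  simp only [h]
  rw [Finset.sum_add_distrib, Finset.sum_add_distrib, ← Finset.sum_mul, ← quad_eq_sum_ψ_mul,
    sum_quad, ← quad_eq_sum_ψ_mul O fun e b => (2 * k) • ∑ f, j b f * u e f, quad_add]
  simp only [Finset.smul_sum, smul_add]

lemma quad_comm_cub_of_antisymm (k : ℂ) (t : Fin n → Fin n → Fin n → R) :
    O.quad (fun a b => k • j a b) * O.cub t
      = O.cub t * O.quad (fun a b => k • j a b)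
        + O.cub fun a b c => (2 * k) • insert3 j t a b c := by
  have h : ∀ e, O.quad (fun a b => k • j a b) * (O.ψ e * O.quad (t e))
      = O.ψ e * O.quad (t e) * O.quad (fun a b => k • j a b)
        + ((O.cub fun a b c => (2 * k) • (j a e * t e b c))
        + O.ψ e * O.quad fun b c => (2 * k) • (∑ f, j b f * t e f c + ∑ f, j c f * t e b f)) := by
    intro e
    rw [← mul_assoc, O.quad_comm_ψ_of_antisymm hj, add_mul, mul_assoc,
      O.quad_comm_quad_of_antisymm hj, mul_add, ← mul_assoc, lin_mul_quad]
    simp only [smul_mul_assoc]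
    abel
  conv_lhs => rw [cub_eq_sum_ψ_mul O t, Finset.mul_sum]
  simp only [h]
  rw [Finset.sum_add_distrib, Finset.sum_add_distrib, ← Finset.sum_mul, ← cub_eq_sum_ψ_mul,
    sum_cub, ← cub_eq_sum_ψ_mul O fun e b c =>
      (2 * k) • (∑ f, j b f * t e f c + ∑ f, j c f * t e b f), cub_add]
  simp only [insert3, Finset.smul_sum, smul_add, add_assoc]

end Rotation

end DiffOpAlg
end CliffordKT

/-! ### Nilpotent charges -/

namespace CliffordKT
namespace DiffOpAlg

variable {n : ℕ} {R A : Type*} [CommRing R] [Algebra ℂ R] [Ring A] [Algebra ℂ A]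
  (O : DiffOpAlg n R A)

/-- The antisymmetrization of a 4-index array, without a numerical factor. -/
def alt4 {ι X : Type*} [AddCommGroup X] (q : ι → ι → ι → ι → X) (a b c e : ι) : X :=
  (q a b c e - q a b e c + q a e b c - q e a b c)
    - (q a c b e - q a c e b + q a e c b - q e a c b)
    + (q c a b e - q c a e b + q c e a b - q e c a b)
    - ((q b a c e - q b a e c + q b e a c - q e b a c)
    - (q b c a e - q b c e a + q b e c a - q e b c a)
    + (q c b a e - q c b e a + q c e b a - q e c b a))

/-- The antisymmetrization of a 3-index array, without a numerical factor. -/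
def alt3 {ι X : Type*} [AddCommGroup X] (r : ι → ι → ι → X) (a b c : ι) : X :=
  r a b c + r b c a + r c a b - r b a c - r a c b - r c b a

variable {z : Fin n → Fin n → R} {τ : Fin n → Fin n → Fin n → R}

/-- The symbol is `[D, x^μ]`, and `{D, [D, x^μ]} = [D², x^μ]`. -/
lemma charge_anticomm_symb_of_mul_self_eq_zero (hD : O.charge z τ * O.charge z τ = 0) (μ : Fin n) :
    O.charge z τ * O.symb z μ + O.symb z μ * O.charge z τ = 0 := by
  rw [← O.charge_x z τ]
  calc _ = O.charge z τ * O.charge z τ * O.m (O.x μ)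
      - O.m (O.x μ) * (O.charge z τ * O.charge z τ) := by noncomm_ring
    _ = 0 := by rw [hD]; simp

/-- One more commutator with a coordinate turns the other factor `D` into a symbol. The symbols of a
nilpotent charge thus generate a Grassmann algebra. -/
lemma symb_anticomm_symb_of_mul_self_eq_zero (hD : O.charge z τ * O.charge z τ = 0)
    (μ ν : Fin n) : O.symb z μ * O.symb z ν + O.symb z ν * O.symb z μ = 0 := by
  have h := O.charge_anticomm_symb_of_mul_self_eq_zero hD μ
  have hx := O.charge_x z τ ν
  calc O.symb z μ * O.symb z ν + O.symb z ν * O.symb z μ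
      = (O.charge z τ * O.symb z μ + O.symb z μ * O.charge z τ) * O.m (O.x ν)
        - O.m (O.x ν) * (O.charge z τ * O.symb z μ + O.symb z μ * O.charge z τ) := by
        rw [← hx]
        simp only [mul_sub, sub_mul, add_mul, mul_add, mul_assoc, O.symb_m]
        simp only [← mul_assoc, O.symb_m]
        abel
    _ = 0 := by rw [h]; simp

lemma m_mul_cub (f : R) (t : Fin n → Fin n → Fin n → R) :
    O.m f * O.cub t = O.cub fun a b c => f * t a b c := by
  simp only [cub, Finset.mul_sum, map_mul, mul_assoc]

lemma smul_cub (k : ℂ) (t : Fin n → Fin n → Fin n → R) :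
    k • O.cub t = O.cub fun a b c => k • t a b c := by
  simp only [cub, Finset.smul_sum, map_smul, smul_mul_assoc]

lemma smul_quart (k : ℂ) (t : Fin n → Fin n → Fin n → Fin n → R) :
    k • O.quart t = O.quart fun a b c e => k • t a b c e := by
  simp only [quart, Finset.smul_sum, map_smul, smul_mul_assoc]

lemma quart_eq_sum_ψ_mul (t : Fin n → Fin n → Fin n → Fin n → R) :
    O.quart t = ∑ a, O.ψ a * O.cub (t a) := by
  simp only [cub, quart, Finset.mul_sum]
  refine Finset.sum_congr rfl fun a _ => Finset.sum_congr rfl fun b _ =>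
    Finset.sum_congr rfl fun c _ => Finset.sum_congr rfl fun e _ => ?_
  rw [← mul_assoc (O.ψ a), O.ψ_m]; simp only [mul_assoc]

lemma sum_quart {ι : Type*} (s : Finset ι) (u : ι → Fin n → Fin n → Fin n → Fin n → R) :
    ∑ i ∈ s, O.quart (u i) = O.quart fun a b c e => ∑ i ∈ s, u i a b c e := by
  simp only [quart_eq_sum_ψ_mul, ← sum_cub, Finset.mul_sum]
  exact Finset.sum_comm

lemma symb_mul_symb_mul_symb (μ ν l : Fin n) :
    O.symb z μ * O.symb z ν * O.symb z l = O.cub fun a b c => z a μ * (z b ν * z c l) := by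
  rw [mul_assoc, symb, symb, symb, lin_mul_lin, lin_mul_quad]

/-- The element `(1/24) C_{μνλ} Θ^μ Θ^ν Θ^λ`. -/
def holCubic (z : Fin n → Fin n → R) (C : Fin n → Fin n → Fin n → R) : A :=
  (1 / 24 : ℂ) • ∑ μ, ∑ ν, ∑ l, O.m (C μ ν l) * (O.symb z μ * O.symb z ν * O.symb z l)

/-- Because `D` anticommutes with each `Θ^μ`, only the coefficient is differentiated: `[D, f] = ∂_σ
f Θ^σ`. On polynomials in `Θ` the charge acts as an exterior derivative. -/
lemma charge_anticomm_holCubic (hD : O.charge z τ * O.charge z τ = 0)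
    (C : Fin n → Fin n → Fin n → R) :
    O.charge z τ * O.holCubic z C + O.holCubic z C * O.charge z τ
      = O.quart fun a b c e => (1 / 24 : ℂ) • ∑ μ, ∑ ν, ∑ l, ∑ σ,
          z a σ * (O.δ σ (C μ ν l) * (z b μ * (z c ν * z e l))) := by
  have hS := O.charge_anticomm_symb_of_mul_self_eq_zero hD
  have h3 : ∀ μ ν l, O.symb z μ * O.symb z ν * O.symb z l * O.charge z τ
      = -(O.charge z τ * (O.symb z μ * O.symb z ν * O.symb z l)) := by
    intro μ ν l
    have e : ∀ μ, O.symb z μ * O.charge z τ = -(O.charge z τ * O.symb z μ) :=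
      fun μ => eq_neg_of_add_eq_zero_right (hS μ)
    rw [mul_assoc, e, mul_neg, ← mul_assoc, mul_assoc (O.symb z μ), e, mul_neg, neg_mul,
      ← mul_assoc, e]
    noncomm_ring
  have h4 : ∀ μ ν l, O.charge z τ * (O.m (C μ ν l) * (O.symb z μ * O.symb z ν * O.symb z l))
      + O.m (C μ ν l) * (O.symb z μ * O.symb z ν * O.symb z l) * O.charge z τ
      = O.quart fun a b c e => ∑ σ,
          z a σ * (O.δ σ (C μ ν l) * (z b μ * (z c ν * z e l))) := by
    intro μ ν l
    rw [← mul_assoc, charge_m, mul_assoc (O.m (C μ ν l)) _ (O.charge z τ), h3, add_mul, mul_neg,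
      mul_assoc, add_comm, neg_add_cancel_left, Finset.sum_mul, ← sum_quart]
    refine Finset.sum_congr rfl fun σ _ => ?_
    rw [symb_mul_symb_mul_symb, ← symb_m, mul_assoc, m_mul_cub, symb, lin_mul_cub]
  simp only [holCubic, mul_smul_comm, smul_mul_assoc, Finset.mul_sum, Finset.sum_mul,
    ← Finset.sum_add_distrib, ← smul_add, h4]
  simp only [sum_quart, smul_quart]

lemma holCubic_eq_cub (C : Fin n → Fin n → Fin n → R) :
    O.holCubic z C = O.cub fun a b c =>
      (1 / 24 : ℂ) • ∑ μ, ∑ ν, ∑ l, C μ ν l * (z a μ * z b ν * z c l) := by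
  simp only [holCubic, symb_mul_symb_mul_symb, m_mul_cub, sum_cub, smul_cub]
  simp only [mul_assoc]

lemma symb_anticomm_holCubic (hS : ∀ μ ν, O.symb z μ * O.symb z ν + O.symb z ν * O.symb z μ = 0)
    (C : Fin n → Fin n → Fin n → R) (μ : Fin n) :
    O.symb z μ * O.holCubic z C + O.holCubic z C * O.symb z μ = 0 := by
  have e : ∀ ν l, O.symb z ν * O.symb z l = -(O.symb z l * O.symb z ν) :=
    fun ν l => eq_neg_of_add_eq_zero_left (hS ν l)
  have h : ∀ ν l r, O.symb z μ * (O.m (C ν l r) * (O.symb z ν * O.symb z l * O.symb z r))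
      + O.m (C ν l r) * (O.symb z ν * O.symb z l * O.symb z r) * O.symb z μ = 0 := by
    intro ν l r
    have h2 : O.symb z ν * O.symb z l * O.symb z r * O.symb z μ
        = -(O.symb z μ * (O.symb z ν * O.symb z l * O.symb z r)) := by
      rw [mul_assoc, e r μ, mul_neg, ← mul_assoc, mul_assoc (O.symb z ν), e l μ, mul_neg,
        ← mul_assoc, e ν μ]
      noncomm_ring
    rw [← mul_assoc, symb_m, mul_assoc, mul_assoc (O.m _), h2, mul_neg, add_neg_cancel]
  simp only [holCubic, mul_smul_comm, smul_mul_assoc, Finset.mul_sum, Finset.sum_mul,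
    ← Finset.sum_add_distrib, ← smul_add, h]
  simp

/-- By `hjz` the rotation by `G` multiplies the symbol by one. The cubic terms of `[G, D]` come from
rotating `τ` and from differentiating the coefficients of `G`; hypothesis `h3` says that after
subtracting `τ` and the holomorphic cubic their alternation is zero, so only a linear element `ε` is
left over. -/
lemma exists_quad_comm_charge {j : Fin n → Fin n → R} (hj : ∀ a b, j a b = -j b a)
    (hjz : ∀ a μ, ∑ b, j a b * z b μ = (-Complex.I) • z a μ)
    (C : Fin n → Fin n → Fin n → R)
    (h3 : ∀ a b c, alt3 (fun a b c => Complex.I • insert3 j τ a b c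
      - (Complex.I / 2) • ∑ μ, z a μ * O.δ μ (j b c) - τ a b c
      - (1 / 24 : ℂ) • ∑ μ, ∑ ν, ∑ l, C μ ν l * (z a μ * z b ν * z c l)) a b c = 0) :
    ∃ ε, O.quad (fun a b => (Complex.I / 2) • j a b) * O.charge z τ
      = O.charge z τ * O.quad (fun a b => (Complex.I / 2) • j a b)
        + (O.charge z τ + (O.holCubic z C + O.lin ε)) := by
  obtain ⟨ε, hε⟩ := O.cub_eq_lin _ h3
  rw [← cub_sub, ← cub_sub, ← cub_sub, ← holCubic_eq_cub] at hε
  set G := O.quad fun a b => (Complex.I / 2) • j a b with hG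
  have h1 : ∀ μ, G * (O.symb z μ * O.d μ) = O.symb z μ * O.d μ * G + (O.symb z μ * O.d μ
      - O.cub fun a b c => (Complex.I / 2) • (z a μ * O.δ μ (j b c))) := by
    intro μ
    -- The normalization `i/2` of `G` is chosen so that the eigenvalue `-i` of `j` becomes `2 ·
    -- (i/2) · (-i) = 1`.
    have e1 : G * O.symb z μ = O.symb z μ * G + O.symb z μ := by
      rw [symb, hG, O.quad_comm_lin_of_antisymm hj]
      congr 2
      ext a
      rw [hjz, smul_smul]
      have : 2 * (Complex.I / 2) * -Complex.I = 1 := by linear_combination -Complex.I_mul_I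
      rw [this, one_smul]
    have e2 : O.d μ * G = G * O.d μ + O.quad fun a b => (Complex.I / 2) • O.δ μ (j a b) := by
      rw [hG, d_quad]; simp only [Derivation.map_smul]
    have e3 : O.cub (fun a b c => (Complex.I / 2) • (z a μ * O.δ μ (j b c)))
        = O.symb z μ * O.quad fun a b => (Complex.I / 2) • O.δ μ (j a b) := by
      rw [symb, lin_mul_quad]; simp only [mul_smul_comm]
    rw [← mul_assoc, e1, mul_assoc (O.symb z μ) (O.d μ), e2, e3]
    noncomm_ring
  have h2 : G * ∑ μ, O.symb z μ * O.d μ = (∑ μ, O.symb z μ * O.d μ) * G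
      + (∑ μ, O.symb z μ * O.d μ
        - O.cub fun a b c => (Complex.I / 2) • ∑ μ, z a μ * O.δ μ (j b c)) := by
    simp only [Finset.mul_sum, Finset.sum_mul, h1, Finset.sum_add_distrib,
      Finset.sum_sub_distrib, Finset.smul_sum, sum_cub]
  have h5 : 2 * (Complex.I / 2) = Complex.I := by ring
  simp only [charge, order0, mul_add, h2]
  rw [hG, O.quad_comm_lin_of_antisymm hj, O.quad_comm_cub_of_antisymm hj, ← hG, h5]
  -- The witness collects the rotation of the divergence term of `D`, minus that term itself, plus
  -- the linear remainder of the cubics.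
  refine ⟨fun a => Complex.I • ∑ e, j a e * ((1 / 2 : ℂ) • ∑ μ, O.δ μ (z e μ))
    - (1 / 2 : ℂ) • ∑ μ, O.δ μ (z a μ) + ε a, ?_⟩
  rw [← lin_add, ← lin_sub, ← hε]
  noncomm_ring


/-- A nilpotent charge that is rotated by a bivector into itself, up to the holomorphic cubic element
made from `C` and a linear element: then the holomorphic part of `dC` vanishes. -/
theorem alt4_eq_zero_of_mul_self_eq_zero (hm : Function.Injective O.m)
    (hD : O.charge z τ * O.charge z τ = 0)
    {j : Fin n → Fin n → R} (hj : ∀ a b, j a b = -j b a)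
    (hjz : ∀ a μ, ∑ b, j a b * z b μ = (-Complex.I) • z a μ)
    (C : Fin n → Fin n → Fin n → R)
    (h3 : ∀ a b c, alt3 (fun a b c => Complex.I • insert3 j τ a b c
      - (Complex.I / 2) • ∑ μ, z a μ * O.δ μ (j b c) - τ a b c
      - (1 / 24 : ℂ) • ∑ μ, ∑ ν, ∑ l, C μ ν l * (z a μ * z b ν * z c l)) a b c = 0)
    (a b c e : Fin n) :
    alt4 (fun a b c e => ∑ μ, ∑ ν, ∑ l, ∑ σ,
          z a σ * (O.δ σ (C μ ν l) * (z b μ * (z c ν * z e l)))) a b c e = 0 := by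
  obtain ⟨ε, hε⟩ := O.exists_quad_comm_charge hj hjz C h3
  set G := O.quad fun a b => (Complex.I / 2) • j a b
  set D := O.charge z τ with hDdef
  set W := O.holCubic z C + O.lin ε with hW
  have hx := O.charge_x z τ
  -- Anticommuting `[G, D] = D + W` with `D` gives zero on the left, because `{D, [G, D]} = [G,
  -- D²]`.
  have hDW : D * W + W * D = 0 := by
    have : D * (G * D) + (G * D) * D = D * D * G + D * G * D + 2 * (D * D) + (D * W + W * D) := by
      rw [hε]; noncomm_ring
    rw [mul_assoc G, hD, mul_zero, zero_mul, mul_zero, ← mul_assoc] at this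
    simpa using this
  have hWm : ∀ f, W * O.m f = O.m f * W := by
    intro f
    rw [hW, holCubic_eq_cub, add_mul, cub_m, lin_m, mul_add]
  -- `W` contains no derivatives, so commuting `{D, W} = 0` with a coordinate replaces `D` by its
  -- symbol.
  have hΘW : ∀ μ, O.symb z μ * W + W * O.symb z μ = 0 := by
    intro μ
    calc O.symb z μ * W + W * O.symb z μ
        = (D * W + W * D) * O.m (O.x μ) - O.m (O.x μ) * (D * W + W * D) := by
          rw [← hx]
          simp only [mul_sub, sub_mul, add_mul, mul_add, mul_assoc, hWm]
          simp only [← mul_assoc, hWm]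
          abel
      _ = 0 := by rw [hDW]; simp
  -- The cubic in the `Θ` already anticommutes with every `Θ^μ`, hence so does the linear remainder.
  have hΘε : ∀ μ, O.symb z μ * O.lin ε + O.lin ε * O.symb z μ = 0 := by
    intro μ
    have h1 := O.symb_anticomm_holCubic (O.symb_anticomm_symb_of_mul_self_eq_zero hD) C μ
    have h2 := hΘW μ
    rw [hW, mul_add, add_mul, add_add_add_comm, h1, zero_add] at h2
    exact h2
  -- By `hΘε` the first-order terms of `{D, ε}` cancel. It has degree at most two in the fermions
  -- and cannot disturb the quartic part of `{D, W}`.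
  have hDε : D * O.lin ε + O.lin ε * D
      = O.quad (fun a b => ∑ μ, z a μ * O.δ μ (ε b))
        + (O.m (∑ e, ((1 / 2 : ℂ) • ∑ μ, O.δ μ (z e μ)) * ε e)
        + O.quad fun a b => ∑ e, ε e * (τ a b e - τ a e b + τ e a b)) := by
    rw [← cub_anticomm_lin, ← lin_anticomm_lin, ← sum_quad, hDdef, charge, order0]
    have : ∀ μ, O.symb z μ * O.d μ * O.lin ε
        = O.quad (fun a b => z a μ * O.δ μ (ε b)) - O.lin ε * (O.symb z μ * O.d μ) := by
      intro μ
      have e : O.symb z μ * O.lin (fun b => O.δ μ (ε b)) = O.quad fun a b => z a μ * O.δ μ (ε b) := by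
        rw [symb, lin_mul_lin]
      rw [mul_assoc, d_lin, mul_add, ← mul_assoc, eq_neg_of_add_eq_zero_left (hΘε μ), e]
      noncomm_ring
    simp only [add_mul, Finset.sum_mul, this, mul_add, Finset.mul_sum, Finset.sum_sub_distrib]
    abel
  have hfin : O.quart (fun a b c e => (1 / 24 : ℂ) • ∑ μ, ∑ ν, ∑ l, ∑ σ,
          z a σ * (O.δ σ (C μ ν l) * (z b μ * (z c ν * z e l))))
        + O.quad (fun a b => (∑ μ, z a μ * O.δ μ (ε b))
          + ∑ e, ε e * (τ a b e - τ a e b + τ e a b))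
        + O.m (∑ e, ((1 / 2 : ℂ) • ∑ μ, O.δ μ (z e μ)) * ε e) = 0 := by
    rw [← O.charge_anticomm_holCubic hD, ← quad_add]
    rw [hW, mul_add, add_mul, add_add_add_comm, hDε] at hDW
    rw [← hDW]; abel
  have h := O.alternation_eq_zero_of_quart_eq hm hfin a b c e
  have h24 := congrArg (fun w => (24 : ℂ) • w) h
  simp only [← smul_sub, ← smul_add, smul_smul, smul_zero] at h24
  norm_num at h24
  exact h24

end DiffOpAlg
end CliffordKT

namespace CliffordKT

/-! ## Endomorphisms acting on the slots of a multi-index array -/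

section Slot

set_option linter.unusedSectionVars false

variable {ι X : Type*} [Fintype ι] [DecidableEq ι] [CommRing X] {k : ℕ}

/-- The action of a matrix on one slot of a multi-index array. -/
def slot (i : Fin k) (J : Matrix ι ι X) : Module.End X ((Fin k → ι) → X) where
  toFun t m := ∑ ν, J (m i) ν * t (Function.update m i ν)
  map_add' s t := by ext m; simp [mul_add, Finset.sum_add_distrib]
  map_smul' c t := by
    ext m; simp only [Pi.smul_apply, smul_eq_mul, RingHom.id_apply, Finset.mul_sum]
    exact Finset.sum_congr rfl fun _ _ => by ring

lemma slot_apply (i : Fin k) (J : Matrix ι ι X) (t : (Fin k → ι) → X) (m : Fin k → ι) :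
    slot i J t m = ∑ ν, J (m i) ν * t (Function.update m i ν) := rfl

lemma slot_mul (i : Fin k) (J J' : Matrix ι ι X) : slot i (J * J') = slot i J * slot i J' := by
  refine LinearMap.ext fun t => funext fun m => ?_
  simp only [slot_apply, Module.End.mul_apply, Matrix.mul_apply, Finset.sum_mul, Finset.mul_sum,
    Function.update_self, Function.update_idem]
  rw [Finset.sum_comm]
  simp only [mul_assoc]

lemma slot_add (i : Fin k) (J J' : Matrix ι ι X) : slot i (J + J') = slot i J + slot i J' := by
  refine LinearMap.ext fun t => funext fun m => ?_
  simp [slot_apply, add_mul, Finset.sum_add_distrib]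

lemma slot_sub (i : Fin k) (J J' : Matrix ι ι X) : slot i (J - J') = slot i J - slot i J' := by
  refine LinearMap.ext fun t => funext fun m => ?_
  simp [slot_apply, sub_mul, Finset.sum_sub_distrib]

lemma slot_neg (i : Fin k) (J : Matrix ι ι X) : slot i (-J) = -slot i J := by
  refine LinearMap.ext fun t => funext fun m => ?_
  simp [slot_apply]

lemma slot_one (i : Fin k) : slot i (1 : Matrix ι ι X) = 1 := by
  refine LinearMap.ext fun t => funext fun m => ?_
  simp [slot_apply, Matrix.one_apply]

lemma slot_smul (i : Fin k) (c : X) (J : Matrix ι ι X) : slot i (c • J) = c • slot i J := by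
  refine LinearMap.ext fun t => funext fun m => ?_
  simp [slot_apply, Finset.mul_sum, mul_assoc]

/-- Together with `slot_mul` this reduces tensor identities for complex structures to polynomial
identities in commuting square roots of `-1`. -/
lemma slot_commute {i j : Fin k} (h : i ≠ j) (J J' : Matrix ι ι X) :
    Commute (slot i J) (slot j J') := by
  refine LinearMap.ext fun t => funext fun m => ?_
  simp only [Module.End.mul_apply, slot_apply, Finset.mul_sum, Function.update_of_ne h,
    Function.update_of_ne h.symm]
  rw [Finset.sum_comm]
  refine Finset.sum_congr rfl fun a _ => Finset.sum_congr rfl fun b _ => ?_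
  rw [Function.update_comm h]
  ring

lemma slot_mul_self {J : Matrix ι ι X} (hJ : J * J = -1) (i : Fin k) :
    slot i J * slot i J = -1 := by
  rw [← slot_mul, hJ, slot_neg, slot_one]

/-- A 3-index array from its curried form. -/
def ofCurry3 (t : ι → ι → ι → X) (m : Fin 3 → ι) : X := t (m 0) (m 1) (m 2)

@[simp] lemma ofCurry3_apply (t : ι → ι → ι → X) (a b c : ι) : ofCurry3 t ![a, b, c] = t a b c := rfl

lemma update_vec3_zero (a b c ν : ι) : Function.update ![a, b, c] 0 ν = ![ν, b, c] := by
  ext i; fin_cases i <;> rfl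

lemma update_vec3_one (a b c ν : ι) : Function.update ![a, b, c] 1 ν = ![a, ν, c] := by
  ext i; fin_cases i <;> rfl

lemma update_vec3_two (a b c ν : ι) : Function.update ![a, b, c] 2 ν = ![a, b, ν] := by
  ext i; fin_cases i <;> rfl

lemma slot_vec3_zero (J : Matrix ι ι X) (t : (Fin 3 → ι) → X) (a b c : ι) :
    slot 0 J t ![a, b, c] = ∑ ν, J a ν * t ![ν, b, c] := by
  simp only [slot_apply, update_vec3_zero]; rfl

lemma slot_vec3_one (J : Matrix ι ι X) (t : (Fin 3 → ι) → X) (a b c : ι) :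
    slot 1 J t ![a, b, c] = ∑ ν, J b ν * t ![a, ν, c] := by
  simp only [slot_apply, update_vec3_one]; rfl

lemma slot_vec3_two (J : Matrix ι ι X) (t : (Fin 3 → ι) → X) (a b c : ι) :
    slot 2 J t ![a, b, c] = ∑ ν, J c ν * t ![a, b, ν] := by
  simp only [slot_apply, update_vec3_two]; rfl

lemma ext_vec3 {s t : (Fin 3 → ι) → X} (h : ∀ a b c, s ![a, b, c] = t ![a, b, c]) : s = t := by
  ext m
  have : m = ![m 0, m 1, m 2] := by ext i; fin_cases i <;> rfl
  rw [this, h]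

/-- A 3-index array on all of whose slots each of two anticommuting complex structures acts in the
same way vanishes. -/
lemma eq_zero_of_slot_eq {p q : Matrix ι ι X} (hp : p * p = -1) (hq : q * q = -1)
    (hpq : p * q = -(q * p)) (h2 : ∀ x : X, 2 * x = 0 → x = 0)
    {β : (Fin 3 → ι) → X} (hp1 : slot 1 p β = slot 0 p β)
    (hq2 : slot 2 q β = slot 0 q β) : β = 0 := by
  have c02 : slot 2 q (slot 0 p β) = slot 0 p (slot 2 q β) :=
    LinearMap.congr_fun (slot_commute (by decide : (2 : Fin 3) ≠ 0) q p) β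
  have c12 : slot 2 q (slot 1 p β) = slot 1 p (slot 2 q β) :=
    LinearMap.congr_fun (slot_commute (by decide : (2 : Fin 3) ≠ 1) q p) β
  have c10 : slot 1 p (slot 0 q β) = slot 0 q (slot 1 p β) :=
    LinearMap.congr_fun (slot_commute (by decide : (1 : Fin 3) ≠ 0) p q) β
  -- Move `p` to slot 1 and `q` to slot 2, where the two actions commute, and move them back in the
  -- other order. Since `p` and `q` anticommute, `pq` then annihilates `β` on slot 0, and `pq` is
  -- invertible.
  have h1 : slot 0 (p * q) β = slot 0 (q * p) β := by
    rw [slot_mul, slot_mul, Module.End.mul_apply, Module.End.mul_apply, ← hq2, ← c02, ← hp1, c12,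
      hq2, c10]
  have h3 : slot 0 (p * q) β = 0 := by
    rw [hpq, slot_neg] at h1
    have h4 : slot 0 (q * p) β = 0 := by
      ext m
      have := congrFun h1 m
      simp only [LinearMap.neg_apply, Pi.neg_apply] at this
      exact h2 _ (by linear_combination -this)
    rw [hpq, slot_neg, LinearMap.neg_apply, h4, neg_zero]
  have h5 : slot 0 (q * p * (p * q)) β = 0 := by
    rw [slot_mul, Module.End.mul_apply, h3, map_zero]
  have h6 : q * p * (p * q) = 1 := by
    rw [mul_assoc, ← mul_assoc p, hp, neg_one_mul, mul_neg, hq, neg_neg]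
  rwa [h6, slot_one, Module.End.one_apply] at h5

end Slot

end CliffordKT

namespace CliffordKT
namespace DiffOpAlg

variable {n : ℕ} {R A : Type*} [CommRing R] [Algebra ℂ R] [Ring A] [Algebra ℂ A]
  (O : DiffOpAlg n R A)

/-! ### Elements that supercommute with all fermions -/

/-- The even (`true`) and odd (`false`) Clifford elements made from the fermions in a list. -/
def parity : List (Fin n) → Bool → AddSubgroup A
  | [], true => O.m.toRingHom.toAddMonoidHom.range
  | [], false => ⊥
  | a :: l, p => parity l p ⊔ (parity l !p).map (AddMonoidHom.mulLeft (O.ψ a))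

lemma mem_parity_cons {a : Fin n} {l : List (Fin n)} {p : Bool} {Z : A} :
    Z ∈ O.parity (a :: l) p ↔ ∃ Y ∈ O.parity l p, ∃ W ∈ O.parity l (!p), Y + O.ψ a * W = Z := by
  simp [parity, AddSubgroup.mem_sup]

lemma m_mem_parity (f : R) : ∀ l, O.m f ∈ O.parity l true
  | [] => ⟨f, rfl⟩
  | a :: l => O.mem_parity_cons.2 ⟨_, m_mem_parity f l, 0, zero_mem _, by simp⟩

lemma m_mul_mem_parity (f : R) : ∀ (l : List (Fin n)) (p : Bool) {Z : A}, Z ∈ O.parity l p →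
    O.m f * Z ∈ O.parity l p
  | [], true, _, ⟨g, hg⟩ => ⟨f * g, by simp [← hg]⟩
  | [], false, Z, h => by
    have : Z = 0 := h
    rw [this, mul_zero]; exact zero_mem _
  | a :: l, p, Z, h => by
    obtain ⟨Y, hY, W, hW, rfl⟩ := O.mem_parity_cons.1 h
    refine O.mem_parity_cons.2 ⟨_, m_mul_mem_parity f l _ hY, _, m_mul_mem_parity f l _ hW, ?_⟩
    rw [mul_add, ← mul_assoc, O.ψ_m, mul_assoc]

lemma mul_m_of_mem_parity (f : R) : ∀ (l : List (Fin n)) (p : Bool) {Z : A}, Z ∈ O.parity l p →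
    Z * O.m f = O.m f * Z
  | [], true, _, ⟨g, hg⟩ => by rw [← hg]; exact O.m_comm g f
  | [], false, Z, h => by
    have : Z = 0 := h
    rw [this, mul_zero, zero_mul]
  | a :: l, p, Z, h => by
    obtain ⟨Y, hY, W, hW, rfl⟩ := O.mem_parity_cons.1 h
    rw [add_mul, mul_m_of_mem_parity f l _ hY, mul_assoc, mul_m_of_mem_parity f l _ hW,
      ← mul_assoc, O.ψ_m, mul_assoc, mul_add]

lemma ψ_mul_self (a : Fin n) : O.ψ a * O.ψ a = (1 / 2 : ℂ) • (1 : A) := by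
  have h := O.ψ_anticomm a a
  rw [if_pos rfl, ← two_smul ℂ] at h
  rw [← h, smul_smul]; norm_num

lemma smul_mem_parity (k : ℂ) (l : List (Fin n)) (p : Bool) {Z : A} (h : Z ∈ O.parity l p) :
    k • Z ∈ O.parity l p := by
  have := O.m_mul_mem_parity (algebraMap ℂ R k) l p h
  rwa [O.m.commutes, ← Algebra.smul_def] at this

/-- If the fermion is the head of the list, then `ψ² = 1/2` exchanges the roles of the two
components; otherwise it is moved past the head. -/
lemma ψ_mul_mem_parity : ∀ (l : List (Fin n)) (p : Bool) {Z : A} {a : Fin n}, a ∈ l →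
    Z ∈ O.parity l p → O.ψ a * Z ∈ O.parity l !p
  | [], _, _, _, ha, _ => by simp at ha
  | b :: l, p, Z, a, ha, h => by
    obtain ⟨Y, hY, W, hW, rfl⟩ := O.mem_parity_cons.1 h
    by_cases hab : a = b
    · subst hab
      refine O.mem_parity_cons.2 ⟨(1 / 2 : ℂ) • W, O.smul_mem_parity _ _ _ hW, Y, by simpa using hY, ?_⟩
      rw [mul_add, ← mul_assoc, ψ_mul_self, smul_mul_assoc, one_mul, add_comm]
    · have ha' : a ∈ l := by simpa [hab] using ha
      refine O.mem_parity_cons.2 ⟨O.ψ a * Y, ψ_mul_mem_parity l _ ha' hY, -(O.ψ a * W),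
        neg_mem (ψ_mul_mem_parity l _ ha' hW), ?_⟩
      rw [mul_add, ← mul_assoc, O.ψ_swap a b, if_neg hab]
      noncomm_ring

/-- A fermion supercommutes with everything made from the other fermions. -/
lemma ψ_mul_of_not_mem : ∀ (l : List (Fin n)) (p : Bool) {Z : A} {a : Fin n}, a ∉ l →
    Z ∈ O.parity l p → Z * O.ψ a = if p then O.ψ a * Z else -(O.ψ a * Z)
  | [], true, _, a, _, ⟨g, hg⟩ => by rw [← hg]; exact (O.ψ_m a g).symm
  | [], false, Z, a, _, h => by
    have : Z = 0 := h
    simp [this]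
  | b :: l, p, Z, a, ha, h => by
    obtain ⟨Y, hY, W, hW, rfl⟩ := O.mem_parity_cons.1 h
    have hab : ¬ b = a := fun h => ha (by simp [h])
    have ha' : a ∉ l := fun h => ha (by simp [h])
    have h1 := ψ_mul_of_not_mem l _ ha' hY
    have h2 := ψ_mul_of_not_mem l _ ha' hW
    have h3 := O.ψ_swap b a
    rw [if_neg hab, zero_sub] at h3
    rw [add_mul, mul_assoc, h1, h2]
    cases p
    · simp only [Bool.not_false, if_true, Bool.false_eq_true, if_false]
      rw [← mul_assoc, h3]; noncomm_ring
    · simp only [Bool.not_true, if_true, Bool.false_eq_true, if_false]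
      rw [mul_neg, ← mul_assoc, h3]; noncomm_ring

/-- Write `Z = Y + ψ_b W` with `Y`, `W` free of `ψ_b`. Here `W` is odd, so commuting with `ψ_b`
gives `W/2 = -W/2`, and `ψ_b` drops out; induction removes the others. Evenness matters: for odd `n`
the product of all fermions commutes with each of them. -/
lemma eq_m_of_commute : ∀ (l : List (Fin n)), l.Nodup → ∀ {Z : A}, Z ∈ O.parity l true →
    (∀ a, Z * O.ψ a = O.ψ a * Z) → ∃ f, Z = O.m f
  | [], _, _, ⟨g, hg⟩, _ => ⟨g, hg.symm⟩
  | b :: l, hl, Z, h, hc => by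
    obtain ⟨Y, hY, W, hW, rfl⟩ := O.mem_parity_cons.1 h
    rw [List.nodup_cons] at hl
    have h1 := O.ψ_mul_of_not_mem l _ hl.1 hY
    have h2 := O.ψ_mul_of_not_mem l _ hl.1 hW
    simp only [Bool.not_true, if_true, Bool.false_eq_true, if_false] at h1 h2
    have h3 := hc b
    rw [add_mul, mul_assoc, h1, h2, mul_add, mul_neg, ← mul_assoc, ψ_mul_self, smul_mul_assoc,
      one_mul] at h3
    have h4 : W = 0 := by
      have h5 : (1 / 2 : ℂ) • W + (1 / 2 : ℂ) • W = 0 := by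
        rw [add_right_inj] at h3
        nth_rewrite 1 [← h3]
        exact neg_add_cancel _
      rw [← add_smul] at h5
      norm_num at h5
      exact h5
    subst h4
    rw [mul_zero, add_zero] at hc ⊢
    exact eq_m_of_commute l hl.2 hY hc

lemma lin_mul_mem_parity (u : Fin n → R) (p : Bool) {Z : A}
    (h : Z ∈ O.parity (List.finRange n) p) : O.lin u * Z ∈ O.parity (List.finRange n) !p := by
  rw [lin, Finset.sum_mul]
  refine sum_mem fun a _ => ?_
  rw [mul_assoc]
  exact O.m_mul_mem_parity _ _ _ (O.ψ_mul_mem_parity _ _ (List.mem_finRange a) h)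

lemma cub_mul_mem_parity (t : Fin n → Fin n → Fin n → R) (p : Bool) {Z : A}
    (h : Z ∈ O.parity (List.finRange n) p) : O.cub t * Z ∈ O.parity (List.finRange n) !p := by
  simp only [cub, Finset.sum_mul]
  refine sum_mem fun a _ => sum_mem fun b _ => sum_mem fun c _ => ?_
  rw [mul_assoc, mul_assoc, mul_assoc]
  have := O.ψ_mul_mem_parity _ _ (List.mem_finRange a) (O.ψ_mul_mem_parity _ _
    (List.mem_finRange b) (O.ψ_mul_mem_parity _ _ (List.mem_finRange c) h))
  rw [Bool.not_not] at this
  exact O.m_mul_mem_parity _ _ _ this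

lemma lin_add_cub_mem_parity (u : Fin n → R) (t : Fin n → Fin n → Fin n → R) :
    O.lin u + O.cub t ∈ O.parity (List.finRange n) false := by
  have h1 := O.lin_mul_mem_parity u true (O.m_mem_parity 1 _)
  have h2 := O.cub_mul_mem_parity t true (O.m_mem_parity 1 _)
  rw [map_one, mul_one] at h1 h2
  exact add_mem h1 h2

/-! ### Traces -/

section Trace

variable {ev : R →ₐ[ℂ] ℂ} {T : A →ₗ[ℂ] ℂ} (hTm : ∀ f Z, T (O.m f * Z) = ev f * T Z)
  (hTψ : ∀ a Z, T (Z * O.ψ a) = T (O.ψ a * Z)) (hT1 : T 1 = 1)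

include hTm hTψ hT1

/-- By cyclicity the trace of a product of two vectors is half the trace of their anticommutator, a
scalar. The traces of higher degree follow by cycling one fermion and contracting. -/
lemma trace_lin_mul_lin (u v : Fin n → R) :
    T (O.lin u * O.lin v) = (1 / 2) * ev (∑ a, u a * v a) := by
  have h : T (O.lin u * O.lin v) = T (O.lin v * O.lin u) := by
    conv_lhs => rw [lin.eq_def O v]
    conv_rhs => rw [lin.eq_def O v]
    simp only [Finset.mul_sum, Finset.sum_mul, map_sum]
    refine Finset.sum_congr rfl fun a _ => ?_
    rw [← mul_assoc, lin_m, mul_assoc, hTm, mul_assoc, hTm, hTψ]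
  have h2 := congrArg T (O.lin_anticomm_lin u v)
  rw [map_add, ← h, ← mul_one (O.m _), hTm, hT1] at h2
  linear_combination (1 / 2) * h2

lemma trace_quad {u : Fin n → Fin n → R} (hu : ∀ a b, u a b = -u b a) : T (O.quad u) = 0 := by
  have h1 : O.quad u = ∑ a, O.lin (fun c => if c = a then 1 else 0) * O.lin (u a) := by
    rw [quad_eq_sum_ψ_mul]
    refine Finset.sum_congr rfl fun a _ => ?_
    congr 1
    simp [lin]
  have h2 : ∀ a, u a a = 0 := by
    intro a
    have h := hu a a
    have h3 : (2 : ℂ) • u a a = 0 := by rw [two_smul]; linear_combination h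
    simpa [smul_smul] using congrArg (fun w => (1 / 2 : ℂ) • w) h3
  rw [h1, map_sum]
  refine Finset.sum_eq_zero fun a _ => ?_
  rw [O.trace_lin_mul_lin hTm hTψ hT1]
  simp [h2]

/-- The anticommutator of the two factors is an antisymmetric bivector, which is traceless. -/
lemma trace_lin_mul_cub (u : Fin n → R) {t : Fin n → Fin n → Fin n → R}
    (h1 : ∀ a b c, t a b c = -t b a c) (h2 : ∀ a b c, t a b c = -t a c b) :
    T (O.lin u * O.cub t) = 0 ∧ T (O.cub t * O.lin u) = 0 := by
  have h : T (O.cub t * O.lin u) = T (O.lin u * O.cub t) := by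
    rw [lin]
    simp only [Finset.mul_sum, Finset.sum_mul, map_sum]
    refine Finset.sum_congr rfl fun a _ => ?_
    rw [← mul_assoc, cub_m, mul_assoc, hTm, mul_assoc, hTm, hTψ]
  have h3 := congrArg T (O.cub_anticomm_lin t u)
  rw [O.trace_quad hTm hTψ hT1, map_add, h] at h3
  · have : T (O.lin u * O.cub t) = 0 := by linear_combination (1 / 2) * h3
    exact ⟨this, by rw [h, this]⟩
  · intro a b
    rw [← Finset.sum_neg_distrib]
    refine Finset.sum_congr rfl fun e _ => ?_
    linear_combination u e * (h1 a b e - h1 a e b - h1 e b a + 2 * h2 e a b)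

lemma trace_quad_mul_quad (u : Fin n → Fin n → R) {v : Fin n → Fin n → R}
    (hv : ∀ a b, v a b = -v b a) :
    T (O.quad u * O.quad v) = (1 / 4) * ev (∑ e, ∑ a, (u a e - u e a) * v e a) := by
  have h1 : ∑ e, O.lin (v e) * O.ψ e = -O.quad v := by
    simp only [lin, quad, Finset.sum_mul, ← Finset.sum_neg_distrib]
    rw [Finset.sum_comm]
    refine Finset.sum_congr rfl fun a _ => Finset.sum_congr rfl fun b _ => ?_
    rw [hv b a, map_neg, neg_mul, neg_mul, mul_assoc]
  have h2 : T (O.quad u * O.quad v)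
      = ∑ e, T (O.lin (fun a => u a e - u e a) * O.lin (v e)) - T (O.quad u * O.quad v) := by
    -- The last fermion of `quad v` is cycled to the front. Averaging with the unmoved expression
    -- turns `quad u` into its commutator with that fermion.
    have h3 : T (O.quad u * O.quad v) = -∑ e, T (O.ψ e * (O.quad u * O.lin (v e))) := by
      rw [← neg_neg (O.quad v), ← h1, mul_neg, map_neg, Finset.mul_sum, map_sum]
      simp only [← mul_assoc, hTψ]
    nth_rewrite 2 [h3]
    rw [sub_neg_eq_add, quad_eq_sum_ψ_mul O v, Finset.mul_sum, map_sum, ← Finset.sum_add_distrib]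
    refine Finset.sum_congr rfl fun e _ => ?_
    rw [← quad_comm_ψ, ← map_add]
    congr 1
    noncomm_ring
  simp only [O.trace_lin_mul_lin hTm hTψ hT1] at h2
  rw [← Finset.mul_sum, ← map_sum] at h2
  linear_combination (1 / 2) * h2

lemma trace_cub_mul_cub {t t' : Fin n → Fin n → Fin n → R}
    (h1 : ∀ a b c, t a b c = -t b a c) (h2 : ∀ a b c, t a b c = -t a c b)
    (h1' : ∀ a b c, t' a b c = -t' b a c) (h2' : ∀ a b c, t' a b c = -t' a c b) :
    T (O.cub t * O.cub t') = -(3 / 4) * ev (∑ a, ∑ b, ∑ c, t a b c * t' a b c) := by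
  have hq : ∑ e, O.quad (t' e) * O.ψ e = O.cub t' := by
    simp only [quad, cub, Finset.sum_mul]
    rw [Finset.sum_comm]
    refine Finset.sum_congr rfl fun a _ => ?_
    rw [Finset.sum_comm]
    refine Finset.sum_congr rfl fun b _ => Finset.sum_congr rfl fun c _ => ?_
    rw [h1' c a b, h2' a c b, neg_neg, mul_assoc]
  have h3 : T (O.cub t * O.cub t') = ∑ e, T (O.ψ e * (O.cub t * O.quad (t' e))) := by
    conv_lhs => rw [← hq, Finset.mul_sum, map_sum]
    simp only [← mul_assoc, hTψ]
  have h4 : T (O.cub t * O.cub t')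
      = ∑ e, T (O.quad (fun a b => t a b e - t a e b + t e a b) * O.quad (t' e))
        - T (O.cub t * O.cub t') := by
    nth_rewrite 2 [h3]
    rw [cub_eq_sum_ψ_mul O t', Finset.mul_sum, map_sum, ← Finset.sum_sub_distrib]
    refine Finset.sum_congr rfl fun e _ => ?_
    rw [← cub_anticomm_ψ, ← map_sub]
    congr 1
    noncomm_ring
  simp only [O.trace_quad_mul_quad hTm hTψ hT1 _ (h2' _)] at h4
  rw [← Finset.mul_sum, ← map_sum] at h4
  -- Each of the six terms is `-t e a b` by antisymmetry. With the prefactor `1/4` and the final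
  -- `1/2` this produces `-3/4`.
  have h5 : ∑ e, ∑ a, ∑ b, ((t b a e - t b e a + t e b a) - (t a b e - t a e b + t e a b)) * t' e a b
      = (-6 : ℂ) • ∑ a, ∑ b, ∑ c, t a b c * t' a b c := by
    simp only [Finset.smul_sum]
    refine Finset.sum_congr rfl fun e _ => Finset.sum_congr rfl fun a _ =>
      Finset.sum_congr rfl fun b _ => ?_
    have e1 : t b a e = -t e a b := by rw [h1, h2, h1]; ring
    have e2 : t b e a = t e a b := by rw [h1, h2]; ring
    have e3 : t e b a = -t e a b := h2 _ _ _
    have e4 : t a b e = t e a b := by rw [h2, h1]; ring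
    have e5 : t a e b = -t e a b := h1 _ _ _
    rw [e1, e2, e3, e4, e5, Algebra.smul_def, map_neg, map_ofNat]
    ring
  rw [h5, map_smul, smul_eq_mul] at h4
  linear_combination (1 / 2) * h4

end Trace

end DiffOpAlg
end CliffordKT

/-! ### The anticommutator of two charges, order by order in derivatives -/

namespace CliffordKT
namespace DiffOpAlg

variable {n : ℕ} {R A : Type*} [CommRing R] [Algebra ℂ R] [Ring A] [Algebra ℂ A]
  (O : DiffOpAlg n R A)

/-- The derivative of a function is a commutator with `d`, so commuting operators `d` give commuting
derivations by the Jacobi identity, once `m` is injective. -/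
lemma δ_comm (hm : Function.Injective O.m) (μ ν : Fin n) (f : R) :
    O.δ μ (O.δ ν f) = O.δ ν (O.δ μ f) := by
  apply hm
  have e : ∀ μ f, O.m (O.δ μ f) = O.d μ * O.m f - O.m f * O.d μ := fun μ f => by
    rw [O.d_m, add_sub_cancel_left]
  rw [e, e, e, e]
  have h := O.d_comm μ ν
  have : O.d μ * (O.d ν * O.m f - O.m f * O.d ν) - (O.d ν * O.m f - O.m f * O.d ν) * O.d μ
      - (O.d ν * (O.d μ * O.m f - O.m f * O.d μ) - (O.d μ * O.m f - O.m f * O.d μ) * O.d ν)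
      = (O.d μ * O.d ν - O.d ν * O.d μ) * O.m f - O.m f * (O.d μ * O.d ν - O.d ν * O.d μ) := by
    noncomm_ring
  rw [h, sub_self, zero_mul, mul_zero, sub_self] at this
  exact sub_eq_zero.1 this

lemma lin_injective (hm : Function.Injective O.m) {u : Fin n → R} (h : O.lin u = 0) (a : Fin n) :
    u a = 0 := by
  apply hm
  rw [← lin_anticomm_ψ, h, zero_mul, mul_zero, add_zero, map_zero]

section Anticommutator

variable (v1 v2 : Fin n → Fin n → R) (t1 t2 : Fin n → Fin n → Fin n → R)

/-- The derivative of the part of order zero of a charge. -/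
def order0Deriv (v : Fin n → Fin n → R) (t : Fin n → Fin n → Fin n → R) (μ : Fin n) : A :=
  O.lin (fun a => (1 / 2 : ℂ) • ∑ ν, O.δ μ (O.δ ν (v a ν))) + O.cub fun a b c => O.δ μ (t a b c)

lemma d_order0 (v : Fin n → Fin n → R) (t : Fin n → Fin n → Fin n → R) (μ : Fin n) :
    O.d μ * O.order0 v t = O.order0 v t * O.d μ + O.order0Deriv v t μ := by
  rw [order0, mul_add, d_lin, d_cub, order0Deriv]
  simp only [Derivation.map_smul, map_sum]
  noncomm_ring

/-- The coefficient of `∂_μ` in the anticommutator of two charges with anticommuting symbols. -/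
def order1 (μ : Fin n) : A :=
  ∑ ν, (O.symb v1 ν * O.lin (fun a => O.δ ν (v2 a μ)) + O.symb v2 ν * O.lin fun a => O.δ ν (v1 a μ))
    + (O.symb v1 μ * O.order0 v2 t2 + O.order0 v2 t2 * O.symb v1 μ)
    + (O.symb v2 μ * O.order0 v1 t1 + O.order0 v1 t1 * O.symb v2 μ)

/-- The part of order zero of the anticommutator of two charges. -/
def orderZero : A :=
  ∑ μ, (O.symb v1 μ * O.order0Deriv v2 t2 μ + O.symb v2 μ * O.order0Deriv v1 t1 μ)
    + (O.order0 v1 t1 * O.order0 v2 t2 + O.order0 v2 t2 * O.order0 v1 t1)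

lemma charge_mul_charge :
    O.charge v1 t1 * O.charge v2 t2
      = ∑ μ, ∑ ν, O.symb v1 μ * O.symb v2 ν * (O.d μ * O.d ν)
        + ∑ μ, (∑ ν, (O.symb v1 ν * O.lin fun a => O.δ ν (v2 a μ)) + O.symb v1 μ * O.order0 v2 t2
          + O.order0 v1 t1 * O.symb v2 μ) * O.d μ
        + (∑ μ, O.symb v1 μ * O.order0Deriv v2 t2 μ + O.order0 v1 t1 * O.order0 v2 t2) := by
  have h1 : ∀ μ ν, O.symb v1 μ * O.d μ * (O.symb v2 ν * O.d ν)
      = O.symb v1 μ * O.symb v2 ν * (O.d μ * O.d ν)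
        + (O.symb v1 μ * O.lin fun a => O.δ μ (v2 a ν)) * O.d ν := by
    intro μ ν
    rw [mul_assoc, ← mul_assoc (O.d μ), symb, symb, d_lin]
    noncomm_ring
  have h2 : ∀ μ, O.symb v1 μ * O.d μ * O.order0 v2 t2
      = O.symb v1 μ * O.order0 v2 t2 * O.d μ + O.symb v1 μ * O.order0Deriv v2 t2 μ := by
    intro μ
    rw [mul_assoc, d_order0]
    noncomm_ring
  have h3 : (∑ μ, O.symb v1 μ * O.d μ) * ∑ ν, O.symb v2 ν * O.d ν
      = ∑ μ, ∑ ν, O.symb v1 μ * O.symb v2 ν * (O.d μ * O.d ν)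
        + ∑ μ, (∑ ν, (O.symb v1 ν * O.lin fun a => O.δ ν (v2 a μ))) * O.d μ := by
    rw [Finset.sum_mul_sum]
    simp only [h1, Finset.sum_add_distrib, Finset.sum_mul]
    congr 1
    exact Finset.sum_comm
  rw [charge, charge, add_mul, mul_add, mul_add, h3]
  simp only [Finset.sum_mul, Finset.mul_sum, h2, add_mul, Finset.sum_add_distrib, mul_assoc]
  abel

variable {v1 v2}

/-- As `∂_μ ∂_ν` is symmetric, its coefficient can be symmetrized in `μ` and `ν`; it is then the
function that `hsym` sets to zero. -/
lemma charge_anticomm_charge (hsym : ∀ μ ν, ∑ a, (v1 a μ * v2 a ν + v2 a μ * v1 a ν) = 0) :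
    O.charge v1 t1 * O.charge v2 t2 + O.charge v2 t2 * O.charge v1 t1
      = ∑ μ, O.order1 v1 v2 t1 t2 μ * O.d μ + O.orderZero v1 v2 t1 t2 := by
  have h0 : ∑ μ, ∑ ν, O.symb v1 μ * O.symb v2 ν * (O.d μ * O.d ν)
      + ∑ μ, ∑ ν, O.symb v2 μ * O.symb v1 ν * (O.d μ * O.d ν) = 0 := by
    have h1 : ∑ μ, ∑ ν, O.symb v2 μ * O.symb v1 ν * (O.d μ * O.d ν)
        = ∑ μ, ∑ ν, O.symb v2 ν * O.symb v1 μ * (O.d μ * O.d ν) := by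
      rw [Finset.sum_comm]
      simp only [O.d_comm]
    have h1' : ∑ μ, ∑ ν, O.symb v1 μ * O.symb v2 ν * (O.d μ * O.d ν)
        = ∑ μ, ∑ ν, O.symb v1 ν * O.symb v2 μ * (O.d μ * O.d ν) := by
      rw [Finset.sum_comm]
      simp only [O.d_comm]
    have h2 : ∑ μ, ∑ ν, O.symb v1 μ * O.symb v2 ν * (O.d μ * O.d ν)
        + ∑ μ, ∑ ν, O.symb v2 ν * O.symb v1 μ * (O.d μ * O.d ν)
        + (∑ μ, ∑ ν, O.symb v1 ν * O.symb v2 μ * (O.d μ * O.d ν)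
        + ∑ μ, ∑ ν, O.symb v2 μ * O.symb v1 ν * (O.d μ * O.d ν)) = 0 := by
      simp only [← Finset.sum_add_distrib, ← add_mul]
      refine Finset.sum_eq_zero fun μ _ => Finset.sum_eq_zero fun ν _ => ?_
      rw [add_comm (O.symb v1 ν * _), symb_anticomm, symb_anticomm, ← map_add,
        ← Finset.sum_add_distrib, hsym, map_zero, zero_mul]
    rw [← h1, ← h1', ← two_smul ℂ] at h2
    simpa [smul_smul] using congrArg (fun w => (1 / 2 : ℂ) • w) h2
  rw [charge_mul_charge, charge_mul_charge, orderZero]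
  have e : ∀ μ, O.order1 v1 v2 t1 t2 μ * O.d μ
      = (∑ ν, (O.symb v1 ν * O.lin fun a => O.δ ν (v2 a μ)) + O.symb v1 μ * O.order0 v2 t2
          + O.order0 v1 t1 * O.symb v2 μ) * O.d μ
        + (∑ ν, (O.symb v2 ν * O.lin fun a => O.δ ν (v1 a μ)) + O.symb v2 μ * O.order0 v1 t1
          + O.order0 v2 t2 * O.symb v1 μ) * O.d μ := by
    intro μ
    rw [← add_mul, order1, Finset.sum_add_distrib]
    congr 1; abel
  simp only [e, Finset.sum_add_distrib]
  rw [← sub_eq_zero, ← h0]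
  abel

/-- The coefficients of the bivector `order1`. -/
def order1Coeff (v1 v2 : Fin n → Fin n → R) (t1 t2 : Fin n → Fin n → Fin n → R)
    (μ a b : Fin n) : R :=
  ∑ ν, (v1 a ν * O.δ ν (v2 b μ) + v2 a ν * O.δ ν (v1 b μ))
    + ∑ e, v1 e μ * (t2 a b e - t2 a e b + t2 e a b)
    + ∑ e, v2 e μ * (t1 a b e - t1 a e b + t1 e a b)

lemma order1_eq (μ : Fin n) :
    O.order1 v1 v2 t1 t2 μ = O.quad (O.order1Coeff v1 v2 t1 t2 μ)
      + O.m ((1 / 2 : ℂ) • ∑ ν, ∑ a, (v1 a μ * O.δ ν (v2 a ν) + v2 a μ * O.δ ν (v1 a ν))) := by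
  have h1 : ∀ (v w : Fin n → Fin n → R) (t : Fin n → Fin n → Fin n → R),
      O.symb v μ * O.order0 w t + O.order0 w t * O.symb v μ
      = O.m ((1 / 2 : ℂ) • ∑ ν, ∑ a, v a μ * O.δ ν (w a ν))
        + O.quad fun a b => ∑ e, v e μ * (t a b e - t a e b + t e a b) := by
    intro v w t
    have e : (1 / 2 : ℂ) • ∑ ν, ∑ a, v a μ * O.δ ν (w a ν)
        = ∑ a, v a μ * ((1 / 2 : ℂ) • ∑ ν, O.δ ν (w a ν)) := by
      rw [Finset.sum_comm]
      simp only [Finset.smul_sum, Finset.mul_sum, mul_smul_comm]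
    rw [e, ← lin_anticomm_lin, ← cub_anticomm_lin, order0, symb]
    noncomm_ring
  have h2 : ∀ ν, O.symb v1 ν * O.lin (fun a => O.δ ν (v2 a μ))
      + (O.symb v2 ν * O.lin fun a => O.δ ν (v1 a μ))
      = O.quad fun a b => v1 a ν * O.δ ν (v2 b μ) + v2 a ν * O.δ ν (v1 b μ) := by
    intro ν
    rw [symb, symb, lin_mul_lin, lin_mul_lin, quad_add]
  rw [order1, h1, h1]
  simp only [h2]
  rw [sum_quad]
  have h3 : O.quad (O.order1Coeff v1 v2 t1 t2 μ)
      = O.quad (fun a b => ∑ ν, (v1 a ν * O.δ ν (v2 b μ) + v2 a ν * O.δ ν (v1 b μ)))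
        + O.quad (fun a b => ∑ e, v1 e μ * (t2 a b e - t2 a e b + t2 e a b))
        + O.quad (fun a b => ∑ e, v2 e μ * (t1 a b e - t1 a e b + t1 e a b)) := by
    rw [quad_add, quad_add]; rfl
  rw [h3]
  simp only [Finset.sum_add_distrib, smul_add, map_add]
  abel

lemma quad_of_symm {u : Fin n → Fin n → R} (hu : ∀ a b, u a b = u b a) :
    O.quad u = O.m ((1 / 2 : ℂ) • ∑ a, u a a) := by
  have h1 : O.quad u = ∑ a, ∑ b, O.m (u a b) * (O.ψ b * O.ψ a) := by
    rw [quad, Finset.sum_comm]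
    simp only [hu]
  have h2 : O.quad u + O.quad u = O.m (∑ a, u a a) := by
    nth_rewrite 2 [h1]
    rw [quad]
    simp only [← Finset.sum_add_distrib, ← mul_add, O.ψ_anticomm, mul_ite, mul_one, mul_zero]
    simp
  rw [map_smul, ← h2, ← two_smul ℂ, smul_smul]
  norm_num

/-- With symmetric coefficients the bivector collapses to its trace. This scalar and the explicit
scalar of `order1_eq` add up to a divergence of the symbol pairing in `hsym`. The cubic coefficients
contribute no trace because they are antisymmetric. -/
lemma order1_eq_zero (hsym : ∀ μ ν, ∑ a, (v1 a μ * v2 a ν + v2 a μ * v1 a ν) = 0)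
    (h1 : ∀ a b c, t1 a b c = -t1 b a c) (h1' : ∀ a b c, t1 a b c = -t1 a c b)
    (h2 : ∀ a b c, t2 a b c = -t2 b a c) (h2' : ∀ a b c, t2 a b c = -t2 a c b)
    (μ : Fin n)
    (hω : ∀ a b, O.order1Coeff v1 v2 t1 t2 μ a b = O.order1Coeff v1 v2 t1 t2 μ b a) :
    O.order1 v1 v2 t1 t2 μ = 0 := by
  rw [order1_eq, O.quad_of_symm hω, ← map_add, ← smul_add]
  have hz : ∀ t : Fin n → Fin n → Fin n → R, (∀ a b c, t a b c = -t b a c) →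
      (∀ a b c, t a b c = -t a c b) → ∀ a e, t a a e - t a e a + t e a a = 0 := by
    intro t ht ht' a e
    have e1 : (2 : ℂ) • t a a e = 0 := by rw [two_smul]; linear_combination ht a a e
    have e2 : t a a e = 0 := by simpa [smul_smul] using congrArg (fun w => (1 / 2 : ℂ) • w) e1
    linear_combination ht e a a - 2 * ht' a a e + 3 * e2
  have h3 : ∑ a, O.order1Coeff v1 v2 t1 t2 μ a a
      + ∑ ν, ∑ a, (v1 a μ * O.δ ν (v2 a ν) + v2 a μ * O.δ ν (v1 a ν))
      = ∑ ν, O.δ ν (∑ a, (v1 a μ * v2 a ν + v2 a μ * v1 a ν)) := by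
    simp only [order1Coeff, hz t1 h1 h1', hz t2 h2 h2', mul_zero, Finset.sum_const_zero, add_zero,
      map_sum, map_add, Derivation.leibniz, smul_eq_mul]
    rw [Finset.sum_comm, ← Finset.sum_add_distrib]
    refine Finset.sum_congr rfl fun ν _ => ?_
    rw [← Finset.sum_add_distrib]
    exact Finset.sum_congr rfl fun a _ => by ring
  rw [h3]
  simp [hsym]

end Anticommutator

end DiffOpAlg
end CliffordKT

/-! ### The trace of the zeroth-order part, and rigidity of the anticommutator -/

namespace CliffordKT
namespace DiffOpAlg

variable {n : ℕ} {R A : Type*} [CommRing R] [Algebra ℂ R] [Ring A] [Algebra ℂ A]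
  (O : DiffOpAlg n R A)

lemma order0Deriv_mem_parity (v : Fin n → Fin n → R) (t : Fin n → Fin n → Fin n → R) (μ : Fin n) :
    O.order0Deriv v t μ ∈ O.parity (List.finRange n) false := O.lin_add_cub_mem_parity _ _

lemma order0_mem_parity (v : Fin n → Fin n → R) (t : Fin n → Fin n → Fin n → R) :
    O.order0 v t ∈ O.parity (List.finRange n) false := O.lin_add_cub_mem_parity _ _

lemma orderZero_mem_parity (v1 v2 : Fin n → Fin n → R) (t1 t2 : Fin n → Fin n → Fin n → R) :
    O.orderZero v1 v2 t1 t2 ∈ O.parity (List.finRange n) true := by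
  have h : ∀ (v : Fin n → Fin n → R) (t : Fin n → Fin n → Fin n → R) {Z : A},
      Z ∈ O.parity (List.finRange n) false →
      O.order0 v t * Z ∈ O.parity (List.finRange n) true := by
    intro v t Z hZ
    rw [order0, add_mul]
    exact add_mem (O.lin_mul_mem_parity _ _ hZ) (O.cub_mul_mem_parity _ _ hZ)
  refine add_mem (sum_mem fun μ _ => add_mem ?_ ?_) (add_mem ?_ ?_)
  · exact O.lin_mul_mem_parity _ _ (O.order0Deriv_mem_parity v2 t2 μ)
  · exact O.lin_mul_mem_parity _ _ (O.order0Deriv_mem_parity v1 t1 μ)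
  · exact h _ _ (O.order0_mem_parity _ _)
  · exact h _ _ (O.order0_mem_parity _ _)

/-- Only the vector-vector and cubic-cubic products have a trace. The second derivatives and the
divergences produced by Weyl ordering are eliminated by differentiating `hsym` twice, which leaves
the crossed product of first derivatives. -/
lemma trace_orderZero (hm : Function.Injective O.m) {ev : R →ₐ[ℂ] ℂ} {T : A →ₗ[ℂ] ℂ}
    (hTm : ∀ f Z, T (O.m f * Z) = ev f * T Z)
    (hTψ : ∀ a Z, T (Z * O.ψ a) = T (O.ψ a * Z)) (hT1 : T 1 = 1)
    {v1 v2 : Fin n → Fin n → R} {t1 t2 : Fin n → Fin n → Fin n → R}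
    (hsym : ∀ μ ν, ∑ a, (v1 a μ * v2 a ν + v2 a μ * v1 a ν) = 0)
    (h1 : ∀ a b c, t1 a b c = -t1 b a c) (h1' : ∀ a b c, t1 a b c = -t1 a c b)
    (h2 : ∀ a b c, t2 a b c = -t2 b a c) (h2' : ∀ a b c, t2 a b c = -t2 a c b) :
    T (O.orderZero v1 v2 t1 t2)
      = -(1 / 4) * ev (∑ a, ∑ μ, ∑ ν, O.δ ν (v1 a μ) * O.δ μ (v2 a ν))
        - (3 / 2) * ev (∑ a, ∑ b, ∑ c, t1 a b c * t2 a b c) := by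
  have hδ := O.δ_comm hm
  have e1 : ∀ (v w : Fin n → Fin n → R) (t : Fin n → Fin n → Fin n → R),
      (∀ a b c, t a b c = -t b a c) → (∀ a b c, t a b c = -t a c b) → ∀ μ,
      T (O.symb v μ * O.order0Deriv w t μ)
        = (1 / 4) * ev (∑ ν, ∑ a, v a μ * O.δ μ (O.δ ν (w a ν))) := by
    intro v w t ht ht' μ
    have hc := (O.trace_lin_mul_cub hTm hTψ hT1 (fun a => v a μ)
      (t := fun a b c => O.δ μ (t a b c)) (fun a b c => by rw [ht, map_neg])
      (fun a b c => by rw [ht', map_neg])).1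
    rw [symb, order0Deriv, mul_add, map_add, hc, O.trace_lin_mul_lin hTm hTψ hT1, add_zero]
    have : ∑ a, v a μ * ((1 / 2 : ℂ) • ∑ ν, O.δ μ (O.δ ν (w a ν)))
        = (1 / 2 : ℂ) • ∑ ν, ∑ a, v a μ * O.δ μ (O.δ ν (w a ν)) := by
      rw [Finset.sum_comm]
      simp only [Finset.smul_sum, Finset.mul_sum, mul_smul_comm]
    rw [this, map_smul, smul_eq_mul]
    ring
  have e2 : ∀ (v w : Fin n → Fin n → R) (t t' : Fin n → Fin n → Fin n → R),
      (∀ a b c, t a b c = -t b a c) → (∀ a b c, t a b c = -t a c b) →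
      (∀ a b c, t' a b c = -t' b a c) → (∀ a b c, t' a b c = -t' a c b) →
      T (O.order0 v t * O.order0 w t')
        = (1 / 8) * ev (∑ μ, ∑ ν, ∑ a, O.δ μ (v a μ) * O.δ ν (w a ν))
          - (3 / 4) * ev (∑ a, ∑ b, ∑ c, t a b c * t' a b c) := by
    intro v w t t' ht1 ht2 ht1' ht2'
    rw [order0, order0, add_mul, mul_add, mul_add, map_add, map_add, map_add,
      (O.trace_lin_mul_cub hTm hTψ hT1 _ ht1' ht2').1,
      (O.trace_lin_mul_cub hTm hTψ hT1 _ ht1 ht2).2,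
      O.trace_cub_mul_cub hTm hTψ hT1 ht1 ht2 ht1' ht2', O.trace_lin_mul_lin hTm hTψ hT1]
    have : ∑ a, ((1 / 2 : ℂ) • ∑ μ, O.δ μ (v a μ)) * ((1 / 2 : ℂ) • ∑ ν, O.δ ν (w a ν))
        = (1 / 4 : ℂ) • ∑ μ, ∑ ν, ∑ a, O.δ μ (v a μ) * O.δ ν (w a ν) := by
      simp only [smul_mul_smul_comm, Finset.sum_mul_sum, ← Finset.smul_sum]
      rw [Finset.sum_comm]
      congr 1
      · norm_num
      · exact Finset.sum_congr rfl fun _ _ => Finset.sum_comm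
    rw [this, map_smul, smul_eq_mul]
    ring
  have e3 : ∑ a, ∑ b, ∑ c, t2 a b c * t1 a b c = ∑ a, ∑ b, ∑ c, t1 a b c * t2 a b c := by
    simp only [mul_comm]
  have e4 : ∑ μ, ∑ ν, ∑ a, O.δ μ (v2 a μ) * O.δ ν (v1 a ν)
      = ∑ μ, ∑ ν, ∑ a, O.δ μ (v1 a μ) * O.δ ν (v2 a ν) := by
    rw [Finset.sum_comm]
    simp only [mul_comm]
  have e5 : ∑ a, ∑ μ, ∑ ν, O.δ ν (v1 a μ) * O.δ μ (v2 a ν)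
      = ∑ μ, ∑ ν, ∑ a, O.δ ν (v1 a μ) * O.δ μ (v2 a ν) := by
    rw [Finset.sum_comm]
    exact Finset.sum_congr rfl fun _ _ => Finset.sum_comm
  rw [orderZero, map_add, map_sum, map_add, e2 v1 v2 t1 t2 h1 h1' h2 h2',
    e2 v2 v1 t2 t1 h2 h2' h1 h1', e3, e4, e5]
  simp only [map_add T, e1 v1 v2 t2 h2 h2', e1 v2 v1 t1 h1 h1']
  rw [Finset.sum_add_distrib, ← Finset.mul_sum, ← Finset.mul_sum, ← map_sum, ← map_sum]
  -- Sum `∂_μ ∂_ν` of the relation `hsym μ ν` over both indices; renaming indices and commuting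
  -- derivatives shows that every term occurs twice.
  have key : ∑ μ, ∑ ν, ∑ a, v1 a μ * O.δ μ (O.δ ν (v2 a ν))
      + ∑ μ, ∑ ν, ∑ a, v2 a μ * O.δ μ (O.δ ν (v1 a ν))
      + ∑ μ, ∑ ν, ∑ a, O.δ μ (v1 a μ) * O.δ ν (v2 a ν)
      + ∑ μ, ∑ ν, ∑ a, O.δ ν (v1 a μ) * O.δ μ (v2 a ν) = 0 := by
    have h : ∑ μ, ∑ ν, ∑ a, (v1 a μ * O.δ μ (O.δ ν (v2 a ν)) + v2 a μ * O.δ μ (O.δ ν (v1 a ν))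
        + v2 a ν * O.δ μ (O.δ ν (v1 a μ)) + v1 a ν * O.δ μ (O.δ ν (v2 a μ))
        + (O.δ μ (v1 a μ) * O.δ ν (v2 a ν) + O.δ μ (v2 a μ) * O.δ ν (v1 a ν))
        + (O.δ ν (v1 a μ) * O.δ μ (v2 a ν) + O.δ ν (v2 a μ) * O.δ μ (v1 a ν))) = 0 := by
      refine Finset.sum_eq_zero fun μ _ => Finset.sum_eq_zero fun ν _ => ?_
      rw [← map_zero (O.δ μ), ← map_zero (O.δ ν), ← hsym μ ν]
      simp only [map_sum, map_add, Derivation.leibniz, smul_eq_mul]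
      exact Finset.sum_congr rfl fun a _ => by ring
    have s1 : ∑ μ, ∑ ν, ∑ a, v2 a ν * O.δ μ (O.δ ν (v1 a μ))
        = ∑ μ, ∑ ν, ∑ a, v2 a μ * O.δ μ (O.δ ν (v1 a ν)) := by
      rw [Finset.sum_comm]
      simp only [hδ]
    have s2 : ∑ μ, ∑ ν, ∑ a, v1 a ν * O.δ μ (O.δ ν (v2 a μ))
        = ∑ μ, ∑ ν, ∑ a, v1 a μ * O.δ μ (O.δ ν (v2 a ν)) := by
      rw [Finset.sum_comm]
      simp only [hδ]
    have s3 : ∑ μ, ∑ ν, ∑ a, O.δ ν (v2 a μ) * O.δ μ (v1 a ν)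
        = ∑ μ, ∑ ν, ∑ a, O.δ ν (v1 a μ) * O.δ μ (v2 a ν) := by
      rw [Finset.sum_comm]
      simp only [mul_comm]
    simp only [Finset.sum_add_distrib] at h
    rw [s1, s2, s3, e4] at h
    have h' := congrArg (fun r => (1 / 2 : ℂ) • r) h
    simp only [smul_zero] at h'
    rw [← h']
    module
  have key' := congrArg ev key
  rw [map_add, map_add, map_add, map_zero] at key'
  linear_combination (1 / 4) * key'

lemma quad_comm_lin (u : Fin n → Fin n → R) (v : Fin n → R) :
    O.quad u * O.lin v - O.lin v * O.quad u = O.lin fun a => ∑ e, v e * (u a e - u e a) := by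
  have h : ∀ e, O.quad u * (O.m (v e) * O.ψ e) - O.m (v e) * O.ψ e * O.quad u
      = O.lin fun a => v e * (u a e - u e a) := by
    intro e
    rw [← mul_assoc, quad_m, mul_assoc, mul_assoc, ← mul_sub, quad_comm_ψ]
    simp only [lin, Finset.mul_sum, map_mul, mul_assoc]
  conv_lhs => rw [lin, Finset.mul_sum, Finset.sum_mul, ← Finset.sum_sub_distrib]
  simp only [h, sum_lin]

/-- Flatten the free index of the antisymmetric part of `α` with the inverse frame `w`. By `h0` the
result is antisymmetric in its first and last indices as well, hence totally. Then `h1` and `h2` say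
that `p` and `q` act equally on different slots, so `eq_zero_of_slot_eq` applies. -/
lemma eq_of_bracket_eq {v0 w : Fin n → Fin n → R}
    (hw : ∀ a b, ∑ μ, v0 a μ * w μ b = if a = b then 1 else 0)
    (hw' : ∀ μ ν, ∑ a, w μ a * v0 a ν = if μ = ν then 1 else 0)
    {p q : Matrix (Fin n) (Fin n) R} (hp : p * p = -1) (hq : q * q = -1) (hpq : p * q = -(q * p))
    (hpa : ∀ a b, p a b = -p b a) (hqa : ∀ a b, q a b = -q b a)
    {α : Fin n → Fin n → Fin n → R}
    (h0 : ∀ μ ν a, ∑ e, (v0 e μ * (α ν a e - α ν e a) + v0 e ν * (α μ a e - α μ e a)) = 0)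
    (h1 : ∀ μ ν a, ∑ e, ((∑ b, p e b * v0 b μ) * (α ν a e - α ν e a)
      + (∑ b, p e b * v0 b ν) * (α μ a e - α μ e a)) = 0)
    (h2 : ∀ μ ν a, ∑ e, ((∑ b, q e b * v0 b μ) * (α ν a e - α ν e a)
      + (∑ b, q e b * v0 b ν) * (α μ a e - α μ e a)) = 0) (μ a b : Fin n) :
    α μ a b = α μ b a := by
  set β : (Fin 3 → Fin n) → R := ofCurry3 fun b a e => ∑ μ, w μ b * (α μ a e - α μ e a) with hβ
  -- All three bracket relations have the same shape, with `M` equal to `1`, `p` or `q`; contraction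
  -- with `w` on both coordinate indices makes them flat.
  have hflat : ∀ M : Matrix (Fin n) (Fin n) R,
      (∀ μ ν a, ∑ e, ((∑ b, M e b * v0 b μ) * (α ν a e - α ν e a)
      + (∑ b, M e b * v0 b ν) * (α μ a e - α μ e a)) = 0) → ∀ b c a,
      ∑ e, (M e c * β ![b, a, e] + M e b * β ![c, a, e]) = 0 := by
    intro M hM b c a
    have hMw : ∀ e c, ∑ μ, (∑ b, M e b * v0 b μ) * w μ c = M e c := by
      intro e c
      simp only [Finset.sum_mul, mul_assoc]
      rw [Finset.sum_comm]
      simp [← Finset.mul_sum, hw]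
    have h : ∑ μ, ∑ ν, w μ c * w ν b * ∑ e, ((∑ b, M e b * v0 b μ) * (α ν a e - α ν e a)
      + (∑ b, M e b * v0 b ν) * (α μ a e - α μ e a)) = 0 := by simp [hM]
    rw [← h]
    have e1 : ∀ e, M e c * β ![b, a, e] + M e b * β ![c, a, e]
        = ∑ μ, ∑ ν, w μ c * w ν b * ((∑ b, M e b * v0 b μ) * (α ν a e - α ν e a)
          + (∑ b, M e b * v0 b ν) * (α μ a e - α μ e a)) := by
      intro e
      rw [← hMw e c, ← hMw e b, hβ, ofCurry3_apply, ofCurry3_apply, Finset.sum_mul_sum,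
        Finset.sum_mul_sum, Finset.sum_comm (γ := Fin n)
          (f := fun μ ν => (∑ b, M e b * v0 b μ) * w μ b * (w ν c * (α ν a e - α ν e a))),
        ← Finset.sum_add_distrib]
      refine Finset.sum_congr rfl fun μ _ => ?_
      rw [← Finset.sum_add_distrib]
      exact Finset.sum_congr rfl fun ν _ => by ring
    simp only [e1, Finset.mul_sum]
    rw [Finset.sum_comm]
    exact Finset.sum_congr rfl fun μ _ => Finset.sum_comm
  have b0 : ∀ b a c, β ![b, a, c] = -β ![c, a, b] := by
    intro b a c
    have := hflat 1 (by simpa [Matrix.one_apply] using h0) b c a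
    rw [Finset.sum_add_distrib] at this
    simp only [Matrix.one_apply, ite_mul, one_mul, zero_mul, Finset.sum_ite_eq',
      Finset.mem_univ, if_true] at this
    linear_combination this
  have b1 : ∀ b a c, β ![b, a, c] = -β ![b, c, a] := by
    intro b a c
    simp only [hβ, ofCurry3_apply, ← Finset.sum_neg_distrib]
    exact Finset.sum_congr rfl fun _ _ => by ring
  have hs1 := hflat p h1
  have hs2 := hflat q h2
  have hz : β = 0 := by
    refine eq_zero_of_slot_eq hp hq hpq (fun x hx => ?_) (ext_vec3 fun x y z => ?_)
      (ext_vec3 fun x y z => ?_)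
    · have : (2 : ℂ) • x = 0 := by rw [two_smul, ← two_mul, hx]
      simpa [smul_smul] using congrArg (fun w => (1 / 2 : ℂ) • w) this
    · rw [slot_vec3_one, slot_vec3_zero, ← sub_eq_zero, ← Finset.sum_sub_distrib, ← hs1 x y z]
      refine Finset.sum_congr rfl fun e _ => ?_
      rw [hpa e y, hpa e x, b1 x z e, b0 y z e, b1 e z y]
      ring
    · rw [slot_vec3_two, slot_vec3_zero, ← sub_eq_zero, ← Finset.sum_sub_distrib, ← neg_inj, neg_zero,
        ← hs2 x z y, ← Finset.sum_neg_distrib]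
      refine Finset.sum_congr rfl fun e _ => ?_
      rw [hqa e z, hqa e x, b0 z y e]
      ring
  have h3 : ∑ c, β ![c, a, b] * v0 c μ = α μ a b - α μ b a := by
    simp only [hβ, ofCurry3_apply, Finset.sum_mul]
    rw [Finset.sum_comm]
    have : ∀ ν, ∑ c, w ν c * (α ν a b - α ν b a) * v0 c μ
        = if ν = μ then α ν a b - α ν b a else 0 := by
      intro ν
      have e : ∀ c, w ν c * (α ν a b - α ν b a) * v0 c μ = w ν c * v0 c μ * (α ν a b - α ν b a) :=
        fun c => by ring
      simp only [e, ← Finset.sum_mul, hw']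
      split_ifs <;> simp
    simp only [this]
    simp
  rw [hz] at h3
  simp only [Pi.zero_apply, zero_mul, Finset.sum_const_zero] at h3
  exact sub_eq_zero.1 h3.symm

/-- Two charges whose squares coincide, and that anticommute with a third one of the same square,
anticommute up to a function, whose values are traces. -/
theorem exists_anticomm_eq_m (hm : Function.Injective O.m)
    {v0 v1 v2 : Fin n → Fin n → R} {t0 t1 t2 : Fin n → Fin n → Fin n → R}
    (h01 : O.charge v0 t0 * O.charge v0 t0 = O.charge v1 t1 * O.charge v1 t1)
    (h02 : O.charge v0 t0 * O.charge v0 t0 = O.charge v2 t2 * O.charge v2 t2)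
    (h1 : O.charge v0 t0 * O.charge v1 t1 + O.charge v1 t1 * O.charge v0 t0 = 0)
    (h2 : O.charge v0 t0 * O.charge v2 t2 + O.charge v2 t2 * O.charge v0 t0 = 0)
    {w : Fin n → Fin n → R} (hw : ∀ a b, ∑ μ, v0 a μ * w μ b = if a = b then 1 else 0)
    (hw' : ∀ μ ν, ∑ a, w μ a * v0 a ν = if μ = ν then 1 else 0)
    {p q : Matrix (Fin n) (Fin n) R} (hp : p * p = -1) (hq : q * q = -1) (hpq : p * q = -(q * p))
    (hpa : ∀ a b, p a b = -p b a) (hqa : ∀ a b, q a b = -q b a)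
    (hv1 : ∀ a μ, v1 a μ = ∑ b, p a b * v0 b μ) (hv2 : ∀ a μ, v2 a μ = ∑ b, q a b * v0 b μ)
    (hsym : ∀ μ ν, ∑ a, (v1 a μ * v2 a ν + v2 a μ * v1 a ν) = 0)
    (ht1 : ∀ a b c, t1 a b c = -t1 b a c) (ht1' : ∀ a b c, t1 a b c = -t1 a c b)
    (ht2 : ∀ a b c, t2 a b c = -t2 b a c) (ht2' : ∀ a b c, t2 a b c = -t2 a c b) :
    ∃ f, O.charge v1 t1 * O.charge v2 t2 + O.charge v2 t2 * O.charge v1 t1 = O.m f ∧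
      ∀ (ev : R →ₐ[ℂ] ℂ) (T : A →ₗ[ℂ] ℂ), (∀ f Z, T (O.m f * Z) = ev f * T Z) →
        (∀ a Z, T (Z * O.ψ a) = T (O.ψ a * Z)) → T 1 = 1 →
        ev f = -(1 / 4) * ev (∑ a, ∑ μ, ∑ ν, O.δ ν (v1 a μ) * O.δ μ (v2 a ν))
        - (3 / 2) * ev (∑ a, ∑ b, ∑ c, t1 a b c * t2 a b c) := by
  set L0 := O.charge v0 t0 with hL0
  set L1 := O.charge v1 t1 with hL1
  set L2 := O.charge v2 t2 with hL2
  set X := L1 * L2 + L2 * L1 with hX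
  have n1 : L0 * L1 = -(L1 * L0) := eq_neg_of_add_eq_zero_left h1
  have n2 : L0 * L2 = -(L2 * L0) := eq_neg_of_add_eq_zero_left h2
  -- `L0` anticommutes with `L1` and `L2`, so it commutes with their anticommutator.
  have c0 : L0 * X = X * L0 := by
    rw [hX, mul_add, ← mul_assoc, ← mul_assoc, n1, n2, neg_mul, neg_mul, mul_assoc, mul_assoc, n1,
      n2]
    noncomm_ring
  -- Here `[L1, X] = [L1², L2]`, and `L1² = L2²` commutes with `L2`; the argument for `L2` is the
  -- same.
  have c1 : L1 * X = X * L1 := by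
    have : L1 * X - X * L1 = L1 * L1 * L2 - L2 * (L1 * L1) := by rw [hX]; noncomm_ring
    rw [← h01, h02] at this
    rw [← sub_eq_zero, this, mul_assoc, sub_self]
  have c2 : L2 * X = X * L2 := by
    have : L2 * X - X * L2 = L2 * L2 * L1 - L1 * (L2 * L2) := by rw [hX]; noncomm_ring
    rw [← h02, h01] at this
    rw [← sub_eq_zero, this, mul_assoc, sub_self]
  have hXe := O.charge_anticomm_charge t1 t2 hsym
  rw [← hL1, ← hL2, ← hX] at hXe
  set F := O.order1 v1 v2 t1 t2 with hF
  set om := O.order1Coeff v1 v2 t1 t2 with hom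
  have hFm : ∀ μ f, F μ * O.m f = O.m f * F μ := by
    intro μ f
    rw [hF, order1_eq, add_mul, quad_m, O.m_comm, mul_add]
  have hYm : ∀ f, O.orderZero v1 v2 t1 t2 * O.m f = O.m f * O.orderZero v1 v2 t1 t2 :=
    fun f => O.mul_m_of_mem_parity f _ _ (O.orderZero_mem_parity v1 v2 t1 t2)
  -- With the second-order part gone, the commutator of `X` with a coordinate is the coefficient of
  -- the corresponding derivative.
  have hXx : ∀ μ, X * O.m (O.x μ) = O.m (O.x μ) * X + F μ := by
    intro μ
    rw [hXe, add_mul, hYm, mul_add, Finset.sum_mul, Finset.mul_sum, add_right_comm]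
    congr 1
    have : ∀ ν, F ν * O.d ν * O.m (O.x μ) = O.m (O.x μ) * (F ν * O.d ν) + if ν = μ then F ν else 0 := by
      intro ν
      rw [mul_assoc, O.d_m, mul_add, ← mul_assoc, hFm, O.δ_x, mul_assoc]
      split_ifs <;> simp
    simp only [this, Finset.sum_add_distrib]
    simp
  -- Commute `[L, X] = 0` with `x^μ` and then with `x^ν`. The operators `L` and `X` are replaced by
  -- their leading coefficients in both possible ways, which gives the symmetrization in `μ` and
  -- `ν`.
  have hbr : ∀ (v : Fin n → Fin n → R) (t : Fin n → Fin n → Fin n → R),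
      O.charge v t * X = X * O.charge v t → ∀ μ ν,
      O.symb v μ * F ν - F ν * O.symb v μ + (O.symb v ν * F μ - F μ * O.symb v ν) = 0 := by
    intro v t hc μ ν
    have hL : ∀ μ, O.charge v t * O.m (O.x μ) = O.m (O.x μ) * O.charge v t + O.symb v μ :=
      fun μ => sub_eq_iff_eq_add'.1 (O.charge_x v t μ)
    have k1 : O.symb v μ * X + O.charge v t * F μ = X * O.symb v μ + F μ * O.charge v t := by
      have := congrArg (· * O.m (O.x μ)) hc
      simp only [mul_assoc, hXx, hL, mul_add] at this
      simp only [← mul_assoc, hXx, hL, add_mul] at this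
      rw [mul_assoc (O.m _), hc, mul_assoc (O.m _), add_assoc, add_assoc, add_right_inj] at this
      rw [this, add_comm]
    have k2 := congrArg (· * O.m (O.x ν)) k1
    simp only [add_mul, mul_assoc, hXx, hL, hFm, O.symb_m, mul_add] at k2
    simp only [← mul_assoc, hXx, hL, hFm, O.symb_m, add_mul] at k2
    have k3 : O.m (O.x ν) * (O.symb v μ * X + O.charge v t * F μ)
        = O.m (O.x ν) * (X * O.symb v μ + F μ * O.charge v t) := by rw [k1]
    simp only [mul_add, ← mul_assoc] at k3
    rw [← sub_eq_zero] at k2 k3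
    rw [← sub_eq_zero_of_eq (k2.trans k3.symm)]
    abel
  have hα : ∀ (v : Fin n → Fin n → R) (t : Fin n → Fin n → Fin n → R),
      O.charge v t * X = X * O.charge v t → ∀ μ ν a,
      ∑ e, (v e μ * (om ν a e - om ν e a) + v e ν * (om μ a e - om μ e a)) = 0 := by
    intro v t hc μ ν a
    have hq : ∀ (u : Fin n → R) (μ : Fin n), O.lin u * F μ - F μ * O.lin u
        = -O.lin fun a => ∑ e, u e * (om μ a e - om μ e a) := by
      intro u μ
      rw [hF, order1_eq, ← hom, mul_add, add_mul, lin_m, add_sub_add_right_eq_sub, ← neg_sub,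
        quad_comm_lin]
    have hb := hbr v t hc μ ν
    rw [symb, symb, hq, hq, ← neg_add, neg_eq_zero, lin_add] at hb
    have := O.lin_injective hm hb a
    rw [← Finset.sum_add_distrib] at this
    exact this
  -- The three charges supply the three bracket relations, with symbols `v0`, `p v0` and `q v0`.
  have hsymm : ∀ μ a b, om μ a b = om μ b a := by
    intro μ
    refine eq_of_bracket_eq hw hw' hp hq hpq hpa hqa (α := om) ?_ ?_ ?_ μ
    · exact hα v0 t0 c0
    · simpa only [hv1] using hα v1 t1 c1
    · simpa only [hv2] using hα v2 t2 c2
  have hF0 : ∀ μ, F μ = 0 := fun μ =>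
    O.order1_eq_zero t1 t2 hsym ht1 ht1' ht2 ht2' μ (hsymm μ)
  have hXY : X = O.orderZero v1 v2 t1 t2 := by
    rw [hXe]; simp [hF0]
  -- Now that `F = 0`, `X` commutes with functions. It therefore commutes with the symbol `[L0,
  -- x^μ]`, and `w` recovers the individual fermions from the symbols.
  have hψ : ∀ a, X * O.ψ a = O.ψ a * X := by
    have h3 : ∀ μ, O.symb v0 μ * X = X * O.symb v0 μ := by
      intro μ
      have hx := O.charge_x v0 t0 μ
      have hxX := hXx μ
      rw [hF0, add_zero] at hxX
      rw [← hx, sub_mul, mul_sub, mul_assoc, ← hxX, ← mul_assoc, ← hL0, c0, mul_assoc, mul_assoc,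
        c0, ← mul_assoc X (O.m _), hxX, mul_assoc]
    intro a
    have h4 : O.ψ a = ∑ μ, O.m (w μ a) * O.symb v0 μ := by
      simp only [symb, lin, Finset.mul_sum, ← mul_assoc, ← map_mul]
      rw [Finset.sum_comm]
      simp only [← Finset.sum_mul, ← map_sum, mul_comm (w _ _), hw]
      simp
    rw [h4, Finset.mul_sum, Finset.sum_mul]
    refine Finset.sum_congr rfl fun μ _ => ?_
    have h5 : X * O.m (w μ a) = O.m (w μ a) * X := by rw [hXY]; exact hYm _
    rw [← mul_assoc, h5, mul_assoc, ← h3, mul_assoc]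
  have hmem : X ∈ O.parity (List.finRange n) true := by
    rw [hXY]; exact O.orderZero_mem_parity _ _ _ _
  obtain ⟨f, hf⟩ := O.eq_m_of_commute _ (List.nodup_finRange n) hmem hψ
  refine ⟨f, hf, fun ev T hTm hTψ hT1 => ?_⟩
  rw [← O.trace_orderZero hm hTm hTψ hT1 hsym ht1 ht1' ht2 ht2', ← hXY, hf, ← mul_one (O.m f), hTm,
    hT1, mul_one]

end DiffOpAlg
end CliffordKT

namespace CliffordKT

/-! ### Permutations of slots and the invariant pairing of arrays -/

section Perm

set_option linter.unusedSectionVars false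

variable {ι X : Type*} [Fintype ι] [DecidableEq ι] [CommRing X] {k : ℕ}

/-- The permutation of the slots of a multi-index array. -/
def permSlots (σ : Equiv.Perm (Fin k)) : Module.End X ((Fin k → ι) → X) where
  toFun t m := t (m ∘ σ)
  map_add' _ _ := rfl
  map_smul' _ _ := rfl

lemma permSlots_apply (σ : Equiv.Perm (Fin k)) (t : (Fin k → ι) → X) (m : Fin k → ι) :
    permSlots σ t m = t (m ∘ σ) := rfl

lemma slot_permSlots (σ : Equiv.Perm (Fin k)) (i : Fin k) (J : Matrix ι ι X)
    (t : (Fin k → ι) → X) :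
    slot i J (permSlots σ t) = permSlots σ (slot (σ.symm i) J t) := by
  ext m
  simp only [slot_apply, permSlots_apply, Function.comp_apply, Equiv.apply_symm_apply]
  refine Finset.sum_congr rfl fun ν _ => ?_
  congr 2
  ext j
  simp only [Function.comp_apply, Function.update_apply, Equiv.eq_symm_apply]

/-- The sum over all multi-indices of the products of two arrays. -/
def pairing (s t : (Fin k → ι) → X) : X := ∑ m, s m * t m

lemma pairing_comm (s t : (Fin k → ι) → X) : pairing s t = pairing t s := by
  simp only [pairing, mul_comm]

lemma pairing_add (s t t' : (Fin k → ι) → X) : pairing s (t + t') = pairing s t + pairing s t' := by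
  simp [pairing, mul_add, Finset.sum_add_distrib]

lemma pairing_neg (s t : (Fin k → ι) → X) : pairing s (-t) = -pairing s t := by
  simp [pairing]

lemma pairing_sub (s t t' : (Fin k → ι) → X) : pairing s (t - t') = pairing s t - pairing s t' := by
  simp [pairing, mul_sub, Finset.sum_sub_distrib]

lemma pairing_smul (c : X) (s t : (Fin k → ι) → X) : pairing s (c • t) = c * pairing s t := by
  simp only [pairing, Finset.mul_sum, Pi.smul_apply, smul_eq_mul]
  exact Finset.sum_congr rfl fun _ _ => by ring

lemma pairing_permSlots (σ : Equiv.Perm (Fin k)) (s t : (Fin k → ι) → X) :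
    pairing (permSlots σ s) (permSlots σ t) = pairing s t :=
  Fintype.sum_equiv (σ.symm.arrowCongr (Equiv.refl ι)) _ _ fun _ => rfl

lemma pairing_slot (i : Fin k) {J : Matrix ι ι X} (hJ : J.transpose = -J) (s t : (Fin k → ι) → X) :
    pairing s (slot i J t) = -pairing (slot i J s) t := by
  have hJ' : ∀ a b, J a b = -J b a := fun a b => by
    have := congrFun (congrFun hJ b) a
    simpa using this
  -- Exchanging the `i`-th index with the contracted index is an involution of the summation domain.
  have h : ∀ f : (Fin k → ι) → ι → X, ∑ m, ∑ ν, f m ν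
      = ∑ m, ∑ ν, f (Function.update m i ν) (m i) := by
    intro f
    rw [← Fintype.sum_prod_type', ← Fintype.sum_prod_type']
    refine Fintype.sum_equiv
      ⟨fun x => (Function.update x.1 i x.2, x.1 i), fun x => (Function.update x.1 i x.2, x.1 i),
        fun x => by simp, fun x => by simp⟩ _ _ fun x => by simp
  simp only [pairing, slot_apply, Finset.mul_sum, Finset.sum_mul]
  rw [h, ← Finset.sum_neg_distrib]
  refine Finset.sum_congr rfl fun m _ => ?_
  rw [← Finset.sum_neg_distrib]
  refine Finset.sum_congr rfl fun ν _ => ?_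
  rw [Function.update_self, Function.update_idem, Function.update_eq_self, hJ' ν]
  ring

end Perm

/-! ### The symmetric group acting on 3-index arrays -/

section Vec3

set_option linter.unusedSectionVars false

variable {ι X : Type*} [Fintype ι] [DecidableEq ι] [CommRing X]

lemma sum_vec3 (f : (Fin 3 → ι) → X) : ∑ m, f m = ∑ a, ∑ b, ∑ c, f ![a, b, c] := by
  have e1 := Fintype.sum_equiv (Fin.consEquiv fun _ : Fin 3 => ι).symm f
    (fun x => f (Fin.cons x.1 x.2)) (fun m => by simp [Fin.consEquiv])
  rw [e1, Fintype.sum_prod_type]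
  refine Finset.sum_congr rfl fun a _ => ?_
  have e2 := Fintype.sum_equiv (Fin.consEquiv fun _ : Fin 2 => ι).symm
    (fun m => f (Fin.cons a m)) (fun x => f (Fin.cons a (Fin.cons x.1 x.2)))
    (fun m => by simp [Fin.consEquiv])
  rw [e2, Fintype.sum_prod_type]
  refine Finset.sum_congr rfl fun b _ => ?_
  have e3 := Fintype.sum_equiv (Fin.consEquiv fun _ : Fin 1 => ι).symm
    (fun m => f (Fin.cons a (Fin.cons b m))) (fun x => f (Fin.cons a (Fin.cons b (Fin.cons x.1 x.2))))
    (fun m => by simp [Fin.consEquiv])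
  rw [e3, Fintype.sum_prod_type]
  refine Finset.sum_congr rfl fun c _ => ?_
  rw [Fintype.sum_unique]
  congr 1

/-- Exchange of the first two slots. -/
def swap01 : Module.End X ((Fin 3 → ι) → X) := permSlots (Equiv.swap 0 1)

/-- Exchange of the last two slots. -/
def swap12 : Module.End X ((Fin 3 → ι) → X) := permSlots (Equiv.swap 1 2)

/-- The cyclic permutation `t_{abc} ↦ t_{bca}` of the slots. -/
def rot : Module.End X ((Fin 3 → ι) → X) := permSlots (finRotate 3)

lemma swap01_apply (t : (Fin 3 → ι) → X) (a b c : ι) : swap01 t ![a, b, c] = t ![b, a, c] := by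
  rw [swap01, permSlots_apply]; congr 1; ext i; fin_cases i <;> rfl

lemma swap12_apply (t : (Fin 3 → ι) → X) (a b c : ι) : swap12 t ![a, b, c] = t ![a, c, b] := by
  rw [swap12, permSlots_apply]; congr 1; ext i; fin_cases i <;> rfl

lemma rot_apply (t : (Fin 3 → ι) → X) (a b c : ι) : rot t ![a, b, c] = t ![b, c, a] := by
  rw [rot, permSlots_apply]; congr 1; ext i; fin_cases i <;> rfl

variable (J : Matrix ι ι X) (t : (Fin 3 → ι) → X)

lemma slot0_swap01 : slot 0 J (swap01 t) = swap01 (slot 1 J t) := slot_permSlots _ _ _ _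
lemma slot1_swap01 : slot 1 J (swap01 t) = swap01 (slot 0 J t) := slot_permSlots _ _ _ _
lemma slot2_swap01 : slot 2 J (swap01 t) = swap01 (slot 2 J t) := slot_permSlots _ _ _ _
lemma slot0_swap12 : slot 0 J (swap12 t) = swap12 (slot 0 J t) := slot_permSlots _ _ _ _
lemma slot1_swap12 : slot 1 J (swap12 t) = swap12 (slot 2 J t) := slot_permSlots _ _ _ _
lemma slot2_swap12 : slot 2 J (swap12 t) = swap12 (slot 1 J t) := slot_permSlots _ _ _ _
lemma slot0_rot : slot 0 J (rot t) = rot (slot 2 J t) := slot_permSlots _ _ _ _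
lemma slot1_rot : slot 1 J (rot t) = rot (slot 0 J t) := slot_permSlots _ _ _ _
lemma slot2_rot : slot 2 J (rot t) = rot (slot 1 J t) := slot_permSlots _ _ _ _

variable (J' : Matrix ι ι X)

lemma slot10 : slot 1 J (slot 0 J' t) = slot 0 J' (slot 1 J t) :=
  LinearMap.congr_fun (slot_commute (by decide : (1 : Fin 3) ≠ 0) J J') t
lemma slot20 : slot 2 J (slot 0 J' t) = slot 0 J' (slot 2 J t) :=
  LinearMap.congr_fun (slot_commute (by decide : (2 : Fin 3) ≠ 0) J J') t
lemma slot21 : slot 2 J (slot 1 J' t) = slot 1 J' (slot 2 J t) :=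
  LinearMap.congr_fun (slot_commute (by decide : (2 : Fin 3) ≠ 1) J J') t

lemma slot_slot_self {J : Matrix ι ι X} (hJ : J * J = -1) {k : ℕ} (i : Fin k) (t : (Fin k → ι) → X) :
    slot i J (slot i J t) = -t := LinearMap.congr_fun (slot_mul_self hJ i) t

/-- An array that is symmetric in the first two slots and antisymmetric in the last two vanishes. -/
lemma eq_zero_of_swap {t : (Fin 3 → ι) → ℝ} (h1 : swap01 t = t) (h2 : swap12 t = -t) : t = 0 := by
  refine ext_vec3 fun a b c => ?_
  have e1 : ∀ a b c, t ![b, a, c] = t ![a, b, c] := fun a b c => by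
    have := congrFun h1 ![a, b, c]
    rwa [swap01_apply] at this
  have e2 : ∀ a b c, t ![a, c, b] = -t ![a, b, c] := fun a b c => by
    have := congrFun h2 ![a, b, c]
    rwa [swap12_apply] at this
  have := e1 a b c; have := e2 b a c; have := e1 b c a; have := e2 c b a
  have := e1 c a b; have := e2 a c b
  rw [Pi.zero_apply]
  linarith

end Vec3

/-! ### Recovering `∇I` from the completed Bismut torsion -/

section Bismut

variable {ι : Type*} [Fintype ι] [DecidableEq ι]

/-- The projection of an antisymmetric 3-index array to its holomorphic and antiholomorphic parts. -/
def holProj (J : Matrix ι ι ℝ) (C : (Fin 3 → ι) → ℝ) : (Fin 3 → ι) → ℝ :=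
  (1 / 4 : ℝ) • (C - slot 0 J (slot 1 J C) - slot 0 J (slot 2 J C) - slot 1 J (slot 2 J C))

/-- The derivative of a complex structure is determined by its Bismut torsion. -/
lemma eq_of_bismut {J : Matrix ι ι ℝ} (hJ : J * J = -1) {N C : (Fin 3 → ι) → ℝ}
    (hN : swap12 N = -N) (hN' : slot 1 J N = slot 2 J N)
    (hint : N - swap01 N = slot 0 J (slot 1 J (N - swap01 N)))
    (hC : C = slot 0 J (slot 1 J (slot 2 J (N + rot N + rot (rot N)))) + holProj J C) :
    N = (1 / 4 : ℝ) • (slot 0 J C - slot 1 J C - slot 2 J C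
      - slot 0 J (slot 1 J (slot 2 J C))) := by
  have hs := fun {k : ℕ} (i : Fin k) (t : (Fin k → ι) → ℝ) => slot_slot_self hJ i t
  -- Integrability makes this difference symmetric in the first two slots; antisymmetry together
  -- with `hN'` makes it antisymmetric in the last two. Only zero has both symmetries, hence `N =
  -- J₀J₁N`.
  have hA : N - slot 0 J (slot 1 J N) = 0 := by
    apply eq_zero_of_swap
    · rw [map_sub, ← slot1_swap01, ← slot0_swap01, slot10]
      simp only [map_sub] at hint
      rw [← sub_eq_zero] at hint ⊢
      rw [← neg_eq_zero, ← hint]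
      abel
    · rw [map_sub, ← slot0_swap12, ← slot2_swap12, hN, map_neg, map_neg, hN']
      abel
  have hA' : slot 0 J (slot 1 J N) = N := (sub_eq_zero.1 hA).symm
  have hA2 : slot 0 J (slot 2 J N) = N := by rw [← hN', hA']
  have h12 : slot 1 J (slot 2 J N) = -N := by rw [← hN', hs]
  set B := slot 0 J (slot 1 J (slot 2 J (N + rot N + rot (rot N)))) with hB
  -- `J₀J₁` is absorbed by `hA'`, and the other two cyclic terms follow by rotation.
  have hB' : B = slot 2 J N + rot (slot 2 J N) + rot (rot (slot 2 J N)) := by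
    rw [hB]
    simp only [map_add, slot0_rot, slot1_rot, slot2_rot, slot10, slot20, slot21]
    rw [← slot21, ← slot20, hA']
  -- In `J₁B + J₂B` the rotated terms cancel by `hA2` and `h12`, and the first contributes `-N`
  -- twice. Hence `B` determines `N`.
  have hNB : N = -(1 / 2 : ℝ) • (slot 1 J B + slot 2 J B) := by
    rw [hB']
    simp only [map_add, slot1_rot, slot2_rot, slot0_rot, hs, h12, hA2, map_neg]
    module
  have hBC : B = C - holProj J C := by rw [eq_sub_iff_add_eq]; exact hC.symm
  rw [hNB, hBC, holProj]
  simp only [map_sub, map_smul, slot10, slot20, slot21, hs, map_neg]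
  module

end Bismut

end CliffordKT

namespace CliffordKT

/-! ### Slot identities for the coefficients of the supercharges in an orthonormal frame -/

section FlatAlgebra

set_option linter.unusedSectionVars false
set_option linter.unusedSimpArgs false

variable {ι : Type*} [Fintype ι] [DecidableEq ι]

lemma rot_rot_rot {X : Type*} [CommRing X] (t : (Fin 3 → ι) → X) : rot (rot (rot t)) = t :=
  ext_vec3 fun a b c => by simp only [rot_apply]

lemma swap12_rot {X : Type*} [CommRing X] (t : (Fin 3 → ι) → X) :
    swap12 (rot t) = rot (rot (swap12 t)) :=
  ext_vec3 fun a b c => by simp only [rot_apply, swap12_apply]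

lemma swap01_eq {X : Type*} [CommRing X] (t : (Fin 3 → ι) → X) :
    swap01 t = rot (swap12 t) :=
  ext_vec3 fun a b c => by simp only [rot_apply, swap12_apply, swap01_apply]

lemma rot_slot0 {X : Type*} [CommRing X] (J : Matrix ι ι X) (t : (Fin 3 → ι) → X) :
    rot (slot 0 J t) = slot 1 J (rot t) := (slot1_rot J t).symm
lemma rot_slot1 {X : Type*} [CommRing X] (J : Matrix ι ι X) (t : (Fin 3 → ι) → X) :
    rot (slot 1 J t) = slot 2 J (rot t) := (slot2_rot J t).symm
lemma rot_slot2 {X : Type*} [CommRing X] (J : Matrix ι ι X) (t : (Fin 3 → ι) → X) :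
    rot (slot 2 J t) = slot 0 J (rot t) := (slot0_rot J t).symm
lemma swap12_slot0 {X : Type*} [CommRing X] (J : Matrix ι ι X) (t : (Fin 3 → ι) → X) :
    swap12 (slot 0 J t) = slot 0 J (swap12 t) := (slot0_swap12 J t).symm
lemma swap12_slot1 {X : Type*} [CommRing X] (J : Matrix ι ι X) (t : (Fin 3 → ι) → X) :
    swap12 (slot 1 J t) = slot 2 J (swap12 t) := (slot2_swap12 J t).symm
lemma swap12_slot2 {X : Type*} [CommRing X] (J : Matrix ι ι X) (t : (Fin 3 → ι) → X) :
    swap12 (slot 2 J t) = slot 1 J (swap12 t) := (slot1_swap12 J t).symm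

/-- The sum over the cyclic permutations of the slots. -/
def cyc (t : (Fin 3 → ι) → ℝ) : (Fin 3 → ι) → ℝ := t + rot t + rot (rot t)

/-- The alternating sum over the permutations of the slots. -/
def altSum (t : (Fin 3 → ι) → ℝ) : (Fin 3 → ι) → ℝ := cyc t - swap12 (cyc t)

/-- The derivative of a complex structure whose completed Bismut torsion is `C`. -/
def structureDeriv (p : Matrix ι ι ℝ) (C : (Fin 3 → ι) → ℝ) : (Fin 3 → ι) → ℝ :=
  (1 / 4 : ℝ) • (slot 0 p C - slot 1 p C - slot 2 p C - slot 0 p (slot 1 p (slot 2 p C)))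

/-- The cubic coefficients of the singlet supercharge. -/
def singletCubic (Om C : (Fin 3 → ι) → ℝ) : (Fin 3 → ι) → ℝ :=
  -(1 / 6 : ℝ) • cyc Om + (1 / 12 : ℝ) • C

/-- The cubic coefficients of the supercharge of a complex structure. -/
def structureCubic (p : Matrix ι ι ℝ) (Om C : (Fin 3 → ι) → ℝ) : (Fin 3 → ι) → ℝ :=
  -(1 / 6 : ℝ) • cyc (slot 0 p Om) - (1 / 12 : ℝ) • slot 0 p (slot 1 p (slot 2 p C))

/-- The sum of the actions of a matrix on the slots. -/
def slotSum (p : Matrix ι ι ℝ) (t : (Fin 3 → ι) → ℝ) : (Fin 3 → ι) → ℝ :=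
  slot 0 p t + slot 1 p t + slot 2 p t

variable {p q : Matrix ι ι ℝ} {Om C : (Fin 3 → ι) → ℝ}

lemma altSum_singlet (hOm : swap12 Om = -Om) (hC : swap12 C = -C) (hC' : rot C = C) :
    (1 / 6 : ℝ) • altSum (-(1 / 2 : ℝ) • Om + (1 / 12 : ℝ) • C) = singletCubic Om C := by
  simp only [altSum, cyc, singletCubic, map_add, map_neg, map_smul, swap12_rot, hOm, hC, hC',
    rot_rot_rot]
  module

/-- After antisymmetrization the Bismut term with weight `-1/4` and the holomorphic term with weight
`1/12` combine into the single term `-(1/12) p₀p₁p₂C`. -/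
lemma altSum_structure (hp : p * p = -1) (hOm : swap12 Om = -Om) (hC : swap12 C = -C)
    (hC' : rot C = C) :
    (1 / 6 : ℝ) • altSum (slot 0 p (-(1 / 2 : ℝ) • Om - (1 / 4 : ℝ) • (C - holProj p C)
      + (1 / 12 : ℝ) • holProj p C)) = structureCubic p Om C := by
  have hs := fun {k : ℕ} (i : Fin k) (t : (Fin k → ι) → ℝ) => slot_slot_self hp i t
  simp only [altSum, cyc, structureCubic, holProj, map_add, map_sub, map_neg, map_smul, swap12_rot,
    rot_slot0, rot_slot1, rot_slot2, swap12_slot0, swap12_slot1, swap12_slot2, hOm, hC, hC',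
    rot_rot_rot, slot10, slot20, slot21, hs]
  module

/-- The real part of the cubic condition `h3` of `exists_quad_comm_charge` for the combination `Q +
i Q^a`; `structureDeriv` and the two terms in `Om` stand for the frame derivative of the flat
complex structure. -/
lemma altSum_re (hp : p * p = -1) (hOm : swap12 Om = -Om) (hC : swap12 C = -C)
    (hC' : rot C = C) :
    altSum (-slotSum p (singletCubic Om C)
      - (1 / 2 : ℝ) • (structureDeriv p C + slot 1 p Om + slot 2 p Om) + structureCubic p Om C
      + (1 / 24 : ℝ) • (slotSum p C - slot 0 p (slot 1 p (slot 2 p C)))) = 0 := by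
  have hs := fun {k : ℕ} (i : Fin k) (t : (Fin k → ι) → ℝ) => slot_slot_self hp i t
  simp only [altSum, cyc, structureCubic, singletCubic, structureDeriv, slotSum, map_add, map_sub,
    map_neg, map_smul, swap12_rot,
    rot_slot0, rot_slot1, rot_slot2, swap12_slot0, swap12_slot1, swap12_slot2, hOm, hC, hC',
    rot_rot_rot, slot10, slot20, slot21, hs]
  module

/-- The imaginary part of the same condition. -/
lemma altSum_im (hp : p * p = -1) (hOm : swap12 Om = -Om) (hC : swap12 C = -C)
    (hC' : rot C = C) :
    altSum (-slotSum p (structureCubic p Om C)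
      - (1 / 2 : ℝ) • slot 0 p (structureDeriv p C + slot 1 p Om + slot 2 p Om)
      - singletCubic Om C
      - (1 / 24 : ℝ) • (C - (slot 0 p (slot 1 p C) + slot 0 p (slot 2 p C)
        + slot 1 p (slot 2 p C)))) = 0 := by
  have hs := fun {k : ℕ} (i : Fin k) (t : (Fin k → ι) → ℝ) => slot_slot_self hp i t
  simp only [altSum, cyc, structureCubic, singletCubic, structureDeriv, slotSum, map_add, map_sub,
    map_neg, map_smul, swap12_rot,
    rot_slot0, rot_slot1, rot_slot2, swap12_slot0, swap12_slot1, swap12_slot2, hOm, hC, hC',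
    rot_rot_rot, slot10, slot20, slot21, hs]
  module

/-- The covariant form of the concomitant of two structures. -/
def flatConcomitant (p q : Matrix ι ι ℝ) (C : (Fin 3 → ι) → ℝ) : (Fin 3 → ι) → ℝ :=
  slot 0 p (structureDeriv q C) + slot 2 p (structureDeriv q C) + slot 0 q (structureDeriv p C)
    + slot 2 q (structureDeriv p C)

lemma slot_swap_of_anticomm (hpq : p * q = -(q * p)) {k : ℕ} (i : Fin k) (t : (Fin k → ι) → ℝ) :
    slot i q (slot i p t) = -slot i p (slot i q t) := by
  rw [← Module.End.mul_apply, ← Module.End.mul_apply, ← slot_mul, ← slot_mul, hpq, slot_neg,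
    LinearMap.neg_apply, neg_neg]

lemma pairing_add_left {k : ℕ} (s s' t : (Fin k → ι) → ℝ) :
    pairing (s + s') t = pairing s t + pairing s' t := by
  simp [pairing, add_mul, Finset.sum_add_distrib]

lemma pairing_sub_left {k : ℕ} (s s' t : (Fin k → ι) → ℝ) :
    pairing (s - s') t = pairing s t - pairing s' t := by
  simp [pairing, sub_mul, Finset.sum_sub_distrib]

lemma pairing_neg_left {k : ℕ} (s t : (Fin k → ι) → ℝ) : pairing (-s) t = -pairing s t := by
  simp [pairing]

lemma pairing_smul_left {k : ℕ} (c : ℝ) (s t : (Fin k → ι) → ℝ) :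
    pairing (c • s) t = c * pairing s t := by
  rw [pairing_comm, pairing_smul, pairing_comm]

lemma pairing_slot_left {k : ℕ} (hpa : p.transpose = -p) (i : Fin k) (s t : (Fin k → ι) → ℝ) :
    pairing (slot i p s) t = -pairing s (slot i p t) := by
  rw [pairing_slot i hpa, neg_neg]

lemma pairing_rot (s t : (Fin 3 → ι) → ℝ) : pairing (rot s) (rot t) = pairing s t :=
  pairing_permSlots _ s t

lemma pairing_swap12 (s t : (Fin 3 → ι) → ℝ) : pairing (swap12 s) (swap12 t) = pairing s t :=
  pairing_permSlots _ s t

lemma pairing_rot_left (s t : (Fin 3 → ι) → ℝ) : pairing (rot s) t = pairing s (rot (rot t)) := by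
  rw [← pairing_rot s, rot_rot_rot]

/-- The part of the trace of two supercharges that is quadratic in the connection. -/
lemma pairing_connection (hpq : p * q = -(q * p))
    (hpa : p.transpose = -p) (hqa : q.transpose = -q) (hOm : swap12 Om = -Om) :
    pairing (slot 2 p Om) (swap12 (rot (slot 2 q Om)))
      + (1 / 6) * pairing (cyc (slot 0 p Om)) (cyc (slot 0 q Om)) = 0 := by
  have hsw := fun {k : ℕ} (i : Fin k) (t : (Fin k → ι) → ℝ) => slot_swap_of_anticomm hpq i t
  have hp' := fun (i : Fin 3) (s t : (Fin 3 → ι) → ℝ) => pairing_slot_left hpa i s t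
  have hq' := fun (i : Fin 3) (s t : (Fin 3 → ι) → ℝ) => pairing_slot_left hqa i s t
  -- All pairings are brought to the form of `Om` against a word in slot actions and permutations.
  -- Symmetry of the pairing and invariance under the exchange of slots identify the remaining
  -- words, and then everything cancels.
  have h0 := pairing_comm (slot 0 p Om) (slot 0 q Om)
  have h1 := pairing_comm (slot 1 q (slot 0 p Om)) (rot Om)
  have h2 := pairing_swap12 Om (slot 0 p (slot 2 q (rot (rot Om))))
  simp only [cyc, map_neg, map_add, rot_rot_rot, pairing_add, pairing_add_left, pairing_neg,
    pairing_neg_left, pairing_rot_left, hp', hq', hsw, rot_slot0, rot_slot1, rot_slot2, swap12_slot0,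
    swap12_slot1, swap12_slot2, swap12_rot, hOm, slot10, slot20, slot21, neg_neg] at h0 h1 h2 ⊢
  linarith

/-- The part of the trace of two supercharges that is quadratic in the torsion. -/
lemma pairing_torsion (hp : p * p = -1) (hq : q * q = -1) (hpq : p * q = -(q * p))
    (hpa : p.transpose = -p) (hqa : q.transpose = -q) (hC : swap12 C = -C) (hC' : rot C = C)
    (hconc : flatConcomitant p q C = swap01 (flatConcomitant p q C)) :
    pairing (structureDeriv p C) (swap12 (rot (structureDeriv q C)))
      + (1 / 24) * pairing (slot 0 p (slot 1 p (slot 2 p C))) (slot 0 q (slot 1 q (slot 2 q C)))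
      = 0 := by
  have hsp := fun {k : ℕ} (i : Fin k) (t : (Fin k → ι) → ℝ) => slot_slot_self hp i t
  have hsq := fun {k : ℕ} (i : Fin k) (t : (Fin k → ι) → ℝ) => slot_slot_self hq i t
  have hsw := fun {k : ℕ} (i : Fin k) (t : (Fin k → ι) → ℝ) => slot_swap_of_anticomm hpq i t
  have hp' := fun (i : Fin 3) (s t : (Fin 3 → ι) → ℝ) => pairing_slot_left hpa i s t
  have hq' := fun (i : Fin 3) (s t : (Fin 3 → ι) → ℝ) => pairing_slot_left hqa i s t
  -- Relations between pairings of `C` with words applied to `C`: invariance under rotation and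
  -- transposition, and symmetry of the pairing.
  have r := fun t : (Fin 3 → ι) → ℝ => pairing_rot C t
  have r1 := r (slot 0 p (slot 1 q C))
  have r2 := r (slot 1 p (slot 2 q C))
  have r3 := r (slot 0 q (slot 1 p C))
  have r4 := r (slot 1 q (slot 2 p C))
  have r5 := pairing_swap12 C (slot 1 p (slot 2 q C))
  have r6 := fun i => pairing_comm (slot i p C) (slot i q C)
  have r60 := r6 0
  have r61 := r6 1
  have r62 := r6 2
  have r7 := pairing_comm (slot 0 p (slot 1 p (slot 2 p C))) (slot 0 q C)
  have r8 := pairing_comm (slot 0 p (slot 1 p (slot 2 p C))) (slot 1 q C)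
  have r9 := pairing_comm (slot 0 p (slot 1 p (slot 2 p C))) (slot 2 q C)
  have r7' := pairing_comm (slot 0 q (slot 1 q (slot 2 q C))) (slot 0 p C)
  have r8' := pairing_comm (slot 0 q (slot 1 q (slot 2 q C))) (slot 1 p C)
  have r9' := pairing_comm (slot 0 q (slot 1 q (slot 2 q C))) (slot 2 p C)
  have r10 := pairing_comm (slot 0 q (slot 1 q (slot 2 q C))) (slot 0 p (slot 1 p (slot 2 p C)))
  -- Pairing with `C` extracts from the concomitant the one further relation that these symmetries
  -- do not give.
  have hc := congrArg (pairing C) hconc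
  rw [swap01_eq] at hc
  simp only [structureDeriv, flatConcomitant, map_add, map_sub, map_smul, map_neg, rot_rot_rot,
    pairing_add, pairing_add_left,
    pairing_neg, pairing_neg_left, pairing_sub, pairing_sub_left, pairing_smul, pairing_smul_left,
    pairing_rot_left, hp', hq', hsw, hsp, hsq, rot_slot0, rot_slot1, rot_slot2,
    swap12_slot0, swap12_slot1, swap12_slot2, swap12_rot, hC, hC', slot10, slot20, slot21,
    neg_neg] at r1 r2 r3 r4 r5 r60 r61 r62 r7 r8 r9 r7' r8' r9' r10 hc ⊢
  linarith

/-- The part of the trace of two supercharges that is bilinear in the connection and the torsion. -/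
lemma pairing_connection_torsion (hp : p * p = -1) (hq : q * q = -1) (hpq : p * q = -(q * p))
    (hpa : p.transpose = -p) (hqa : q.transpose = -q) (hOm : swap12 Om = -Om)
    (hC : swap12 C = -C) (hC' : rot C = C)
    (hconc : flatConcomitant p q C = swap01 (flatConcomitant p q C)) :
    pairing (structureDeriv p C) (swap12 (rot (slot 2 q Om)))
      + pairing (slot 2 p Om) (swap12 (rot (structureDeriv q C)))
      + (1 / 12) * (pairing (cyc (slot 0 p Om)) (slot 0 q (slot 1 q (slot 2 q C)))
        + pairing (slot 0 p (slot 1 p (slot 2 p C))) (cyc (slot 0 q Om))) = 0 := by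
  have hsp := fun {k : ℕ} (i : Fin k) (t : (Fin k → ι) → ℝ) => slot_slot_self hp i t
  have hsq := fun {k : ℕ} (i : Fin k) (t : (Fin k → ι) → ℝ) => slot_slot_self hq i t
  have hsw := fun {k : ℕ} (i : Fin k) (t : (Fin k → ι) → ℝ) => slot_swap_of_anticomm hpq i t
  have hp' := fun (i : Fin 3) (s t : (Fin 3 → ι) → ℝ) => pairing_slot_left hpa i s t
  have hq' := fun (i : Fin 3) (s t : (Fin 3 → ι) → ℝ) => pairing_slot_left hqa i s t
  have hc := congrArg (fun t => pairing Om (rot t)) hconc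
  have s1 := fun t : (Fin 3 → ι) → ℝ => pairing_swap12 Om t
  rw [pairing_comm (structureDeriv p C), pairing_comm _ (cyc (slot 0 q Om))]
  -- The connection is antisymmetric in its last two indices and sees only the part of `Z` with the
  -- same antisymmetry.
  have hZ : ∀ Z : (Fin 3 → ι) → ℝ, pairing Om Z = (1 / 2) * pairing Om (Z - swap12 Z) := by
    intro Z
    have := s1 Z
    rw [hOm, pairing_neg_left] at this
    rw [pairing_sub]
    linarith
  -- All terms are collected into one pairing with `Om`; its other entry depends on `C` alone.
  have hX : pairing (swap12 (rot (slot 2 q Om))) (structureDeriv p C)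
      + pairing (slot 2 p Om) (swap12 (rot (structureDeriv q C)))
      + (1 / 12) * (pairing (cyc (slot 0 p Om)) (slot 0 q (slot 1 q (slot 2 q C)))
        + pairing (cyc (slot 0 q Om)) (slot 0 p (slot 1 p (slot 2 p C))))
      = pairing Om (-swap12 (rot (slot 0 q (structureDeriv p C) + slot 0 p (structureDeriv q C)))
        - (1 / 4 : ℝ) • (slot 0 p (slot 0 q (slot 1 q (slot 2 q C)))
          + slot 0 q (slot 0 p (slot 1 p (slot 2 p C))))) := by
    have hS : ∀ s t : (Fin 3 → ι) → ℝ, pairing (swap12 s) t = pairing s (swap12 t) := fun s t => by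
      rw [← pairing_swap12 s (swap12 t)]
      congr 1
      exact ext_vec3 fun a b c => by simp only [swap12_apply]
    have w1 := s1 (slot 1 q (slot 2 p C))
    have w2 := s1 (slot 1 p (slot 1 q C))
    have w3 := s1 (slot 0 p (slot 1 q C))
    have w4 := s1 (slot 0 p (slot 1 p (slot 1 q (slot 2 p C))))
    simp only [structureDeriv, cyc, map_add, map_sub, map_smul, map_neg, rot_rot_rot,
      pairing_add, pairing_add_left, hS,
      pairing_neg, pairing_neg_left, pairing_sub, pairing_sub_left, pairing_smul, pairing_smul_left,
      pairing_rot_left, hp', hq', hsw, hsp, hsq, rot_slot0, rot_slot1, rot_slot2,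
      swap12_slot0, swap12_slot1, swap12_slot2, swap12_rot, hC, hC', hOm, slot10, slot20, slot21,
      neg_neg] at w1 w2 w3 w4 ⊢
    linarith
  rw [hX, hZ, show ∀ s : (Fin 3 → ι) → ℝ, pairing Om s = pairing Om 0 → (1 / 2) * pairing Om s = 0
    from fun s h => by rw [h]; simp [pairing]]
  congr 1
  -- The antisymmetric part of that entry is precisely the rotated concomitant condition, so it
  -- vanishes for an arbitrary connection.
  rw [← sub_eq_zero.2 (congrArg rot hconc), swap01_eq]
  simp only [structureDeriv, flatConcomitant, map_add, map_sub, map_smul, map_neg, rot_rot_rot,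
    hsw, hsp, hsq, rot_slot0, rot_slot1, rot_slot2,
    swap12_slot0, swap12_slot1, swap12_slot2, swap12_rot, hC, hC', slot10, slot20, slot21]
  module

/-- The trace of the anticommutator of two supercharges vanishes. -/
lemma pairing_charges (hp : p * p = -1) (hq : q * q = -1) (hpq : p * q = -(q * p))
    (hpa : p.transpose = -p) (hqa : q.transpose = -q) (hOm : swap12 Om = -Om)
    (hC : swap12 C = -C) (hC' : rot C = C)
    (hconc : flatConcomitant p q C = swap01 (flatConcomitant p q C)) :
    pairing (structureDeriv p C + slot 2 p Om) (swap12 (rot (structureDeriv q C + slot 2 q Om)))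
      + 6 * pairing (structureCubic p Om C) (structureCubic q Om C) = 0 := by
  -- The expression is split into the parts of degree two, zero and one in the connection, each of
  -- which is zero separately.
  have h1 := pairing_connection hpq hpa hqa hOm
  have h2 := pairing_torsion hp hq hpq hpa hqa hC hC' hconc
  have h3 := pairing_connection_torsion hp hq hpq hpa hqa hOm hC hC' hconc
  simp only [structureCubic, map_add, pairing_add, pairing_add_left, pairing_sub, pairing_sub_left,
    pairing_smul, pairing_smul_left]
  linarith

end FlatAlgebra

end CliffordKT

namespace CliffordKT

/-! ## Covariant derivatives at a point -/

section CovariantDerivative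

set_option linter.unusedSectionVars false
set_option linter.unusedSimpArgs false

variable {ι : Type*} [Fintype ι] [DecidableEq ι]

open Matrix

/-- The 3-index array of a family of matrices; the first index labels the matrices. -/
def arr (A : ι → Matrix ι ι ℝ) (m : Fin 3 → ι) : ℝ := A (m 0) (m 1) (m 2)

lemma arr_apply (A : ι → Matrix ι ι ℝ) (a b c : ι) : arr A ![a, b, c] = A a b c := rfl

lemma slot1_arr (J : Matrix ι ι ℝ) (A : ι → Matrix ι ι ℝ) :
    slot 1 J (arr A) = arr fun l => J * A l :=
  ext_vec3 fun a b c => by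
    rw [slot_vec3_one, arr_apply, Matrix.mul_apply]; rfl

lemma slot2_arr (J : Matrix ι ι ℝ) (A : ι → Matrix ι ι ℝ) :
    slot 2 J (arr A) = arr fun l => A l * Jᵀ :=
  ext_vec3 fun a b c => by
    rw [slot_vec3_two, arr_apply, Matrix.mul_apply]
    exact Finset.sum_congr rfl fun ν _ => mul_comm _ _

lemma swap12_arr (A : ι → Matrix ι ι ℝ) : swap12 (arr A) = arr fun l => (A l)ᵀ :=
  ext_vec3 fun a b c => by rw [swap12_apply]; rfl

lemma arr_add (A B : ι → Matrix ι ι ℝ) : arr (fun l => A l + B l) = arr A + arr B := rfl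
lemma arr_sub (A B : ι → Matrix ι ι ℝ) : arr (fun l => A l - B l) = arr A - arr B := rfl
lemma arr_neg (A : ι → Matrix ι ι ℝ) : arr (fun l => -A l) = -arr A := rfl

/-- The covariant derivative of an endomorphism with derivative `dJ`; `Γ l ν ρ` is
the connection coefficient with upper index `ρ`. -/
def covDeriv (Γ dJ : ι → Matrix ι ι ℝ) (J : Matrix ι ι ℝ) (l : ι) : Matrix ι ι ℝ :=
  dJ l - Γ l * J + J * Γ l

variable {G E J J' : Matrix ι ι ℝ} {Γ dG dE dJ dJ' : ι → Matrix ι ι ℝ}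

lemma covDeriv_mul_metric (hdG : ∀ l, dG l = Γ l * G + G * (Γ l)ᵀ) (l : ι) :
    covDeriv Γ dJ J l * G =
      dJ l * G + J * dG l - Γ l * (J * G) - (J * G) * (Γ l)ᵀ := by
  rw [covDeriv, hdG]; noncomm_ring

lemma transpose_covDeriv (hJG : (J * G)ᵀ = -(J * G))
    (hdG : ∀ l, dG l = Γ l * G + G * (Γ l)ᵀ)
    (hdJG : ∀ l, (dJ l * G + J * dG l)ᵀ = -(dJ l * G + J * dG l)) (l : ι) :
    (covDeriv Γ dJ J l * G)ᵀ = -(covDeriv Γ dJ J l * G) := by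
  rw [covDeriv_mul_metric hdG, transpose_sub, transpose_sub, hdJG, transpose_mul (Γ l),
    transpose_mul (J * G), hJG, transpose_transpose]
  noncomm_ring

lemma covDeriv_anticomm (hJ : J * J = -1) (hdJ : ∀ l, dJ l * J + J * dJ l = 0) (l : ι) :
    covDeriv Γ dJ J l * J + J * covDeriv Γ dJ J l = 0 := by
  have : covDeriv Γ dJ J l * J + J * covDeriv Γ dJ J l
      = (dJ l * J + J * dJ l) - Γ l * (J * J) + (J * J) * Γ l := by
    rw [covDeriv]; noncomm_ring
  rw [this, hdJ, hJ]; simp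

lemma metric_mul_transpose (hG : Gᵀ = G) (hJG : (J * G)ᵀ = -(J * G)) : G * Jᵀ = -(J * G) := by
  rw [← hJG, transpose_mul, hG]

/-- Differentiating `J² = -1` shows that `∇J` anticommutes with `J`. Lowering the last index with
the metric gives a second sign, by antisymmetry of `J G`. -/
lemma slot1_covDeriv (hG : Gᵀ = G) (hJ : J * J = -1) (hJG : (J * G)ᵀ = -(J * G))
    (hdJ : ∀ l, dJ l * J + J * dJ l = 0) :
    slot 1 J (arr fun l => covDeriv Γ dJ J l * G) = slot 2 J (arr fun l => covDeriv Γ dJ J l * G) := by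
  rw [slot1_arr, slot2_arr]
  congr 1
  funext l
  rw [mul_assoc, metric_mul_transpose hG hJG, mul_neg, ← mul_assoc, ← mul_assoc,
    eq_neg_of_add_eq_zero_right (covDeriv_anticomm hJ hdJ l), neg_mul]

lemma arr_covDeriv : arr (covDeriv Γ dJ J) = arr dJ - slot 2 Jᵀ (arr Γ) + slot 1 J (arr Γ) := by
  rw [slot2_arr, slot1_arr, transpose_transpose]; rfl

lemma swap01_symm {t : (Fin 3 → ι) → ℝ} (h : ∀ a b c, t ![a, b, c] = t ![b, a, c]) :
    swap01 t = t := ext_vec3 fun a b c => by rw [swap01_apply, h]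

lemma swap01_slot0 (J : Matrix ι ι ℝ) (t : (Fin 3 → ι) → ℝ) :
    swap01 (slot 0 J t) = slot 1 J (swap01 t) := (slot1_swap01 J t).symm
lemma swap01_slot1 (J : Matrix ι ι ℝ) (t : (Fin 3 → ι) → ℝ) :
    swap01 (slot 1 J t) = slot 0 J (swap01 t) := (slot0_swap01 J t).symm
lemma swap01_slot2 (J : Matrix ι ι ℝ) (t : (Fin 3 → ι) → ℝ) :
    swap01 (slot 2 J t) = slot 2 J (swap01 t) := (slot2_swap01 J t).symm

/-- The Nijenhuis condition does not see a connection that is symmetric in its lower indices, so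
partial derivatives may be replaced by covariant ones; the metric factor acts only on the last slot.
-/
lemma nijenhuis_covDeriv (hJ : J * J = -1) (hΓ : swap01 (arr Γ) = arr Γ)
    (hN : arr dJ - swap01 (arr dJ) = slot 0 J (slot 1 J (arr dJ - swap01 (arr dJ)))) :
    arr (fun l => covDeriv Γ dJ J l * G) - swap01 (arr fun l => covDeriv Γ dJ J l * G)
      = slot 0 J (slot 1 J (arr (fun l => covDeriv Γ dJ J l * G)
        - swap01 (arr fun l => covDeriv Γ dJ J l * G))) := by
  have hs := fun {k : ℕ} (i : Fin k) (t : (Fin k → ι) → ℝ) => slot_slot_self hJ i t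
  have e : arr (fun l => covDeriv Γ dJ J l * G) = slot 2 Gᵀ (arr (covDeriv Γ dJ J)) := by
    rw [slot2_arr, transpose_transpose]
  rw [e, swap01_slot2, ← map_sub, ← slot21, ← slot20]
  congr 1
  simp only [arr_covDeriv, map_add, map_sub, swap01_slot0, swap01_slot1, swap01_slot2, hΓ, hs,
    slot10, slot20, slot21, map_neg] at hN ⊢
  rw [← sub_eq_zero] at hN ⊢
  rw [← hN]
  abel

/-- Again the symmetric connection drops out; the term bilinear in `J` and `J'` uses that they
anticommute. Lowering the last index replaces `Jᵀ` by `-J`, whence the plus signs in the covariant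
form. -/
lemma concomitant_covDeriv (hG : Gᵀ = G) (hJG : (J * G)ᵀ = -(J * G)) (hJG' : (J' * G)ᵀ = -(J' * G))
    (hJJ : J * J' = -(J' * J)) (hΓ : swap01 (arr Γ) = arr Γ)
    (hN : slot 0 J (arr dJ') - slot 2 Jᵀ (arr dJ') + (slot 0 J' (arr dJ) - slot 2 J'ᵀ (arr dJ))
      = swap01 (slot 0 J (arr dJ') - slot 2 Jᵀ (arr dJ')
        + (slot 0 J' (arr dJ) - slot 2 J'ᵀ (arr dJ)))) :
    slot 0 J (arr fun l => covDeriv Γ dJ' J' l * G) + slot 2 J (arr fun l => covDeriv Γ dJ' J' l * G)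
      + slot 0 J' (arr fun l => covDeriv Γ dJ J l * G)
      + slot 2 J' (arr fun l => covDeriv Γ dJ J l * G)
    = swap01 (slot 0 J (arr fun l => covDeriv Γ dJ' J' l * G)
      + slot 2 J (arr fun l => covDeriv Γ dJ' J' l * G)
      + slot 0 J' (arr fun l => covDeriv Γ dJ J l * G)
      + slot 2 J' (arr fun l => covDeriv Γ dJ J l * G)) := by
  have e : ∀ (dJ : ι → Matrix ι ι ℝ) (J : Matrix ι ι ℝ),
      arr (fun l => covDeriv Γ dJ J l * G) = slot 2 G (arr (covDeriv Γ dJ J)) := fun dJ J => by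
    rw [slot2_arr, hG]
  have c : ∀ J : Matrix ι ι ℝ, (J * G)ᵀ = -(J * G) → ∀ t : (Fin 3 → ι) → ℝ,
      slot 2 J (slot 2 G t) = -slot 2 G (slot 2 Jᵀ t) := fun J h t => by
    rw [← Module.End.mul_apply, ← Module.End.mul_apply, ← slot_mul, ← slot_mul,
      metric_mul_transpose hG h, slot_neg, LinearMap.neg_apply, neg_neg]
  have hsw : ∀ t : (Fin 3 → ι) → ℝ, slot 2 J'ᵀ (slot 2 Jᵀ t) = -slot 2 Jᵀ (slot 2 J'ᵀ t) :=
    fun t => by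
      rw [← Module.End.mul_apply, ← Module.End.mul_apply, ← slot_mul, ← slot_mul, ← transpose_mul,
        ← transpose_mul, hJJ, transpose_neg, slot_neg, LinearMap.neg_apply]
  have c0 : ∀ (J : Matrix ι ι ℝ) (t : (Fin 3 → ι) → ℝ),
      slot 0 J (slot 2 G t) = slot 2 G (slot 0 J t) := fun J t => (slot20 _ _ _).symm
  simp only [e, c J hJG, c J' hJG', c0]
  simp only [← map_neg, ← map_add, swap01_slot2]
  congr 1
  simp only [arr_covDeriv, map_add, map_sub, swap01_slot0, swap01_slot1, swap01_slot2, hΓ, hsw,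
    slot10, slot20, slot21, map_neg, neg_add, neg_sub, neg_neg] at hN ⊢
  rw [← sub_eq_zero] at hN ⊢
  rw [← hN]
  abel

/-! ### Orthonormal frames -/

/-- The flat components of a 3-index array in the frame `E`. -/
def flatten (E : Matrix ι ι ℝ) (t : (Fin 3 → ι) → ℝ) : (Fin 3 → ι) → ℝ :=
  slot 0 E (slot 1 E (slot 2 E t))

/-- The flat components of an endomorphism. -/
def flatMat (G E J : Matrix ι ι ℝ) : Matrix ι ι ℝ := E * J * G * Eᵀ

/-- The spin connection in the direction `l`. -/
def spinMat (G E : Matrix ι ι ℝ) (Γ dE : ι → Matrix ι ι ℝ) (l : ι) : Matrix ι ι ℝ :=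
  E * G * (dE l + E * Γ l)ᵀ

lemma metric_mul_frame (hE : E * G * Eᵀ = 1) : G * Eᵀ * E = 1 := by
  rw [mul_assoc] at hE
  exact mul_eq_one_comm.1 hE

/-- The frame intertwines the endomorphism with its flat components. The relations between complex
structures are transported through this identity. -/
lemma flatMat_mul_frame (hE : E * G * Eᵀ = 1) : flatMat G E J * E = E * J := by
  rw [flatMat, mul_assoc, mul_assoc, ← mul_assoc G, metric_mul_frame hE, mul_one]

lemma flatMat_mul_flatMat (hE : E * G * Eᵀ = 1) :
    flatMat G E J * flatMat G E J' = flatMat G E (J * J') := by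
  have := flatMat_mul_frame (J := J) hE
  calc flatMat G E J * (E * J' * G * Eᵀ) = flatMat G E J * E * J' * G * Eᵀ := by noncomm_ring
    _ = _ := by rw [this]; rw [flatMat]; noncomm_ring

lemma flatMat_neg_one (hE : E * G * Eᵀ = 1) : flatMat G E (-1) = -1 := by
  simp [flatMat, hE]

lemma transpose_flatMat (hJG : (J * G)ᵀ = -(J * G)) : (flatMat G E J)ᵀ = -flatMat G E J := by
  rw [flatMat, mul_assoc E, transpose_mul, transpose_mul, hJG, transpose_transpose]
  noncomm_ring

lemma flatMat_sq (hE : E * G * Eᵀ = 1) (hJ : J * J = -1) :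
    flatMat G E J * flatMat G E J = -1 := by
  rw [flatMat_mul_flatMat hE, hJ, flatMat_neg_one hE]

lemma flatMat_anticomm (hE : E * G * Eᵀ = 1) (hJJ : J * J' = -(J' * J)) :
    flatMat G E J * flatMat G E J' = -(flatMat G E J' * flatMat G E J) := by
  rw [flatMat_mul_flatMat hE, flatMat_mul_flatMat hE, hJJ]; simp [flatMat]

lemma slot_flatMat (hE : E * G * Eᵀ = 1) {k : ℕ} (i : Fin k) (t : (Fin k → ι) → ℝ) :
    slot i (flatMat G E J) (slot i E t) = slot i E (slot i J t) := by
  rw [← Module.End.mul_apply, ← Module.End.mul_apply, ← slot_mul, ← slot_mul, flatMat_mul_frame hE]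

lemma slot0_flatten (hE : E * G * Eᵀ = 1) (t : (Fin 3 → ι) → ℝ) :
    slot 0 (flatMat G E J) (flatten E t) = flatten E (slot 0 J t) := by
  rw [flatten, slot_flatMat hE, flatten, slot20, slot10]

lemma slot1_flatten (hE : E * G * Eᵀ = 1) (t : (Fin 3 → ι) → ℝ) :
    slot 1 (flatMat G E J) (flatten E t) = flatten E (slot 1 J t) := by
  rw [flatten, slot10, slot_flatMat hE, flatten, slot21]

lemma slot2_flatten (hE : E * G * Eᵀ = 1) (t : (Fin 3 → ι) → ℝ) :
    slot 2 (flatMat G E J) (flatten E t) = flatten E (slot 2 J t) := by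
  rw [flatten, slot20, slot21, slot_flatMat hE, flatten]

lemma flatten_add (t t' : (Fin 3 → ι) → ℝ) : flatten E (t + t') = flatten E t + flatten E t' := by
  simp [flatten]
lemma flatten_sub (t t' : (Fin 3 → ι) → ℝ) : flatten E (t - t') = flatten E t - flatten E t' := by
  simp [flatten]
lemma flatten_neg (t : (Fin 3 → ι) → ℝ) : flatten E (-t) = -flatten E t := by
  simp [flatten]
lemma flatten_smul (c : ℝ) (t : (Fin 3 → ι) → ℝ) : flatten E (c • t) = c • flatten E t := by
  simp [flatten]

lemma rot_flatten (t : (Fin 3 → ι) → ℝ) : rot (flatten E t) = flatten E (rot t) := by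
  simp only [flatten, rot_slot0, rot_slot1, rot_slot2, slot10, slot20, slot21]

lemma swap12_flatten (t : (Fin 3 → ι) → ℝ) : swap12 (flatten E t) = flatten E (swap12 t) := by
  simp only [flatten, swap12_slot0, swap12_slot1, swap12_slot2, slot10, slot20, slot21]

lemma structureDeriv_flatten (hE : E * G * Eᵀ = 1) (C : (Fin 3 → ι) → ℝ) :
    structureDeriv (flatMat G E J) (flatten E C) = flatten E (structureDeriv J C) := by
  simp only [structureDeriv, slot0_flatten hE, slot1_flatten hE, slot2_flatten hE, flatten_sub,
    flatten_smul]

lemma transpose_spinMat (hG : Gᵀ = G) (hdG : ∀ l, dG l = Γ l * G + G * (Γ l)ᵀ)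
    (hdE : ∀ l, dE l * G * Eᵀ + E * dG l * Eᵀ + E * G * (dE l)ᵀ = 0) (l : ι) :
    (spinMat G E Γ dE l)ᵀ = -spinMat G E Γ dE l := by
  rw [eq_neg_iff_add_eq_zero, ← hdE l, hdG]
  simp only [spinMat, transpose_mul, transpose_add, transpose_transpose, hG]
  noncomm_ring

/-- The full covariant derivative of the frame vanishes. The orthonormality of the frame enters
through the antisymmetry of the spin connection. -/
lemma frameDeriv (hG : Gᵀ = G) (hE : E * G * Eᵀ = 1) (hdG : ∀ l, dG l = Γ l * G + G * (Γ l)ᵀ)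
    (hdE : ∀ l, dE l * G * Eᵀ + E * dG l * Eᵀ + E * G * (dE l)ᵀ = 0) (l : ι) :
    dE l = -(spinMat G E Γ dE l * E) - E * Γ l := by
  have h := transpose_spinMat hG hdG hdE l
  have h2 : -spinMat G E Γ dE l * E = dE l + E * Γ l := by
    rw [← h, spinMat, transpose_mul, transpose_transpose, transpose_mul, hG, mul_assoc,
      metric_mul_frame hE, mul_one]
  rw [← neg_mul, h2]; abel

/-- The derivative of the flat components of an endomorphism. -/
lemma flatMat_deriv (hG : Gᵀ = G) (hE : E * G * Eᵀ = 1)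
    (hdG : ∀ l, dG l = Γ l * G + G * (Γ l)ᵀ)
    (hdE : ∀ l, dE l * G * Eᵀ + E * dG l * Eᵀ + E * G * (dE l)ᵀ = 0) (l : ι) :
    dE l * J * G * Eᵀ + E * dJ l * G * Eᵀ + E * J * dG l * Eᵀ + E * J * G * (dE l)ᵀ
      = E * (covDeriv Γ dJ J l * G) * Eᵀ - spinMat G E Γ dE l * flatMat G E J
        + flatMat G E J * spinMat G E Γ dE l := by
  have h := transpose_spinMat hG hdG hdE l
  have h2 : (dE l)ᵀ = Eᵀ * spinMat G E Γ dE l - (Γ l)ᵀ * Eᵀ := by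
    conv_lhs => rw [frameDeriv hG hE hdG hdE l]
    rw [transpose_sub, transpose_neg, transpose_mul, transpose_mul, h]
    noncomm_ring
  rw [covDeriv_mul_metric hdG, h2, hdG]
  conv_lhs => enter [1, 1, 1]; rw [frameDeriv hG hE hdG hdE l]
  simp only [flatMat]
  noncomm_ring

/-- The derivative of a rotated frame. -/
lemma rotatedFrame_deriv (hG : Gᵀ = G) (hE : E * G * Eᵀ = 1)
    (hdG : ∀ l, dG l = Γ l * G + G * (Γ l)ᵀ)
    (hdE : ∀ l, dE l * G * Eᵀ + E * dG l * Eᵀ + E * G * (dE l)ᵀ = 0) (l : ι) :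
    dE l * J + E * dJ l
      = (E * (covDeriv Γ dJ J l * G) * Eᵀ - spinMat G E Γ dE l * flatMat G E J) * E
        - flatMat G E J * E * Γ l := by
  have e1 : E * (covDeriv Γ dJ J l * G) * Eᵀ * E = E * covDeriv Γ dJ J l := by
    calc _ = E * covDeriv Γ dJ J l * (G * Eᵀ * E) := by noncomm_ring
      _ = _ := by rw [metric_mul_frame hE, mul_one]
  rw [sub_mul, e1, mul_assoc (spinMat G E Γ dE l), flatMat_mul_frame hE, covDeriv]
  conv_lhs => rw [frameDeriv hG hE hdG hdE l]
  noncomm_ring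

end CovariantDerivative

end CliffordKT

namespace CliffordKT

/-! ## Geometry in one coordinate chart -/

section ChartGeometry

set_option linter.unusedSimpArgs false

open Matrix Topology

variable {n : ℕ} {U : Set (Coord n)}

/-- Entrywise smoothness of a matrix-valued function. -/
def SmoothMat (U : Set (Coord n)) (A : Coord n → Matrix (Fin n) (Fin n) ℝ) : Prop :=
  ∀ i j, ContDiffOn ℝ ∞ (fun y => A y i j) U

/-- The partial derivatives of the entries of a matrix-valued function. -/
def pdMat (A : Coord n → Matrix (Fin n) (Fin n) ℝ) (y : Coord n) (l : Fin n) :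
    Matrix (Fin n) (Fin n) ℝ :=
  Matrix.of fun i j => pd l (fun z => A z i j) y

lemma SmoothMat.mul {A B : Coord n → Matrix (Fin n) (Fin n) ℝ} (hA : SmoothMat U A)
    (hB : SmoothMat U B) : SmoothMat U fun y => A y * B y := fun i j => by
  simp only [Matrix.mul_apply]
  exact ContDiffOn.sum fun k _ => (hA i k).mul (hB k j)

lemma SmoothMat.transpose {A : Coord n → Matrix (Fin n) (Fin n) ℝ} (hA : SmoothMat U A) :
    SmoothMat U fun y => (A y)ᵀ := fun i j => hA j i

lemma SmoothMat.congr {A B : Coord n → Matrix (Fin n) (Fin n) ℝ} (hA : SmoothMat U A)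
    (h : ∀ y ∈ U, B y = A y) : SmoothMat U B := fun i j =>
  (hA i j).congr fun y hy => by rw [h y hy]

lemma SmoothMat.differentiableAt {A : Coord n → Matrix (Fin n) (Fin n) ℝ} (hA : SmoothMat U A)
    (hU : IsOpen U) {y : Coord n} (hy : y ∈ U) (i j : Fin n) :
    DifferentiableAt ℝ (fun y => A y i j) y :=
  ((hA i j).contDiffAt (hU.mem_nhds hy)).differentiableAt (by simp)

lemma contDiffOn_det {m : ℕ} {A : Coord n → Matrix (Fin m) (Fin m) ℝ}
    (hA : ∀ i j, ContDiffOn ℝ ∞ (fun y => A y i j) U) :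
    ContDiffOn ℝ ∞ (fun y => (A y).det) U := by
  simp only [Matrix.det_apply]
  exact ContDiffOn.sum fun σ _ => (contDiffOn_prod fun i _ => hA _ _).const_smul _

lemma SmoothMat.inv {A : Coord n → Matrix (Fin n) (Fin n) ℝ} (hA : SmoothMat U A)
    (h : ∀ y ∈ U, (A y).det ≠ 0) : SmoothMat U fun y => (A y)⁻¹ := fun i j => by
  -- Cramer's rule: the entries of the inverse are quotients of determinants, hence smooth.
  have : ∀ y, (A y)⁻¹ i j = ((A y).det)⁻¹ * ((A y).updateRow j (Pi.single i 1)).det := fun y => by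
    rw [Matrix.inv_def, Matrix.smul_apply, Matrix.adjugate_apply, Ring.inverse_eq_inv', smul_eq_mul]
  simp only [this]
  refine ((contDiffOn_det hA).inv h).mul (contDiffOn_det fun k l => ?_)
  by_cases hk : k = j
  · subst hk; simp only [Matrix.updateRow_self]; exact contDiffOn_const
  · simp only [Matrix.updateRow_ne hk]; exact hA k l

lemma pd_congr {f f' : Coord n → ℝ} {y : Coord n} (l : Fin n) (h : f =ᶠ[𝓝 y] f') :
    pd l f y = pd l f' y := by rw [pd, pd, h.fderiv_eq]

lemma pd_const (l : Fin n) (c : ℝ) (y : Coord n) : pd l (fun _ => c) y = 0 := by simp [pd]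

lemma pd_add {f f' : Coord n → ℝ} {y : Coord n} (l : Fin n) (hf : DifferentiableAt ℝ f y)
    (hf' : DifferentiableAt ℝ f' y) : pd l (fun z => f z + f' z) y = pd l f y + pd l f' y := by
  rw [pd, fderiv_fun_add hf hf']; rfl

lemma pd_neg {f : Coord n → ℝ} {y : Coord n} (l : Fin n) :
    pd l (fun z => -f z) y = -pd l f y := by
  rw [pd, fderiv_fun_neg]; rfl

lemma pd_mul {f f' : Coord n → ℝ} {y : Coord n} (l : Fin n) (hf : DifferentiableAt ℝ f y)
    (hf' : DifferentiableAt ℝ f' y) :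
    pd l (fun z => f z * f' z) y = pd l f y * f' y + f y * pd l f' y := by
  rw [pd, fderiv_fun_mul hf hf']
  simp only [pd, _root_.add_apply, _root_.smul_apply, smul_eq_mul]
  ring

lemma pd_sum {κ : Type*} (s : Finset κ) {f : κ → Coord n → ℝ} {y : Coord n} (l : Fin n)
    (hf : ∀ k ∈ s, DifferentiableAt ℝ (f k) y) :
    pd l (fun z => ∑ k ∈ s, f k z) y = ∑ k ∈ s, pd l (f k) y := by
  rw [pd, fderiv_fun_sum hf]; simp [pd]

lemma pdMat_mul {A B : Coord n → Matrix (Fin n) (Fin n) ℝ} {y : Coord n}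
    (hA : ∀ i j, DifferentiableAt ℝ (fun y => A y i j) y)
    (hB : ∀ i j, DifferentiableAt ℝ (fun y => B y i j) y) (l : Fin n) :
    pdMat (fun z => A z * B z) y l = pdMat A y l * B y + A y * pdMat B y l := by
  ext i j
  simp only [pdMat, Matrix.of_apply, Matrix.mul_apply, Matrix.add_apply]
  rw [pd_sum Finset.univ (f := fun k z => A z i k * B z k j) l
    fun k _ => (hA i k).mul (hB k j), ← Finset.sum_add_distrib]
  exact Finset.sum_congr rfl fun k _ => pd_mul l (hA i k) (hB k j)

lemma pdMat_congr {A B : Coord n → Matrix (Fin n) (Fin n) ℝ} {y : Coord n} (hU : IsOpen U)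
    (hy : y ∈ U) (h : ∀ z ∈ U, A z = B z) (l : Fin n) : pdMat A y l = pdMat B y l := by
  ext i j
  refine pd_congr l ?_
  filter_upwards [hU.mem_nhds hy] with z hz
  rw [h z hz]

lemma pdMat_const (A : Matrix (Fin n) (Fin n) ℝ) (y : Coord n) (l : Fin n) :
    pdMat (fun _ => A) y l = 0 := by
  ext i j; simp [pdMat, pd_const]

lemma pdMat_neg (A : Coord n → Matrix (Fin n) (Fin n) ℝ) (y : Coord n) (l : Fin n) :
    pdMat (fun z => -A z) y l = -pdMat A y l := by
  ext i j; simp [pdMat, pd_neg]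

lemma pdMat_transpose (A : Coord n → Matrix (Fin n) (Fin n) ℝ) (y : Coord n) (l : Fin n) :
    pdMat (fun z => (A z)ᵀ) y l = (pdMat A y l)ᵀ := rfl

/-- A smooth vielbein `e` for the metric `g` on an open set. -/
structure IsFrame (U : Set (Coord n)) (g e : Coord n → Matrix (Fin n) (Fin n) ℝ) : Prop where
  isOpen : IsOpen U
  symm : ∀ y ∈ U, (g y)ᵀ = g y
  smooth : SmoothMat U e
  orthonormal : ∀ y ∈ U, e y * g y * (e y)ᵀ = 1

/-- A smooth integrable antisymmetric complex structure on an open set. -/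
structure IsComplexStr (U : Set (Coord n)) (g J : Coord n → Matrix (Fin n) (Fin n) ℝ) : Prop where
  smooth : SmoothMat U J
  sq : ∀ y ∈ U, J y * J y = -1
  antisymm : ∀ y ∈ U, (J y * g y)ᵀ = -(J y * g y)
  integrable : ∀ y ∈ U, NijenhuisVanishes J y

variable {g e J J' : Coord n → Matrix (Fin n) (Fin n) ℝ} {y : Coord n}

lemma IsFrame.det_ne_zero (h : IsFrame U g e) (hy : y ∈ U) : (e y).det ≠ 0 := by
  have := congrArg Matrix.det (h.orthonormal y hy)
  rw [Matrix.det_mul, Matrix.det_mul, Matrix.det_one] at this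
  intro h0
  rw [h0] at this
  simp at this

/-- Smoothness of the metric components and positivity of their determinant are both obtained from
the vielbein through this factorization. -/
lemma IsFrame.metric_eq (h : IsFrame U g e) (hy : y ∈ U) : g y = (e y)⁻¹ * ((e y)⁻¹)ᵀ := by
  have hd : IsUnit (e y).det := isUnit_iff_ne_zero.2 (h.det_ne_zero hy)
  have h1 : (e y)⁻¹ * (e y * g y * (e y)ᵀ) * ((e y)⁻¹)ᵀ = (e y)⁻¹ * ((e y)⁻¹)ᵀ := by
    rw [h.orthonormal y hy, mul_one]
  have h2 : (e y)ᵀ * ((e y)⁻¹)ᵀ = 1 := by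
    rw [← Matrix.transpose_mul, Matrix.nonsing_inv_mul _ hd, Matrix.transpose_one]
  rw [← h1, mul_assoc, mul_assoc (e y * g y), h2, mul_one, ← mul_assoc,
    Matrix.nonsing_inv_mul _ hd, one_mul]

lemma IsFrame.smooth_metric (h : IsFrame U g e) : SmoothMat U g := by
  have hi : SmoothMat U fun y => (e y)⁻¹ := h.smooth.inv fun y hy => h.det_ne_zero hy
  exact (hi.mul hi.transpose).congr fun y hy => h.metric_eq hy

lemma IsFrame.det_metric_pos (h : IsFrame U g e) (hy : y ∈ U) : 0 < (g y).det := by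
  rw [h.metric_eq hy, Matrix.det_mul, Matrix.det_transpose]
  have hd : IsUnit (e y).det := isUnit_iff_ne_zero.2 (h.det_ne_zero hy)
  have : ((e y)⁻¹).det ≠ 0 := by
    rw [Matrix.det_nonsing_inv, Ring.inverse_eq_inv']; exact inv_ne_zero (h.det_ne_zero hy)
  exact mul_self_pos.2 this

/-- The connection matrices of the Levi-Civita connection. -/
def connMat (g : Coord n → Matrix (Fin n) (Fin n) ℝ) (y : Coord n) (l : Fin n) :
    Matrix (Fin n) (Fin n) ℝ := Matrix.of fun ν ρ => christoffel g y ρ l ν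

lemma pdMat_metric_symm (h : IsFrame U g e) (hy : y ∈ U) (l : Fin n) :
    (pdMat g y l)ᵀ = pdMat g y l := by
  rw [← pdMat_transpose]
  exact pdMat_congr h.isOpen hy h.symm l

lemma connMat_symm (h : IsFrame U g e) (hy : y ∈ U) :
    swap01 (arr (connMat g y)) = arr (connMat g y) := by
  refine swap01_symm fun a b c => ?_
  rw [arr_apply, arr_apply]
  simp only [connMat, Matrix.of_apply, christoffel]
  refine Finset.sum_congr rfl fun σ _ => ?_
  have s := fun l i j => congrFun (congrFun (pdMat_metric_symm h hy l) i) j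
  simp only [pdMat, Matrix.transpose_apply, Matrix.of_apply] at s
  rw [s a b σ, s b σ a, s σ b a]
  ring

lemma connMat_metric (h : IsFrame U g e) (hy : y ∈ U) (l : Fin n) :
    pdMat g y l = connMat g y l * g y + g y * (connMat g y l)ᵀ := by
  have hd : IsUnit (g y).det := (h.det_metric_pos hy).ne'.isUnit
  have s := fun l i j => congrFun (congrFun (pdMat_metric_symm h hy l) i) j
  simp only [pdMat, Matrix.transpose_apply, Matrix.of_apply] at s
  -- The lowered Christoffel symbols; the inverse metric in their definition is cancelled. Adding
  -- the expression with the two indices exchanged leaves the derivative of the metric.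
  have key : ∀ ν κ, (connMat g y l * g y) ν κ = (1 / 2) * (pd l (fun z => g z κ ν) y
      + pd ν (fun z => g z l κ) y - pd κ (fun z => g z l ν) y) := by
    intro ν κ
    set b : Fin n → ℝ := fun σ => (1 / 2) * (pd l (fun z => g z σ ν) y
      + pd ν (fun z => g z l σ) y - pd σ (fun z => g z l ν) y) with hb
    have e1 : (connMat g y l * g y) ν κ = (g y *ᵥ ((g y)⁻¹ *ᵥ b)) κ := by
      rw [Matrix.mul_apply, Matrix.mulVec, dotProduct]
      refine Finset.sum_congr rfl fun ρ _ => ?_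
      rw [connMat, Matrix.of_apply, christoffel, mul_comm]
      congr 1
      exact congrFun (congrFun (h.symm y hy) κ) ρ
    rw [e1, Matrix.mulVec_mulVec, Matrix.mul_nonsing_inv _ hd, Matrix.one_mulVec]
  have e2 : g y * (connMat g y l)ᵀ = (connMat g y l * g y)ᵀ := by
    rw [Matrix.transpose_mul, h.symm y hy]
  ext ν κ
  rw [e2, Matrix.add_apply, Matrix.transpose_apply, key, key, pdMat, Matrix.of_apply, s l κ ν]
  ring

lemma nablaLower_eq (h : IsFrame U g e) (hJ : SmoothMat U J) (hy : y ∈ U) (a b c : Fin n) :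
    nablaLower g J y a b c = arr (fun l => covDeriv (connMat g y) (pdMat J y) (J y) l * g y)
      ![a, b, c] := by
  rw [arr_apply, covDeriv_mul_metric (connMat_metric h hy),
    ← pdMat_mul (hJ.differentiableAt h.isOpen hy) (h.smooth_metric.differentiableAt h.isOpen hy)]
  simp only [Matrix.sub_apply, Matrix.mul_apply, nablaLower, connMat, Matrix.of_apply, lower, pdMat,
    Matrix.transpose_apply]
  congr 1
  exact Finset.sum_congr rfl fun σ _ => mul_comm _ _

/-- The array of the components `∇_α I_{βγ}`. -/
def nablaArr (g J : Coord n → Matrix (Fin n) (Fin n) ℝ) (y : Coord n) : (Fin 3 → Fin n) → ℝ :=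
  arr fun l => covDeriv (connMat g y) (pdMat J y) (J y) l * g y

lemma pdMat_sq (h : IsFrame U g e) (hJ : IsComplexStr U g J) (hy : y ∈ U) (l : Fin n) :
    pdMat J y l * J y + J y * pdMat J y l = 0 := by
  rw [← pdMat_mul (hJ.smooth.differentiableAt h.isOpen hy) (hJ.smooth.differentiableAt h.isOpen hy),
    pdMat_congr h.isOpen hy hJ.sq, pdMat_const]

lemma swap12_nablaArr (h : IsFrame U g e) (hJ : IsComplexStr U g J) (hy : y ∈ U) :
    swap12 (nablaArr g J y) = -nablaArr g J y := by
  rw [nablaArr, swap12_arr, ← arr_neg]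
  congr 1
  funext l
  refine transpose_covDeriv (hJ.antisymm y hy) (connMat_metric h hy) (fun l => ?_) l
  rw [← pdMat_mul (hJ.smooth.differentiableAt h.isOpen hy)
    (h.smooth_metric.differentiableAt h.isOpen hy), ← pdMat_transpose, ← pdMat_neg]
  exact pdMat_congr h.isOpen hy hJ.antisymm l

lemma arr_pdMat (J : Coord n → Matrix (Fin n) (Fin n) ℝ) (y : Coord n) (a b c : Fin n) :
    arr (pdMat J y) ![a, b, c] = pd a (fun z => J z b c) y := rfl

lemma integrable_arr (hJ : NijenhuisVanishes J y) :
    arr (pdMat J y) - swap01 (arr (pdMat J y))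
      = slot 0 (J y) (slot 1 (J y) (arr (pdMat J y) - swap01 (arr (pdMat J y)))) := by
  refine ext_vec3 fun a b c => ?_
  simp only [slot_vec3_zero, slot_vec3_one, Pi.sub_apply, swap01_apply, arr_pdMat]
  rw [hJ a b c]
  simp only [Finset.mul_sum, mul_assoc]

/-- Cyclic invariance is enough to bring the three double insertions to a common index order. -/
lemma holPart_eq {C : Coord n → (Fin 3 → Fin n) → ℝ} (hC : rot (C y) = C y) (a b c : Fin n) :
    holPart J C y a b c = holProj (J y) (C y) ![a, b, c] := by
  have c1 : ∀ a b c, C y ![b, c, a] = C y ![a, b, c] := fun a b c => by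
    rw [← rot_apply (C y), hC]
  simp only [holPart, holProj, slot_vec3_zero, slot_vec3_one, slot_vec3_two, Pi.smul_apply,
    Pi.sub_apply, smul_eq_mul, Finset.mul_sum]
  have e1 : ∑ ρ, ∑ σ, J y c ρ * J y a σ * C y ![ρ, σ, b]
      = ∑ ν, ∑ i, J y a ν * (J y c i * C y ![ν, b, i]) := by
    rw [Finset.sum_comm]
    refine Finset.sum_congr rfl fun ν _ => Finset.sum_congr rfl fun i _ => ?_
    rw [c1 i ν b]; ring
  have e2 : ∑ ρ, ∑ σ, J y b ρ * J y c σ * C y ![ρ, σ, a]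
      = ∑ ν, ∑ i, J y b ν * (J y c i * C y ![a, ν, i]) := by
    refine Finset.sum_congr rfl fun ν _ => Finset.sum_congr rfl fun i _ => ?_
    rw [c1 a ν i]; ring
  simp only [← Finset.mul_sum] at e1 e2 ⊢
  rw [e1, e2]
  simp only [Finset.mul_sum, mul_assoc]

/-- The completed Bismut torsion in terms of slot operations. -/
lemma bismut_add_holPart (h : IsFrame U g e) (hJ : IsComplexStr U g J) (hy : y ∈ U)
    {C : Coord n → (Fin 3 → Fin n) → ℝ} (hC : rot (C y) = C y)
    (hB : ∀ μ ν l, C y ![μ, ν, l] = bismut g J y μ ν l + holPart J C y μ ν l) :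
    C y = slot 0 (J y) (slot 1 (J y) (slot 2 (J y) (nablaArr g J y + rot (nablaArr g J y)
      + rot (rot (nablaArr g J y))))) + holProj (J y) (C y) := by
  refine ext_vec3 fun a b c => ?_
  rw [hB, Pi.add_apply, holPart_eq hC]
  congr 1
  simp only [bismut, slot_vec3_zero, slot_vec3_one, slot_vec3_two, Pi.add_apply, rot_apply,
    nablaLower_eq h hJ.smooth hy, nablaArr, Finset.mul_sum, mul_assoc]

/-- The covariant derivative of a complex structure with completed Bismut torsion `C`. -/
lemma nablaArr_eq (h : IsFrame U g e) (hJ : IsComplexStr U g J) (hy : y ∈ U)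
    {C : Coord n → (Fin 3 → Fin n) → ℝ} (hC : rot (C y) = C y)
    (hB : ∀ μ ν l, C y ![μ, ν, l] = bismut g J y μ ν l + holPart J C y μ ν l) :
    nablaArr g J y = structureDeriv (J y) (C y) :=
  eq_of_bismut (hJ.sq y hy) (swap12_nablaArr h hJ hy)
    (slot1_covDeriv (h.symm y hy) (hJ.sq y hy) (hJ.antisymm y hy) (pdMat_sq h hJ hy))
    (nijenhuis_covDeriv (hJ.sq y hy) (connMat_symm h hy) (integrable_arr (hJ.integrable y hy)))
    (bismut_add_holPart h hJ hy hC hB)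

/-- Weak covariance of the complex structure. -/
lemma nablaTorsion_symm (h : IsFrame U g e) (hJ : IsComplexStr U g J) (hy : y ∈ U)
    {C : Coord n → (Fin 3 → Fin n) → ℝ} (hC : rot (C y) = C y) (hC' : swap12 (C y) = -C y)
    (hB : ∀ μ ν l, C y ![μ, ν, l] = bismut g J y μ ν l + holPart J C y μ ν l) (l μ ν : Fin n) :
    nablaTorsion g C J y l μ ν + nablaTorsion g C J y μ l ν = 0 := by
  have hd : IsUnit (g y).det := (h.det_metric_pos hy).ne'.isUnit
  set T : (Fin 3 → Fin n) → ℝ := ofCurry3 fun a b c => nablaTorsion g C J y a b c with hT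
  -- With the last index lowered, the two torsion terms act on slots 1 and 2 of `C`; the sign of the
  -- transpose is absorbed by antisymmetry of the structure.
  have hlow : slot 2 (g y) T = nablaArr g J y + (1 / 2 : ℝ) • (slot 1 (J y) (C y)
      + slot 2 (J y) (C y)) := by
    have hTe : T = arr (covDeriv (connMat g y) (pdMat J y) (J y))
        + (1 / 2 : ℝ) • (slot 1 (J y) (slot 2 (g y)⁻¹ (C y))
          - slot 2 (J y)ᵀ (slot 2 (g y)⁻¹ (C y))) := by
      have c1 : ∀ a b c, C y ![b, c, a] = C y ![a, b, c] := fun a b c => by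
        rw [← rot_apply (C y), hC]
      refine ext_vec3 fun a b c => ?_
      simp only [hT, ofCurry3_apply, nablaTorsion, torsionConn, arr_covDeriv, Pi.add_apply,
        Pi.sub_apply, Pi.smul_apply, smul_eq_mul, slot_vec3_one, slot_vec3_two, arr_pdMat,
        Matrix.transpose_apply, arr_apply, connMat, Matrix.of_apply, add_mul, mul_add,
        Finset.sum_add_distrib, c1]
      have e1 : ∀ f : Fin n → Fin n → ℝ, ∑ x, 1 / 2 * (∑ k, (g y)⁻¹ x k * f k x) * J y x c
          = (1 / 2) * ∑ x, J y x c * ∑ k, (g y)⁻¹ x k * f k x := fun f => by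
        rw [Finset.mul_sum]; exact Finset.sum_congr rfl fun _ _ => by ring
      have e2 : ∀ f : Fin n → Fin n → ℝ, ∑ x, 1 / 2 * (∑ k, (g y)⁻¹ c k * f k x) * J y b x
          = (1 / 2) * ∑ x, J y b x * ∑ k, (g y)⁻¹ c k * f k x := fun f => by
        rw [Finset.mul_sum]; exact Finset.sum_congr rfl fun _ _ => by ring
      have e3 : ∀ f : Fin n → ℝ, ∑ x, f x * J y x c = ∑ x, J y x c * f x := fun f =>
        Finset.sum_congr rfl fun _ _ => mul_comm _ _
      have e4 : ∀ f : Fin n → ℝ, ∑ x, f x * J y b x = ∑ x, J y b x * f x := fun f =>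
        Finset.sum_congr rfl fun _ _ => mul_comm _ _
      have f1 := e1 fun k x => C y ![a, b, k]
      have f2 := e2 fun k x => C y ![a, x, k]
      have f3 := e3 fun x => christoffel g y x a b
      have f4 := e4 fun x => christoffel g y c a x
      simp only [pdMat, Matrix.of_apply]
      rw [f1, f2, f3, f4]
      ring
    have e1 : slot 2 (g y) (arr (covDeriv (connMat g y) (pdMat J y) (J y))) = nablaArr g J y := by
      rw [slot2_arr, h.symm y hy, nablaArr]
    have e2 : ∀ t : (Fin 3 → Fin n) → ℝ, slot 2 (g y) (slot 2 (g y)⁻¹ t) = t := fun t => by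
      rw [← Module.End.mul_apply, ← slot_mul, Matrix.mul_nonsing_inv _ hd, slot_one,
        Module.End.one_apply]
    have e3 : ∀ t : (Fin 3 → Fin n) → ℝ, slot 2 (g y) (slot 2 (J y)ᵀ t)
        = -slot 2 (J y) (slot 2 (g y) t) := fun t => by
      rw [← Module.End.mul_apply, ← slot_mul, metric_mul_transpose (h.symm y hy) (hJ.antisymm y hy),
        slot_neg, slot_mul]; rfl
    rw [hTe, map_add, e1, map_smul, map_sub, e3, slot21, e2]
    abel_nf
  -- The formula for `∇I` combines with these terms to `¼ (J₀ + J₁ + J₂ - J₀J₁J₂) C`, which is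
  -- symmetric in its treatment of the slots and so inherits the antisymmetry of `C`.
  have hanti : swap01 (slot 2 (g y) T) = -slot 2 (g y) T := by
    rw [hlow, nablaArr_eq h hJ hy hC hB, structureDeriv]
    have hC01 : swap01 (C y) = -C y := by rw [swap01_eq, hC', map_neg, hC]
    simp only [map_add, map_sub, map_smul, swap01_slot0, swap01_slot1, swap01_slot2, hC01, slot10,
      slot20, slot21, map_neg]
    module
  have hanti' : swap01 T = -T := by
    have e2 : ∀ t : (Fin 3 → Fin n) → ℝ, slot 2 (g y)⁻¹ (slot 2 (g y) t) = t := fun t => by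
      rw [← Module.End.mul_apply, ← slot_mul, Matrix.nonsing_inv_mul _ hd, slot_one,
        Module.End.one_apply]
    rw [swap01_slot2, ← map_neg] at hanti
    rw [← e2 (swap01 T), hanti, e2]
  have := congrFun hanti' ![l, μ, ν]
  rw [swap01_apply, Pi.neg_apply, hT, ofCurry3_apply, ofCurry3_apply] at this
  rw [this]
  ring

end ChartGeometry

end CliffordKT

namespace CliffordKT

/-! ## Exterior derivative and complex structures -/

section ExteriorDerivative

set_option linter.unusedSimpArgs false

open Matrix Topology

variable {n : ℕ} {U : Set (Coord n)} {y : Coord n}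

lemma fderiv_fderiv_comm {V : Type*} [NormedAddCommGroup V] [NormedSpace ℝ V] {f : Coord n → V}
    (hU : IsOpen U) (hf : ContDiffOn ℝ ∞ f U) (hy : y ∈ U) (v w : Coord n) :
    fderiv ℝ (fun z => fderiv ℝ f z v) y w = fderiv ℝ (fun z => fderiv ℝ f z w) y v := by
  have hf' : ContDiffAt ℝ ∞ f y := hf.contDiffAt (hU.mem_nhds hy)
  have hd : DifferentiableAt ℝ (fderiv ℝ f) y :=
    (hf'.fderiv_right (m := 1) (by norm_cast)).differentiableAt (by simp)
  have hs : IsSymmSndFDerivAt ℝ f y := hf'.isSymmSndFDerivAt (by simp only [minSmoothness_of_isRCLikeNormedField]; exact WithTop.coe_le_coe.2 le_top)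
  have e : ∀ v w : Coord n, fderiv ℝ (fun z => fderiv ℝ f z v) y w = fderiv ℝ (fderiv ℝ f) y w v := by
    intro v w
    rw [fderiv_clm_apply hd (differentiableAt_const v)]
    simp
  rw [e, e, hs]

lemma contDiffOn_fderiv_apply {V : Type*} [NormedAddCommGroup V] [NormedSpace ℝ V] {f : Coord n → V}
    (hU : IsOpen U) (hf : ContDiffOn ℝ ∞ f U) (v : Coord n) :
    ContDiffOn ℝ ∞ (fun z => fderiv ℝ f z v) U :=
  (hf.fderiv_of_isOpen hU (by simp)).clm_apply contDiffOn_const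

lemma contDiffOn_pd {f : Coord n → ℝ} (hU : IsOpen U) (hf : ContDiffOn ℝ ∞ f U) (l : Fin n) :
    ContDiffOn ℝ ∞ (pd l f) U := contDiffOn_fderiv_apply hU hf _

lemma differentiableAt_of_contDiffOn {V : Type*} [NormedAddCommGroup V] [NormedSpace ℝ V]
    {f : Coord n → V} (hU : IsOpen U) (hf : ContDiffOn ℝ ∞ f U) (hy : y ∈ U) :
    DifferentiableAt ℝ f y := (hf.contDiffAt (hU.mem_nhds hy)).differentiableAt (by simp)

lemma pd_pd_comm {f : Coord n → ℝ} (hU : IsOpen U) (hf : ContDiffOn ℝ ∞ f U) (hy : y ∈ U)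
    (l k : Fin n) : pd l (fun z => pd k f z) y = pd k (fun z => pd l f z) y :=
  fderiv_fderiv_comm hU hf hy _ _

variable {p : ℕ}

/-- Smoothness of the components of a multi-index array of functions. -/
def SmoothArr (U : Set (Coord n)) (η : Coord n → (Fin p → Fin n) → ℝ) : Prop :=
  ∀ m, ContDiffOn ℝ ∞ (fun y => η y m) U

lemma SmoothArr.iota {J : Coord n → Matrix (Fin n) (Fin n) ℝ} (hJ : SmoothMat U J)
    {η : Coord n → (Fin p → Fin n) → ℝ} (hη : SmoothArr U η) : SmoothArr U (iota J η) := fun _ =>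
  ContDiffOn.sum fun _ _ => ContDiffOn.sum fun _ _ => (hJ _ _).mul (hη _)

/-- The sum of the actions of a matrix on all slots. -/
def allSlots {X : Type*} [CommRing X] (J : Matrix (Fin n) (Fin n) X) :
    Module.End X ((Fin p → Fin n) → X) := ∑ k, slot k J

lemma allSlots_apply {X : Type*} [CommRing X] (J : Matrix (Fin n) (Fin n) X)
    (t : (Fin p → Fin n) → X) (m : Fin p → Fin n) : allSlots J t m = ∑ k, slot k J t m := by
  simp [allSlots]

lemma iota_eq (J : Coord n → Matrix (Fin n) (Fin n) ℝ) (η : Coord n → (Fin p → Fin n) → ℝ) :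
    iota J η y = allSlots (J y) (η y) := by
  ext m; rw [allSlots_apply]; rfl

/-- Matrices act as derivations of the tensor product, and this action represents the commutator:
contributions from two different slots cancel. -/
lemma allSlots_comm (A J : Matrix (Fin n) (Fin n) ℝ) :
    (allSlots A * allSlots J : Module.End ℝ ((Fin p → Fin n) → ℝ))
      = allSlots J * allSlots A + allSlots (A * J - J * A) := by
  simp only [allSlots, Finset.sum_mul_sum]
  rw [Finset.sum_comm, ← Finset.sum_add_distrib]
  refine Finset.sum_congr rfl fun k _ => ?_
  rw [slot_sub, slot_mul, slot_mul, ← sub_eq_iff_eq_add', ← Finset.sum_sub_distrib]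
  refine Finset.sum_eq_single k (fun j _ hj => ?_) fun h => absurd (Finset.mem_univ k) h
  rw [sub_eq_zero]
  exact slot_commute hj A J

/-- The alternation that turns the array `∂_{m_0} η_{m_1 …}` into the exterior derivative. -/
def shuffle : Module.End ℝ ((Fin (p + 1) → Fin n) → ℝ) :=
  ∑ k : Fin (p + 1), ((-1) ^ (k : ℕ) : ℝ) • permSlots k.cycleRange.symm

lemma shuffle_apply (t : (Fin (p + 1) → Fin n) → ℝ) : shuffle t
    = ∑ k : Fin (p + 1), ((-1) ^ (k : ℕ) : ℝ) • permSlots k.cycleRange.symm t := by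
  simp [shuffle]

/-- The array of the partial derivatives of the components. -/
def dArr (η : Coord n → (Fin p → Fin n) → ℝ) (y : Coord n) (m : Fin (p + 1) → Fin n) : ℝ :=
  pd (m 0) (fun z => η z (Fin.tail m)) y

/-- The inverse of `k.cycleRange` brings index `k` to the front and keeps the order of the others,
as in the coordinate formula for `d`. -/
lemma extD_eq (η : Coord n → (Fin p → Fin n) → ℝ) : extD η y = shuffle (dArr η y) := by
  ext m
  simp only [extD, shuffle_apply, Finset.sum_apply, Pi.smul_apply, smul_eq_mul, permSlots_apply, dArr,
    Function.comp_apply, Fin.cycleRange_symm_zero]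
  refine Finset.sum_congr rfl fun k _ => ?_
  congr 3
  funext z
  congr 1
  funext i
  simp only [Fin.tail, Function.comp_apply, Fin.cycleRange_symm_succ]

/-- A permutation only renames the slots, and the sum over all slots is invariant. The action of `ι`
can therefore be computed before alternation. -/
lemma allSlots_shuffle (J : Matrix (Fin n) (Fin n) ℝ) (t : (Fin (p + 1) → Fin n) → ℝ) :
    allSlots J (shuffle t) = shuffle (allSlots J t) := by
  simp only [shuffle_apply, map_sum, map_smul]
  refine Finset.sum_congr rfl fun k _ => ?_
  congr 1
  simp only [allSlots, LinearMap.sum_apply, slot_permSlots, map_sum]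
  exact Equiv.sum_comp k.cycleRange.symm.symm fun i => permSlots k.cycleRange.symm (slot i J t)

/-- The action of a family of matrices, labelled by the first index, on the slots of an array. -/
def famSlots (A : Fin n → Matrix (Fin n) (Fin n) ℝ) (t : (Fin p → Fin n) → ℝ)
    (m : Fin (p + 1) → Fin n) : ℝ := allSlots (A (m 0)) t (Fin.tail m)

/-- The action of a matrix on all slots but the first. -/
def tailSlots (J : Matrix (Fin n) (Fin n) ℝ) : Module.End ℝ ((Fin (p + 1) → Fin n) → ℝ) :=
  ∑ k : Fin p, slot k.succ J

lemma allSlots_eq (J : Matrix (Fin n) (Fin n) ℝ) (t : (Fin (p + 1) → Fin n) → ℝ) :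
    allSlots J t = slot 0 J t + tailSlots J t := by
  rw [allSlots, Fin.sum_univ_succ]; rfl

lemma tailSlots_apply (J : Matrix (Fin n) (Fin n) ℝ) (t : (Fin (p + 1) → Fin n) → ℝ)
    (m : Fin (p + 1) → Fin n) :
    tailSlots J t m = allSlots J (fun m' => t (Fin.cons (m 0) m')) (Fin.tail m) := by
  simp only [tailSlots, LinearMap.sum_apply, Finset.sum_apply, allSlots_apply, slot_apply]
  refine Finset.sum_congr rfl fun k _ => Finset.sum_congr rfl fun ν _ => ?_
  rw [Fin.cons_update, Fin.cons_self_tail]; rfl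

lemma dArr_iota {J : Coord n → Matrix (Fin n) (Fin n) ℝ} (hU : IsOpen U) (hJ : SmoothMat U J)
    {η : Coord n → (Fin p → Fin n) → ℝ} (hη : SmoothArr U η) (hy : y ∈ U) :
    dArr (iota J η) y = tailSlots (J y) (dArr η y) + famSlots (pdMat J y) (η y) := by
  ext m
  rw [Pi.add_apply, tailSlots_apply, famSlots, allSlots_apply, allSlots_apply,
    ← Finset.sum_add_distrib, dArr]
  simp only [iota]
  rw [pd_sum Finset.univ (f := fun k z => ∑ ν, J z (Fin.tail m k) ν
    * η z (Function.update (Fin.tail m) k ν)) (m 0) fun k _ => DifferentiableAt.fun_sum fun ν _ =>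
    (hJ.differentiableAt hU hy _ _).mul (differentiableAt_of_contDiffOn hU (hη _) hy)]
  refine Finset.sum_congr rfl fun k _ => ?_
  rw [pd_sum Finset.univ (f := fun ν z => J z (Fin.tail m k) ν
    * η z (Function.update (Fin.tail m) k ν)) (m 0) fun ν _ =>
    (hJ.differentiableAt hU hy _ _).mul (differentiableAt_of_contDiffOn hU (hη _) hy), slot_apply,
    slot_apply, ← Finset.sum_add_distrib]
  refine Finset.sum_congr rfl fun ν _ => ?_
  rw [pd_mul _ (hJ.differentiableAt hU hy _ _) (differentiableAt_of_contDiffOn hU (hη _) hy),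
    add_comm]
  simp only [dArr, Fin.cons_zero, Fin.tail_cons]
  rfl

lemma slot0_famSlots (J : Matrix (Fin n) (Fin n) ℝ) (A : Fin n → Matrix (Fin n) (Fin n) ℝ)
    (t : (Fin p → Fin n) → ℝ) :
    slot 0 J (famSlots A t) = famSlots (fun μ => ∑ σ, J μ σ • A σ) t := by
  have h : ∀ μ, (allSlots (∑ σ, J μ σ • A σ) : Module.End ℝ ((Fin p → Fin n) → ℝ))
      = ∑ σ, J μ σ • allSlots (A σ) := by
    intro μ
    simp only [allSlots, Finset.smul_sum]
    rw [Finset.sum_comm]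
    refine Finset.sum_congr rfl fun k _ => ?_
    refine LinearMap.ext fun t => funext fun m => ?_
    simp only [slot_apply, Matrix.sum_apply, Finset.sum_mul, LinearMap.sum_apply, Finset.sum_apply,
      LinearMap.smul_apply, Pi.smul_apply, smul_eq_mul, Matrix.smul_apply, Finset.mul_sum, mul_assoc]
    exact Finset.sum_comm
  ext m
  rw [slot_apply, famSlots, h]
  simp only [LinearMap.sum_apply, Finset.sum_apply, LinearMap.smul_apply, Pi.smul_apply, smul_eq_mul]
  refine Finset.sum_congr rfl fun σ _ => ?_
  rw [famSlots, Function.update_self, Fin.tail_update_zero]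

/-- `allSlots_comm` applied for each value of the first index, on which `tailSlots` does not act. -/
lemma famSlots_comm (J : Matrix (Fin n) (Fin n) ℝ) (A : Fin n → Matrix (Fin n) (Fin n) ℝ)
    (t : (Fin p → Fin n) → ℝ) :
    famSlots A (allSlots J t) = tailSlots J (famSlots A t)
      + famSlots (fun μ => A μ * J - J * A μ) t := by
  ext m
  rw [Pi.add_apply, tailSlots_apply, famSlots, famSlots, ← Module.End.mul_apply, allSlots_comm]
  simp only [LinearMap.add_apply, Pi.add_apply, Module.End.mul_apply]
  rfl

lemma famSlots_add (A B : Fin n → Matrix (Fin n) (Fin n) ℝ) (t : (Fin p → Fin n) → ℝ) :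
    famSlots (fun μ => A μ + B μ) t = famSlots A t + famSlots B t := by
  ext m
  simp [famSlots, allSlots_apply, slot_add, Finset.sum_add_distrib]

lemma famSlots_smul (c : ℝ) (A : Fin n → Matrix (Fin n) (Fin n) ℝ) (t : (Fin p → Fin n) → ℝ) :
    famSlots (fun μ => c • A μ) t = c • famSlots A t := by
  ext m
  simp [famSlots, allSlots_apply, slot_smul, Finset.mul_sum]

/-- A family of matrices that is symmetric in its first two indices acts trivially on alternating
arrays, up to the alternation. -/
lemma shuffle_famSlots_eq_zero {A : Fin n → Matrix (Fin n) (Fin n) ℝ}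
    (hA : ∀ a b c, A a b c = A b a c) {t : (Fin 3 → Fin n) → ℝ} (h1 : swap12 t = -t)
    (h2 : rot t = t) : shuffle (famSlots A t) = 0 := by
  have hr : ∀ a b c, t ![b, c, a] = t ![a, b, c] := fun a b c => by rw [← rot_apply t, h2]
  have hs : ∀ a b c, t ![a, c, b] = -t ![a, b, c] := fun a b c => by
    have := congrFun h1 ![a, b, c]
    rwa [swap12_apply] at this
  -- The contracted index is brought to the front of `t`, so that the remaining indices appear as an
  -- alternating pair.
  have hf : ∀ m : Fin 4 → Fin n, famSlots A t m = ∑ ν, (A (m 0) (m 1) ν * t ![ν, m 2, m 3]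
      - A (m 0) (m 2) ν * t ![ν, m 1, m 3] + A (m 0) (m 3) ν * t ![ν, m 1, m 2]) := by
    intro m
    have e : Fin.tail m = ![m 1, m 2, m 3] := by ext i; fin_cases i <;> rfl
    rw [famSlots, allSlots_apply, Fin.sum_univ_three, e, slot_vec3_zero, slot_vec3_one,
      slot_vec3_two, ← Finset.sum_add_distrib, ← Finset.sum_add_distrib]
    refine Finset.sum_congr rfl fun ν _ => ?_
    rw [← hr ν (m 1) (m 2), ← hr (m 1) ν (m 3), hs ν (m 3) (m 1), hr, hs ν (m 1) (m 3)]
    ring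
  ext m
  rw [shuffle_apply]
  rw [Fin.sum_univ_four]
  simp only [Pi.add_apply, Pi.smul_apply, permSlots_apply, smul_eq_mul]
  have c0 : ((0 : Fin 4).cycleRange.symm : Fin 4 → Fin 4) = ![0, 1, 2, 3] := by decide
  have c1 : ((1 : Fin 4).cycleRange.symm : Fin 4 → Fin 4) = ![1, 0, 2, 3] := by decide
  have c2 : ((2 : Fin 4).cycleRange.symm : Fin 4 → Fin 4) = ![2, 0, 1, 3] := by decide
  have c3 : ((3 : Fin 4).cycleRange.symm : Fin 4 → Fin 4) = ![3, 0, 1, 2] := by decide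
  rw [c0, c1, c2, c3, hf, hf, hf, hf]
  simp only [Function.comp_apply, Finset.mul_sum, ← Finset.sum_add_distrib, Pi.zero_apply]
  refine Finset.sum_eq_zero fun ν _ => ?_
  simp [Matrix.cons_val]
  rw [hA (m 1) (m 0), hA (m 2) (m 0), hA (m 3) (m 0), hA (m 2) (m 1), hA (m 3) (m 1),
    hA (m 3) (m 2)]
  ring

/-- The commutation relation of `d` with the slot action of an integrable complex structure. -/
lemma extD_iota_iota {J : Coord n → Matrix (Fin n) (Fin n) ℝ} (hU : IsOpen U) (hJ : SmoothMat U J)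
    (hsq : ∀ z ∈ U, J z * J z = -1) (hy : y ∈ U) (hint : NijenhuisVanishes J y)
    {η : Coord n → (Fin 3 → Fin n) → ℝ} (hη : SmoothArr U η) (h1 : swap12 (η y) = -η y)
    (h2 : rot (η y) = η y) :
    allSlots (J y) (allSlots (J y) (extD η y)) - (2 : ℝ) • allSlots (J y) (extD (iota J η) y)
      + extD (iota J (iota J η)) y + extD η y = 0 := by
  have hd : ∀ l, pdMat J y l * J y = -(J y * pdMat J y l) := fun l => by
    rw [eq_neg_iff_add_eq_zero, ← pdMat_mul (hJ.differentiableAt hU hy) (hJ.differentiableAt hU hy),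
      pdMat_congr hU hy hsq, pdMat_const]
  set A : Fin n → Matrix (Fin n) (Fin n) ℝ := fun μ => ∑ σ, J y μ σ • pdMat J y σ
    + J y * pdMat J y μ with hA
  -- The symmetry of `A` in its first two indices is the Nijenhuis condition with `J` applied on
  -- slot 0.
  have hAs : ∀ a b c, A a b c = A b a c := by
    have e : arr A = slot 0 (J y) (arr (pdMat J y)) + slot 1 (J y) (arr (pdMat J y)) := by
      refine ext_vec3 fun a b c => ?_
      rw [arr_apply, Pi.add_apply, slot_vec3_zero, slot_vec3_one]
      simp [hA, Matrix.sum_apply, Matrix.mul_apply, arr_apply]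
    have hi := congrArg (slot 0 (J y)) (integrable_arr hint)
    have hs := fun {k : ℕ} (i : Fin k) (t : (Fin k → Fin n) → ℝ) => slot_slot_self (hsq y hy) i t
    have : swap01 (arr A) = arr A := by
      rw [e]
      simp only [map_add, map_sub, swap01_slot0, swap01_slot1, hs, neg_sub] at hi ⊢
      rw [← sub_eq_zero] at hi ⊢
      rw [← neg_eq_zero, ← hi]
      abel
    intro a b c
    rw [← arr_apply A a, ← this, swap01_apply, arr_apply]
  have hz := shuffle_famSlots_eq_zero hAs h1 h2
  simp only [extD_eq, allSlots_shuffle]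
  rw [dArr_iota hU hJ (hη.iota hJ) hy, dArr_iota hU hJ hη hy, iota_eq, famSlots_comm]
  -- Since `∂J` anticommutes with `J`, its commutator is `-2 J ∂J`.
  have hcomm : famSlots (fun μ => pdMat J y μ * J y - J y * pdMat J y μ) (η y)
      = (-2 : ℝ) • famSlots (fun μ => J y * pdMat J y μ) (η y) := by
    rw [← famSlots_smul]
    congr 1
    funext μ
    rw [hd]; module
  rw [hcomm]
  rw [hA, famSlots_add, ← slot0_famSlots] at hz
  have hs := fun {k : ℕ} (i : Fin k) (t : (Fin k → Fin n) → ℝ) => slot_slot_self (hsq y hy) i t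
  have hct : ∀ t : (Fin 4 → Fin n) → ℝ, tailSlots (J y) (slot 0 (J y) t)
      = slot 0 (J y) (tailSlots (J y) t) := by
    intro t
    simp only [tailSlots, LinearMap.sum_apply, map_sum]
    exact Finset.sum_congr rfl fun k _ =>
      LinearMap.congr_fun (slot_commute (Fin.succ_ne_zero k) (J y) (J y)) t
  -- Before alternation, the double commutator differs from minus the derivative only by the action
  -- of the family `A`, which the alternation kills.
  have key : allSlots (J y) (allSlots (J y) (dArr η y))
      - (2 : ℝ) • allSlots (J y) (tailSlots (J y) (dArr η y) + famSlots (pdMat J y) (η y))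
      + (tailSlots (J y) (tailSlots (J y) (dArr η y) + famSlots (pdMat J y) (η y))
        + (tailSlots (J y) (famSlots (pdMat J y) (η y))
          + (-2 : ℝ) • famSlots (fun μ => J y * pdMat J y μ) (η y))) + dArr η y
      = (-2 : ℝ) • (slot 0 (J y) (famSlots (pdMat J y) (η y))
        + famSlots (fun μ => J y * pdMat J y μ) (η y)) := by
    simp only [allSlots_eq, map_add, hs, hct]
    module
  have := congrArg shuffle key
  rw [map_smul, hz, smul_zero] at this
  rw [← this]
  simp only [map_add, map_sub, map_smul]

end ExteriorDerivative

end CliffordKT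

namespace CliffordKT

/-! ### From the type of `dC` to the torsion equation -/

section TorsionEquation

set_option linter.unusedSimpArgs false

open Matrix Topology

variable {n : ℕ} {U : Set (Coord n)} {y : Coord n}

lemma extD_add {p : ℕ} {η θ : Coord n → (Fin p → Fin n) → ℝ} (hU : IsOpen U) (hη : SmoothArr U η)
    (hθ : SmoothArr U θ) (hy : y ∈ U) :
    extD (fun z => η z + θ z) y = extD η y + extD θ y := by
  rw [extD_eq, extD_eq, extD_eq, ← map_add]
  congr 1
  ext m
  exact pd_add (m 0) (differentiableAt_of_contDiffOn hU (hη _) hy)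
    (differentiableAt_of_contDiffOn hU (hθ _) hy)

lemma extD_smul {p : ℕ} (c : ℝ) {η : Coord n → (Fin p → Fin n) → ℝ} (hU : IsOpen U)
    (hη : SmoothArr U η) (hy : y ∈ U) :
    extD (fun z => c • η z) y = c • extD η y := by
  rw [extD_eq, extD_eq, ← map_smul]
  congr 1
  ext m
  have := pd_mul (m 0) (differentiableAt_const c)
    (differentiableAt_of_contDiffOn hU (hη (Fin.tail m)) hy)
  rw [pd_const, zero_mul, zero_add] at this
  exact this

lemma extD_congr {p : ℕ} {η θ : Coord n → (Fin p → Fin n) → ℝ} (hU : IsOpen U) (hy : y ∈ U)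
    (h : ∀ z ∈ U, η z = θ z) : extD η y = extD θ y := by
  rw [extD_eq, extD_eq]
  congr 1
  ext m
  refine pd_congr _ ?_
  filter_upwards [hU.mem_nhds hy] with z hz
  rw [h z hz]

lemma extD_two (om : Coord n → (Fin 2 → Fin n) → ℝ) (y : Coord n) (m : Fin 3 → Fin n) :
    extD om y m = pd (m 0) (fun z => om z ![m 1, m 2]) y - pd (m 1) (fun z => om z ![m 0, m 2]) y
      + pd (m 2) (fun z => om z ![m 0, m 1]) y := by
  have e0 : (fun i => m ((0 : Fin 3).succAbove i)) = ![m 1, m 2] := by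
    ext i; fin_cases i <;> rfl
  have e1 : (fun i => m ((1 : Fin 3).succAbove i)) = ![m 0, m 2] := by
    ext i; fin_cases i <;> rfl
  have e2 : (fun i => m ((2 : Fin 3).succAbove i)) = ![m 0, m 1] := by
    ext i; fin_cases i <;> rfl
  rw [extD, Fin.sum_univ_three, e0, e1, e2]
  simp
  ring

lemma extD_three (η : Coord n → (Fin 3 → Fin n) → ℝ) (y : Coord n) (m : Fin 4 → Fin n) :
    extD η y m = pd (m 0) (fun z => η z ![m 1, m 2, m 3]) y
      - pd (m 1) (fun z => η z ![m 0, m 2, m 3]) y + pd (m 2) (fun z => η z ![m 0, m 1, m 3]) y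
      - pd (m 3) (fun z => η z ![m 0, m 1, m 2]) y := by
  have e0 : (fun i => m ((0 : Fin 4).succAbove i)) = ![m 1, m 2, m 3] := by
    ext i; fin_cases i <;> rfl
  have e1 : (fun i => m ((1 : Fin 4).succAbove i)) = ![m 0, m 2, m 3] := by
    ext i; fin_cases i <;> rfl
  have e2 : (fun i => m ((2 : Fin 4).succAbove i)) = ![m 0, m 1, m 3] := by
    ext i; fin_cases i <;> rfl
  have e3 : (fun i => m ((3 : Fin 4).succAbove i)) = ![m 0, m 1, m 2] := by
    ext i; fin_cases i <;> rfl
  rw [extD, Fin.sum_univ_four, e0, e1, e2, e3]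
  simp only [Fin.val_zero, Fin.val_one, Fin.val_two, pow_zero, pow_one]
  have : ((3 : Fin 4) : ℕ) = 3 := rfl
  rw [this]
  ring

lemma pd_sub {f f' : Coord n → ℝ} {y : Coord n} (l : Fin n) (hf : DifferentiableAt ℝ f y)
    (hf' : DifferentiableAt ℝ f' y) : pd l (fun z => f z - f' z) y = pd l f y - pd l f' y := by
  rw [pd, fderiv_fun_sub hf hf']; rfl

lemma extD_extD {om : Coord n → (Fin 2 → Fin n) → ℝ} (hU : IsOpen U) (hom : SmoothArr U om)
    (hy : y ∈ U) : extD (extD om) y = 0 := by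
  have hd : ∀ l m, DifferentiableAt ℝ (pd l fun z => om z m) y := fun l m =>
    differentiableAt_of_contDiffOn hU (contDiffOn_pd hU (hom m) l) hy
  ext m
  rw [extD_three]
  simp only [extD_two]
  have e : ∀ k a b c : Fin n, pd k (fun z => pd a (fun z => om z ![b, c]) z
      - pd b (fun z => om z ![a, c]) z + pd c (fun z => om z ![a, b]) z) y
      = pd k (pd a fun z => om z ![b, c]) y - pd k (pd b fun z => om z ![a, c]) y
        + pd k (pd c fun z => om z ![a, b]) y := by
    intro k a b c
    rw [pd_add k ((hd _ _).fun_sub (hd _ _)) (hd _ _), pd_sub k (hd _ _) (hd _ _)]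
  have hc := fun l k (w : Fin 2 → Fin n) => pd_pd_comm hU (hom w) hy l k
  simp only [Matrix.cons_val] at e ⊢
  rw [e, e, e, e, hc (m 1) (m 0), hc (m 2) (m 0), hc (m 3) (m 0), hc (m 2) (m 1),
    hc (m 3) (m 1), hc (m 3) (m 2)]
  simp only [Pi.zero_apply]
  ring

variable {g e J : Coord n → Matrix (Fin n) (Fin n) ℝ}

/-- The fundamental 2-form. -/
def fundForm (g J : Coord n → Matrix (Fin n) (Fin n) ℝ) (y : Coord n) (m : Fin 2 → Fin n) : ℝ :=
  lower g J y (m 0) (m 1)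

/-- The Levi-Civita connection has no torsion, so the partial derivatives in `d` may be replaced by
covariant ones. -/
lemma extD_fundForm (h : IsFrame U g e) (hJ : IsComplexStr U g J) (hy : y ∈ U) :
    extD (fundForm g J) y = nablaArr g J y + rot (nablaArr g J y) + rot (rot (nablaArr g J y)) := by
  have ha : ∀ a b, lower g J y a b = -lower g J y b a := fun a b => by
    have := congrFun (congrFun (hJ.antisymm y hy) b) a
    simpa [lower] using this
  have hΓ : ∀ a b c, christoffel g y c a b = christoffel g y c b a := fun a b c => by
    have := congrFun (connMat_symm h hy) ![b, a, c]
    rw [swap01_apply] at this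
    exact this
  have hp : ∀ l a b, pd l (fun z => lower g J z a b) y = -pd l (fun z => lower g J z b a) y := by
    intro l a b
    rw [← pd_neg]
    refine pd_congr l ?_
    filter_upwards [h.isOpen.mem_nhds hy] with z hz
    have := congrFun (congrFun (hJ.antisymm z hz) b) a
    simpa [lower] using this
  refine ext_vec3 fun a b c => ?_
  rw [extD_two]
  simp only [Pi.add_apply, rot_apply, nablaArr, ← nablaLower_eq h hJ.smooth hy, nablaLower, fundForm,
    Matrix.cons_val]
  rw [hp b a c]
  have f1 : ∑ σ, christoffel g y σ a c * lower g J y b σ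
      = -∑ σ, christoffel g y σ c a * lower g J y σ b := by
    rw [← Finset.sum_neg_distrib]
    exact Finset.sum_congr rfl fun σ _ => by rw [hΓ a c, ha b]; ring
  have f2 : ∑ σ, christoffel g y σ b a * lower g J y c σ
      = -∑ σ, christoffel g y σ a b * lower g J y σ c := by
    rw [← Finset.sum_neg_distrib]
    exact Finset.sum_congr rfl fun σ _ => by rw [hΓ b a, ha c]; ring
  have f3 : ∑ σ, christoffel g y σ c b * lower g J y a σ
      = -∑ σ, christoffel g y σ b c * lower g J y σ a := by
    rw [← Finset.sum_neg_distrib]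
    exact Finset.sum_congr rfl fun σ _ => by rw [hΓ c b, ha a]; ring
  rw [f1, f2, f3]
  ring

/-- The cubic slot identity behind `d(ι³C + 9ιC) = 0`. -/
lemma iota_cubed_add (h : IsFrame U g e) (hJ : IsComplexStr U g J) (hy : y ∈ U)
    {C : Coord n → (Fin 3 → Fin n) → ℝ} (hC : rot (C y) = C y)
    (hB : ∀ μ ν l, C y ![μ, ν, l] = bismut g J y μ ν l + holPart J C y μ ν l) :
    iota J (iota J (iota J C)) y + (9 : ℝ) • iota J C y = (-8 : ℝ) • extD (fundForm g J) y := by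
  have hs := fun {k : ℕ} (i : Fin k) (t : (Fin k → Fin n) → ℝ) => slot_slot_self (hJ.sq y hy) i t
  have hBis := bismut_add_holPart h hJ hy hC hB
  rw [← extD_fundForm h hJ hy] at hBis
  set D : (Fin 3 → Fin n) → ℝ := extD (fundForm g J) y
  -- `J₀J₁J₂` squares to `-1`, so the Bismut relation is inverted by applying it once more. On
  -- types, `ι³ + 9ι` annihilates `(3,0) + (0,3)`, where `ι = ±3i`, and is `8ι` on the rest.
  have hD : -D = slot 0 (J y) (slot 1 (J y) (slot 2 (J y) (C y - holProj (J y) (C y)))) := by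
    have : C y - holProj (J y) (C y) = slot 0 (J y) (slot 1 (J y) (slot 2 (J y) D)) := by
      rw [sub_eq_iff_eq_add]; exact hBis
    rw [this]
    simp only [slot10, slot20, slot21, hs, map_neg, neg_neg]
  have : (-8 : ℝ) • D = (8 : ℝ) • -D := by module
  rw [this, hD, iota_eq, iota_eq, iota_eq]
  simp only [allSlots, Fin.sum_univ_three, LinearMap.add_apply, holProj, map_add, map_sub, map_smul,
    slot10, slot20, slot21, hs, map_neg]
  module

section FourSlots

variable {X : Type*} [CommRing X] (J J' : Matrix (Fin n) (Fin n) X) (t : (Fin 4 → Fin n) → X)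

lemma slot4_10 : slot 1 J (slot 0 J' t) = slot 0 J' (slot 1 J t) :=
  LinearMap.congr_fun (slot_commute (by decide : (1 : Fin 4) ≠ 0) J J') t
lemma slot4_20 : slot 2 J (slot 0 J' t) = slot 0 J' (slot 2 J t) :=
  LinearMap.congr_fun (slot_commute (by decide : (2 : Fin 4) ≠ 0) J J') t
lemma slot4_30 : slot 3 J (slot 0 J' t) = slot 0 J' (slot 3 J t) :=
  LinearMap.congr_fun (slot_commute (by decide : (3 : Fin 4) ≠ 0) J J') t
lemma slot4_21 : slot 2 J (slot 1 J' t) = slot 1 J' (slot 2 J t) :=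
  LinearMap.congr_fun (slot_commute (by decide : (2 : Fin 4) ≠ 1) J J') t
lemma slot4_31 : slot 3 J (slot 1 J' t) = slot 1 J' (slot 3 J t) :=
  LinearMap.congr_fun (slot_commute (by decide : (3 : Fin 4) ≠ 1) J J') t
lemma slot4_32 : slot 3 J (slot 2 J' t) = slot 2 J' (slot 3 J t) :=
  LinearMap.congr_fun (slot_commute (by decide : (3 : Fin 4) ≠ 2) J J') t

end FourSlots

/-- The type decomposition of a 4-index array on which `ι` satisfies `3ι² + 8 = 0` is trivial. -/
lemma eq_zero_of_allSlots {J : Matrix (Fin n) (Fin n) ℝ} (hJ : J * J = -1)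
    {W : (Fin 4 → Fin n) → ℝ} (hW : (3 : ℝ) • allSlots J (allSlots J W) + (8 : ℝ) • W = 0) :
    W = 0 := by
  have hs := fun {k : ℕ} (i : Fin k) (t : (Fin k → Fin n) → ℝ) => slot_slot_self hJ i t
  -- Elementary symmetric polynomials of four commuting square roots of `-1`. In terms of them `ι² =
  -- 2e₂ - 4`, `e₂² = 6 - 4e₂ + 6e₄` and `e₄² = 1`.
  set e2 : Module.End ℝ ((Fin 4 → Fin n) → ℝ) := slot 0 J * slot 1 J + slot 0 J * slot 2 J
    + slot 0 J * slot 3 J + slot 1 J * slot 2 J + slot 1 J * slot 3 J + slot 2 J * slot 3 J with h2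
  set e4 : Module.End ℝ ((Fin 4 → Fin n) → ℝ) := slot 0 J * slot 1 J * slot 2 J * slot 3 J with h4
  have a1 : (3 : ℝ) • allSlots J (allSlots J W) + (8 : ℝ) • W = (6 : ℝ) • e2 W - (4 : ℝ) • W := by
    simp only [h2, allSlots, Fin.sum_univ_four, LinearMap.add_apply, Module.End.mul_apply, map_add,
      slot4_10, slot4_20, slot4_30, slot4_21, slot4_31, slot4_32, hs]
    module
  have a2 : e2 (e2 W) = (6 : ℝ) • W - (4 : ℝ) • e2 W + (6 : ℝ) • e4 W := by
    simp only [h2, h4, LinearMap.add_apply, Module.End.mul_apply, map_add, map_neg,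
      slot4_10, slot4_20, slot4_30, slot4_21, slot4_31, slot4_32, hs]
    module
  have a4 : e4 (e4 W) = W := by
    simp only [h4, Module.End.mul_apply, map_neg,
      slot4_10, slot4_20, slot4_30, slot4_21, slot4_31, slot4_32, hs, neg_neg]
  have b1 : e2 W = (2 / 3 : ℝ) • W := by
    rw [a1] at hW
    have : e2 W = (1 / 6 : ℝ) • ((6 : ℝ) • e2 W - (4 : ℝ) • W) + (2 / 3 : ℝ) • W := by module
    rw [this, hW, smul_zero, zero_add]
  -- The hypothesis forces `e₂ = 2/3` on `W`, hence `e₄ = -13/27`. This contradicts `e₄² = 1` unless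
  -- `W = 0`; `729/560` is the inverse of `1 - (13/27)²`.
  have b2 : e4 W = (-13 / 27 : ℝ) • W := by
    have : e4 W = (1 / 6 : ℝ) • ((6 : ℝ) • W - (4 : ℝ) • e2 W + (6 : ℝ) • e4 W)
        - W + (2 / 3 : ℝ) • e2 W := by module
    rw [this, ← a2, b1, map_smul, b1]
    module
  rw [b2, map_smul, b2] at a4
  have : W = (729 / 560 : ℝ) • (W - (-13 / 27 : ℝ) • (-13 / 27 : ℝ) • W) := by module
  rw [this, a4, sub_self, smul_zero]

/-- The hypothesis equates the first and third elementary symmetric polynomials of the slot actions.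
They agree on types `(3,1)`, `(2,2)` and `(1,3)` and are opposite on `(4,0)` and `(0,4)`, so `ι` has
only the eigenvalues `0, ±2i` on `d`. -/
lemma allSlots_cubed_of_type {J : Matrix (Fin n) (Fin n) ℝ} (hJ : J * J = -1)
    {d : (Fin 4 → Fin n) → ℝ}
    (htype : slot 0 J d + slot 1 J d + slot 2 J d + slot 3 J d
      = slot 0 J (slot 1 J (slot 2 J d)) + slot 0 J (slot 1 J (slot 3 J d))
        + slot 0 J (slot 2 J (slot 3 J d)) + slot 1 J (slot 2 J (slot 3 J d))) :
    allSlots J (allSlots J (allSlots J d)) + (4 : ℝ) • allSlots J d = 0 := by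
  have hs := fun {k : ℕ} (i : Fin k) (t : (Fin k → Fin n) → ℝ) => slot_slot_self hJ i t
  rw [← sub_eq_zero] at htype
  refine Eq.trans ?_ ((congrArg (fun t => (-6 : ℝ) • t) htype).trans (smul_zero _))
  simp only [allSlots, Fin.sum_univ_four, LinearMap.add_apply, map_add, map_neg,
    slot4_10, slot4_20, slot4_30, slot4_21, slot4_31, slot4_32, hs]
  module

/-- The torsion equation follows from the vanishing of the `(4,0)` parts of `dC`. -/
lemma torsion_eq_of_type (h : IsFrame U g e) (hJ : IsComplexStr U g J) (hy : y ∈ U)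
    {C : Coord n → (Fin 3 → Fin n) → ℝ} (hCs : SmoothArr U C)
    (hC : ∀ z ∈ U, rot (C z) = C z) (hC' : ∀ z ∈ U, swap12 (C z) = -C z)
    (hB : ∀ z ∈ U, ∀ μ ν l, C z ![μ, ν, l] = bismut g J z μ ν l + holPart J C z μ ν l)
    (htype : slot 0 (J y) (extD C y) + slot 1 (J y) (extD C y) + slot 2 (J y) (extD C y)
        + slot 3 (J y) (extD C y)
      = slot 0 (J y) (slot 1 (J y) (slot 2 (J y) (extD C y)))
        + slot 0 (J y) (slot 1 (J y) (slot 3 (J y) (extD C y)))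
        + slot 0 (J y) (slot 2 (J y) (slot 3 (J y) (extD C y)))
        + slot 1 (J y) (slot 2 (J y) (slot 3 (J y) (extD C y)))) :
    iota J (extD C) y = (2 / 3 : ℝ) • extD (iota J C) y := by
  have hi1 := hCs.iota hJ.smooth
  have hi2 := hi1.iota hJ.smooth
  have hi3 := hi2.iota hJ.smooth
  have hJC : swap12 (iota J C y) = -iota J C y ∧ rot (iota J C y) = iota J C y := by
    rw [iota_eq]
    simp only [allSlots, Fin.sum_univ_three, LinearMap.add_apply, map_add, swap12_slot0, swap12_slot1,
      swap12_slot2, rot_slot0, rot_slot1, rot_slot2, hC y hy, hC' y hy, map_neg]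
    constructor <;> abel
  have L0 := extD_iota_iota h.isOpen hJ.smooth hJ.sq hy (hJ.integrable y hy) hCs (hC' y hy) (hC y hy)
  have L1 := extD_iota_iota h.isOpen hJ.smooth hJ.sq hy (hJ.integrable y hy) hi1 hJC.1 hJC.2
  have hf : SmoothArr U (fundForm g J) := fun m => (hJ.smooth.mul h.smooth_metric) _ _
  have hfd : SmoothArr U (extD (fundForm g J)) := fun m => by
    simp only [extD_two]
    exact ((contDiffOn_pd h.isOpen (hf _) _).sub (contDiffOn_pd h.isOpen (hf _) _)).add
      (contDiffOn_pd h.isOpen (hf _) _)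
  have hi9 : SmoothArr U fun z => (9 : ℝ) • iota J C z := fun m => contDiffOn_const.mul (hi1 m)
  -- `ι³C + 9ιC` is a multiple of `d` of the fundamental form, so its exterior derivative vanishes.
  have L3 : extD (iota J (iota J (iota J C))) y + (9 : ℝ) • extD (iota J C) y = 0 := by
    rw [← extD_smul 9 h.isOpen hi1 hy, ← extD_add h.isOpen hi3 hi9 hy,
      extD_congr h.isOpen hy fun z hz => iota_cubed_add h hJ hz (hC z hz) (hB z hz),
      extD_smul _ h.isOpen hfd hy, extD_extD h.isOpen hf hy, smul_zero]
  set d0 := extD C y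
  set d1 := extD (iota J C) y
  have hd2 : extD (iota J (iota J C)) y = (2 : ℝ) • allSlots (J y) d1
      - allSlots (J y) (allSlots (J y) d0) - d0 := by
    rw [← sub_eq_zero, ← L0]; abel
  rw [hd2] at L1
  have hd3 : extD (iota J (iota J (iota J C))) y = -((9 : ℝ) • d1) := eq_neg_of_add_eq_zero_left L3
  rw [hd3] at L1
  have ht := allSlots_cubed_of_type (hJ.sq y hy) htype
  -- Eliminating `dι²C` and `dι³C` gives `(3ι² + 8) d1 = 2ι³d0 + 2ι d0`. By `ht` the right side is
  -- `-6ι d0`, which is also `3ι² + 8` applied to `(3/2) ι d0`.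
  have hW : d1 - (3 / 2 : ℝ) • allSlots (J y) d0 = 0 := by
    refine eq_zero_of_allSlots (hJ.sq y hy) ?_
    have e1 := congrArg (fun t => -t) L1
    have e2 := congrArg (fun t => -(5 / 2 : ℝ) • t) ht
    rw [neg_zero] at e1
    rw [smul_zero] at e2
    refine Eq.trans ?_ ((congrArg₂ (· + ·) e1 e2).trans (add_zero 0))
    simp only [map_sub, map_smul]
    module
  rw [iota_eq, sub_eq_zero.1 hW]
  module

end TorsionEquation

end CliffordKT

namespace CliffordKT

/-! ## Differential operators on an open set -/

section Concrete

open Topology TopologicalSpace Matrix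

variable {n : ℕ} {U : Opens (Coord n)}

section ZeroExtension

set_option linter.unusedSectionVars false

variable {W : Type*} [NormedAddCommGroup W] [NormedSpace ℂ W]

open Classical in
/-- The extension by zero of a function on an open set. -/
def zext (f : U → W) (y : Coord n) : W := if h : y ∈ U then f ⟨y, h⟩ else 0

lemma zext_of_mem (f : U → W) {y : Coord n} (h : y ∈ U) : zext f y = f ⟨y, h⟩ := dif_pos h

/-- Smooth functions on an open set. -/
def IsSmooth (f : U → W) : Prop := ContDiffOn ℝ ∞ (zext f) U

lemma isSmooth_of_eq {f : U → W} {Ψ : Coord n → W} (hΨ : ContDiffOn ℝ ∞ Ψ U)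
    (h : ∀ y : U, f y = Ψ y) : IsSmooth f :=
  hΨ.congr fun y hy => by rw [zext_of_mem f hy, h]

/-- The partial derivative of a function on an open set. -/
def pdv (μ : Fin n) (f : U → W) (y : U) : W :=
  fderiv ℝ (zext f) y (EuclideanSpace.single μ 1)

lemma pdv_of_eq {f : U → W} {Ψ : Coord n → W} (h : ∀ y : U, f y = Ψ y) (μ : Fin n) (y : U) :
    pdv μ f y = fderiv ℝ Ψ y (EuclideanSpace.single μ 1) := by
  have : zext f =ᶠ[𝓝 (y : Coord n)] Ψ := by
    filter_upwards [U.isOpen.mem_nhds y.2] with z hz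
    rw [zext_of_mem f hz, h]
  rw [pdv, this.fderiv_eq]

lemma IsSmooth.pdv {f : U → W} (hf : IsSmooth f) (μ : Fin n) : IsSmooth (pdv μ f) :=
  isSmooth_of_eq (contDiffOn_fderiv_apply U.isOpen hf _) fun _ => rfl

lemma IsSmooth.differentiableAt {f : U → W} (hf : IsSmooth f) (y : U) :
    DifferentiableAt ℝ (zext f) y := differentiableAt_of_contDiffOn U.isOpen hf y.2

lemma IsSmooth.add {f f' : U → W} (hf : IsSmooth f) (hf' : IsSmooth f') :
    IsSmooth fun y => f y + f' y :=
  isSmooth_of_eq (ContDiffOn.add hf hf') fun y => by rw [zext_of_mem _ y.2, zext_of_mem _ y.2]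

lemma IsSmooth.smul {f : U → ℂ} {s : U → W} (hf : IsSmooth f) (hs : IsSmooth s) :
    IsSmooth fun y => f y • s y :=
  isSmooth_of_eq (Ψ := fun y => zext f y • zext s y) (ContDiffOn.smul hf hs) fun y => by rw [zext_of_mem _ y.2, zext_of_mem _ y.2]

lemma IsSmooth.const (w : W) : IsSmooth fun _ : U => w :=
  isSmooth_of_eq contDiffOn_const fun _ => rfl

lemma IsSmooth.clm {W' : Type*} [NormedAddCommGroup W'] [NormedSpace ℂ W'] (L : W →L[ℂ] W')
    {s : U → W} (hs : IsSmooth s) : IsSmooth fun y => L (s y) :=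
  isSmooth_of_eq ((L.restrictScalars ℝ).contDiff.comp_contDiffOn hs) fun y => by
    rw [Function.comp_apply, zext_of_mem _ y.2]; rfl

lemma pdv_add {f f' : U → W} (hf : IsSmooth f) (hf' : IsSmooth f') (μ : Fin n) (y : U) :
    pdv μ (fun y => f y + f' y) y = pdv μ f y + pdv μ f' y := by
  rw [pdv_of_eq (Ψ := fun y => zext f y + zext f' y)
    (fun y => by rw [zext_of_mem _ y.2, zext_of_mem _ y.2]),
    fderiv_fun_add (hf.differentiableAt y) (hf'.differentiableAt y)]
  rfl

lemma pdv_smul {f : U → ℂ} {s : U → W} (hf : IsSmooth f) (hs : IsSmooth s) (μ : Fin n) (y : U) :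
    pdv μ (fun y => f y • s y) y = f y • pdv μ s y + pdv μ f y • s y := by
  rw [pdv_of_eq (Ψ := fun y => zext f y • zext s y)
    (fun y => by rw [zext_of_mem _ y.2, zext_of_mem _ y.2]),
    fderiv_fun_smul (hf.differentiableAt y) (hs.differentiableAt y)]
  simp [pdv, zext_of_mem _ y.2]

lemma pdv_const (w : W) (μ : Fin n) (y : U) : pdv μ (fun _ => w) y = 0 := by
  rw [pdv_of_eq (Ψ := fun _ => w) fun _ => rfl]; simp

lemma pdv_clm {W' : Type*} [NormedAddCommGroup W'] [NormedSpace ℂ W'] (L : W →L[ℂ] W')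
    {s : U → W} (hs : IsSmooth s) (μ : Fin n) (y : U) :
    pdv μ (fun y => L (s y)) y = L (pdv μ s y) := by
  rw [pdv_of_eq (Ψ := fun y => (L.restrictScalars ℝ) (zext s y))
    (fun y => by rw [zext_of_mem _ y.2]; rfl)]
  have := ((L.restrictScalars ℝ).hasFDerivAt.comp (y : Coord n)
    (hs.differentiableAt y).hasFDerivAt).fderiv
  rw [Function.comp_def] at this
  rw [this]
  rfl

lemma pdv_comm {f : U → W} (hf : IsSmooth f) (μ ν : Fin n) (y : U) :
    pdv μ (pdv ν f) y = pdv ν (pdv μ f) y := by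
  rw [pdv_of_eq (f := pdv ν f)
      (Ψ := fun z => fderiv ℝ (zext f) z (EuclideanSpace.single ν 1)) fun _ => rfl,
    pdv_of_eq (f := pdv μ f)
      (Ψ := fun z => fderiv ℝ (zext f) z (EuclideanSpace.single μ 1)) fun _ => rfl]
  exact fderiv_fderiv_comm U.isOpen hf y.2 _ _

end ZeroExtension

/-- The algebra of smooth complex functions on an open set. -/
def smoothFun (U : Opens (Coord n)) : Subalgebra ℂ (U → ℂ) where
  carrier := {f | IsSmooth f}
  mul_mem' hf hg := IsSmooth.smul hf hg
  add_mem' hf hg := IsSmooth.add hf hg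
  algebraMap_mem' c := IsSmooth.const c

variable {S : Type*} [NormedAddCommGroup S] [NormedSpace ℂ S]

/-- The smooth functions on an open set with values in a vector space. -/
def smoothSec (U : Opens (Coord n)) (S : Type*) [NormedAddCommGroup S] [NormedSpace ℂ S] :
    Submodule ℂ (U → S) where
  carrier := {f | IsSmooth f}
  add_mem' hf hg := IsSmooth.add hf hg
  zero_mem' := IsSmooth.const 0
  smul_mem' c _ hf := IsSmooth.smul (IsSmooth.const c) hf

/-- Multiplication by smooth functions. -/
def mulOp (U : Opens (Coord n)) (S : Type*) [NormedAddCommGroup S] [NormedSpace ℂ S] :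
    smoothFun U →ₐ[ℂ] Module.End ℂ (smoothSec U S) where
  toFun f :=
    { toFun s := ⟨fun y => f.1 y • s.1 y, IsSmooth.smul f.2 s.2⟩
      map_add' _ _ := Subtype.ext (funext fun _ => smul_add _ _ _)
      map_smul' _ _ := Subtype.ext (funext fun _ => smul_comm _ _ _) }
  map_one' := LinearMap.ext fun _ => Subtype.ext (funext fun _ => one_smul _ _)
  map_mul' _ _ := LinearMap.ext fun _ => Subtype.ext (funext fun _ => mul_smul _ _ _)
  map_zero' := LinearMap.ext fun _ => Subtype.ext (funext fun _ => zero_smul _ _)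
  map_add' _ _ := LinearMap.ext fun _ => Subtype.ext (funext fun _ => add_smul _ _ _)
  commutes' _ := LinearMap.ext fun _ => Subtype.ext (funext fun _ => rfl)

/-- The partial derivatives of vector-valued functions. -/
def derivOp (U : Opens (Coord n)) (S : Type*) [NormedAddCommGroup S] [NormedSpace ℂ S] (μ : Fin n) :
    Module.End ℂ (smoothSec U S) where
  toFun s := ⟨pdv μ s.1, IsSmooth.pdv s.2 μ⟩
  map_add' s t := Subtype.ext (funext fun y => pdv_add s.2 t.2 μ y)
  map_smul' c s := Subtype.ext (funext fun y => by
    have := pdv_smul (IsSmooth.const (U := U) c) s.2 μ y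
    rw [pdv_const, zero_smul, add_zero] at this
    exact this)

/-- The partial derivatives of functions. -/
def derivFun (U : Opens (Coord n)) (μ : Fin n) : Derivation ℂ (smoothFun U) (smoothFun U) :=
  Derivation.mk'
    { toFun f := ⟨pdv μ f.1, IsSmooth.pdv f.2 μ⟩
      map_add' s t := Subtype.ext (funext fun y => pdv_add s.2 t.2 μ y)
      map_smul' c s := Subtype.ext (funext fun y => by
        have := pdv_smul (IsSmooth.const (U := U) c) s.2 μ y
        rw [pdv_const, zero_smul, add_zero] at this
        exact this) }
    fun f f' => Subtype.ext (funext fun y => by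
      refine (pdv_smul f.2 f'.2 μ y).trans ?_
      simp only [smul_eq_mul, mul_comm (pdv μ f.1 y)]
      rfl)

/-- A linear operator on the values. -/
def valueOp (U : Opens (Coord n)) [FiniteDimensional ℂ S] (L : Module.End ℂ S) :
    Module.End ℂ (smoothSec U S) where
  toFun s := ⟨fun y => L (s.1 y), IsSmooth.clm (LinearMap.toContinuousLinearMap L) s.2⟩
  map_add' _ _ := Subtype.ext (funext fun _ => map_add _ _ _)
  map_smul' _ _ := Subtype.ext (funext fun _ => map_smul _ _ _)

/-- The coordinate functions. -/
def coordFun (U : Opens (Coord n)) (μ : Fin n) : smoothFun U :=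
  ⟨fun y => ((y.1 μ : ℝ) : ℂ), isSmooth_of_eq (Ψ := fun y : Coord n => ((y μ : ℝ) : ℂ))
    ((Complex.ofRealCLM.comp (EuclideanSpace.proj μ : Coord n →L[ℝ] ℝ)).contDiff.contDiffOn)
    fun _ => rfl⟩

/-- The algebra of differential operators on functions with values in a representation of the
canonical anticommutation relations. -/
def diffOps (U : Opens (Coord n)) [FiniteDimensional ℂ S] (F : FermionRep n S) :
    DiffOpAlg n (smoothFun U) (Module.End ℂ (smoothSec U S)) where
  m := mulOp U S
  δ := derivFun U
  x := coordFun U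
  ψ a := valueOp U (F.ψ a)
  d := derivOp U S
  ψ_anticomm a b := LinearMap.ext fun s => Subtype.ext (funext fun y => by
    have := LinearMap.congr_fun (F.anticomm a b) (s.1 y)
    refine Eq.trans this ?_
    split_ifs <;> rfl)
  ψ_m a f := LinearMap.ext fun s => Subtype.ext (funext fun y => map_smul _ _ _)
  d_ψ μ a := LinearMap.ext fun s => Subtype.ext (funext fun y =>
    pdv_clm (LinearMap.toContinuousLinearMap (F.ψ a)) s.2 μ y)
  d_m μ f := LinearMap.ext fun s => Subtype.ext (funext fun y => pdv_smul f.2 s.2 μ y)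
  d_comm μ ν := LinearMap.ext fun s => Subtype.ext (funext fun y => pdv_comm s.2 μ ν y)
  δ_x μ ν := Subtype.ext (funext fun y => by
    refine (pdv_of_eq (Ψ := fun y : Coord n => ((y ν : ℝ) : ℂ)) (fun _ => rfl) μ y).trans ?_
    have : fderiv ℝ (fun y : Coord n => ((y ν : ℝ) : ℂ)) y
        = Complex.ofRealCLM.comp (EuclideanSpace.proj ν : Coord n →L[ℝ] ℝ) :=
      (Complex.ofRealCLM.comp (EuclideanSpace.proj ν : Coord n →L[ℝ] ℝ)).fderiv
    rw [this]
    by_cases h : μ = ν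
    · subst h; simp
    · rw [if_neg h]; simp [Ne.symm h])

/-- Testing on a constant nonzero section; this is where the representation space must be nonzero.
-/
lemma mulOp_injective [Nontrivial S] : Function.Injective (mulOp U S) := by
  rw [injective_iff_map_eq_zero]
  intro f hf
  obtain ⟨s, hs⟩ := exists_ne (0 : S)
  refine Subtype.ext (funext fun y => ?_)
  have := congrFun (congrArg Subtype.val (LinearMap.congr_fun hf
    (⟨fun _ => s, IsSmooth.const s⟩ : smoothSec U S))) y
  exact (smul_eq_zero.1 this).resolve_right hs

/-- Evaluation of functions at a point. -/
def evalAt (y : U) : smoothFun U →ₐ[ℂ] ℂ := (Pi.evalAlgHom ℂ _ y).comp (smoothFun U).val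

/-- The operator on the values at a point which an operator induces on constant functions. -/
def symbolAt (y : U) : Module.End ℂ (smoothSec U S) →ₗ[ℂ] Module.End ℂ S where
  toFun Z :=
    { toFun s := (Z ⟨fun _ => s, IsSmooth.const s⟩).1 y
      map_add' s t := by
        have : (⟨fun _ => s + t, IsSmooth.const _⟩ : smoothSec U S)
          = ⟨fun _ => s, IsSmooth.const s⟩ + ⟨fun _ => t, IsSmooth.const t⟩ := rfl
        rw [this, map_add]; rfl
      map_smul' c s := by
        have : (⟨fun _ => c • s, IsSmooth.const _⟩ : smoothSec U S)
          = c • ⟨fun _ => s, IsSmooth.const s⟩ := rfl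
        rw [this, map_smul]; rfl }
  map_add' _ _ := rfl
  map_smul' _ _ := rfl

/-- The normalized trace of an operator at a point. -/
def traceAt (y : U) : Module.End ℂ (smoothSec U S) →ₗ[ℂ] ℂ :=
  ((Module.finrank ℂ S : ℂ)⁻¹) • (LinearMap.trace ℂ S ∘ₗ symbolAt y)

lemma traceAt_mul (y : U) (f : smoothFun U) (Z : Module.End ℂ (smoothSec U S)) :
    traceAt y (mulOp U S f * Z) = evalAt y f * traceAt y Z := by
  have : symbolAt y (mulOp U S f * Z) = f.1 y • symbolAt y Z := rfl
  simp only [traceAt, LinearMap.smul_apply, LinearMap.comp_apply, this, map_smul, smul_eq_mul]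
  rw [mul_left_comm]
  rfl

/-- Operators on values preserve constant sections, so here the induced operator of a product is the
product of the induced operators, which fails for products of general differential operators. -/
lemma traceAt_cyclic [FiniteDimensional ℂ S] (y : U) (L : Module.End ℂ S)
    (Z : Module.End ℂ (smoothSec U S)) :
    traceAt y (Z * valueOp U L) = traceAt y (valueOp U L * Z) := by
  have h1 : symbolAt y (Z * valueOp U L) = symbolAt y Z * L := rfl
  have h2 : symbolAt y (valueOp U L * Z) = L * symbolAt y Z := rfl
  simp only [traceAt, LinearMap.smul_apply, LinearMap.comp_apply, h1, h2, LinearMap.trace_mul_comm]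

lemma traceAt_one [FiniteDimensional ℂ S] [Nontrivial S] (y : U) :
    traceAt y (1 : Module.End ℂ (smoothSec U S)) = 1 := by
  have h1 : symbolAt y (1 : Module.End ℂ (smoothSec U S)) = 1 := rfl
  simp only [traceAt, LinearMap.smul_apply, LinearMap.comp_apply, h1, LinearMap.trace_one,
    smul_eq_mul]
  exact inv_mul_cancel₀ (Nat.cast_ne_zero.2 Module.finrank_pos.ne')

end Concrete

end CliffordKT

namespace CliffordKT

/-! ## Quantization as a differential operator -/

section Quantization

set_option linter.unusedSectionVars false

open Topology TopologicalSpace Matrix DiffOpAlg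

variable {n : ℕ} {U : Opens (Coord n)}

/-- A smooth real function as an element of the algebra of smooth complex functions. -/
def realFun {f : Coord n → ℝ} (hf : ContDiffOn ℝ ∞ f U) : smoothFun U :=
  ⟨fun y => (f y : ℂ), isSmooth_of_eq (Ψ := fun y => (f y : ℂ))
    (Complex.ofRealCLM.contDiff.comp_contDiffOn hf) fun _ => rfl⟩

lemma evalAt_realFun {f : Coord n → ℝ} (hf : ContDiffOn ℝ ∞ f U) (y : U) :
    evalAt y (realFun hf) = (f y : ℂ) := rfl

lemma evalAt_derivFun_realFun {f : Coord n → ℝ} (hf : ContDiffOn ℝ ∞ f U) (μ : Fin n) (y : U) :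
    evalAt y (derivFun U μ (realFun hf)) = (pd μ f y : ℂ) := by
  refine (pdv_of_eq (Ψ := fun y => (f y : ℂ)) (fun _ => rfl) μ y).trans ?_
  have := (Complex.ofRealCLM.hasFDerivAt.comp (y : Coord n)
    (differentiableAt_of_contDiffOn U.isOpen hf y.2).hasFDerivAt).fderiv
  rw [Function.comp_def] at this
  exact congrFun (congrArg DFunLike.coe this) _

lemma evalAt_injective {f f' : smoothFun U} (h : ∀ y, evalAt y f = evalAt y f') : f = f' :=
  Subtype.ext (funext h)

variable {S : Type*} [NormedAddCommGroup S] [NormedSpace ℂ S] [FiniteDimensional ℂ S]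

lemma sum_apply_val {κ : Type*} (I : Finset κ) (Z : κ → Module.End ℂ (smoothSec U S))
    (s : smoothSec U S) (y : U) : ((∑ k ∈ I, Z k) s).1 y = ∑ k ∈ I, (Z k s).1 y := by
  rw [LinearMap.sum_apply, AddSubmonoidClass.coe_finsetSum, Finset.sum_apply]

variable (F : FermionRep n S)

lemma lin_val (u : Fin n → smoothFun U) (s : smoothSec U S) (y : U) :
    ((diffOps U F).lin u s).1 y = ∑ a, evalAt y (u a) • F.ψ a (s.1 y) := by
  rw [lin, sum_apply_val]; rfl

lemma cub_val (u : Fin n → Fin n → Fin n → smoothFun U) (s : smoothSec U S) (y : U) :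
    ((diffOps U F).cub u s).1 y
      = ∑ a, ∑ b, ∑ c, evalAt y (u a b c) • (F.ψ a * F.ψ b * F.ψ c) (s.1 y) := by
  rw [cub, sum_apply_val]
  refine Finset.sum_congr rfl fun a _ => ?_
  rw [sum_apply_val]
  refine Finset.sum_congr rfl fun b _ => ?_
  rw [sum_apply_val]
  rfl

lemma charge_val (v : Fin n → Fin n → smoothFun U) (t : Fin n → Fin n → Fin n → smoothFun U)
    (s : smoothSec U S) (y : U) :
    ((diffOps U F).charge v t s).1 y = ∑ a, ∑ μ, F.ψ a (evalAt y (v a μ) • pdv μ s.1 y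
        + ((1 / 2 : ℂ) * evalAt y (derivFun U μ (v a μ))) • s.1 y)
      + ∑ a, ∑ b, ∑ c, evalAt y (t a b c) • (F.ψ a * F.ψ b * F.ψ c) (s.1 y) := by
  have h0 : ((diffOps U F).charge v t s).1 y = (∑ μ, (((diffOps U F).lin (fun a => v a μ))
      (derivOp U S μ s)).1 y) + (((diffOps U F).lin (fun a => (1 / 2 : ℂ) •
        ∑ μ, derivFun U μ (v a μ)) s).1 y + ((diffOps U F).cub t s).1 y) := by
    rw [charge, LinearMap.add_apply, order0, LinearMap.add_apply]
    exact congrArg (fun w : S => w + _) (sum_apply_val _ _ _ _)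
  rw [h0, lin_val, cub_val, ← add_assoc]
  congr 1
  simp only [lin_val]
  rw [Finset.sum_comm, ← Finset.sum_add_distrib]
  refine Finset.sum_congr rfl fun a _ => ?_
  rw [map_smul, map_sum, Finset.smul_sum, Finset.sum_smul, ← Finset.sum_add_distrib]
  refine Finset.sum_congr rfl fun μ _ => ?_
  rw [map_add, map_smul, map_smul]
  rfl

/-- Renaming summation indices moves the antisymmetrization from the fermions to the coefficients.
-/
lemma sum_weylCubic (T : Fin n → Fin n → Fin n → ℝ) (s : S) :
    ∑ a, ∑ b, ∑ c, (Complex.I * (T a b c : ℂ)) • weylCubic F a b c s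
      = ∑ a, ∑ b, ∑ c, (Complex.I * (((1 / 6 : ℝ) * alt3 T a b c : ℝ) : ℂ))
        • (F.ψ a * F.ψ b * F.ψ c) s := by
  set Z : Fin n → Fin n → Fin n → S := fun a b c => (F.ψ a * F.ψ b * F.ψ c) s with hZ
  set k : Fin n → Fin n → Fin n → ℂ := fun a b c => Complex.I * (T a b c : ℂ) * (1 / 6) with hk
  have p12 : ∀ f : Fin n → Fin n → Fin n → S, ∑ a, ∑ b, ∑ c, f a b c = ∑ a, ∑ b, ∑ c, f b a c :=
    fun f => Finset.sum_comm
  have p23 : ∀ f : Fin n → Fin n → Fin n → S, ∑ a, ∑ b, ∑ c, f a b c = ∑ a, ∑ b, ∑ c, f a c b :=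
    fun f => Finset.sum_congr rfl fun a _ => Finset.sum_comm
  have e1 : ∑ a, ∑ b, ∑ c, k a b c • Z b c a = ∑ a, ∑ b, ∑ c, k c a b • Z a b c := by
    rw [p12, p23]
  have e2 : ∑ a, ∑ b, ∑ c, k a b c • Z c a b = ∑ a, ∑ b, ∑ c, k b c a • Z a b c := by
    rw [p23, p12]
  have e3 : ∑ a, ∑ b, ∑ c, k a b c • Z b a c = ∑ a, ∑ b, ∑ c, k b a c • Z a b c := by
    rw [p12]
  have e4 : ∑ a, ∑ b, ∑ c, k a b c • Z a c b = ∑ a, ∑ b, ∑ c, k a c b • Z a b c := by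
    rw [p23]
  have e5 : ∑ a, ∑ b, ∑ c, k a b c • Z c b a = ∑ a, ∑ b, ∑ c, k c b a • Z a b c := by
    rw [p12, p23, p12]
  have hl : ∀ a b c, (Complex.I * (T a b c : ℂ)) • weylCubic F a b c s
      = k a b c • Z a b c + k a b c • Z b c a + k a b c • Z c a b - k a b c • Z b a c
        - k a b c • Z a c b - k a b c • Z c b a := by
    intro a b c
    simp only [weylCubic, LinearMap.smul_apply, LinearMap.add_apply, LinearMap.sub_apply, hk, hZ]
    module
  have hr : ∀ a b c, (Complex.I * (((1 / 6 : ℝ) * alt3 T a b c : ℝ) : ℂ)) • Z a b c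
      = k a b c • Z a b c + k c a b • Z a b c + k b c a • Z a b c - k b a c • Z a b c
        - k a c b • Z a b c - k c b a • Z a b c := by
    intro a b c
    simp only [alt3, hk, Complex.ofReal_mul, Complex.ofReal_sub, Complex.ofReal_add,
      Complex.ofReal_div, Complex.ofReal_one, Complex.ofReal_ofNat]
    module
  change _ = ∑ a, ∑ b, ∑ c, (Complex.I * (((1 / 6 : ℝ) * alt3 T a b c : ℝ) : ℂ)) • Z a b c
  simp only [hl, hr, Finset.sum_add_distrib, Finset.sum_sub_distrib, e1, e2, e3, e4, e5]

/-- The operator of a smooth classical charge with alternating cubic coefficients. -/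
def chargeOp {v : Fin n → Fin n → Coord n → ℝ} (hv : ∀ a μ, ContDiffOn ℝ ∞ (v a μ) U)
    {t : Fin n → Fin n → Fin n → Coord n → ℝ} (ht : ∀ a b c, ContDiffOn ℝ ∞ (t a b c) U) :
    Module.End ℂ (smoothSec U S) :=
  (diffOps U F).charge (fun a μ => (-Complex.I) • realFun (hv a μ))
    (fun a b c => Complex.I • realFun (ht a b c))

variable {v : Fin n → Fin n → Coord n → ℝ} {hv : ∀ a μ, ContDiffOn ℝ ∞ (v a μ) U}
  {t : Fin n → Fin n → Fin n → Coord n → ℝ} {ht : ∀ a b c, ContDiffOn ℝ ∞ (t a b c) U}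
  {q : ClassicalCharge n}

lemma weylOrder_eq (hqv : ∀ y ∈ U, ∀ a μ, q.v y a μ = v a μ y)
    (hqt : ∀ y ∈ U, ∀ a b c, (1 / 6) * alt3 (q.T y) a b c = t a b c y)
    (s : smoothSec U S) {Ψ : Coord n → S} (hΨ : ∀ y : U, Ψ y = s.1 y) (y : U) :
    weylOrder F q Ψ y = (chargeOp F hv ht s).1 y := by
  rw [chargeOp, charge_val, weylOrder, sum_weylCubic]
  congr 1
  · refine Finset.sum_congr rfl fun a _ => Finset.sum_congr rfl fun μ _ => ?_
    rw [← map_smul]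
    congr 1
    have e1 : momentum μ Ψ y = (-Complex.I) • pdv μ s.1 y := by
      rw [momentum, ← pdv_of_eq (f := s.1) fun y => (hΨ y).symm]
    have e2 : momentum μ (fun z => ((q.v z a μ : ℝ) : ℂ) • Ψ z) y
        = (-Complex.I) • (((v a μ y : ℝ) : ℂ) • pdv μ s.1 y + ((pd μ (v a μ) y : ℝ) : ℂ) • s.1 y) := by
      rw [momentum, ← pdv_of_eq (f := fun z : U => (realFun (hv a μ)).1 z • s.1 z) fun y => by
        rw [hΨ, hqv y y.2]; rfl, pdv_smul (realFun (hv a μ)).2 s.2]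
      congr 2
      exact congrArg (· • s.1 y) (evalAt_derivFun_realFun (hv a μ) μ y)
    rw [e1, e2, hqv y y.2, map_smul, Derivation.map_smul, map_smul, evalAt_derivFun_realFun,
      evalAt_realFun]
    simp only [smul_eq_mul]
    module
  · refine Finset.sum_congr rfl fun a _ => Finset.sum_congr rfl fun b _ =>
      Finset.sum_congr rfl fun c _ => ?_
    rw [hqt y y.2, hΨ, map_smul, evalAt_realFun]
    rfl

lemma contDiffOn_rpow {f : Coord n → ℝ} (hf : ContDiffOn ℝ ∞ f U) (h : ∀ y ∈ U, 0 < f y) (r : ℝ) :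
    ContDiffOn ℝ ∞ (fun y => f y ^ r) U := hf.rpow_const_of_ne fun y hy => (h y hy).ne'

/-- A frame on an open set gives a smooth positive metric density. -/
lemma IsFrame.contDiffOn_det_rpow {g e : Coord n → Matrix (Fin n) (Fin n) ℝ}
    (h : IsFrame (U : Set (Coord n)) g e) (r : ℝ) :
    ContDiffOn ℝ ∞ (fun y => (g y).det ^ r) U :=
  contDiffOn_rpow (contDiffOn_det h.smooth_metric) (fun _ hy => h.det_metric_pos hy) r

/-- Conjugation with a power of the metric density. -/
def conjDensity {g e : Coord n → Matrix (Fin n) (Fin n) ℝ}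
    (h : IsFrame (U : Set (Coord n)) g e) (Z : Module.End ℂ (smoothSec U S)) :
    Module.End ℂ (smoothSec U S) :=
  mulOp U S (realFun (h.contDiffOn_det_rpow (-(1 / 4)))) * Z
    * mulOp U S (realFun (h.contDiffOn_det_rpow (1 / 4)))

lemma quantize_eq {g e : Coord n → Matrix (Fin n) (Fin n) ℝ}
    (h : IsFrame (U : Set (Coord n)) g e) (hqv : ∀ y ∈ U, ∀ a μ, q.v y a μ = v a μ y)
    (hqt : ∀ y ∈ U, ∀ a b c, (1 / 6) * alt3 (q.T y) a b c = t a b c y)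
    (s : smoothSec U S) {Ψ : Coord n → S} (hΨ : ∀ y : U, Ψ y = s.1 y) (y : U) :
    quantize F g q Ψ y = (conjDensity h (chargeOp F hv ht) s).1 y := by
  rw [quantize, weylOrder_eq F (hv := hv) (ht := ht) hqv hqt
    (mulOp U S (realFun (h.contDiffOn_det_rpow (1 / 4))) s) (fun y => by rw [hΨ]; rfl)]
  rfl

lemma density_mul {g e : Coord n → Matrix (Fin n) (Fin n) ℝ}
    (h : IsFrame (U : Set (Coord n)) g e) :
    realFun (h.contDiffOn_det_rpow (1 / 4)) * realFun (h.contDiffOn_det_rpow (-(1 / 4))) = 1 :=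
  evalAt_injective fun y => by
    rw [map_mul, map_one, evalAt_realFun, evalAt_realFun, ← Complex.ofReal_mul,
      ← Real.rpow_add (h.det_metric_pos y.2)]
    simp

/-- The two powers of the density are mutually inverse, so conjugation preserves all quadratic
relations. Together with injectivity this allows the algebra to be checked without the density. -/
lemma conjDensity_mul {g e : Coord n → Matrix (Fin n) (Fin n) ℝ}
    (h : IsFrame (U : Set (Coord n)) g e) (Z Z' : Module.End ℂ (smoothSec U S)) :
    conjDensity h (Z * Z') = conjDensity h Z * conjDensity h Z' := by
  have e1 : mulOp U S (realFun (h.contDiffOn_det_rpow (1 / 4)))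
      * mulOp U S (realFun (h.contDiffOn_det_rpow (-(1 / 4)))) = 1 := by
    rw [← map_mul, density_mul h, map_one]
  unfold conjDensity
  generalize mulOp U S (realFun (h.contDiffOn_det_rpow (1 / 4))) = A at *
  generalize mulOp U S (realFun (h.contDiffOn_det_rpow (-(1 / 4)))) = B at *
  calc B * (Z * Z') * A = B * Z * 1 * Z' * A := by noncomm_ring
    _ = B * Z * (A * B) * Z' * A := by rw [e1]
    _ = _ := by noncomm_ring

lemma conjDensity_add {g e : Coord n → Matrix (Fin n) (Fin n) ℝ}
    (h : IsFrame (U : Set (Coord n)) g e) (Z Z' : Module.End ℂ (smoothSec U S)) :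
    conjDensity h (Z + Z') = conjDensity h Z + conjDensity h Z' := by
  unfold conjDensity; noncomm_ring

lemma conjDensity_injective {g e : Coord n → Matrix (Fin n) (Fin n) ℝ}
    (h : IsFrame (U : Set (Coord n)) g e) :
    Function.Injective (conjDensity (S := S) h) := by
  have e1 : mulOp U S (realFun (h.contDiffOn_det_rpow (1 / 4)))
      * mulOp U S (realFun (h.contDiffOn_det_rpow (-(1 / 4)))) = 1 := by
    rw [← map_mul, density_mul h, map_one]
  intro Z Z' hZ
  unfold conjDensity at hZ
  generalize mulOp U S (realFun (h.contDiffOn_det_rpow (1 / 4))) = A at *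
  generalize mulOp U S (realFun (h.contDiffOn_det_rpow (-(1 / 4)))) = B at *
  calc Z = A * B * Z * (A * B) := by rw [e1, one_mul, mul_one]
    _ = A * (B * Z * A) * B := by noncomm_ring
    _ = A * (B * Z' * A) * B := by rw [hZ]
    _ = A * B * Z' * (A * B) := by noncomm_ring
    _ = Z' := by rw [e1, one_mul, mul_one]

omit [FiniteDimensional ℂ S] in
lemma smoothSec_ext_iff (s s' : smoothSec U S) : s = s' ↔ ∀ y, s.1 y = s'.1 y :=
  Subtype.ext_iff.trans funext_iff

/-- An operator on functions acts on the smooth functions on an open set as a given endomorphism. -/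
def Represents (q : (Coord n → S) → Coord n → S) (Z : Module.End ℂ (smoothSec U S)) : Prop :=
  ∀ (s : smoothSec U S) (Ψ : Coord n → S), (∀ y : U, Ψ y = s.1 y) → ∀ y : U, q Ψ y = (Z s).1 y

/-- The supersymmetry algebra as relations between endomorphisms. -/
lemma formsSusyAlgebra_iff {N : ℕ} {q : Fin N → (Coord n → S) → Coord n → S}
    {Z : Fin N → Module.End ℂ (smoothSec U S)} (h : ∀ A, Represents (q A) (Z A)) (A₀ : Fin N) :
    FormsSusyAlgebra (U : Set (Coord n)) q ↔
      ∀ A B, Z A * Z B + Z B * Z A = if A = B then (2 : ℂ) • (Z A₀ * Z A₀) else 0 := by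
  have hq : ∀ A B (s : smoothSec U S) (Ψ : Coord n → S), (∀ y : U, Ψ y = s.1 y) → ∀ y : U,
      q A (q B Ψ) y + q B (q A Ψ) y = ((Z A * Z B + Z B * Z A) s).1 y := by
    intro A B s Ψ hΨ y
    rw [h A (Z B s) (q B Ψ) (h B s Ψ hΨ) y, h B (Z A s) (q A Ψ) (h A s Ψ hΨ) y]
    rfl
  constructor
  · rintro ⟨H, hH⟩ A B
    refine LinearMap.ext fun s => (smoothSec_ext_iff _ _).2 fun y => ?_
    have hs : ∀ A B, ((Z A * Z B + Z B * Z A) s).1 y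
        = if A = B then (2 : ℂ) • H (zext s.1) y else 0 := fun A B => by
      -- The algebra is tested on the zero extension of the section; its values outside the open set
      -- do not matter.
      rw [← hq A B s (zext s.1) (fun y => zext_of_mem _ y.2) y]
      exact hH A B _ s.2 y y.2
    rw [hs]
    split_ifs
    · have := hs A₀ A₀
      rw [if_pos rfl, ← two_smul ℂ] at this
      exact this.symm
    · rfl
  · intro hZ
    refine ⟨fun Ψ y => q A₀ (q A₀ Ψ) y, fun A B Ψ hΨ y hy => ?_⟩
    -- The Hamiltonian is taken to be the square of the charge `A₀`.
    set s : smoothSec U S := ⟨fun y => Ψ y, isSmooth_of_eq hΨ fun _ => rfl⟩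
    have e := hq A B s Ψ (fun _ => rfl) ⟨y, hy⟩
    have e0 := hq A₀ A₀ s Ψ (fun _ => rfl) ⟨y, hy⟩
    rw [← two_smul ℂ] at e0
    rw [hZ, if_pos rfl] at e0
    refine e.trans ?_
    rw [hZ]
    split_ifs
    · exact e0.symm
    · rfl

end Quantization

end CliffordKT

namespace CliffordKT

/-! ## The supercharges in the vielbein frame -/

section FrameCharges

open Topology Matrix DiffOpAlg

section Pointwise

set_option linter.unusedSectionVars false

variable {ι : Type*} [Fintype ι] [DecidableEq ι] {G E J J' : Matrix ι ι ℝ}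
  {Γ dG dE dJ dJ' A A' V V' : ι → Matrix ι ι ℝ} {P P' : Matrix ι ι ℝ}

lemma sum_mul_eq_zero_of_symm {f f' : ι → ι → ℝ} (h : ∀ a b, f a b = f b a)
    (h' : ∀ a b, f' a b = -f' b a) : ∑ a, ∑ b, f a b * f' a b = 0 := by
  have : ∑ a, ∑ b, f a b * f' a b = -∑ a, ∑ b, f a b * f' a b := by
    conv_lhs => rw [Finset.sum_comm]
    simp only [← Finset.sum_neg_distrib]
    refine Finset.sum_congr rfl fun a _ => Finset.sum_congr rfl fun b _ => ?_
    rw [h, h']; ring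
  linarith

/-- The trace of the product of the derivatives of two rotated frames does not involve the
connection coefficients. -/
lemma sum_rotatedFrame_deriv (hV : ∀ l, V l = A l * E - P * E * Γ l)
    (hV' : ∀ l, V' l = A' l * E - P' * E * Γ l) (hP : Pᵀ = -P) (hP' : P'ᵀ = -P')
    (hPP : P * P' = -(P' * P)) (hΓ : swap01 (arr Γ) = arr Γ)
    (hA : ∀ l, (P * A' l + P' * A l)ᵀ = -(P * A' l + P' * A l)) :
    ∑ a, ∑ μ, ∑ ν, V ν a μ * V' μ a ν
      = pairing (slot 0 E (arr A)) (swap12 (rot (slot 0 E (arr A')))) := by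
  have hΓ' : ∀ a b c, Γ a b c = Γ b a c := fun a b c => by
    have := congrFun hΓ ![b, a, c]
    rwa [swap01_apply] at this
  have hQ : (Eᵀ * (Pᵀ * P') * E)ᵀ = -(Eᵀ * (Pᵀ * P') * E) := by
    simp only [transpose_mul, transpose_transpose, hP, hP', neg_mul, hPP, mul_neg, neg_neg]
    noncomm_ring
  have hZ : ∀ l, (Eᵀ * (P * A' l + P' * A l) * E)ᵀ = -(Eᵀ * (P * A' l + P' * A l) * E) := fun l => by
    rw [transpose_mul, transpose_mul, hA, transpose_transpose]; noncomm_ring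
  have e0 : ∑ a, ∑ μ, ∑ ν, V ν a μ * V' μ a ν = ∑ μ, ∑ ν, ((V ν)ᵀ * V' μ) μ ν := by
    rw [Finset.sum_comm]
    refine Finset.sum_congr rfl fun μ _ => ?_
    rw [Finset.sum_comm]
    rfl
  -- Expansion into a term without connection coefficients, one quadratic in them, and two mixed
  -- ones.
  have e1 : ∀ μ ν, (V ν)ᵀ * V' μ = (A ν * E)ᵀ * (A' μ * E)
      + (Γ ν)ᵀ * (Eᵀ * (Pᵀ * P') * E) * Γ μ + (Γ ν)ᵀ * (Eᵀ * (P * A' μ) * E)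
      + ((Γ μ)ᵀ * (Eᵀ * (P' * A ν) * E))ᵀ := fun μ ν => by
    rw [hV, hV']
    simp only [transpose_mul, transpose_sub, transpose_transpose, hP, hP']
    noncomm_ring
  -- `PᵀP'` is antisymmetric because `P` and `P'` anticommute, so the quadratic term is odd under
  -- the exchange of `μ` and `ν`.
  have s4 : ∑ μ, ∑ ν, ((Γ ν)ᵀ * (Eᵀ * (Pᵀ * P') * E) * Γ μ) μ ν = 0 := by
    have : ∑ μ, ∑ ν, ((Γ ν)ᵀ * (Eᵀ * (Pᵀ * P') * E) * Γ μ) μ ν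
        = -∑ μ, ∑ ν, ((Γ ν)ᵀ * (Eᵀ * (Pᵀ * P') * E) * Γ μ) μ ν := by
      conv_lhs => rw [Finset.sum_comm]
      simp only [← Finset.sum_neg_distrib]
      refine Finset.sum_congr rfl fun μ _ => Finset.sum_congr rfl fun ν _ => ?_
      rw [← transpose_apply ((Γ μ)ᵀ * (Eᵀ * (Pᵀ * P') * E) * Γ ν), transpose_mul, transpose_mul,
        hQ, transpose_transpose, neg_mul, mul_neg, Matrix.neg_apply,
        ← Matrix.mul_assoc (Γ ν)ᵀ]
    linarith
  -- The mixed terms pair the symmetric lower indices of `Γ` with the antisymmetric matrix supplied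
  -- by `hA`.
  have s3 : ∑ μ, ∑ ν, ((Γ ν)ᵀ * (Eᵀ * (P * A' μ) * E)) μ ν
      + ∑ μ, ∑ ν, (((Γ μ)ᵀ * (Eᵀ * (P' * A ν) * E))ᵀ) μ ν = 0 := by
    conv_lhs => enter [2]; rw [Finset.sum_comm]
    rw [← Finset.sum_add_distrib]
    refine Finset.sum_eq_zero fun μ _ => ?_
    rw [← Finset.sum_add_distrib]
    have e : ∀ ν, ((Γ ν)ᵀ * (Eᵀ * (P * A' μ) * E)) μ ν + (((Γ ν)ᵀ * (Eᵀ * (P' * A μ) * E))ᵀ) ν μ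
        = ∑ σ, Γ ν σ μ * (Eᵀ * (P * A' μ + P' * A μ) * E) σ ν := fun ν => by
      rw [transpose_apply, ← Matrix.add_apply, ← mul_add, Matrix.mul_apply, ← add_mul, ← mul_add]
      rfl
    simp only [e]
    refine sum_mul_eq_zero_of_symm (f := fun ν σ => Γ ν σ μ) (fun ν σ => hΓ' ν σ μ)
      (f' := fun ν σ => (Eᵀ * (P * A' μ + P' * A μ) * E) σ ν) fun ν σ => ?_
    have := congrFun (congrFun (hZ μ) ν) σ
    simpa using this
  have e2 : ∑ μ, ∑ ν, ((A ν * E)ᵀ * (A' μ * E)) μ ν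
      = pairing (slot 0 E (arr A)) (swap12 (rot (slot 0 E (arr A')))) := by
    rw [pairing, sum_vec3]
    simp only [swap12_apply, rot_apply, slot_vec3_zero, arr_apply, Matrix.mul_apply,
      transpose_apply, Finset.sum_mul_sum]
    have H : ∀ f : ι → ι → ι → ι → ℝ,
        ∑ x, ∑ a, ∑ b, ∑ c, f x a b c = ∑ a, ∑ b, ∑ c, ∑ x, f x a b c := fun f => by
      rw [Finset.sum_comm]
      refine Finset.sum_congr rfl fun a _ => ?_
      rw [Finset.sum_comm]
      exact Finset.sum_congr rfl fun b _ => Finset.sum_comm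
    have H' : ∀ f : ι → ι → ι → ℝ, ∑ a, ∑ b, ∑ c, f a b c = ∑ c, ∑ a, ∑ b, f a b c := fun f => by
      have : ∀ a, ∑ b, ∑ c, f a b c = ∑ c, ∑ b, f a b c := fun a => Finset.sum_comm
      simp only [this]
      exact Finset.sum_comm
    refine (Finset.sum_congr rfl fun μ _ => H _).trans ?_
    refine (H _).trans ((H' _).trans ?_)
    refine Finset.sum_congr rfl fun c _ => Finset.sum_congr rfl fun a _ =>
      Finset.sum_congr rfl fun b _ => ?_
    refine Finset.sum_comm.trans ?_
    refine Finset.sum_congr rfl fun ν _ => Finset.sum_congr rfl fun μ _ => ?_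
    ring
  rw [e0]
  simp only [e1, Matrix.add_apply, Finset.sum_add_distrib]
  rw [s4, e2]
  linarith [s3]

/-- The directional derivative of the frame matrices along the frame. -/
lemma flatten_covDeriv (hJG : (J * G)ᵀ = -(J * G)) :
    slot 0 E (arr fun l => E * (covDeriv Γ dJ J l * G) * Eᵀ - spinMat G E Γ dE l * flatMat G E J)
      = flatten E (arr fun l => covDeriv Γ dJ J l * G)
        + slot 2 (flatMat G E J) (slot 0 E (arr (spinMat G E Γ dE))) := by
  have e1 : (arr fun l => E * (covDeriv Γ dJ J l * G) * Eᵀ)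
      = slot 1 E (slot 2 E (arr fun l => covDeriv Γ dJ J l * G)) := by
    rw [slot2_arr, slot1_arr]; simp only [mul_assoc]
  have e2 : (arr fun l => spinMat G E Γ dE l * flatMat G E J)
      = -slot 2 (flatMat G E J) (arr (spinMat G E Γ dE)) := by
    rw [slot2_arr, transpose_flatMat hJG, ← arr_neg]
    simp only [mul_neg, neg_neg]
  rw [arr_sub, map_sub, e1, e2, map_neg, sub_neg_eq_add, slot20]
  rfl

lemma flatten_flatMat_deriv (hJG : (J * G)ᵀ = -(J * G)) :
    slot 0 E (arr fun l => E * (covDeriv Γ dJ J l * G) * Eᵀ - spinMat G E Γ dE l * flatMat G E J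
        + flatMat G E J * spinMat G E Γ dE l)
      = flatten E (arr fun l => covDeriv Γ dJ J l * G)
        + slot 2 (flatMat G E J) (slot 0 E (arr (spinMat G E Γ dE)))
        + slot 1 (flatMat G E J) (slot 0 E (arr (spinMat G E Γ dE))) := by
  have e1 : (arr fun l => flatMat G E J * spinMat G E Γ dE l)
      = slot 1 (flatMat G E J) (arr (spinMat G E Γ dE)) := by
    rw [slot1_arr]
  rw [arr_add, map_add, flatten_covDeriv hJG, e1, slot10]

end Pointwise

end FrameCharges

end CliffordKT

namespace CliffordKT

/-! ### Flat components of the structures, the spin connection and the torsion -/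

section FrameFields

open Topology Matrix DiffOpAlg

variable {n : ℕ} {U : Set (Coord n)} {g e J J' : Coord n → Matrix (Fin n) (Fin n) ℝ}
  {C : Coord n → (Fin 3 → Fin n) → ℝ} {y : Coord n}

/-- A smooth alternating 3-form on an open set. -/
structure IsThreeForm (U : Set (Coord n)) (C : Coord n → (Fin 3 → Fin n) → ℝ) : Prop where
  smooth : SmoothArr U C
  rot_eq : ∀ y ∈ U, rot (C y) = C y
  swap12_eq : ∀ y ∈ U, swap12 (C y) = -C y

/-- The 3-form `C` is the completed Bismut torsion of the complex structure `J`. -/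
def IsCompletion (U : Set (Coord n)) (g J : Coord n → Matrix (Fin n) (Fin n) ℝ)
    (C : Coord n → (Fin 3 → Fin n) → ℝ) : Prop :=
  ∀ y ∈ U, ∀ μ ν l, C y ![μ, ν, l] = bismut g J y μ ν l + holPart J C y μ ν l

/-- The flat components of an endomorphism field. -/
def flatJ (g e J : Coord n → Matrix (Fin n) (Fin n) ℝ) (y : Coord n) : Matrix (Fin n) (Fin n) ℝ :=
  flatMat (g y) (e y) (J y)

/-- The spin connection matrices in the coordinate directions. -/
def spinField (g e : Coord n → Matrix (Fin n) (Fin n) ℝ) (y : Coord n) :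
    Fin n → Matrix (Fin n) (Fin n) ℝ := spinMat (g y) (e y) (connMat g y) (pdMat e y)

/-- The flat components of the spin connection. -/
def flatOm (g e : Coord n → Matrix (Fin n) (Fin n) ℝ) (y : Coord n) : (Fin 3 → Fin n) → ℝ :=
  slot 0 (e y) (arr (spinField g e y))

/-- The flat components of a 3-form. -/
def flatC (e : Coord n → Matrix (Fin n) (Fin n) ℝ) (C : Coord n → (Fin 3 → Fin n) → ℝ)
    (y : Coord n) : (Fin 3 → Fin n) → ℝ := flatten (e y) (C y)

lemma rot_flatC (hC : IsThreeForm U C) (hy : y ∈ U) : rot (flatC e C y) = flatC e C y := by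
  rw [flatC, rot_flatten, hC.rot_eq y hy]

lemma swap12_flatC (hC : IsThreeForm U C) (hy : y ∈ U) : swap12 (flatC e C y) = -flatC e C y := by
  rw [flatC, swap12_flatten, hC.swap12_eq y hy, flatten_neg]

lemma pdMat_orthonormal (h : IsFrame U g e) (hy : y ∈ U) (l : Fin n) :
    pdMat e y l * g y * (e y)ᵀ + e y * pdMat g y l * (e y)ᵀ + e y * g y * (pdMat e y l)ᵀ = 0 := by
  have he := h.smooth
  have hg := h.smooth_metric
  have e1 := pdMat_congr h.isOpen hy h.orthonormal l
  rw [pdMat_const, pdMat_mul ((he.mul hg).differentiableAt h.isOpen hy)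
    (he.transpose.differentiableAt h.isOpen hy), pdMat_mul (he.differentiableAt h.isOpen hy)
    (hg.differentiableAt h.isOpen hy), pdMat_transpose, add_mul] at e1
  exact e1

lemma transpose_spinField (h : IsFrame U g e) (hy : y ∈ U) (l : Fin n) :
    (spinField g e y l)ᵀ = -spinField g e y l :=
  transpose_spinMat (h.symm y hy) (connMat_metric h hy) (pdMat_orthonormal h hy) l

lemma swap12_flatOm (h : IsFrame U g e) (hy : y ∈ U) : swap12 (flatOm g e y) = -flatOm g e y := by
  rw [flatOm, swap12_slot0, swap12_arr, ← map_neg, ← arr_neg]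
  simp only [transpose_spinField h hy]

lemma flatten_nablaArr (h : IsFrame U g e) (hJ : IsComplexStr U g J) (hC : IsThreeForm U C)
    (hB : IsCompletion U g J C) (hy : y ∈ U) :
    flatten (e y) (nablaArr g J y) = structureDeriv (flatJ g e J y) (flatC e C y) := by
  rw [nablaArr_eq h hJ hy (hC.rot_eq y hy) (hB y hy), flatJ, flatC,
    structureDeriv_flatten (h.orthonormal y hy)]

/-- The derivatives of the flat components of a complex structure along the frame. -/
lemma frame_pdMat_flatJ (h : IsFrame U g e) (hJ : IsComplexStr U g J) (hC : IsThreeForm U C)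
    (hB : IsCompletion U g J C) (hy : y ∈ U) :
    slot 0 (e y) (arr (pdMat (flatJ g e J) y)) = structureDeriv (flatJ g e J y) (flatC e C y)
      + slot 1 (flatJ g e J y) (flatOm g e y) + slot 2 (flatJ g e J y) (flatOm g e y) := by
  have hd : ∀ {A}, SmoothMat U A → ∀ i j, DifferentiableAt ℝ (fun y => A y i j) y :=
    fun hA => hA.differentiableAt h.isOpen hy
  have he := h.smooth
  have hg := h.smooth_metric
  have e1 : pdMat (flatJ g e J) y = fun l => e y * (covDeriv (connMat g y) (pdMat J y) (J y) l * g y)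
      * (e y)ᵀ - spinField g e y l * flatJ g e J y + flatJ g e J y * spinField g e y l := by
    funext l
    refine Eq.trans ?_ (flatMat_deriv (h.symm y hy) (h.orthonormal y hy) (connMat_metric h hy)
      (pdMat_orthonormal h hy) l)
    rw [show flatJ g e J = fun z => e z * J z * g z * (e z)ᵀ from rfl,
      pdMat_mul (hd ((he.mul hJ.smooth).mul hg)) (hd he.transpose),
      pdMat_mul (hd (he.mul hJ.smooth)) (hd hg), pdMat_mul (hd he) (hd hJ.smooth), pdMat_transpose]
    noncomm_ring
  rw [e1]
  refine (flatten_flatMat_deriv (hJ.antisymm y hy)).trans ?_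
  have := flatten_nablaArr h hJ hC hB hy
  rw [nablaArr] at this
  rw [this]
  exact add_right_comm _ _ _

/-- The matrices that describe the derivatives of a rotated frame. -/
def rotatedSpin (g e J : Coord n → Matrix (Fin n) (Fin n) ℝ) (y : Coord n) (l : Fin n) :
    Matrix (Fin n) (Fin n) ℝ :=
  e y * (covDeriv (connMat g y) (pdMat J y) (J y) l * g y) * (e y)ᵀ
    - spinField g e y l * flatJ g e J y

lemma pdMat_rotatedFrame (h : IsFrame U g e) (hJ : IsComplexStr U g J) (hy : y ∈ U) (l : Fin n) :
    pdMat (fun z => e z * J z) y l = rotatedSpin g e J y l * e y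
      - flatJ g e J y * e y * connMat g y l := by
  rw [pdMat_mul (h.smooth.differentiableAt h.isOpen hy) (hJ.smooth.differentiableAt h.isOpen hy)]
  exact rotatedFrame_deriv (h.symm y hy) (h.orthonormal y hy) (connMat_metric h hy)
    (pdMat_orthonormal h hy) l

lemma slot0_rotatedSpin (h : IsFrame U g e) (hJ : IsComplexStr U g J) (hC : IsThreeForm U C)
    (hB : IsCompletion U g J C) (hy : y ∈ U) :
    slot 0 (e y) (arr (rotatedSpin g e J y)) = structureDeriv (flatJ g e J y) (flatC e C y)
      + slot 2 (flatJ g e J y) (flatOm g e y) := by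
  have := flatten_nablaArr h hJ hC hB hy
  rw [← this]
  exact flatten_covDeriv (hJ.antisymm y hy)

lemma transpose_flatJ (hJ : IsComplexStr U g J) (hy : y ∈ U) :
    (flatJ g e J y)ᵀ = -flatJ g e J y := transpose_flatMat (hJ.antisymm y hy)

lemma flatJ_sq (h : IsFrame U g e) (hJ : IsComplexStr U g J) (hy : y ∈ U) :
    flatJ g e J y * flatJ g e J y = -1 := flatMat_sq (h.orthonormal y hy) (hJ.sq y hy)

lemma flatJ_anticomm (h : IsFrame U g e) (hJJ : ∀ y ∈ U, J y * J' y = -(J' y * J y)) (hy : y ∈ U) :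
    flatJ g e J y * flatJ g e J' y = -(flatJ g e J' y * flatJ g e J y) :=
  flatMat_anticomm (h.orthonormal y hy) (hJJ y hy)

lemma flatJ_mul_frame (h : IsFrame U g e) (hy : y ∈ U) : flatJ g e J y * e y = e y * J y :=
  flatMat_mul_frame (h.orthonormal y hy)

lemma transpose_frame_covDeriv (h : IsFrame U g e) (hJ : IsComplexStr U g J) (hy : y ∈ U)
    (l : Fin n) :
    (e y * (covDeriv (connMat g y) (pdMat J y) (J y) l * g y) * (e y)ᵀ)ᵀ
      = -(e y * (covDeriv (connMat g y) (pdMat J y) (J y) l * g y) * (e y)ᵀ) := by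
  have := swap12_nablaArr h hJ hy
  rw [nablaArr, swap12_arr, ← arr_neg] at this
  have e1 : (covDeriv (connMat g y) (pdMat J y) (J y) l * g y)ᵀ
      = -(covDeriv (connMat g y) (pdMat J y) (J y) l * g y) := by
    ext a b; exact congrFun this ![l, a, b]
  rw [transpose_mul, transpose_mul, e1, transpose_transpose]
  noncomm_ring

lemma frame_covDeriv_mul (h : IsFrame U g e) (hy : y ∈ U) (l : Fin n) :
    e y * (covDeriv (connMat g y) (pdMat J y) (J y) l * g y) * (e y)ᵀ * flatJ g e J' y
      = flatMat (g y) (e y) (covDeriv (connMat g y) (pdMat J y) (J y) l * J' y) := by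
  rw [← flatMat_mul_flatMat (h.orthonormal y hy), flatJ, flatMat, flatMat]
  noncomm_ring

/-- The trace of the product of the derivatives of two rotated frames. -/
lemma sum_pdMat_rotatedFrame (h : IsFrame U g e) (hJ : IsComplexStr U g J)
    (hJ' : IsComplexStr U g J') (hJJ : ∀ y ∈ U, J y * J' y = -(J' y * J y)) (hC : IsThreeForm U C)
    (hB : IsCompletion U g J C) (hB' : IsCompletion U g J' C) (hy : y ∈ U) :
    ∑ a, ∑ μ, ∑ ν, pdMat (fun z => e z * J z) y ν a μ * pdMat (fun z => e z * J' z) y μ a ν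
      = pairing (structureDeriv (flatJ g e J y) (flatC e C y)
          + slot 2 (flatJ g e J y) (flatOm g e y))
        (swap12 (rot (structureDeriv (flatJ g e J' y) (flatC e C y)
          + slot 2 (flatJ g e J' y) (flatOm g e y)))) := by
  rw [← slot0_rotatedSpin h hJ hC hB hy, ← slot0_rotatedSpin h hJ' hC hB' hy]
  refine sum_rotatedFrame_deriv (pdMat_rotatedFrame h hJ hy) (pdMat_rotatedFrame h hJ' hy)
    (transpose_flatJ hJ hy) (transpose_flatJ hJ' hy) (flatJ_anticomm h hJJ hy) (connMat_symm h hy)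
    fun l => ?_
  set K := e y * (covDeriv (connMat g y) (pdMat J y) (J y) l * g y) * (e y)ᵀ with hK
  set K' := e y * (covDeriv (connMat g y) (pdMat J' y) (J' y) l * g y) * (e y)ᵀ with hK'
  set P := flatJ g e J y
  set P' := flatJ g e J' y
  set W := spinField g e y l
  have hKt : Kᵀ = -K := transpose_frame_covDeriv h hJ hy l
  have hKt' : K'ᵀ = -K' := transpose_frame_covDeriv h hJ' hy l
  have hPt : Pᵀ = -P := transpose_flatJ hJ hy
  have hPt' : P'ᵀ = -P' := transpose_flatJ hJ' hy
  have hWt : Wᵀ = -W := transpose_spinField h hy l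
  -- The covariant derivative of `J J' + J' J = 0`; the connection terms contain the anticommutator
  -- itself and disappear.
  have hder : covDeriv (connMat g y) (pdMat J y) (J y) l * J' y
      + J y * covDeriv (connMat g y) (pdMat J' y) (J' y) l
      + (covDeriv (connMat g y) (pdMat J' y) (J' y) l * J y
        + J' y * covDeriv (connMat g y) (pdMat J y) (J y) l) = 0 := by
    have e1 := pdMat_congr (A := fun z => J z * J' z) (B := fun z => -(J' z * J z)) h.isOpen hy hJJ l
    rw [pdMat_neg, pdMat_mul (hJ.smooth.differentiableAt h.isOpen hy)
      (hJ'.smooth.differentiableAt h.isOpen hy), pdMat_mul (hJ'.smooth.differentiableAt h.isOpen hy)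
      (hJ.smooth.differentiableAt h.isOpen hy), ← sub_eq_zero] at e1
    have e2 : covDeriv (connMat g y) (pdMat J y) (J y) l * J' y
      + J y * covDeriv (connMat g y) (pdMat J' y) (J' y) l
      + (covDeriv (connMat g y) (pdMat J' y) (J' y) l * J y
        + J' y * covDeriv (connMat g y) (pdMat J y) (J y) l)
        = (pdMat J y l * J' y + J y * pdMat J' y l - -(pdMat J' y l * J y + J' y * pdMat J y l))
          + (J y * J' y - -(J' y * J y)) * connMat g y l
          - connMat g y l * (J y * J' y - -(J' y * J y)) := by
      simp only [covDeriv]; noncomm_ring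
    rw [e2, e1, sub_eq_zero.2 (hJJ y hy)]; simp
  have hsum : K * P' + P * K' + (K' * P + P' * K) = 0 := by
    have e1 := congrArg (fun X => e y * X * (g y * (e y)ᵀ)) hder
    have f1 : ∀ (J₁ J₂ : Coord n → Matrix (Fin n) (Fin n) ℝ),
        e y * (covDeriv (connMat g y) (pdMat J₁ y) (J₁ y) l * g y) * (e y)ᵀ * flatJ g e J₂ y
          = e y * (covDeriv (connMat g y) (pdMat J₁ y) (J₁ y) l * J₂ y) * (g y * (e y)ᵀ) :=
      fun J₁ J₂ => by
        rw [frame_covDeriv_mul h hy, flatMat]; noncomm_ring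
    have f2 : ∀ (J₁ J₂ : Coord n → Matrix (Fin n) (Fin n) ℝ),
        flatJ g e J₂ y * (e y * (covDeriv (connMat g y) (pdMat J₁ y) (J₁ y) l * g y) * (e y)ᵀ)
          = e y * (J₂ y * covDeriv (connMat g y) (pdMat J₁ y) (J₁ y) l) * (g y * (e y)ᵀ) :=
      fun J₁ J₂ => by
        rw [← mul_assoc, ← mul_assoc, flatJ_mul_frame h hy]; noncomm_ring
    simp only [mul_zero, zero_mul] at e1
    rw [hK, hK', f1, f1, f2, f2, ← e1]
    noncomm_ring
  -- In this combination the spin connection enters only through `P W P' + P' W P`, which is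
  -- antisymmetric. Antisymmetry of the rest is `hsum`.
  have hL : P * rotatedSpin g e J' y l + P' * rotatedSpin g e J y l
      = P * K' + P' * K - (P * W * P' + P' * W * P) := by
    have hr : rotatedSpin g e J y l = K - W * P := rfl
    have hr' : rotatedSpin g e J' y l = K' - W * P' := rfl
    rw [hr, hr']; noncomm_ring
  rw [hL]
  simp only [transpose_sub, transpose_add, transpose_mul, hKt, hKt', hPt, hPt', hWt]
  have e3 : -(P * K' + P' * K - (P * W * P' + P' * W * P))
      = (K * P' + K' * P) + (P * W * P' + P' * W * P)
        - (K * P' + P * K' + (K' * P + P' * K)) := by abel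
  rw [e3, hsum]
  noncomm_ring

/-- The concomitant condition in the vielbein frame. -/
lemma flatConcomitant_eq (h : IsFrame U g e) (hJ : IsComplexStr U g J)
    (hJ' : IsComplexStr U g J') (hJJ : ∀ y ∈ U, J y * J' y = -(J' y * J y)) (hC : IsThreeForm U C)
    (hB : IsCompletion U g J C) (hB' : IsCompletion U g J' C) (hy : y ∈ U)
    (hN : ∀ μ ν l, concomitant J J' y μ ν l = 0) :
    flatConcomitant (flatJ g e J y) (flatJ g e J' y) (flatC e C y)
      = swap01 (flatConcomitant (flatJ g e J y) (flatJ g e J' y) (flatC e C y)) := by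
  have hE := h.orthonormal y hy
  have h1 : slot 0 (J y) (arr (pdMat J' y)) - slot 2 (J y)ᵀ (arr (pdMat J' y))
        + (slot 0 (J' y) (arr (pdMat J y)) - slot 2 (J' y)ᵀ (arr (pdMat J y)))
      = swap01 (slot 0 (J y) (arr (pdMat J' y)) - slot 2 (J y)ᵀ (arr (pdMat J' y))
        + (slot 0 (J' y) (arr (pdMat J y)) - slot 2 (J' y)ᵀ (arr (pdMat J y)))) := by
    refine ext_vec3 fun a b c => ?_
    have := hN a b c
    simp only [concomitant, concomitantHalf] at this
    rw [swap01_apply]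
    simp only [Pi.add_apply, Pi.sub_apply, slot_vec3_zero, slot_vec3_two, arr_pdMat,
      transpose_apply]
    have d1 : ∀ (J₁ J₂ : Coord n → Matrix (Fin n) (Fin n) ℝ) (i j : Fin n),
        ∑ σ, J₁ y σ c * pd i (fun z => J₂ z j σ) y = ∑ σ, pd i (fun z => J₂ z j σ) y * J₁ y σ c :=
      fun J₁ J₂ i j => Finset.sum_congr rfl fun _ _ => mul_comm _ _
    rw [d1 J J', d1 J' J, d1 J J', d1 J' J]
    linarith
  have h2 := concomitant_covDeriv (h.symm y hy) (hJ.antisymm y hy) (hJ'.antisymm y hy) (hJJ y hy)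
    (connMat_symm h hy) h1
  have h3 := congrArg (flatten (e y)) h2
  have hsw : ∀ t : (Fin 3 → Fin n) → ℝ, flatten (e y) (swap01 t) = swap01 (flatten (e y) t) := by
    intro t
    rw [swap01_eq, swap01_eq, swap12_flatten, rot_flatten]
  rw [hsw] at h3
  rw [flatConcomitant, ← flatten_nablaArr h hJ hC hB hy, ← flatten_nablaArr h hJ' hC hB' hy]
  simp only [flatJ, slot0_flatten hE, slot2_flatten hE, ← flatten_add]
  exact h3

/-- The trace identity for the supercharges of two anticommuting complex structures. -/
lemma trace_charges (h : IsFrame U g e) (hJ : IsComplexStr U g J)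
    (hJ' : IsComplexStr U g J') (hJJ : ∀ y ∈ U, J y * J' y = -(J' y * J y)) (hC : IsThreeForm U C)
    (hB : IsCompletion U g J C) (hB' : IsCompletion U g J' C) (hy : y ∈ U)
    (hN : ∀ μ ν l, concomitant J J' y μ ν l = 0) :
    ∑ a, ∑ μ, ∑ ν, pdMat (fun z => e z * J z) y ν a μ * pdMat (fun z => e z * J' z) y μ a ν
      + 6 * pairing (structureCubic (flatJ g e J y) (flatOm g e y) (flatC e C y))
        (structureCubic (flatJ g e J' y) (flatOm g e y) (flatC e C y)) = 0 := by
  rw [sum_pdMat_rotatedFrame h hJ hJ' hJJ hC hB hB' hy]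
  exact pairing_charges (flatJ_sq h hJ hy) (flatJ_sq h hJ' hy) (flatJ_anticomm h hJJ hy)
    (transpose_flatJ hJ hy) (transpose_flatJ hJ' hy) (swap12_flatOm h hy) (swap12_flatC hC hy)
    (rot_flatC hC hy) (flatConcomitant_eq h hJ hJ' hJJ hC hB hB' hy hN)

/-! ### Cubic coefficients of the classical charges -/

lemma alt3_eq_altSum (T : Fin n → Fin n → Fin n → ℝ) (a b c : Fin n) :
    alt3 T a b c = altSum (ofCurry3 T) ![a, b, c] := by
  simp only [alt3, altSum, cyc, Pi.sub_apply, Pi.add_apply, rot_apply, swap12_apply, ofCurry3_apply]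
  ring

lemma spinConn_eq (h : IsFrame U g e) (hy : y ∈ U) (μ ν l : Fin n) :
    spinConn g e y μ ν l = slot 1 (g y * (e y)ᵀ) (slot 2 (g y * (e y)ᵀ) (arr (spinField g e y)))
      ![μ, ν, l] := by
  have hs : ∀ μ a b, spinConnFlat g e y μ a b = spinField g e y μ a b := by
    intro μ a b
    simp only [spinConnFlat, spinField, spinMat, Matrix.mul_apply, transpose_apply, Matrix.add_apply,
      connMat, Matrix.of_apply, pdMat]
    refine Finset.sum_congr rfl fun ρ _ => ?_
    congr 1
    · refine Finset.sum_congr rfl fun τ _ => ?_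
      rw [mul_comm]
      congr 1
      exact congrFun (congrFun (h.symm y hy) τ) ρ
    · congr 1
      exact Finset.sum_congr rfl fun σ _ => mul_comm _ _
  simp only [spinConn, slot_vec3_one, slot_vec3_two, hs, arr_apply, Matrix.mul_apply,
    transpose_apply]
  refine Finset.sum_congr rfl fun a _ => ?_
  rw [Finset.mul_sum]
  exact Finset.sum_congr rfl fun b _ => mul_assoc _ _ _

lemma flatten_spinConn (h : IsFrame U g e) (hy : y ∈ U) :
    flatten (e y) (slot 1 (g y * (e y)ᵀ) (slot 2 (g y * (e y)ᵀ) (arr (spinField g e y))))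
      = flatOm g e y := by
  have hE : e y * (g y * (e y)ᵀ) = 1 := by rw [← mul_assoc]; exact h.orthonormal y hy
  have e1 : ∀ (i : Fin 3) (t : (Fin 3 → Fin n) → ℝ),
      slot i (e y) (slot i (g y * (e y)ᵀ) t) = t := fun i t => by
    rw [← Module.End.mul_apply, ← slot_mul, hE, slot_one, Module.End.one_apply]
  rw [flatten, flatOm, slot21 (e y), e1, e1]

lemma sum_frame (A B D : Matrix (Fin n) (Fin n) ℝ) (t : (Fin 3 → Fin n) → ℝ) (a b c : Fin n) :
    ∑ μ, ∑ ν, ∑ l, A a μ * B b ν * D c l * t ![μ, ν, l]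
      = slot 0 A (slot 1 B (slot 2 D t)) ![a, b, c] := by
  simp only [slot_vec3_zero, slot_vec3_one, slot_vec3_two, Finset.mul_sum, mul_assoc]

lemma singletCharge_T (h : IsFrame U g e) (hy : y ∈ U) :
    ofCurry3 ((singletCharge g e C).T y)
      = -(1 / 2 : ℝ) • flatOm g e y + (1 / 12 : ℝ) • flatC e C y := by
  rw [← flatten_spinConn h hy, flatC, ← flatten_smul, ← flatten_smul, ← flatten_add]
  refine ext_vec3 fun a b c => ?_
  rw [ofCurry3_apply, flatten, ← sum_frame]
  simp only [singletCharge, spinConn_eq h hy, Pi.add_apply, Pi.smul_apply, smul_eq_mul]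

lemma flatten_holProj (h : IsFrame U g e) (hy : y ∈ U) (t : (Fin 3 → Fin n) → ℝ) :
    flatten (e y) (holProj (J y) t) = holProj (flatJ g e J y) (flatten (e y) t) := by
  have hE := h.orthonormal y hy
  simp only [holProj, flatJ, flatten_smul, flatten_sub, slot0_flatten hE, slot1_flatten hE,
    slot2_flatten hE]

/-- `C = B + H` eliminates the Bismut torsion from the charge, so that only the projection of `C`
occurs. -/
lemma structureCharge_T (h : IsFrame U g e) (hC : IsThreeForm U C)
    (hB : IsCompletion U g J C) (hy : y ∈ U) :
    ofCurry3 ((structureCharge g e C J).T y)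
      = slot 0 (flatJ g e J y) (-(1 / 2 : ℝ) • flatOm g e y
        - (1 / 4 : ℝ) • (flatC e C y - holProj (flatJ g e J y) (flatC e C y))
        + (1 / 12 : ℝ) • holProj (flatJ g e J y) (flatC e C y)) := by
  have hE := h.orthonormal y hy
  rw [← flatten_spinConn h hy, flatC, ← flatten_holProj h hy, ← flatten_smul, ← flatten_sub,
    ← flatten_smul, ← flatten_smul, ← flatten_sub, ← flatten_add, flatJ, slot0_flatten hE]
  refine ext_vec3 fun a b c => ?_
  have hbis : ∀ μ ν l, bismut g J y μ ν l = (C y - holProj (J y) (C y)) ![μ, ν, l] := by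
    intro μ ν l
    rw [Pi.sub_apply, hB y hy μ ν l, holPart_eq (hC.rot_eq y hy), add_sub_cancel_right]
  have e1 : ∀ t : (Fin 3 → Fin n) → ℝ, flatten (e y) (slot 0 (J y) t)
      = slot 0 (e y * J y) (slot 1 (e y) (slot 2 (e y) t)) := fun t => by
    rw [flatten, slot_mul, Module.End.mul_apply, slot20, slot10]
  rw [ofCurry3_apply, e1, ← sum_frame]
  simp only [structureCharge, spinConn_eq h hy, hbis, holPart_eq (hC.rot_eq y hy), Pi.add_apply,
    Pi.sub_apply, Pi.smul_apply, smul_eq_mul, Matrix.mul_apply]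

lemma singletCharge_alt (h : IsFrame U g e) (hC : IsThreeForm U C) (hy : y ∈ U) (a b c : Fin n) :
    (1 / 6) * alt3 ((singletCharge g e C).T y) a b c
      = singletCubic (flatOm g e y) (flatC e C y) ![a, b, c] := by
  rw [← altSum_singlet (swap12_flatOm h hy) (swap12_flatC hC hy) (rot_flatC hC hy), alt3_eq_altSum,
    singletCharge_T h hy]
  rfl

lemma structureCharge_alt (h : IsFrame U g e) (hJ : IsComplexStr U g J) (hC : IsThreeForm U C)
    (hB : IsCompletion U g J C) (hy : y ∈ U) (a b c : Fin n) :
    (1 / 6) * alt3 ((structureCharge g e C J).T y) a b c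
      = structureCubic (flatJ g e J y) (flatOm g e y) (flatC e C y) ![a, b, c] := by
  rw [← altSum_structure (flatJ_sq h hJ hy) (swap12_flatOm h hy) (swap12_flatC hC hy)
    (rot_flatC hC hy), alt3_eq_altSum, structureCharge_T h hC hB hy]
  rfl

/-! ### Smoothness -/

lemma SmoothArr.slot {p : ℕ} {A : Coord n → Matrix (Fin n) (Fin n) ℝ} (hA : SmoothMat U A)
    {η : Coord n → (Fin p → Fin n) → ℝ} (hη : SmoothArr U η) (i : Fin p) :
    SmoothArr U fun y => slot i (A y) (η y) := fun m => by
  have : ContDiffOn ℝ ∞ (fun y => ∑ ν, A y (m i) ν * η y (Function.update m i ν)) U :=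
    ContDiffOn.sum fun ν _ => (hA _ _).mul (hη _)
  exact this

lemma SmoothArr.add {p : ℕ} {η θ : Coord n → (Fin p → Fin n) → ℝ} (hη : SmoothArr U η)
    (hθ : SmoothArr U θ) : SmoothArr U fun y => η y + θ y := fun m => (hη m).add (hθ m)

lemma SmoothArr.sub {p : ℕ} {η θ : Coord n → (Fin p → Fin n) → ℝ} (hη : SmoothArr U η)
    (hθ : SmoothArr U θ) : SmoothArr U fun y => η y - θ y := fun m => (hη m).sub (hθ m)

lemma SmoothArr.const_smul {p : ℕ} {η : Coord n → (Fin p → Fin n) → ℝ} (hη : SmoothArr U η) (c : ℝ) :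
    SmoothArr U fun y => c • η y := fun m => contDiffOn_const.mul (hη m)

lemma SmoothArr.cyc {η : Coord n → (Fin 3 → Fin n) → ℝ} (hη : SmoothArr U η) :
    SmoothArr U fun y => cyc (η y) := fun m => ((hη m).add (hη _)).add (hη _)

lemma IsFrame.smooth_connMat (h : IsFrame U g e) (l : Fin n) : SmoothMat U fun y => connMat g y l := by
  intro ν ρ
  have hg := h.smooth_metric
  have hi : SmoothMat U fun y => (g y)⁻¹ := hg.inv fun y hy => (h.det_metric_pos hy).ne'
  have hp : ∀ k i j, ContDiffOn ℝ ∞ (fun y => pd k (fun z => g z i j) y) U := fun k i j =>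
    contDiffOn_pd h.isOpen (hg i j) k
  have : ContDiffOn ℝ ∞ (fun y => ∑ σ, (g y)⁻¹ ρ σ * ((1 / 2) *
      (pd l (fun z => g z σ ν) y + pd ν (fun z => g z l σ) y - pd σ (fun z => g z l ν) y))) U :=
    ContDiffOn.sum fun σ _ => (hi _ _).mul (contDiffOn_const.mul
      (((hp _ _ _).add (hp _ _ _)).sub (hp _ _ _)))
  exact this

lemma IsFrame.smooth_flatOm (h : IsFrame U g e) : SmoothArr U (flatOm g e) := by
  refine SmoothArr.slot h.smooth (fun m => ?_) 0
  have hd : SmoothMat U fun y => pdMat e y (m 0) + e y * connMat g y (m 0) := fun i j =>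
    (contDiffOn_pd h.isOpen (h.smooth i j) _).add ((h.smooth.mul (h.smooth_connMat _)) i j)
  exact ((h.smooth.mul h.smooth_metric).mul hd.transpose) _ _

lemma IsFrame.smooth_flatC (h : IsFrame U g e) (hC : IsThreeForm U C) : SmoothArr U (flatC e C) :=
  ((hC.smooth.slot h.smooth 2).slot h.smooth 1).slot h.smooth 0

lemma IsFrame.smooth_flatJ (h : IsFrame U g e) (hJ : SmoothMat U J) : SmoothMat U (flatJ g e J) :=
  ((h.smooth.mul hJ).mul h.smooth_metric).mul h.smooth.transpose

lemma IsFrame.smooth_singletCubic (h : IsFrame U g e) (hC : IsThreeForm U C) :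
    SmoothArr U fun y => singletCubic (flatOm g e y) (flatC e C y) :=
  (h.smooth_flatOm.cyc.const_smul _).add ((h.smooth_flatC hC).const_smul _)

lemma IsFrame.smooth_structureCubic (h : IsFrame U g e) (hJ : SmoothMat U J)
    (hC : IsThreeForm U C) :
    SmoothArr U fun y => structureCubic (flatJ g e J y) (flatOm g e y) (flatC e C y) := by
  have hj := h.smooth_flatJ hJ
  exact ((h.smooth_flatOm.slot hj 0).cyc.const_smul _).sub
    (((((h.smooth_flatC hC).slot hj 2).slot hj 1).slot hj 0).const_smul _)

end FrameFields

end CliffordKT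

namespace CliffordKT

/-! ## The supercharges on an open set -/

section Supercharges

open Topology TopologicalSpace Matrix DiffOpAlg

variable {n : ℕ} {U : Opens (Coord n)} {g e J J' : Coord n → Matrix (Fin n) (Fin n) ℝ}
  {C : Coord n → (Fin 3 → Fin n) → ℝ}

lemma swap12_structureCubic {ι : Type*} [Fintype ι] [DecidableEq ι] {p : Matrix ι ι ℝ}
    {Om C : (Fin 3 → ι) → ℝ} (hOm : swap12 Om = -Om) (hC : swap12 C = -C) :
    swap12 (structureCubic p Om C) = -structureCubic p Om C := by
  simp only [structureCubic, cyc, map_add, map_sub, map_smul, swap12_rot, swap12_slot0, swap12_slot1,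
    swap12_slot2, hOm, hC, map_neg, rot_rot_rot, slot21]
  module

lemma rot_structureCubic {ι : Type*} [Fintype ι] [DecidableEq ι] {p : Matrix ι ι ℝ}
    {Om C : (Fin 3 → ι) → ℝ} (hC : rot C = C) :
    rot (structureCubic p Om C) = structureCubic p Om C := by
  simp only [structureCubic, cyc, map_add, map_sub, map_smul, rot_slot0, rot_slot1, rot_slot2, hC,
    rot_rot_rot, slot10, slot20]
  module

lemma apply_swap_first {ι : Type*} [Fintype ι] [DecidableEq ι] {t : (Fin 3 → ι) → ℝ} (h1 : swap12 t = -t) (h2 : rot t = t)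
    (a b c : ι) : t ![a, b, c] = -t ![b, a, c] := by
  have e1 := congrFun h1 ![b, c, a]
  have e2 := congrFun h2 ![a, b, c]
  simp only [swap12_apply, rot_apply, Pi.neg_apply] at e1 e2
  linarith

lemma apply_swap_last {ι : Type*} [Fintype ι] [DecidableEq ι] {t : (Fin 3 → ι) → ℝ} (h1 : swap12 t = -t) (a b c : ι) :
    t ![a, b, c] = -t ![a, c, b] := by
  have e1 := congrFun h1 ![a, b, c]
  simp only [swap12_apply, Pi.neg_apply] at e1
  linarith

/-- A smooth real matrix as a matrix over the algebra of smooth complex functions. -/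
def realMat {A : Coord n → Matrix (Fin n) (Fin n) ℝ} (hA : SmoothMat (U : Set (Coord n)) A) :
    Matrix (Fin n) (Fin n) (smoothFun U) := Matrix.of fun a b => realFun (hA a b)

lemma evalAt_realMat {A : Coord n → Matrix (Fin n) (Fin n) ℝ}
    (hA : SmoothMat (U : Set (Coord n)) A) (y : U) (a b : Fin n) :
    evalAt y (realMat hA a b) = (A y a b : ℂ) := rfl

lemma evalAt_sum_mul {A B : Coord n → Matrix (Fin n) (Fin n) ℝ}
    (hA : SmoothMat (U : Set (Coord n)) A) (hB : SmoothMat (U : Set (Coord n)) B) (y : U)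
    (a b : Fin n) : evalAt y (∑ c, realMat hA a c * realMat hB c b) = ((A y * B y) a b : ℝ) := by
  rw [map_sum, Matrix.mul_apply, Complex.ofReal_sum]
  refine Finset.sum_congr rfl fun c _ => ?_
  rw [map_mul, evalAt_realMat, evalAt_realMat, Complex.ofReal_mul]

lemma realMat_sq {A : Coord n → Matrix (Fin n) (Fin n) ℝ} (hA : SmoothMat (U : Set (Coord n)) A)
    (h : ∀ y ∈ U, A y * A y = -1) : realMat hA * realMat hA = -1 := by
  ext1 a b
  refine evalAt_injective fun y => ?_
  rw [Matrix.mul_apply, evalAt_sum_mul, h y y.2, Matrix.neg_apply, Matrix.neg_apply, map_neg,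
    Matrix.one_apply, Matrix.one_apply]
  split_ifs <;> simp

lemma realMat_anticomm {A B : Coord n → Matrix (Fin n) (Fin n) ℝ}
    (hA : SmoothMat (U : Set (Coord n)) A) (hB : SmoothMat (U : Set (Coord n)) B)
    (h : ∀ y ∈ U, A y * B y = -(B y * A y)) :
    realMat hA * realMat hB = -(realMat hB * realMat hA) := by
  ext1 a b
  refine evalAt_injective fun y => ?_
  rw [Matrix.mul_apply, evalAt_sum_mul, h y y.2, Matrix.neg_apply, Matrix.neg_apply, map_neg,
    Matrix.mul_apply (M := realMat hB), evalAt_sum_mul, Complex.ofReal_neg]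

lemma realMat_antisymm {A : Coord n → Matrix (Fin n) (Fin n) ℝ}
    (hA : SmoothMat (U : Set (Coord n)) A) (h : ∀ y ∈ U, (A y)ᵀ = -A y) (a b : Fin n) :
    realMat hA a b = -realMat hA b a := by
  refine evalAt_injective fun y => ?_
  have := congrFun (congrFun (h y y.2) b) a
  rw [map_neg, evalAt_realMat, evalAt_realMat, ← Complex.ofReal_neg]
  exact congrArg _ this

/-- The symbol of the singlet charge. -/
def singletSymbol (h : IsFrame (U : Set (Coord n)) g e) (a μ : Fin n) : smoothFun U :=
  (-Complex.I) • realFun (h.smooth a μ)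

/-- The cubic coefficients of the singlet charge. -/
def singletCoeff (h : IsFrame (U : Set (Coord n)) g e) (hC : IsThreeForm (U : Set (Coord n)) C)
    (a b c : Fin n) : smoothFun U := Complex.I • realFun (h.smooth_singletCubic hC ![a, b, c])

/-- The symbol of the charge of a complex structure. -/
def structureSymbol (h : IsFrame (U : Set (Coord n)) g e) (hJ : IsComplexStr (U : Set (Coord n)) g J)
    (a μ : Fin n) : smoothFun U := (-Complex.I) • realFun ((h.smooth.mul hJ.smooth) a μ)

/-- The cubic coefficients of the charge of a complex structure. -/
def structureCoeff (h : IsFrame (U : Set (Coord n)) g e)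
    (hJ : IsComplexStr (U : Set (Coord n)) g J) (hC : IsThreeForm (U : Set (Coord n)) C)
    (a b c : Fin n) : smoothFun U :=
  Complex.I • realFun (h.smooth_structureCubic hJ.smooth hC ![a, b, c])

variable {S : Type*} [NormedAddCommGroup S] [NormedSpace ℂ S] [FiniteDimensional ℂ S]
  (F : FermionRep n S)

/-- The singlet charge as an operator on half-densities. -/
def singletOp (h : IsFrame (U : Set (Coord n)) g e) (hC : IsThreeForm (U : Set (Coord n)) C) :
    Module.End ℂ (smoothSec U S) :=
  (diffOps U F).charge (singletSymbol h) (singletCoeff h hC)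

/-- The charge of a complex structure as an operator on half-densities. -/
def structureOp (h : IsFrame (U : Set (Coord n)) g e) (hJ : IsComplexStr (U : Set (Coord n)) g J)
    (hC : IsThreeForm (U : Set (Coord n)) C) : Module.End ℂ (smoothSec U S) :=
  (diffOps U F).charge (structureSymbol h hJ) (structureCoeff h hJ hC)

lemma represents_singlet (h : IsFrame (U : Set (Coord n)) g e)
    (hC : IsThreeForm (U : Set (Coord n)) C) :
    Represents (quantize F g (singletCharge g e C)) (conjDensity h (singletOp F h hC)) :=
  fun s _ hΨ y => quantize_eq F h (hv := h.smooth)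
    (ht := fun a b c => h.smooth_singletCubic hC ![a, b, c]) (fun _ _ _ _ => rfl)
    (fun _ hy a b c => singletCharge_alt h hC hy a b c) s hΨ y

lemma represents_structure (h : IsFrame (U : Set (Coord n)) g e)
    (hJ : IsComplexStr (U : Set (Coord n)) g J) (hC : IsThreeForm (U : Set (Coord n)) C)
    (hB : IsCompletion (U : Set (Coord n)) g J C) :
    Represents (quantize F g (structureCharge g e C J)) (conjDensity h (structureOp F h hJ hC)) :=
  fun s _ hΨ y => quantize_eq F h (hv := h.smooth.mul hJ.smooth)
    (ht := fun a b c => h.smooth_structureCubic hJ.smooth hC ![a, b, c])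
    (fun _ _ _ _ => rfl)
    (fun _ hy a b c => structureCharge_alt h hJ hC hB hy a b c) s hΨ y

lemma structureSymbol_eq (h : IsFrame (U : Set (Coord n)) g e)
    (hJ : IsComplexStr (U : Set (Coord n)) g J) (a μ : Fin n) :
    structureSymbol h hJ a μ = ∑ b, realMat (h.smooth_flatJ hJ.smooth) a b * singletSymbol h b μ := by
  refine evalAt_injective fun y => ?_
  simp only [structureSymbol, singletSymbol, map_sum, map_mul, map_smul, evalAt_realFun,
    evalAt_realMat, smul_eq_mul]
  rw [← flatJ_mul_frame h y.2, Matrix.mul_apply, Complex.ofReal_sum, Finset.mul_sum]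
  refine Finset.sum_congr rfl fun b _ => ?_
  rw [Complex.ofReal_mul]; ring

/-- The pairing of the two symbols is the frame transform of the anticommutator of the flat
structures; the scalar factor `(-i)²` is immaterial. -/
lemma structureSymbol_symm (h : IsFrame (U : Set (Coord n)) g e)
    (hJ : IsComplexStr (U : Set (Coord n)) g J) (hJ' : IsComplexStr (U : Set (Coord n)) g J')
    (hJJ : ∀ y ∈ U, J y * J' y = -(J' y * J y)) (μ ν : Fin n) :
    ∑ a, (structureSymbol h hJ a μ * structureSymbol h hJ' a ν
      + structureSymbol h hJ' a μ * structureSymbol h hJ a ν) = 0 := by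
  refine evalAt_injective fun y => ?_
  have h1 : (flatJ g e J y * e y)ᵀ * (flatJ g e J' y * e y)
      + (flatJ g e J' y * e y)ᵀ * (flatJ g e J y * e y) = 0 := by
    have := flatJ_anticomm h hJJ y.2
    rw [transpose_mul, transpose_mul, transpose_flatJ hJ y.2, transpose_flatJ hJ' y.2]
    calc _ = -((e y)ᵀ * (flatJ g e J y * flatJ g e J' y + flatJ g e J' y * flatJ g e J y) * e y) := by
          noncomm_ring
      _ = 0 := by rw [this]; simp
  rw [flatJ_mul_frame h y.2, flatJ_mul_frame h y.2] at h1
  have h2 := congrFun (congrFun h1 μ) ν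
  rw [Matrix.add_apply, Matrix.mul_apply, Matrix.mul_apply, ← Finset.sum_add_distrib] at h2
  have h3 := congrArg (fun r : ℝ => (r : ℂ)) h2
  simp only [Complex.ofReal_sum, Complex.ofReal_add, Complex.ofReal_mul, Matrix.transpose_apply,
    Matrix.zero_apply, Complex.ofReal_zero] at h3
  rw [map_zero, ← neg_zero, ← h3, ← Finset.sum_neg_distrib, map_sum]
  refine Finset.sum_congr rfl fun a _ => ?_
  simp only [structureSymbol, map_add, map_mul, map_smul, evalAt_realFun, smul_eq_mul]
  linear_combination ((↑((e y * J y) a μ) * ↑((e y * J' y) a ν)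
    + ↑((e y * J' y) a μ) * ↑((e y * J y) a ν)) : ℂ) * Complex.I_sq

lemma structureCoeff_swap_first (h : IsFrame (U : Set (Coord n)) g e)
    (hJ : IsComplexStr (U : Set (Coord n)) g J) (hC : IsThreeForm (U : Set (Coord n)) C)
    (a b c : Fin n) : structureCoeff h hJ hC a b c = -structureCoeff h hJ hC b a c := by
  refine evalAt_injective fun y => ?_
  simp only [structureCoeff, map_neg, map_smul, evalAt_realFun]
  rw [apply_swap_first (swap12_structureCubic (swap12_flatOm h y.2) (swap12_flatC hC y.2))
    (rot_structureCubic (rot_flatC hC y.2)) a b c]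
  simp

lemma structureCoeff_swap_last (h : IsFrame (U : Set (Coord n)) g e)
    (hJ : IsComplexStr (U : Set (Coord n)) g J) (hC : IsThreeForm (U : Set (Coord n)) C)
    (a b c : Fin n) : structureCoeff h hJ hC a b c = -structureCoeff h hJ hC a c b := by
  refine evalAt_injective fun y => ?_
  simp only [structureCoeff, map_neg, map_smul, evalAt_realFun]
  rw [apply_swap_last (swap12_structureCubic (swap12_flatOm h y.2) (swap12_flatC hC y.2)) a b c]
  simp

/-- The charges of two complex structures anticommute if both of them form an `𝒩 = 2` algebra with
the singlet charge. -/
theorem structureOp_anticomm [Nontrivial S] (h : IsFrame (U : Set (Coord n)) g e)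
    (hJ : IsComplexStr (U : Set (Coord n)) g J) (hJ' : IsComplexStr (U : Set (Coord n)) g J')
    (hJJ : ∀ y ∈ U, J y * J' y = -(J' y * J y)) (hC : IsThreeForm (U : Set (Coord n)) C)
    (hB : IsCompletion (U : Set (Coord n)) g J C) (hB' : IsCompletion (U : Set (Coord n)) g J' C)
    (hN : ∀ y ∈ U, ∀ μ ν l, concomitant J J' y μ ν l = 0)
    (h01 : singletOp F h hC * singletOp F h hC = structureOp F h hJ hC * structureOp F h hJ hC)
    (h02 : singletOp F h hC * singletOp F h hC = structureOp F h hJ' hC * structureOp F h hJ' hC)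
    (h1 : singletOp F h hC * structureOp F h hJ hC + structureOp F h hJ hC * singletOp F h hC = 0)
    (h2 : singletOp F h hC * structureOp F h hJ' hC
      + structureOp F h hJ' hC * singletOp F h hC = 0) :
    structureOp F h hJ hC * structureOp F h hJ' hC
      + structureOp F h hJ' hC * structureOp F h hJ hC = 0 := by
  have hge : SmoothMat (U : Set (Coord n)) fun y => g y * (e y)ᵀ :=
    h.smooth_metric.mul h.smooth.transpose
  have hinv : ∀ y ∈ U, g y * (e y)ᵀ * e y = 1 := fun y hy => metric_mul_frame (h.orthonormal y hy)
  obtain ⟨f, hf, hev⟩ := (diffOps U F).exists_anticomm_eq_m mulOp_injective h01 h02 h1 h2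
    -- The symbol of the singlet charge is `-i e`, and `g eᵀ` is the inverse of the frame `e`; the
    -- factor `i` compensates `-i`.
    (w := fun μ b => Complex.I • realMat hge μ b)
    (fun a b => evalAt_injective fun y => by
      have h3 := congrFun (congrFun (h.orthonormal y y.2) a) b
      rw [mul_assoc, Matrix.mul_apply, Matrix.one_apply] at h3
      have h4 := congrArg (fun r : ℝ => (r : ℂ)) h3
      simp only [Complex.ofReal_sum, Complex.ofReal_mul] at h4
      simp only [singletSymbol, map_sum, map_mul, map_smul, evalAt_realFun, evalAt_realMat,
        smul_eq_mul]
      have h5 : evalAt y (if a = b then 1 else 0 : smoothFun U)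
          = (((if a = b then 1 else 0 : ℝ)) : ℂ) := by split_ifs <;> simp
      rw [h5, ← h4]
      refine Finset.sum_congr rfl fun μ _ => ?_
      linear_combination (-(e y a μ : ℂ) * ((g y * (e y)ᵀ) μ b : ℝ)) * Complex.I_sq)
    (fun μ ν => evalAt_injective fun y => by
      have h3 := congrFun (congrFun (hinv y y.2) μ) ν
      rw [Matrix.mul_apply, Matrix.one_apply] at h3
      have h4 := congrArg (fun r : ℝ => (r : ℂ)) h3
      simp only [Complex.ofReal_sum, Complex.ofReal_mul] at h4
      simp only [singletSymbol, map_sum, map_mul, map_smul, evalAt_realFun, evalAt_realMat,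
        smul_eq_mul]
      have h5 : evalAt y (if μ = ν then 1 else 0 : smoothFun U)
          = (((if μ = ν then 1 else 0 : ℝ)) : ℂ) := by split_ifs <;> simp
      rw [h5, ← h4]
      refine Finset.sum_congr rfl fun a _ => ?_
      linear_combination (-(e y a ν : ℂ) * ((g y * (e y)ᵀ) μ a : ℝ)) * Complex.I_sq)
    (realMat_sq (h.smooth_flatJ hJ.smooth) fun y hy => flatJ_sq h hJ hy)
    (realMat_sq (h.smooth_flatJ hJ'.smooth) fun y hy => flatJ_sq h hJ' hy)
    (realMat_anticomm _ _ fun y hy => flatJ_anticomm h hJJ hy)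
    (realMat_antisymm _ fun y hy => transpose_flatJ hJ hy)
    (realMat_antisymm _ fun y hy => transpose_flatJ hJ' hy)
    (structureSymbol_eq h hJ) (structureSymbol_eq h hJ') (structureSymbol_symm h hJ hJ' hJJ)
    (structureCoeff_swap_first h hJ hC) (structureCoeff_swap_last h hJ hC)
    (structureCoeff_swap_first h hJ' hC) (structureCoeff_swap_last h hJ' hC)
  -- At each point `f` is a normalized trace. Both sums acquire the sign `i² = -1` from the
  -- coefficients of the charges, and the result is a quarter of `trace_charges`.
  have hf0 : f = 0 := evalAt_injective fun y => by
    rw [hev (evalAt y) (traceAt y) (traceAt_mul y) (fun a Z => traceAt_cyclic y _ Z) (traceAt_one y),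
      map_zero]
    have htr := congrArg (fun r : ℝ => (r : ℂ))
      (trace_charges h hJ hJ' hJJ hC hB hB' y.2 (hN y y.2))
    simp only [pairing, sum_vec3, Complex.ofReal_add, Complex.ofReal_mul, Complex.ofReal_sum,
      Complex.ofReal_zero, Complex.ofReal_ofNat] at htr
    have e1 : evalAt y (∑ a, ∑ μ, ∑ ν, (diffOps U F).δ ν (structureSymbol h hJ a μ)
          * (diffOps U F).δ μ (structureSymbol h hJ' a ν))
        = -∑ a, ∑ μ, ∑ ν, (pdMat (fun z => e z * J z) y ν a μ : ℂ)
          * (pdMat (fun z => e z * J' z) y μ a ν : ℂ) := by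
      simp only [map_sum, ← Finset.sum_neg_distrib]
      refine Finset.sum_congr rfl fun a _ => Finset.sum_congr rfl fun μ _ =>
        Finset.sum_congr rfl fun ν _ => ?_
      have e2 : ∀ {J₁} (hJ₁ : IsComplexStr (U : Set (Coord n)) g J₁) (ν a μ : Fin n),
          evalAt y ((diffOps U F).δ ν (structureSymbol h hJ₁ a μ))
            = -Complex.I * (pdMat (fun z => e z * J₁ z) y ν a μ : ℂ) := fun hJ₁ ν a μ => by
        rw [structureSymbol, Derivation.map_smul, map_smul, smul_eq_mul]
        exact congrArg _ (evalAt_derivFun_realFun _ ν y)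
      rw [map_mul, e2, e2]
      linear_combination ((pdMat (fun z => e z * J z) y ν a μ : ℂ)
          * (pdMat (fun z => e z * J' z) y μ a ν : ℂ)) * Complex.I_sq
    have e3 : evalAt y (∑ a, ∑ b, ∑ c, structureCoeff h hJ hC a b c * structureCoeff h hJ' hC a b c)
        = -∑ a, ∑ b, ∑ c, (structureCubic (flatJ g e J y) (flatOm g e y) (flatC e C y) ![a, b, c] : ℂ)
          * (structureCubic (flatJ g e J' y) (flatOm g e y) (flatC e C y) ![a, b, c] : ℂ) := by
      simp only [map_sum, ← Finset.sum_neg_distrib]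
      refine Finset.sum_congr rfl fun a _ => Finset.sum_congr rfl fun b _ =>
        Finset.sum_congr rfl fun c _ => ?_
      simp only [structureCoeff, map_mul, map_smul, evalAt_realFun, smul_eq_mul]
      linear_combination ((structureCubic (flatJ g e J y) (flatOm g e y) (flatC e C y) ![a, b, c] : ℂ)
          * (structureCubic (flatJ g e J' y) (flatOm g e y) (flatC e C y) ![a, b, c] : ℂ))
          * Complex.I_sq
    rw [e1, e3]
    linear_combination (1 / 4 : ℂ) * htr
  rw [hf0, map_zero] at hf
  exact hf

end Supercharges

end CliffordKT

namespace CliffordKT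

/-! ## The type of the exterior derivative of the torsion -/

section TorsionType

open Topology TopologicalSpace Matrix DiffOpAlg

section ComplexArrays

set_option linter.unusedSectionVars false

variable {ι : Type*} [Fintype ι] [DecidableEq ι] {k : ℕ}

/-- A real array as a complex array. -/
def cArr (t : (Fin k → ι) → ℝ) (m : Fin k → ι) : ℂ := t m

/-- A real matrix as a complex matrix. -/
def cMat (A : Matrix ι ι ℝ) : Matrix ι ι ℂ := A.map Complex.ofRealHom

lemma cMat_apply (A : Matrix ι ι ℝ) (a b : ι) : cMat A a b = (A a b : ℂ) := rfl

lemma cMat_mul (A B : Matrix ι ι ℝ) : cMat (A * B) = cMat A * cMat B := Matrix.map_mul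

lemma cMat_one : cMat (1 : Matrix ι ι ℝ) = 1 := Matrix.map_one _ (map_zero _) (map_one _)

lemma slot_cArr (i : Fin k) (A : Matrix ι ι ℝ) (t : (Fin k → ι) → ℝ) :
    slot i (cMat A) (cArr t) = cArr (slot i A t) := by
  ext m
  simp only [slot_apply, cArr, cMat_apply, Complex.ofReal_sum, Complex.ofReal_mul]

/-- The matrix `1 + i A`. -/
def holMat (A : Matrix ι ι ℝ) : Matrix ι ι ℂ := 1 + Complex.I • cMat A

lemma slot_holMat (i : Fin k) (A : Matrix ι ι ℝ) (t : (Fin k → ι) → ℂ) :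
    slot i (holMat A) t = t + Complex.I • slot i (cMat A) t := by
  rw [holMat, slot_add, slot_one, slot_smul]; rfl

/-- The action of a matrix on all slots of a 3-index array. -/
def act3 {X : Type*} [CommRing X] (Z : Matrix ι ι X) : Module.End X ((Fin 3 → ι) → X) :=
  slot 0 Z * slot 1 Z * slot 2 Z

lemma act3_mul {X : Type*} [CommRing X] (V Z : Matrix ι ι X) : act3 (V * Z) = act3 V * act3 Z := by
  refine LinearMap.ext fun t => ?_
  simp only [act3, slot_mul, Module.End.mul_apply, slot10, slot20, slot21]

lemma act3_smul {X : Type*} [CommRing X] (c : X) (Z : Matrix ι ι X) :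
    act3 (c • Z) = c ^ 3 • act3 Z := by
  refine LinearMap.ext fun t => ?_
  simp only [act3, slot_smul, Module.End.mul_apply, LinearMap.smul_apply, map_smul, smul_smul]
  congr 1; ring

lemma act3_apply {X : Type*} [CommRing X] (Z : Matrix ι ι X) (t : (Fin 3 → ι) → X) (a b c : ι) :
    act3 Z t ![a, b, c] = ∑ μ, ∑ ν, ∑ l, t ![μ, ν, l] * (Z a μ * Z b ν * Z c l) := by
  simp only [act3, Module.End.mul_apply, slot_vec3_zero, slot_vec3_one, slot_vec3_two,
    Finset.mul_sum]
  refine Finset.sum_congr rfl fun _ _ => Finset.sum_congr rfl fun _ _ =>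
    Finset.sum_congr rfl fun _ _ => ?_
  ring

/-- Expansion of `(1 + ip₀)(1 + ip₁)(1 + ip₂)` into real and imaginary parts. -/
lemma act3_holMat (p : Matrix ι ι ℝ) (t : (Fin 3 → ι) → ℝ) (m : Fin 3 → ι) :
    act3 (holMat p) (cArr t) m
      = ((t - (slot 0 p (slot 1 p t) + slot 0 p (slot 2 p t) + slot 1 p (slot 2 p t))) m : ℝ)
        + Complex.I * ((slotSum p t - slot 0 p (slot 1 p (slot 2 p t))) m : ℝ) := by
  simp only [act3, Module.End.mul_apply, slot_holMat, map_add, map_smul, slot_cArr, cArr, slotSum,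
    Pi.add_apply, Pi.smul_apply, Pi.sub_apply, smul_eq_mul, Complex.ofReal_add, Complex.ofReal_sub]
  linear_combination ((slot 0 p (slot 1 p t) m : ℂ) + slot 0 p (slot 2 p t) m
    + slot 1 p (slot 2 p t) m + Complex.I * slot 0 p (slot 1 p (slot 2 p t)) m) * Complex.I_sq

lemma update_vec4_zero (a b c e ν : ι) : Function.update ![a, b, c, e] 0 ν = ![ν, b, c, e] := by
  ext i; fin_cases i <;> rfl
lemma update_vec4_one (a b c e ν : ι) : Function.update ![a, b, c, e] 1 ν = ![a, ν, c, e] := by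
  ext i; fin_cases i <;> rfl
lemma update_vec4_two (a b c e ν : ι) : Function.update ![a, b, c, e] 2 ν = ![a, b, ν, e] := by
  ext i; fin_cases i <;> rfl
lemma update_vec4_three (a b c e ν : ι) : Function.update ![a, b, c, e] 3 ν = ![a, b, c, ν] := by
  ext i; fin_cases i <;> rfl

lemma ext_vec4 {X : Type*} {s t : (Fin 4 → ι) → X}
    (h : ∀ a b c e, s ![a, b, c, e] = t ![a, b, c, e]) : s = t := by
  ext m
  have : m = ![m 0, m 1, m 2, m 3] := by ext i; fin_cases i <;> rfl
  rw [this, h]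

end ComplexArrays

variable {n : ℕ}

/-- The action of a matrix on all slots of a 4-index array. -/
def act4 {X : Type*} [CommRing X] (Z : Matrix (Fin n) (Fin n) X) :
    Module.End X ((Fin 4 → Fin n) → X) := slot 0 Z * slot 1 Z * slot 2 Z * slot 3 Z

lemma act4_mul {X : Type*} [CommRing X] (V Z : Matrix (Fin n) (Fin n) X) :
    act4 (V * Z) = act4 V * act4 Z := by
  refine LinearMap.ext fun t => ?_
  simp only [act4, slot_mul, Module.End.mul_apply, slot4_10, slot4_20, slot4_30, slot4_21, slot4_31,
    slot4_32]

lemma act4_apply {X : Type*} [CommRing X] (Z : Matrix (Fin n) (Fin n) X)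
    (t : (Fin 4 → Fin n) → X) (a b c e : Fin n) :
    act4 Z t ![a, b, c, e] = ∑ μ, ∑ ν, ∑ l, ∑ σ,
      Z a σ * (t ![σ, μ, ν, l] * (Z b μ * (Z c ν * Z e l))) := by
  have h : act4 Z t = slot 1 Z (slot 2 Z (slot 3 Z (slot 0 Z t))) := by
    simp only [act4, Module.End.mul_apply, slot4_10, slot4_20, slot4_30]
  rw [h]
  simp only [slot_apply, update_vec4_zero, update_vec4_one, update_vec4_two, update_vec4_three,
    Finset.mul_sum]
  refine Finset.sum_congr rfl fun _ _ => Finset.sum_congr rfl fun _ _ =>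
    Finset.sum_congr rfl fun _ _ => Finset.sum_congr rfl fun _ _ => ?_
  simp only [Matrix.cons_val]
  ring

section Permutations

variable {X : Type*} [CommRing X] (Z : Matrix (Fin n) (Fin n) X) (t : (Fin 4 → Fin n) → X)

lemma act4_swap01 : act4 Z (permSlots (Equiv.swap 0 1) t) = permSlots (Equiv.swap 0 1) (act4 Z t) := by
  have e0 : ∀ t, slot 0 Z (permSlots (Equiv.swap 0 1) t) = permSlots (Equiv.swap 0 1) (slot 1 Z t) :=
    fun t => slot_permSlots _ (0 : Fin 4) _ _
  have e1 : ∀ t, slot 1 Z (permSlots (Equiv.swap 0 1) t) = permSlots (Equiv.swap 0 1) (slot 0 Z t) :=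
    fun t => slot_permSlots _ (1 : Fin 4) _ _
  have e2 : ∀ t, slot 2 Z (permSlots (Equiv.swap 0 1) t) = permSlots (Equiv.swap 0 1) (slot 2 Z t) :=
    fun t => slot_permSlots _ (2 : Fin 4) _ _
  have e3 : ∀ t, slot 3 Z (permSlots (Equiv.swap 0 1) t) = permSlots (Equiv.swap 0 1) (slot 3 Z t) :=
    fun t => slot_permSlots _ (3 : Fin 4) _ _
  simp only [act4, Module.End.mul_apply, e0, e1, e2, e3, slot4_10]

lemma act4_swap12 : act4 Z (permSlots (Equiv.swap 1 2) t) = permSlots (Equiv.swap 1 2) (act4 Z t) := by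
  have e0 : ∀ t, slot 0 Z (permSlots (Equiv.swap 1 2) t) = permSlots (Equiv.swap 1 2) (slot 0 Z t) :=
    fun t => slot_permSlots _ (0 : Fin 4) _ _
  have e1 : ∀ t, slot 1 Z (permSlots (Equiv.swap 1 2) t) = permSlots (Equiv.swap 1 2) (slot 2 Z t) :=
    fun t => slot_permSlots _ (1 : Fin 4) _ _
  have e2 : ∀ t, slot 2 Z (permSlots (Equiv.swap 1 2) t) = permSlots (Equiv.swap 1 2) (slot 1 Z t) :=
    fun t => slot_permSlots _ (2 : Fin 4) _ _
  have e3 : ∀ t, slot 3 Z (permSlots (Equiv.swap 1 2) t) = permSlots (Equiv.swap 1 2) (slot 3 Z t) :=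
    fun t => slot_permSlots _ (3 : Fin 4) _ _
  simp only [act4, Module.End.mul_apply, e0, e1, e2, e3, slot4_21]

lemma act4_swap23 : act4 Z (permSlots (Equiv.swap 2 3) t) = permSlots (Equiv.swap 2 3) (act4 Z t) := by
  have e0 : ∀ t, slot 0 Z (permSlots (Equiv.swap 2 3) t) = permSlots (Equiv.swap 2 3) (slot 0 Z t) :=
    fun t => slot_permSlots _ (0 : Fin 4) _ _
  have e1 : ∀ t, slot 1 Z (permSlots (Equiv.swap 2 3) t) = permSlots (Equiv.swap 2 3) (slot 1 Z t) :=
    fun t => slot_permSlots _ (1 : Fin 4) _ _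
  have e2 : ∀ t, slot 2 Z (permSlots (Equiv.swap 2 3) t) = permSlots (Equiv.swap 2 3) (slot 3 Z t) :=
    fun t => slot_permSlots _ (2 : Fin 4) _ _
  have e3 : ∀ t, slot 3 Z (permSlots (Equiv.swap 2 3) t) = permSlots (Equiv.swap 2 3) (slot 2 Z t) :=
    fun t => slot_permSlots _ (3 : Fin 4) _ _
  simp only [act4, Module.End.mul_apply, e0, e1, e2, e3, slot4_32]

lemma permSlots_swap01_vec4 (a b c e : Fin n) :
    permSlots (Equiv.swap 0 1) t ![a, b, c, e] = t ![b, a, c, e] := by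
  rw [permSlots_apply]; congr 1; ext i; fin_cases i <;> rfl

lemma permSlots_swap12_vec4 (a b c e : Fin n) :
    permSlots (Equiv.swap 1 2) t ![a, b, c, e] = t ![a, c, b, e] := by
  rw [permSlots_apply]; congr 1; ext i; fin_cases i <;> rfl

lemma permSlots_swap23_vec4 (a b c e : Fin n) :
    permSlots (Equiv.swap 2 3) t ![a, b, c, e] = t ![a, b, e, c] := by
  rw [permSlots_apply]; congr 1; ext i; fin_cases i <;> rfl

end Permutations

/-- The antisymmetrization of an array that is alternating in its last three indices. -/
lemma alt4_of_alternating {q : Fin n → Fin n → Fin n → Fin n → ℂ}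
    (h1 : ∀ a b c e, q a c b e = -q a b c e) (h2 : ∀ a b c e, q a b e c = -q a b c e)
    (a b c e : Fin n) :
    alt4 q a b c e = 6 * (q a b c e - q b a c e + q c a b e - q e a b c) := by
  have k1 : ∀ x u v w, q x v w u = q x u v w := fun x u v w => by
    rw [h2, h1, neg_neg]
  have k2 : ∀ x u v w, q x w u v = q x u v w := fun x u v w => by
    rw [h1, h2, neg_neg]
  have k3 : ∀ x u v w, q x w v u = -q x u v w := fun x u v w => by
    rw [h1, k1]
  have s := fun x u v w =>
    (⟨h1 x u v w, h2 x u v w, k1 x u v w, k2 x u v w, k3 x u v w⟩ :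
      _ ∧ _ ∧ _ ∧ _ ∧ _)
  obtain ⟨a1, a2, a3, a4, a5⟩ := s a b c e
  obtain ⟨b1, b2, b3, b4, b5⟩ := s b a c e
  obtain ⟨c1, c2, c3, c4, c5⟩ := s c a b e
  obtain ⟨d1, d2, d3, d4, d5⟩ := s e a b c
  rw [alt4, a1, a2, a3, a4, a5, b1, b2, b3, b4, b5, c1, c2, c3, c4, c5, d1, d2, d3, d4, d5]
  ring

/-- If the antisymmetrization of a transformed array vanishes, so does the transform of its
antisymmetrization. -/
lemma act4_eq_zero_of_alt4 {D d : (Fin 4 → Fin n) → ℝ}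
    (h1 : ∀ a b c e, D ![a, c, b, e] = -D ![a, b, c, e])
    (h2 : ∀ a b c e, D ![a, b, e, c] = -D ![a, b, c, e])
    (hd : ∀ a b c e, d ![a, b, c, e]
      = D ![a, b, c, e] - D ![b, a, c, e] + D ![c, a, b, e] - D ![e, a, b, c])
    {Z : Matrix (Fin n) (Fin n) ℂ}
    (hZ : ∀ a b c e, alt4 (fun a b c e => act4 Z (cArr D) ![a, b, c, e]) a b c e = 0) :
    act4 Z (cArr d) = 0 := by
  have n1 : permSlots (Equiv.swap 1 2) (cArr D) = -cArr D := ext_vec4 fun a b c e => by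
    rw [permSlots_swap12_vec4, Pi.neg_apply, cArr, cArr, ← Complex.ofReal_neg, h1]
  have n2 : permSlots (Equiv.swap 2 3) (cArr D) = -cArr D := ext_vec4 fun a b c e => by
    rw [permSlots_swap23_vec4, Pi.neg_apply, cArr, cArr, ← Complex.ofReal_neg, h2]
  -- The alternation is written with successive adjacent transpositions, each of which commutes with
  -- the action of `Z` on all slots.
  have hD : cArr d = cArr D - permSlots (Equiv.swap 0 1) (cArr D)
      + permSlots (Equiv.swap 1 2) (permSlots (Equiv.swap 0 1) (cArr D))
      - permSlots (Equiv.swap 2 3) (permSlots (Equiv.swap 1 2)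
        (permSlots (Equiv.swap 0 1) (cArr D))) := ext_vec4 fun a b c e => by
    simp only [Pi.add_apply, Pi.sub_apply, permSlots_swap01_vec4, permSlots_swap12_vec4,
      permSlots_swap23_vec4]
    simp only [cArr, hd, Complex.ofReal_sub, Complex.ofReal_add]
  have m1 := act4_swap12 Z (cArr D)
  have m2 := act4_swap23 Z (cArr D)
  rw [n1, map_neg] at m1
  rw [n2, map_neg] at m2
  have hA : ∀ a b c e, act4 Z (cArr D) ![a, c, b, e] = -act4 Z (cArr D) ![a, b, c, e] :=
    fun a b c e => by rw [← permSlots_swap12_vec4 (act4 Z (cArr D)), ← m1]; rfl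
  have hB : ∀ a b c e, act4 Z (cArr D) ![a, b, e, c] = -act4 Z (cArr D) ![a, b, c, e] :=
    fun a b c e => by rw [← permSlots_swap23_vec4 (act4 Z (cArr D)), ← m2]; rfl
  refine ext_vec4 fun a b c e => ?_
  have h := hZ a b c e
  rw [alt4_of_alternating (q := fun a b c e => act4 Z (cArr D) ![a, b, c, e]) hA hB] at h
  rw [hD]
  simp only [map_add, map_sub, act4_swap01, act4_swap12, act4_swap23, Pi.add_apply, Pi.sub_apply,
    permSlots_swap01_vec4, permSlots_swap12_vec4, permSlots_swap23_vec4]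
  exact (mul_eq_zero.1 h).resolve_left (by norm_num)

/-- If the antisymmetrization of the transformed derivative of a 3-form vanishes, so does its
transformed exterior derivative. -/
lemma act4_extD_eq_zero {C : Coord n → (Fin 3 → Fin n) → ℝ} {y : Coord n}
    {U : Set (Coord n)} (hU : IsOpen U) (hC : IsThreeForm U C) (hy : y ∈ U)
    {Z : Matrix (Fin n) (Fin n) ℂ}
    (hZ : ∀ a b c e, alt4 (fun a b c e => act4 Z (cArr (dArr C y)) ![a, b, c, e]) a b c e = 0) :
    act4 Z (cArr (extD C y)) = 0 := by
  refine act4_eq_zero_of_alt4 (D := dArr C y) (fun a b c e => ?_) (fun a b c e => ?_)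
    (fun a b c e => ?_) hZ
  · change pd a (fun z => C z ![c, b, e]) y = -pd a (fun z => C z ![b, c, e]) y
    rw [← pd_neg]
    refine pd_congr _ ?_
    filter_upwards [hU.mem_nhds hy] with z hz
    exact apply_swap_first (hC.swap12_eq z hz) (hC.rot_eq z hz) _ _ _
  · change pd a (fun z => C z ![b, e, c]) y = -pd a (fun z => C z ![b, c, e]) y
    rw [← pd_neg]
    refine pd_congr _ ?_
    filter_upwards [hU.mem_nhds hy] with z hz
    exact apply_swap_last (hC.swap12_eq z hz) _ _ _
  · exact extD_three C y ![a, b, c, e]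

/-- The imaginary part of `∏ (1 + iJ_k)` is the first elementary symmetric polynomial of the slot
actions minus the third. As `d` is real, the complex equation contains this real one. -/
lemma slotSum_of_act4_holMat {J : Matrix (Fin n) (Fin n) ℝ} {d : (Fin 4 → Fin n) → ℝ}
    (hd : act4 (holMat J) (cArr d) = 0) :
    slot 0 J d + slot 1 J d + slot 2 J d + slot 3 J d
      = slot 0 J (slot 1 J (slot 2 J d)) + slot 0 J (slot 1 J (slot 3 J d))
        + slot 0 J (slot 2 J (slot 3 J d)) + slot 1 J (slot 2 J (slot 3 J d)) := by
  ext m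
  have h := congrArg Complex.im (congrFun hd m)
  simp only [act4, Module.End.mul_apply, slot_holMat, map_add, map_smul, slot_cArr, cArr,
    Pi.add_apply, Pi.smul_apply, smul_eq_mul, Complex.add_im, Complex.mul_im, Complex.mul_re,
    Complex.add_re, Complex.I_re, Complex.I_im, Complex.ofReal_re, Complex.ofReal_im, Pi.zero_apply,
    Complex.zero_im, zero_mul, one_mul, zero_add, add_zero, mul_zero, sub_zero, zero_sub] at h
  simp only [Pi.add_apply]
  linarith

end TorsionType

end CliffordKT

namespace CliffordKT

/-! ### The holomorphic combination `Q + i Q^a` -/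

namespace DiffOpAlg

variable {n : ℕ} {R A : Type*} [CommRing R] [Algebra ℂ R] [Ring A] [Algebra ℂ A]
  (O : DiffOpAlg n R A)

/-- Charges depend linearly on their coefficients. -/
lemma charge_add_smul (v v' : Fin n → Fin n → R) (t t' : Fin n → Fin n → Fin n → R) (k : ℂ) :
    O.charge (fun a μ => v a μ + k • v' a μ) (fun a b c => t a b c + k • t' a b c)
      = O.charge v t + k • O.charge v' t' := by
  have hl : ∀ u u' : Fin n → R, O.lin (fun a => u a + k • u' a) = O.lin u + k • O.lin u' := by
    intro u u'
    simp only [lin, map_add, map_smul, add_mul, smul_mul_assoc, Finset.sum_add_distrib,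
      Finset.smul_sum]
  have hc : O.cub (fun a b c => t a b c + k • t' a b c) = O.cub t + k • O.cub t' := by
    simp only [cub, map_add, map_smul, add_mul, smul_mul_assoc, Finset.sum_add_distrib,
      Finset.smul_sum]
  have hd : O.lin (fun a => (1 / 2 : ℂ) • ∑ μ, O.δ μ (v a μ + k • v' a μ))
      = O.lin (fun a => (1 / 2 : ℂ) • ∑ μ, O.δ μ (v a μ))
        + k • O.lin (fun a => (1 / 2 : ℂ) • ∑ μ, O.δ μ (v' a μ)) := by
    rw [← hl]
    congr 1
    funext a
    simp only [map_add, Derivation.map_smul, Finset.sum_add_distrib, smul_add, ← Finset.smul_sum]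
    rw [smul_comm k]
  have hs : ∀ μ, O.symb (fun a μ => v a μ + k • v' a μ) μ = O.symb v μ + k • O.symb v' μ :=
    fun μ => hl _ _
  simp only [charge, order0, hs, hc, hd, add_mul, smul_mul_assoc, Finset.sum_add_distrib, smul_add,
    ← Finset.smul_sum]
  abel

end DiffOpAlg

/-- The holomorphic combination of two anticommuting elements with equal squares is nilpotent. -/
lemma add_I_smul_mul_self {A : Type*} [Ring A] [Algebra ℂ A] {x y : A} (h01 : x * x = y * y)
    (h1 : x * y + y * x = 0) : (x + Complex.I • y) * (x + Complex.I • y) = 0 := by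
  have e2 : x * y = -(y * x) := eq_neg_of_add_eq_zero_left h1
  rw [mul_add, add_mul, add_mul, smul_mul_smul_comm, Complex.I_mul_I, mul_smul_comm,
    smul_mul_assoc, h01, e2, neg_one_smul, smul_neg]
  abel

section ChargeType

open Topology TopologicalSpace Matrix DiffOpAlg

variable {n : ℕ} {U : Opens (Coord n)} {g e J : Coord n → Matrix (Fin n) (Fin n) ℝ}
  {C : Coord n → (Fin 3 → Fin n) → ℝ}

/-- The holomorphic combination of the symbols of the charges. -/
def holSymbol (h : IsFrame (U : Set (Coord n)) g e) (hJ : IsComplexStr (U : Set (Coord n)) g J)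
    (a μ : Fin n) : smoothFun U := singletSymbol h a μ + Complex.I • structureSymbol h hJ a μ

/-- The holomorphic combination of the cubic coefficients of the charges. -/
def holCoeff (h : IsFrame (U : Set (Coord n)) g e)
    (hJ : IsComplexStr (U : Set (Coord n)) g J) (hC : IsThreeForm (U : Set (Coord n)) C)
    (a b c : Fin n) : smoothFun U :=
  singletCoeff h hC a b c + Complex.I • structureCoeff h hJ hC a b c

/-- The values of the holomorphic symbol. -/
def holFrame (e J : Coord n → Matrix (Fin n) (Fin n) ℝ) (y : Coord n) : Matrix (Fin n) (Fin n) ℂ :=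
  (-Complex.I) • (cMat (e y) * holMat (J y))

lemma holFrame_apply (y : Coord n) (a μ : Fin n) :
    holFrame e J y a μ = -Complex.I * (e y a μ : ℂ) + ((e y * J y) a μ : ℝ) := by
  rw [holFrame, holMat, mul_add, mul_one, Matrix.mul_smul, ← cMat_mul, Matrix.smul_apply,
    Matrix.add_apply, Matrix.smul_apply, cMat_apply, cMat_apply, smul_eq_mul, smul_eq_mul]
  linear_combination (-((e y * J y) a μ : ℝ) : ℂ) * Complex.I_sq

lemma evalAt_holSymbol (h : IsFrame (U : Set (Coord n)) g e)
    (hJ : IsComplexStr (U : Set (Coord n)) g J) (y : U) (a μ : Fin n) :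
    evalAt y (holSymbol h hJ a μ) = holFrame e J y a μ := by
  rw [holFrame_apply]
  simp only [holSymbol, singletSymbol, structureSymbol, map_add, map_smul, evalAt_realFun, smul_eq_mul]
  linear_combination (-((e y * J y) a μ : ℝ) : ℂ) * Complex.I_sq

lemma evalAt_holCoeff (h : IsFrame (U : Set (Coord n)) g e)
    (hJ : IsComplexStr (U : Set (Coord n)) g J) (hC : IsThreeForm (U : Set (Coord n)) C) (y : U)
    (a b c : Fin n) : evalAt y (holCoeff h hJ hC a b c)
      = Complex.I * (singletCubic (flatOm g e y) (flatC e C y) ![a, b, c] : ℂ)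
        - (structureCubic (flatJ g e J y) (flatOm g e y) (flatC e C y) ![a, b, c] : ℂ) := by
  simp only [holCoeff, singletCoeff, structureCoeff, map_add, map_smul, evalAt_realFun, smul_eq_mul]
  linear_combination
    (structureCubic (flatJ g e J y) (flatOm g e y) (flatC e C y) ![a, b, c] : ℂ) * Complex.I_sq

lemma evalAt_insert3_holCoeff (h : IsFrame (U : Set (Coord n)) g e)
    (hJ : IsComplexStr (U : Set (Coord n)) g J) (hC : IsThreeForm (U : Set (Coord n)) C) (y : U)
    (a b c : Fin n) :
    evalAt y (insert3 (realMat (h.smooth_flatJ hJ.smooth)) (holCoeff h hJ hC) a b c)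
      = Complex.I * (slotSum (flatJ g e J y) (singletCubic (flatOm g e y) (flatC e C y)) ![a, b, c] : ℂ)
        - (slotSum (flatJ g e J y)
          (structureCubic (flatJ g e J y) (flatOm g e y) (flatC e C y)) ![a, b, c] : ℂ) := by
  have key : ∀ (P s t : Fin n → ℝ), ∑ k, (P k : ℂ) * (Complex.I * (s k : ℂ) - (t k : ℂ))
      = Complex.I * ((∑ k, P k * s k : ℝ) : ℂ) - ((∑ k, P k * t k : ℝ) : ℂ) := by
    intro P s t
    simp only [Complex.ofReal_sum, Complex.ofReal_mul, Finset.mul_sum, ← Finset.sum_sub_distrib]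
    exact Finset.sum_congr rfl fun k _ => by ring
  simp only [insert3, map_add, map_sum, map_mul, evalAt_realMat, evalAt_holCoeff, key, slotSum,
    Pi.add_apply, slot_vec3_zero, slot_vec3_one, slot_vec3_two, Complex.ofReal_add]
  ring

lemma evalAt_holSymbol_deriv (h : IsFrame (U : Set (Coord n)) g e)
    (hJ : IsComplexStr (U : Set (Coord n)) g J) (hC : IsThreeForm (U : Set (Coord n)) C)
    (hB : IsCompletion (U : Set (Coord n)) g J C) (y : U) (a b c : Fin n) :
    evalAt y (∑ μ, holSymbol h hJ a μ * derivFun U μ (realMat (h.smooth_flatJ hJ.smooth) b c))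
      = -Complex.I * ((structureDeriv (flatJ g e J y) (flatC e C y)
          + slot 1 (flatJ g e J y) (flatOm g e y) + slot 2 (flatJ g e J y) (flatOm g e y)) ![a, b, c] : ℝ)
        + (slot 0 (flatJ g e J y) (structureDeriv (flatJ g e J y) (flatC e C y)
          + slot 1 (flatJ g e J y) (flatOm g e y) + slot 2 (flatJ g e J y) (flatOm g e y)) ![a, b, c] : ℝ) := by
  rw [← frame_pdMat_flatJ h hJ hC hB y.2, ← Module.End.mul_apply, ← slot_mul, flatJ_mul_frame h y.2,
    slot_vec3_zero, slot_vec3_zero, map_sum, Complex.ofReal_sum, Complex.ofReal_sum, Finset.mul_sum,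
    ← Finset.sum_add_distrib]
  refine Finset.sum_congr rfl fun μ _ => ?_
  have e1 : evalAt y (derivFun U μ (realMat (h.smooth_flatJ hJ.smooth) b c))
      = (arr (pdMat (flatJ g e J) y) ![μ, b, c] : ℂ) :=
    evalAt_derivFun_realFun (h.smooth_flatJ hJ.smooth b c) μ y
  rw [map_mul, e1, evalAt_holSymbol, holFrame_apply, Complex.ofReal_mul, Complex.ofReal_mul]
  ring

/-- The holomorphic frame is `-i` times `1 + iP` times the vielbein. The overall factor `(-i)³ = i`
exchanges the real and imaginary parts of `act3_holMat`, up to sign. -/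
lemma evalAt_sum_holSymbol (h : IsFrame (U : Set (Coord n)) g e)
    (hJ : IsComplexStr (U : Set (Coord n)) g J) (hC : IsThreeForm (U : Set (Coord n)) C)
    (y : U) (a b c : Fin n) :
    evalAt y (∑ μ, ∑ ν, ∑ l, realFun (hC.smooth ![μ, ν, l])
        * (holSymbol h hJ a μ * holSymbol h hJ b ν * holSymbol h hJ c l))
      = Complex.I * ((flatC e C y - (slot 0 (flatJ g e J y) (slot 1 (flatJ g e J y) (flatC e C y))
          + slot 0 (flatJ g e J y) (slot 2 (flatJ g e J y) (flatC e C y))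
          + slot 1 (flatJ g e J y) (slot 2 (flatJ g e J y) (flatC e C y)))) ![a, b, c] : ℝ)
        - ((slotSum (flatJ g e J y) (flatC e C y)
          - slot 0 (flatJ g e J y) (slot 1 (flatJ g e J y) (slot 2 (flatJ g e J y) (flatC e C y))))
            ![a, b, c] : ℝ) := by
  have e1 : holFrame e J y = (-Complex.I) • (holMat (flatJ g e J y) * cMat (e y)) := by
    rw [holFrame, holMat, holMat, mul_add, add_mul, mul_one, one_mul, Matrix.mul_smul,
      Matrix.smul_mul, ← cMat_mul, ← cMat_mul, flatJ_mul_frame h y.2]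
  have e2 : act3 (cMat (e y)) (cArr (C y)) = cArr (flatC e C y) := by
    simp only [act3, Module.End.mul_apply, slot_cArr]; rfl
  have e3 : evalAt y (∑ μ, ∑ ν, ∑ l, realFun (hC.smooth ![μ, ν, l])
        * (holSymbol h hJ a μ * holSymbol h hJ b ν * holSymbol h hJ c l))
      = act3 (holFrame e J y) (cArr (C y)) ![a, b, c] := by
    simp only [act3_apply, map_sum, map_mul, evalAt_holSymbol]
    rfl
  rw [e3, e1, act3_smul, act3_mul, LinearMap.smul_apply, Module.End.mul_apply, e2, Pi.smul_apply,
    act3_holMat, smul_eq_mul]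
  have e4 : (-Complex.I) ^ 3 = Complex.I := by
    rw [show (-Complex.I) ^ 3 = -(Complex.I ^ 2 * Complex.I) by ring, Complex.I_sq]; ring
  rw [e4, mul_add, ← mul_assoc, Complex.I_mul_I]
  ring

variable {S : Type*} [NormedAddCommGroup S] [NormedSpace ℂ S] [FiniteDimensional ℂ S]
  (F : FermionRep n S)

/-- The type of the exterior derivative of the torsion if the charges form an `𝒩 = 2` algebra. -/
theorem act4_holMat_extD [Nontrivial S] (h : IsFrame (U : Set (Coord n)) g e)
    (hJ : IsComplexStr (U : Set (Coord n)) g J) (hC : IsThreeForm (U : Set (Coord n)) C)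
    (hB : IsCompletion (U : Set (Coord n)) g J C)
    (h01 : singletOp F h hC * singletOp F h hC = structureOp F h hJ hC * structureOp F h hJ hC)
    (h1 : singletOp F h hC * structureOp F h hJ hC + structureOp F h hJ hC * singletOp F h hC = 0)
    (y : U) : act4 (holMat (J y)) (cArr (extD C y)) = 0 := by
  -- The square is `Q² - (Q^a)² + i {Q, Q^a}`.
  have hD : (diffOps U F).charge (holSymbol h hJ) (holCoeff h hJ hC)
      * (diffOps U F).charge (holSymbol h hJ) (holCoeff h hJ hC) = 0 := by
    have e1 : (diffOps U F).charge (holSymbol h hJ) (holCoeff h hJ hC)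
        = singletOp F h hC + Complex.I • structureOp F h hJ hC := charge_add_smul _ _ _ _ _ _
    rw [e1]
    exact add_I_smul_mul_self (A := Module.End ℂ (smoothSec U S)) h01 h1
  -- `J (1 + iJ) = -i (1 + iJ)`: the holomorphic frame lies in one eigenspace of the structure.
  have hjz : ∀ a μ, ∑ b, realMat (h.smooth_flatJ hJ.smooth) a b * holSymbol h hJ b μ
      = (-Complex.I) • holSymbol h hJ a μ := by
    intro a μ
    refine evalAt_injective fun y => ?_
    have e1 : cMat (flatJ g e J y) * holFrame e J y = (-Complex.I) • holFrame e J y := by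
      rw [holFrame, holMat, Matrix.mul_smul, ← mul_assoc, ← cMat_mul, flatJ_mul_frame h y.2, cMat_mul,
        mul_assoc, mul_add, Matrix.mul_smul, ← cMat_mul, hJ.sq y y.2]
      have e2 : cMat (-1 : Matrix (Fin n) (Fin n) ℝ) = -1 := by
        ext a b; rw [cMat_apply, Matrix.neg_apply, Matrix.neg_apply, Complex.ofReal_neg, ← cMat_apply,
          cMat_one]
      rw [e2, smul_smul, mul_one, mul_add, mul_add, Matrix.mul_smul, Matrix.mul_smul]
      simp only [smul_add, smul_smul, mul_neg, mul_one, neg_mul, neg_neg, Complex.I_mul_I, smul_neg,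
        neg_smul, one_smul]
      module
    have e3 := congrFun (congrFun e1 a) μ
    rw [Matrix.mul_apply, Matrix.smul_apply] at e3
    rw [map_smul, evalAt_holSymbol, ← e3, map_sum]
    refine Finset.sum_congr rfl fun b _ => ?_
    rw [map_mul, evalAt_holSymbol, evalAt_realMat, cMat_apply]
  have h4 := (diffOps U F).alt4_eq_zero_of_mul_self_eq_zero mulOp_injective hD
    (realMat_antisymm (h.smooth_flatJ hJ.smooth) fun y hy => transpose_flatJ hJ hy) hjz
    (fun μ ν l => realFun (hC.smooth ![μ, ν, l])) (fun a b c => evalAt_injective fun y => by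
      -- `X` and `Y` are the real and imaginary parts of the cubic mismatch in `[G, D]`, evaluated
      -- at the point; their alternations vanish by `altSum_re` and `altSum_im`.
      set X := -slotSum (flatJ g e J y) (singletCubic (flatOm g e y) (flatC e C y))
        - (1 / 2 : ℝ) • (structureDeriv (flatJ g e J y) (flatC e C y)
          + slot 1 (flatJ g e J y) (flatOm g e y) + slot 2 (flatJ g e J y) (flatOm g e y))
        + structureCubic (flatJ g e J y) (flatOm g e y) (flatC e C y)
        + (1 / 24 : ℝ) • (slotSum (flatJ g e J y) (flatC e C y)
          - slot 0 (flatJ g e J y) (slot 1 (flatJ g e J y) (slot 2 (flatJ g e J y) (flatC e C y)))) with hX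
      set Y := -slotSum (flatJ g e J y) (structureCubic (flatJ g e J y) (flatOm g e y) (flatC e C y))
        - (1 / 2 : ℝ) • slot 0 (flatJ g e J y) (structureDeriv (flatJ g e J y) (flatC e C y)
          + slot 1 (flatJ g e J y) (flatOm g e y) + slot 2 (flatJ g e J y) (flatOm g e y))
        - singletCubic (flatOm g e y) (flatC e C y)
        - (1 / 24 : ℝ) • (flatC e C y - (slot 0 (flatJ g e J y) (slot 1 (flatJ g e J y) (flatC e C y))
          + slot 0 (flatJ g e J y) (slot 2 (flatJ g e J y) (flatC e C y))
          + slot 1 (flatJ g e J y) (slot 2 (flatJ g e J y) (flatC e C y)))) with hY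
      have hXY : altSum X ![a, b, c] = 0 ∧ altSum Y ![a, b, c] = 0 :=
        ⟨congrFun (altSum_re (flatJ_sq h hJ y.2) (swap12_flatOm h y.2) (swap12_flatC hC y.2)
          (rot_flatC hC y.2)) _, congrFun (altSum_im (flatJ_sq h hJ y.2) (swap12_flatOm h y.2)
          (swap12_flatC hC y.2) (rot_flatC hC y.2)) _⟩
      have hr : ∀ a b c, evalAt y (Complex.I • insert3 (realMat (h.smooth_flatJ hJ.smooth))
            (holCoeff h hJ hC) a b c - (Complex.I / 2) • ∑ μ, holSymbol h hJ a μ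
              * (diffOps U F).δ μ (realMat (h.smooth_flatJ hJ.smooth) b c) - holCoeff h hJ hC a b c
            - (1 / 24 : ℂ) • ∑ μ, ∑ ν, ∑ l, realFun (hC.smooth ![μ, ν, l])
              * (holSymbol h hJ a μ * holSymbol h hJ b ν * holSymbol h hJ c l))
          = (X ![a, b, c] : ℂ) + Complex.I * (Y ![a, b, c] : ℂ) := by
        intro a b c
        have e5 := evalAt_holSymbol_deriv h hJ hC hB y a b c
        rw [map_sub, map_sub, map_sub, map_smul, map_smul, map_smul, evalAt_insert3_holCoeff,
          evalAt_holCoeff, evalAt_sum_holSymbol h hJ hC]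
        erw [e5]
        simp only [hX, hY, Pi.add_apply, Pi.sub_apply, Pi.neg_apply, Pi.smul_apply, smul_eq_mul,
          Complex.ofReal_add, Complex.ofReal_sub, Complex.ofReal_neg, Complex.ofReal_mul,
          Complex.ofReal_div, Complex.ofReal_one, Complex.ofReal_ofNat]
        ring_nf
        simp only [Complex.I_sq]
        ring
      rw [map_zero]
      simp only [alt3, map_add, map_sub, hr] at hr ⊢
      obtain ⟨x1, y1⟩ := hXY
      simp only [altSum, cyc, Pi.sub_apply, Pi.add_apply, rot_apply, swap12_apply] at x1 y1
      have x2 := congrArg (fun r : ℝ => (r : ℂ)) x1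
      have y2 := congrArg (fun r : ℝ => (r : ℂ)) y1
      simp only [Complex.ofReal_add, Complex.ofReal_sub, Complex.ofReal_zero] at x2 y2
      linear_combination x2 + Complex.I * y2)
  have h5 : act4 (holFrame e J y) (cArr (extD C y)) = 0 := by
    refine act4_extD_eq_zero h.isOpen hC y.2 fun a b c d => ?_
    have h6 := congrArg (evalAt y) (h4 a b c d)
    rw [map_zero] at h6
    rw [← h6]
    have e6 : ∀ a b c d, act4 (holFrame e J y) (cArr (dArr C y)) ![a, b, c, d]
        = evalAt y (∑ μ, ∑ ν, ∑ l, ∑ σ, holSymbol h hJ a σ * ((diffOps U F).δ σ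
          (realFun (hC.smooth ![μ, ν, l])) * (holSymbol h hJ b μ * (holSymbol h hJ c ν
            * holSymbol h hJ d l)))) := by
      intro a b c d
      rw [act4_apply]
      simp only [map_sum, map_mul, evalAt_holSymbol]
      refine Finset.sum_congr rfl fun μ _ => Finset.sum_congr rfl fun ν _ =>
        Finset.sum_congr rfl fun l _ => Finset.sum_congr rfl fun σ _ => ?_
      congr 2
      exact (evalAt_derivFun_realFun (hC.smooth ![μ, ν, l]) σ y).symm
    simp only [alt4, e6, map_add, map_sub]
  -- The vielbein is stripped off by its inverse, leaving the projection in coordinate indices.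
  have hV : (Complex.I • cMat (g y * (e y)ᵀ)) * holFrame e J y = holMat (J y) := by
    rw [holFrame, Matrix.smul_mul, Matrix.mul_smul, ← mul_assoc, ← cMat_mul,
      metric_mul_frame (h.orthonormal y y.2), cMat_one, one_mul, smul_smul]
    simp
  rw [← hV, act4_mul, Module.End.mul_apply, h5, map_zero]

end ChargeType

end CliffordKT

namespace CliffordKT

/-! ### Both conclusions in a single chart -/

section Chart

open Topology TopologicalSpace Matrix DiffOpAlg

variable {n : ℕ} {U : Opens (Coord n)} {g e J : Coord n → Matrix (Fin n) (Fin n) ℝ}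
  {C : Coord n → (Fin 3 → Fin n) → ℝ}
  {S : Type*} [NormedAddCommGroup S] [NormedSpace ℂ S] [FiniteDimensional ℂ S]
  (F : FermionRep n S)

/-- The relations between the charges of an `𝒩 = 2` algebra. -/
lemma relations_of_susy (h : IsFrame (U : Set (Coord n)) g e)
    (hJ : IsComplexStr (U : Set (Coord n)) g J) (hC : IsThreeForm (U : Set (Coord n)) C)
    (hB : IsCompletion (U : Set (Coord n)) g J C)
    (hN2 : FormsSusyAlgebra (U : Set (Coord n))
      ![quantize F g (singletCharge g e C), quantize F g (structureCharge g e C J)]) :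
    singletOp F h hC * singletOp F h hC = structureOp F h hJ hC * structureOp F h hJ hC ∧
      singletOp F h hC * structureOp F h hJ hC + structureOp F h hJ hC * singletOp F h hC = 0 := by
  have hZ : ∀ A, Represents (![quantize F g (singletCharge g e C),
      quantize F g (structureCharge g e C J)] A)
      ((![conjDensity h (singletOp F h hC), conjDensity h (structureOp F h hJ hC)] :
        Fin 2 → Module.End ℂ (smoothSec U S)) A) := by
    intro A
    fin_cases A
    · exact represents_singlet F h hC
    · exact represents_structure F h hJ hC hB
  have h2 := (formsSusyAlgebra_iff hZ 0).1 hN2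
  have h00 := h2 1 1
  have h01 := h2 0 1
  rw [if_pos rfl, ← two_smul ℂ] at h00
  rw [if_neg (by decide)] at h01
  -- The diagonal relations read `2 (Q^a)² = 2 Q²`; division by two gives the equality of squares.
  have h3 := smul_right_injective _ (two_ne_zero (α := ℂ)) h00
  simp only [cons_val_zero, cons_val_one] at h3 h01
  rw [← conjDensity_mul, ← conjDensity_mul] at h3
  rw [← conjDensity_mul, ← conjDensity_mul, ← conjDensity_add] at h01
  refine ⟨(conjDensity_injective h h3).symm, conjDensity_injective h (h01.trans ?_)⟩
  simp [conjDensity]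

/-- The charges of a Clifford family of complex structures form an extended algebra if each of them
forms an `𝒩 = 2` algebra with the singlet charge. -/
theorem formsSusyAlgebra_cons [Nontrivial S] {K : ℕ}
    {J : Fin K → Coord n → Matrix (Fin n) (Fin n) ℝ}
    (h : IsFrame (U : Set (Coord n)) g e) (hJ : ∀ a, IsComplexStr (U : Set (Coord n)) g (J a))
    (hJJ : ∀ a b, a ≠ b → ∀ y ∈ U, J a y * J b y = -(J b y * J a y))
    (hC : IsThreeForm (U : Set (Coord n)) C)
    (hB : ∀ a, IsCompletion (U : Set (Coord n)) g (J a) C)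
    (hN : ∀ a b, ∀ y ∈ U, ∀ μ ν l, concomitant (J a) (J b) y μ ν l = 0)
    (hN2 : ∀ a, FormsSusyAlgebra (U : Set (Coord n))
      ![quantize F g (singletCharge g e C), quantize F g (structureCharge g e C (J a))]) :
    FormsSusyAlgebra (U : Set (Coord n)) (Fin.cons (quantize F g (singletCharge g e C))
      (fun a => quantize F g (structureCharge g e C (J a))) :
        Fin (K + 1) → (Coord n → S) → Coord n → S) := by
  have hr := fun a => relations_of_susy F h (hJ a) hC (hB a) (hN2 a)
  set Z : Fin (K + 1) → Module.End ℂ (smoothSec U S) :=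
    Fin.cons (singletOp F h hC) fun a => structureOp F h (hJ a) hC with hZdef
  have hZ : ∀ A, Represents ((Fin.cons (quantize F g (singletCharge g e C))
      (fun a => quantize F g (structureCharge g e C (J a))) :
        Fin (K + 1) → (Coord n → S) → Coord n → S) A) (conjDensity h (Z A)) := by
    intro A
    refine Fin.cases ?_ (fun a => ?_) A
    · exact represents_singlet F h hC
    · exact represents_structure F h (hJ a) hC (hB a)
  have hsq : ∀ A, Z A * Z A = Z 0 * Z 0 := fun A => by
    refine Fin.cases rfl (fun a => ?_) A
    exact (hr a).1.symm
  have hne : ∀ A B, A ≠ B → Z A * Z B + Z B * Z A = 0 := fun A B => by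
    refine Fin.cases ?_ (fun a => ?_) A
    · refine Fin.cases (fun hAB => absurd rfl hAB) (fun b _ => ?_) B
      exact (hr b).2
    · refine Fin.cases (fun _ => ?_) (fun b hAB => ?_) B
      · exact (add_comm _ _).trans (hr a).2
      · have hab : a ≠ b := fun hab => hAB (congrArg Fin.succ hab)
        -- Only pairs of distinct complex structures go beyond the given `𝒩 = 2` relations.
        exact structureOp_anticomm F h (hJ a) (hJ b) (hJJ a b hab) hC (hB a) (hB b) (hN a b)
          (hr a).1 (hr b).1 (hr a).2 (hr b).2
  refine (formsSusyAlgebra_iff hZ 0).2 fun A B => ?_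
  simp only [← conjDensity_mul, ← conjDensity_add]
  split_ifs with hAB
  · subst hAB
    rw [hsq, conjDensity_add, two_smul]
  · rw [hne A B hAB]
    simp [conjDensity]

/-- The torsion equation holds if the charges form an `𝒩 = 2` algebra. -/
theorem torsion_eq_of_susy [Nontrivial S] (h : IsFrame (U : Set (Coord n)) g e)
    (hJ : IsComplexStr (U : Set (Coord n)) g J) (hC : IsThreeForm (U : Set (Coord n)) C)
    (hB : IsCompletion (U : Set (Coord n)) g J C)
    (hN2 : FormsSusyAlgebra (U : Set (Coord n))
      ![quantize F g (singletCharge g e C), quantize F g (structureCharge g e C J)])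
    {y : Coord n} (hy : y ∈ U) : iota J (extD C) y = (2 / 3 : ℝ) • extD (iota J C) y := by
  obtain ⟨h01, h1⟩ := relations_of_susy F h hJ hC hB hN2
  exact torsion_eq_of_type h hJ hy hC.smooth hC.rot_eq hC.swap12_eq hB
    (slotSum_of_act4_holMat (act4_holMat_extD F h hJ hC hB h01 h1 ⟨y, hy⟩))

end Chart

end CliffordKT

namespace CliffordKT

/-! ## Components of tensor fields in a chart -/

section Components

set_option linter.unusedSectionVars false

open Topology TopologicalSpace Matrix

variable {n : ℕ} {M : Type*} [TopologicalSpace M] [ChartedSpace (Coord n) M]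
  [IsManifold (𝓡 n) ∞ M] {c : OpenPartialHomeomorph M (Coord n)} {y : Coord n}

lemma mfderiv_comp_symm (hc : c ∈ atlas (Coord n) M) (hy : y ∈ c.target) (w : Coord n) :
    mfderiv (𝓡 n) (𝓡 n) c (c.symm y) (mfderiv (𝓡 n) (𝓡 n) c.symm y w) = w :=
  haveI : IsManifold (𝓡 n) 1 M := IsManifold.of_le (n := ∞) (by simp)
  DFunLike.congr_fun ((mdifferentiable_of_mem_atlas (I := 𝓡 n) hc).comp_symm_deriv hy) w

/-- In finite dimension a one-sided inverse is two-sided, so the images of the standard basis form a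
basis with the components of `D` as dual coordinates. -/
lemma sum_proj_smul_of_leftInverse {D E : Coord n →L[ℝ] Coord n} (h : ∀ w, D (E w) = w)
    (w : Coord n) : ∑ ν, D w ν • E (EuclideanSpace.single ν 1) = w := by
  have h1 : D.toLinearMap * E.toLinearMap = 1 := LinearMap.ext h
  have h2 : E (D w) = w := LinearMap.congr_fun (mul_eq_one_comm.1 h1) w
  have h3 : D w = ∑ ν, D w ν • (EuclideanSpace.single ν (1 : ℝ) : Coord n) := by
    ext ν
    rw [WithLp.ofLp_sum, Finset.sum_apply]
    simp [PiLp.single_apply]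
  conv_rhs => rw [← h2, h3, map_sum]
  exact Finset.sum_congr rfl fun ν _ => (E.map_smul _ _).symm

lemma sum_coordDiff_smul (hc : c ∈ atlas (Coord n) M) (hy : y ∈ c.target)
    (w : TangentSpace (𝓡 n) (c.symm y)) :
    ∑ ν, coordDiff c (c.symm y) ν w • coordVec c y ν = w :=
  sum_proj_smul_of_leftInverse (D := mfderiv (𝓡 n) (𝓡 n) c (c.symm y))
    (E := mfderiv (𝓡 n) (𝓡 n) c.symm y) (mfderiv_comp_symm hc hy) w

lemma coordDiff_coordVec (hc : c ∈ atlas (Coord n) M) (hy : y ∈ c.target) (μ ν : Fin n) :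
    coordDiff c (c.symm y) ν (coordVec c y μ) = if μ = ν then 1 else 0 := by
  have h := mfderiv_comp_symm hc hy (EuclideanSpace.single μ (1 : ℝ))
  have h2 := congrArg (EuclideanSpace.proj ν : Coord n →L[ℝ] ℝ) h
  refine h2.trans ?_
  simp [PiLp.single_apply, eq_comm]

lemma endField_coordVec (hc : c ∈ atlas (Coord n) M) (hy : y ∈ c.target) (J : EndField n M)
    (μ : Fin n) : J (c.symm y) (coordVec c y μ) = ∑ ν, endComp J c y μ ν • coordVec c y ν :=
  (sum_coordDiff_smul hc hy _).symm

lemma coordDiff_add (x : M) (ν : Fin n) (w w' : TangentSpace (𝓡 n) x) :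
    coordDiff c x ν (w + w') = coordDiff c x ν w + coordDiff c x ν w' := by
  simp only [coordDiff, map_add]
  rfl

lemma coordDiff_smul (x : M) (ν : Fin n) (k : ℝ) (w : TangentSpace (𝓡 n) x) :
    coordDiff c x ν (k • w) = k * coordDiff c x ν w := by
  simp only [coordDiff, map_smul]
  rfl

lemma coordDiff_sum {κ : Type*} (s : Finset κ) (x : M) (ν : Fin n) (w : κ → TangentSpace (𝓡 n) x) :
    coordDiff c x ν (∑ k ∈ s, w k) = ∑ k ∈ s, coordDiff c x ν (w k) := by
  classical
  induction s using Finset.induction_on with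
  | empty =>
    rw [Finset.sum_empty, Finset.sum_empty]
    have := coordDiff_smul (c := c) x ν 0 0
    rwa [zero_smul, zero_mul] at this
  | insert k s hk ih => rw [Finset.sum_insert hk, Finset.sum_insert hk, coordDiff_add, ih]

/-- Components are arranged with the lower index as row, so the matrix product corresponds to
composition in the opposite order. -/
lemma endComp_mul (hc : c ∈ atlas (Coord n) M) (hy : y ∈ c.target) (J J' : EndField n M) (μ ν : Fin n) :
    (endComp J c y * endComp J' c y) μ ν
      = coordDiff c (c.symm y) ν (J' (c.symm y) (J (c.symm y) (coordVec c y μ))) := by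
  rw [endField_coordVec hc hy, map_sum, coordDiff_sum, Matrix.mul_apply]
  refine Finset.sum_congr rfl fun l _ => ?_
  rw [map_smul, coordDiff_smul]
  rfl

variable {g : Metric n M} {K : ℕ} {J : Fin K → EndField n M}

lemma IsCliffordFamily.endComp_anticomm (hJ : IsCliffordFamily g J) (hc : c ∈ atlas (Coord n) M)
    (hy : y ∈ c.target) (a b : Fin K) :
    endComp (J a) c y * endComp (J b) c y + endComp (J b) c y * endComp (J a) c y
      = if a = b then (-2 : ℝ) • 1 else 0 := by
  ext μ ν
  rw [Matrix.add_apply, endComp_mul hc hy, endComp_mul hc hy, ← coordDiff_add]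
  have h := DFunLike.congr_fun (hJ.clifford b a (c.symm y)) (coordVec c y μ)
  have h' : J b (c.symm y) (J a (c.symm y) (coordVec c y μ))
      + J a (c.symm y) (J b (c.symm y) (coordVec c y μ))
      = (if b = a then (-2 : ℝ) else 0) • coordVec c y μ := by
    refine Eq.trans h ?_
    split_ifs
    · rfl
    · rw [zero_smul]; rfl
  rw [h', coordDiff_smul, coordDiff_coordVec hc hy]
  by_cases hab : a = b
  · rw [if_pos hab, if_pos hab.symm, Matrix.smul_apply, Matrix.one_apply, smul_eq_mul]
  · rw [if_neg hab, if_neg (Ne.symm hab), zero_mul, Matrix.zero_apply]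

lemma IsCliffordFamily.isComplexStr (hJ : IsCliffordFamily g J) (hc : c ∈ atlas (Coord n) M)
    (a : Fin K) : IsComplexStr c.target (metricComp g c) (endComp (J a) c) where
  smooth := hJ.smooth a c hc
  sq y hy := by
    have h := hJ.endComp_anticomm hc hy a a
    rw [if_pos rfl, ← two_smul ℝ, neg_smul, ← smul_neg] at h
    exact smul_right_injective _ (two_ne_zero (α := ℝ)) h
  antisymm y hy := by
    have h1 : ∀ μ ν, (endComp (J a) c y * metricComp g c y) μ ν
        = g.inner (c.symm y) (J a (c.symm y) (coordVec c y μ)) (coordVec c y ν) := by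
      intro μ ν
      rw [endField_coordVec hc hy, map_sum, _root_.sum_apply, Matrix.mul_apply]
      refine Finset.sum_congr rfl fun l _ => ?_
      rw [map_smul]
      rfl
    ext μ ν
    rw [Matrix.transpose_apply, Matrix.neg_apply, h1, h1, hJ.antisymm, g.symm]
  integrable y hy := hJ.integrable a c hc y hy

lemma IsVielbein.isFrame {e : Coord n → Matrix (Fin n) (Fin n) ℝ} (he : IsVielbein g c e) :
    IsFrame c.target (metricComp g c) e where
  isOpen := c.open_target
  symm y _ := by
    ext μ ν
    exact g.symm _ _ _
  smooth := he.1
  orthonormal y hy := by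
    ext a b
    rw [Matrix.one_apply, ← he.2 y hy a b, Matrix.mul_apply, Finset.sum_comm]
    refine Finset.sum_congr rfl fun ν _ => ?_
    rw [Matrix.mul_apply, Finset.sum_mul]
    refine Finset.sum_congr rfl fun μ _ => ?_
    rw [Matrix.transpose_apply]
    ring

lemma SmoothForm.isThreeForm {C : ThreeForm n M} (hC : SmoothForm C) (hc : c ∈ atlas (Coord n) M) :
    IsThreeForm c.target (formComp C c) where
  smooth := hC c hc
  rot_eq y _ := by
    ext m
    refine ((C (c.symm y)).map_perm (fun k => coordVec c y (m k)) (finRotate 3)).trans ?_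
    -- A cyclic permutation of three indices is even.
    rw [sign_finRotate]
    simp [formComp]
  swap12_eq y _ := by
    ext m
    refine ((C (c.symm y)).map_perm (fun k => coordVec c y (m k)) (Equiv.swap 1 2)).trans ?_
    rw [Equiv.Perm.sign_swap (by decide)]
    simp [formComp]

end Components

end CliffordKT

end

/-! ### Assembly over the charts of the atlas -/

theorem mainTheorem1 {n : ℕ} {M : Type*} [TopologicalSpace M]
    [ChartedSpace (CliffordKT.Coord n) M] [IsManifold (𝓡 n) ∞ M]
    {S : Type*} [NormedAddCommGroup S] [NormedSpace ℂ S] [FiniteDimensional ℂ S] [Nontrivial S]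
    (F : CliffordKT.FermionRep n S)
    (K : ℕ) (hK : K = 3 ∨ K = 7)
    (g : CliffordKT.Metric n M)
    (I : Fin K → CliffordKT.EndField n M) (hI : CliffordKT.IsCliffordFamily g I)
    (C : CliffordKT.ThreeForm n M) (hC : CliffordKT.SmoothForm C)
    (hCBH : CliffordKT.IsCompletedBismut g I C)
    (e : OpenPartialHomeomorph M (CliffordKT.Coord n) →
      CliffordKT.Coord n → Matrix (Fin n) (Fin n) ℝ)
    (he : ∀ c ∈ atlas (CliffordKT.Coord n) M, CliffordKT.IsVielbein g c (e c))
    (hN2 : ∀ c ∈ atlas (CliffordKT.Coord n) M, ∀ a : Fin K,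
      CliffordKT.FormsSusyAlgebra c.target
        ![CliffordKT.Q F g C c (e c), CliffordKT.QI F g C (I a) c (e c)]) :
    (∀ c ∈ atlas (CliffordKT.Coord n) M,
      CliffordKT.FormsSusyAlgebra c.target
        (Fin.cons (CliffordKT.Q F g C c (e c))
          (fun a : Fin K => CliffordKT.QI F g C (I a) c (e c)) :
            Fin (K + 1) → (CliffordKT.Coord n → S) → (CliffordKT.Coord n → S))) ∧
    CliffordKT.IsCliffordKahlerTorsion g I C := by
  have hcomp : ∀ c ∈ atlas (CliffordKT.Coord n) M, ∀ a, CliffordKT.IsCompletion c.target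
      (CliffordKT.metricComp g c) (CliffordKT.endComp (I a) c) (CliffordKT.formComp C c) :=
    fun c hc a => hCBH a c hc
  refine ⟨fun c hc => ?_, hI, hC, fun a c hc y hy l μ ν => ?_, fun a c hc y hy m => ?_⟩
  · refine CliffordKT.formsSusyAlgebra_cons (U := ⟨c.target, c.open_target⟩) F (he c hc).isFrame
      (hI.isComplexStr hc) (fun a b hab y hy => ?_) (hC.isThreeForm hc) (hcomp c hc)
      (fun a b y hy => hI.concomitant_eq_zero a b c hc y hy) (hN2 c hc)
    have h := hI.endComp_anticomm hc hy a b
    rw [if_neg hab] at h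
    exact eq_neg_of_add_eq_zero_left h
  · have h3 := hC.isThreeForm hc
    exact CliffordKT.nablaTorsion_symm (he c hc).isFrame (hI.isComplexStr hc a) hy (h3.rot_eq y hy)
      (h3.swap12_eq y hy) (hcomp c hc a y hy) l μ ν
  · exact congrFun (CliffordKT.torsion_eq_of_susy (U := ⟨c.target, c.open_target⟩) F
      (he c hc).isFrame (hI.isComplexStr hc a) (hC.isThreeForm hc) (hcomp c hc a) (hN2 c hc a) hy) m
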